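/- Let $K$ be an algebraically closed field of characteristic $2$. Let $\mathfrak o_\Pi(8)$ be the Lie algebra of $8\times 8$ matrices $X$ with $X^T\Pi=\Pi X$, where $\Pi=\begin{pmatrix}0&1_4\\1_4&0\end{pmatrix}$, let $\mathfrak o'_\Pi(8)$, $\mathfrak o^{(2)}_\Pi(8)$ be its first and second derived algebras and $I_0=\mathrm{diag}(1_4,0_4)$; $\mathfrak c$ always denotes the center. Let $e_i^+=E^{i,i+1}+E^{4+i+1,4+i}$ ($i=1,2,3$), $e_4^+=E^{3,8}+E^{4,7}$, $e_i^-=(e_i^+)^T$. Let $\mathfrak g$ be one of $\mathfrak o^{(2)}_\Pi(8)/\mathfrak c$, $\mathfrak o'_\Pi(8)/\mathfrak c$, $(\mathfrak o'_\Pi(8)\ltimes KI_0)/\mathfrak c$ (set $j=0,1,2$, respectively), with the $\mathbb Z$-grading $\deg e_2^\pm=\pm1$, $\deg e_i^\pm=0$ for $i\ne 2$ (the branching node is selected). For $\underline N=(N_1,\dots,N_9)$ with $N_i\in\{1,2,\dots,\infty\}$, let $\mathfrak{vect}(9;\underline N)$ be the Lie algebra of distinguished vector fields $\sum f_i\partial_i$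 with coefficients in the divided power algebra $\mathcal O(9;\underline N)$, graded by $\deg x_1=2$, $\deg x_i=1$ for $i>1$. Let $X_2^-=\partial_2$, $X_1^-=x_4x_5\partial_1+x_2\partial_3+x_4\partial_6+x_5\partial_7+x_8\partial_9$, $X_1^+=x_6x_7\partial_1+x_3\partial_2+x_6\partial_4+x_7\partial_5+x_9\partial_8$, $X_3^-=x_3x_5\partial_1+x_2\partial_4+x_3\partial_6+x_5\partial_8+x_7\partial_9$, $X_3^+=x_6x_8\partial_1+x_4\partial_2+x_6\partial_3+x_8\partial_5+x_9\partial_7$, $X_4^-=x_3x_4\partial_1+x_2\partial_5+x_3\partial_7+x_4\partial_8+x_6\partial_9$, $X_4^+=x_7x_8\partial_1+x_5\partial_2+x_7\partial_3+x_8\partial_4+x_9\partial_6$, $X_2^+=x_1x_2\partial_1+x_3x_4x_5\partial_1+x_1\partial_9+x_2x_3\partial_3+x_2x_4\partial_4+x_2x_5\partial_5+x_2x_9\partial_9+x_3x_4\partial_6+x_3x_5\partial_7+x_3x_8\partial_9+x_4x_5\partial_8+x_4x_7\partial_9+x_5x_6\partial_9$, and let $d_1=\sum_{i\in\{1,3,6,7,9\}}x_i\partial_i$,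 $d_2=\sum_{i\in\{1,4,6,8,9\}}x_i\partial_i$. For a Lie algebra $\mathfrak g\subset\mathfrak{vect}(9;(1,\dots,1))$ graded in this way, with components $\mathfrak g_k$, $k\ge-2$, and a subspace $\mathfrak h_0\subset\mathfrak g_0$, the CTS prolong $(\mathfrak g_-,\mathfrak h_0)_{*,\underline N}$ is the sum of $\mathfrak g_{-2}$, $\mathfrak g_{-1}$, $\mathfrak h_0$ and the spaces $\mathfrak h_k$, $k>0$, of the fields $D\in\mathfrak{vect}(9;\underline N)$ of degree $k$ with $[D,\mathfrak g_{-i}]\subset\mathfrak h_{k-i}$ for $i=1,2$ (where $\mathfrak h_{-1}=\mathfrak g_{-1}$). Then: (1) For $j=0,1,2$, there is an isomorphism of graded Lie algebras, sending $e_i^\pm$ to $X_i^\pm$, from $\mathfrak g$ onto the Lie algebra generated by all $X_i^\pm$ together with, respectively, nothing, $d_1$, or $d_1$ and $d_2$. Identify $\mathfrak g$ with its image. (2) For every $\underline N$, the prolongs $(\mathfrak g_-,[\mathfrak g_{-1},\mathfrak g_1])_{*,\underline N}$ and $(\mathfrak g_-,\mathfrak g_0)_{*,\underline N}$ are Lie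 algebras, and they do not change if $\underline N$ is replaced with $(N_1,1,\dots,1)$. The first of them is the same for $j=0,1,2$, and equals $(\mathfrak g_-,\mathfrak g_0)_{*,\underline N}$ for $j=0$. (3) For $\underline N=(n,1,\dots,1)$ and every $n\in\{1,2,\dots,\infty\}$, the derived algebra $\mathfrak{ir}(9;\underline N)$ of $(\mathfrak g_-,[\mathfrak g_{-1},\mathfrak g_1])_{*,\underline N}$ is a simple Lie algebra. (4) If $\underline N=(n,1,\dots,1)$ with $n$ finite, then $\mathfrak{ir}(9;\underline N)$ is an ideal in $(\mathfrak g_-,\mathfrak g_0)_{*,\underline N}$, and the latter is a semidirect sum $\mathfrak{ir}(9;\underline N)\ltimes\mathfrak D$, where $\mathfrak D$ is the sum of a $6$-dimensional subspace of the highest component, which has degree $2^{n+1}-2$, and the span of the $j$ elements among $d_1,d_2$ that were added in (1); $\dim\mathfrak D=6+j$, and non-zero elements of $\mathfrak D$ act on $\mathfrak{ir}(9;\underline N)$ as outer derivations. In particular, the full prolong of the non-positive part of $\mathfrak o^{(2)}_\Pi(8)/\mathfrak c$ is $\mathfrak{ir}(9;\underline N)$ extended by $6$ outer derivations. (5) $\mathfrak{ir}(9;(1,\dots,1))$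 is the image of $\mathfrak o^{(2)}_\Pi(8)/\mathfrak c$ in (1). (6) A Lie superalgebra in characteristic $2$ is a $\mathbb Z/2$-graded Lie algebra with a squaring $x\mapsto x^2$ from its odd to its even part such that $(ax)^2=a^2x^2$ for $a\in K$, $(x+y)^2=x^2+y^2+[x,y]$ and $[x^2,z]=[x,[x,z]]$ for all odd $x,y$ and all $z$; derived superalgebras are spanned by brackets and squares of odd elements. Declare the pairs $X_i^\pm$ to be of parity $p_i\in\mathbb Z/2$, where $p\neq0$ and $p_1+p_3+p_4=0$; this amounts to a choice of parities of the $x_i$ for which $x_1$ is even. If $p=(0,1,0,0)$, then exactly $x_2,\dots,x_9$ are odd; otherwise exactly four indeterminates are odd ($x_3,x_5,x_6,x_8$ for $p=(1,0,0,1)$). For $\underline N=(n,1,\dots,1)$, $n\in\{1,2,\dots,\infty\}$, the Lie algebra $(\mathfrak g_-,[\mathfrak g_{-1},\mathfrak g_1])_{*,\underline N}$ is a Lie superalgebra with respect to these parities and the squaring $D\mapsto D\circ D$ of odd vector fields on $\mathcal O(9;\underline N)$; its derived superalgebra is $\mathfrak{ir}(9;\underline N)$, which thereby becomes a simple Lie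 superalgebra, denoted $\mathfrak{ir}(1;\underline N|8)$ if $p=(0,1,0,0)$ and $\mathfrak{ir}(5;\underline N|4)$ otherwise. For $\underline N=(1,\dots,1)$, $\mathfrak{ir}(1;\underline N|8)\simeq\mathfrak{oo}^{(2)}_{\Pi\Pi}(4|4)/\mathfrak c$ and $\mathfrak{ir}(5;\underline N|4)\simeq\mathfrak{oo}^{(2)}_{\Pi\Pi}(2|6)/\mathfrak c\simeq\mathfrak{pe}^{(2)}(4)/\mathfrak c$, where $\mathfrak{oo}_{\Pi\Pi}(2a|2b)$ and $\mathfrak{pe}(4)$ are the Lie superalgebras of matrices that preserve the form $\Pi$ when the basis vectors of $K^8$ are given the parities of the formats $a|b|a|b$ (for $\mathfrak{oo}$; $\Pi$ is even) and $4|4$ (for $\mathfrak{pe}$; $\Pi$ is odd), with the square of a matrix as squaring. -/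

import Mathlib

/-! Everything below is over a field `K`, which the theorem takes algebraically closed of
characteristic `2`. Lie algebras of vector fields and of matrices are Lie subalgebras of the
associative algebras `Module.End K _` and `Matrix _ _ K` with the commutator bracket. -/

attribute [local instance 100] LieRing.ofAssociativeRing

namespace CTS

/-! ### Generalities on Lie subalgebras -/

/-- The linear span of all brackets `⁅a, b⁆` with `a ∈ A`, `b ∈ B`. -/
def bracketSpan (K : Type*) {A : Type*} [Field K] [LieRing A] [LieAlgebra K A]
    (S T : Submodule K A) : Submodule K A :=
  Submodule.span K {z | ∃ a ∈ S, ∃ b ∈ T, z = ⁅a, b⁆}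

/-- The derived algebra `[L, L]` of a Lie subalgebra `L`, as a Lie subalgebra of the ambient
Lie algebra. -/
def derivedSub {K A : Type*} [Field K] [LieRing A] [LieAlgebra K A]
    (L : LieSubalgebra K A) : LieSubalgebra K A :=
  { bracketSpan K L.toSubmodule L.toSubmodule with
    lie_mem' := by
      intro x y hx hy
      have key : bracketSpan K L.toSubmodule L.toSubmodule ≤ L.toSubmodule := by
        refine Submodule.span_le.2 ?_
        rintro z ⟨a, ha, b, hb, rfl⟩
        exact L.lie_mem ha hb
      exact Submodule.subset_span ⟨x, key hx, y, key hy, rfl⟩ }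

/-! ### Divided powers and distinguished vector fields in nine indeterminates

The indeterminate called `x_j` (`1 ≤ j ≤ 9`) has index `j - 1` in `Fin 9`. -/

/-- The divided power algebra on `x_1, …, x_9` without bounds on the exponents, as a vector
space: the basis vector of index `r` is the divided power monomial `x^(r)`. -/
abbrev DP (K : Type*) [Field K] : Type _ := (Fin 9 → ℕ) →₀ K

/-- Linear operators on the divided power algebra, with the commutator bracket. -/
abbrev Op (K : Type*) [Field K] : Type _ := Module.End K (DP K)

/-- Multiplication by the divided power monomial `x^(r)`:
`x^(r) x^(s) = ∏ⱼ (rⱼ + sⱼ choose rⱼ) x^(r + s)`. -/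
noncomputable def mulMono (K : Type*) [Field K] (r : Fin 9 → ℕ) : Op K :=
  Finsupp.linearCombination K fun s : Fin 9 → ℕ =>
    Finsupp.single (r + s) (((∏ j, (r j + s j).choose (r j) : ℕ) : K))

/-- The distinguished partial derivative `∂_i`, lowering the exponent of `x_i` by one. -/
noncomputable def pd (K : Type*) [Field K] (i : Fin 9) : Op K :=
  Finsupp.linearCombination K fun s : Fin 9 → ℕ =>
    if s i = 0 then 0 else Finsupp.single (Function.update s i (s i - 1)) (1 : K)

/-- The vector field `x^(r) ∂_i`. -/
noncomputable def vf (K : Type*) [Field K] (r : Fin 9 → ℕ) (i : Fin 9) : Op K :=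
  mulMono K r * pd K i

/-- `rⱼ < 2 ^ Nⱼ` for all `j`; no condition where `Nⱼ = ∞`. -/
def Adm (N : Fin 9 → ℕ∞) (r : Fin 9 → ℕ) : Prop :=
  ∀ j, ∀ m : ℕ, N j = (m : ℕ∞) → r j < 2 ^ m

/-- The divided power algebra `𝒪(9; N)` inside `DP K`. -/
noncomputable def dpSub (K : Type*) [Field K] (N : Fin 9 → ℕ∞) : Submodule K (DP K) :=
  Finsupp.supported K K {r | Adm N r}

/-- Degrees of the indeterminates: `deg x_1 = 2` and `deg x_j = 1` for `j > 1`. -/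
def varDeg (j : Fin 9) : ℤ := if j = 0 then 2 else 1

/-- The homogeneous component of degree `k` of `𝔳𝔢𝔠𝔱(9; N)`: the span of the `x^(r) ∂_i` with
`rⱼ < 2 ^ Nⱼ` and `∑ rⱼ deg x_j - deg x_i = k`. -/
noncomputable def vectDeg (K : Type*) [Field K] (N : Fin 9 → ℕ∞) (k : ℤ) : Submodule K (Op K) :=
  Submodule.span K {D | ∃ (r : Fin 9 → ℕ) (i : Fin 9),
    Adm N r ∧ ∑ j, (r j : ℤ) * varDeg j - varDeg i = k ∧ D = vf K r i}

/-- The shearing vector `(n, 1, …, 1)`. -/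
def shear (n : ℕ∞) : Fin 9 → ℕ∞ := fun j => if j = 0 then n else 1

/-! ### Cartan–Tanaka–Shchepochkina prolongs in depth two -/

/-- The elements `D` with `⁅X, D⁆ ∈ B` for all `X ∈ A`. -/
noncomputable def bracketInto (K : Type*) [Field K] (A B : Submodule K (Op K)) : Submodule K (Op K) :=
  ⨅ X : A, B.comap (LieAlgebra.ad K (Op K) (X : Op K))

/-- The components of degree `k ≥ 0` of the prolong `(𝔤₋, 𝔤₀)_{*,N}`, where `𝔤₋` is the sum of
`m2 = 𝔤₋₂` and `m1 = 𝔤₋₁`, and `m0 = 𝔤₀`. For `k > 0`, the component consists of all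
fields `D ∈ 𝔳𝔢𝔠𝔱(9; N)` of degree `k` such that `⁅𝔤₋₁, D⁆ ⊆ 𝔤ₖ₋₁` and `⁅𝔤₋₂, D⁆ ⊆ 𝔤ₖ₋₂`. -/
noncomputable def ctsComp (K : Type*) [Field K] (N : Fin 9 → ℕ∞) (m2 m1 m0 : Submodule K (Op K)) :
    ℕ → Submodule K (Op K)
  | 0 => m0
  | 1 => vectDeg K N 1 ⊓ bracketInto K m1 m0 ⊓ bracketInto K m2 m1
  | k + 2 => vectDeg K N ((k : ℤ) + 2) ⊓ bracketInto K m1 (ctsComp K N m2 m1 m0 (k + 1)) ⊓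
      bracketInto K m2 (ctsComp K N m2 m1 m0 k)

/-- The sum of all components of the prolong. -/
noncomputable def ctsSum (K : Type*) [Field K] (N : Fin 9 → ℕ∞) (m2 m1 m0 : Submodule K (Op K)) :
    Submodule K (Op K) :=
  m2 ⊔ m1 ⊔ ⨆ k, ctsComp K N m2 m1 m0 k

/-- The prolong `(𝔤₋, 𝔤₀)_{*,N}` as a Lie algebra. (The sum of the components is closed under
the bracket whenever the non-positive part is; the theorem asserts this for the prolongs it
deals with.) -/
noncomputable def ctsProlong (K : Type*) [Field K] (N : Fin 9 → ℕ∞) (m2 m1 m0 : Submodule K (Op K)) :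
    LieSubalgebra K (Op K) :=
  LieSubalgebra.lieSpan K (Op K) (ctsSum K N m2 m1 m0 : Set (Op K))

/-! ### The Chevalley generators in terms of vector fields -/

/-- `fld K L k` is the field `x_{l₁} x_{l₂} ⋯ ∂_k`, where `L = [l₁, l₂, …]` (indices of the
indeterminates run from `1` to `9` here). -/
noncomputable def fld (K : Type*) [Field K] (L : List ℕ) (k : ℕ) : Op K :=
  vf K (fun j => L.count (j.val + 1)) (Fin.ofNat 9 (k - 1))

/-- The generators `X_1^+, …, X_4^+`; the second one belongs to the branching node. -/
noncomputable def chevPlus (K : Type*) [Field K] : Fin 4 → Op K :=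
  ![fld K [6, 7] 1 + fld K [3] 2 + fld K [6] 4 + fld K [7] 5 + fld K [9] 8,
    fld K [1, 2] 1 + fld K [3, 4, 5] 1 + fld K [1] 9 + fld K [2, 3] 3 + fld K [2, 4] 4
      + fld K [2, 5] 5 + fld K [2, 9] 9 + fld K [3, 4] 6 + fld K [3, 5] 7 + fld K [3, 8] 9
      + fld K [4, 5] 8 + fld K [4, 7] 9 + fld K [5, 6] 9,
    fld K [6, 8] 1 + fld K [4] 2 + fld K [6] 3 + fld K [8] 5 + fld K [9] 7,
    fld K [7, 8] 1 + fld K [5] 2 + fld K [7] 3 + fld K [8] 4 + fld K [9] 6]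

/-- The generators `X_1^-, …, X_4^-`. -/
noncomputable def chevMinus (K : Type*) [Field K] : Fin 4 → Op K :=
  ![fld K [4, 5] 1 + fld K [2] 3 + fld K [4] 6 + fld K [5] 7 + fld K [8] 9,
    fld K [] 2,
    fld K [3, 5] 1 + fld K [2] 4 + fld K [3] 6 + fld K [5] 8 + fld K [7] 9,
    fld K [3, 4] 1 + fld K [2] 5 + fld K [3] 7 + fld K [4] 8 + fld K [6] 9]

/-- `d_1 = ∑ x_i ∂_i` over `i = 1, 3, 6, 7, 9`. -/
noncomputable def tor1 (K : Type*) [Field K] : Op K :=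
  fld K [1] 1 + fld K [3] 3 + fld K [6] 6 + fld K [7] 7 + fld K [9] 9

/-- `d_2 = ∑ x_i ∂_i` over `i = 1, 4, 6, 8, 9`. -/
noncomputable def tor2 (K : Type*) [Field K] : Op K :=
  fld K [1] 1 + fld K [4] 4 + fld K [6] 6 + fld K [8] 8 + fld K [9] 9

/-- The elements added to the Chevalley generators: none, `d_1`, or `d_1` and `d_2`. -/
noncomputable def extraTorus (K : Type*) [Field K] : Fin 3 → Set (Op K) :=
  ![∅, {tor1 K}, {tor1 K, tor2 K}]

/-- The Lie algebra of vector fields generated by the Chevalley generators and the extra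
elements; the theorem identifies it with `𝔬_Π^{(2)}(8)/𝔠`, `𝔬'_Π(8)/𝔠` and
`(𝔬'_Π(8) ⋉ K I₀)/𝔠` for `j = 0, 1, 2`, graded by selecting the branching node. -/
noncomputable def branchAlg (K : Type*) [Field K] (j : Fin 3) : LieSubalgebra K (Op K) :=
  LieSubalgebra.lieSpan K (Op K)
    (Set.range (chevPlus K) ∪ Set.range (chevMinus K) ∪ extraTorus K j)

/-- The component `𝔤ₖ` of `𝔤 = branchAlg K j`. -/
noncomputable def branchComp (K : Type*) [Field K] (j : Fin 3) (k : ℤ) : Submodule K (Op K) :=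
  (branchAlg K j).toSubmodule ⊓ vectDeg K (shear 1) k

/-- `[𝔤₋₁, 𝔤₁]` for `𝔤 = branchAlg K j`. -/
noncomputable def tildeZero (K : Type*) [Field K] (j : Fin 3) : Submodule K (Op K) :=
  bracketSpan (A := Op K) K (branchComp K j (-1)) (branchComp K j 1)

/-- The prolong `(𝔤₋, [𝔤₋₁, 𝔤₁])_{*,N}`. -/
noncomputable def tildeProlong (K : Type*) [Field K] (j : Fin 3) (N : Fin 9 → ℕ∞) :
    LieSubalgebra K (Op K) :=
  ctsProlong K N (branchComp K j (-2)) (branchComp K j (-1)) (tildeZero K j)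

/-- The full prolong `(𝔤₋, 𝔤₀)_{*,N}` of the non-positive part. -/
noncomputable def fullProlong (K : Type*) [Field K] (j : Fin 3) (N : Fin 9 → ℕ∞) :
    LieSubalgebra K (Op K) :=
  ctsProlong K N (branchComp K j (-2)) (branchComp K j (-1)) (branchComp K j 0)

/-- The component of degree `k ≥ 0` of the full prolong. -/
noncomputable def fullComp (K : Type*) [Field K] (j : Fin 3) (N : Fin 9 → ℕ∞) (k : ℕ) :
    Submodule K (Op K) :=
  ctsComp K N (branchComp K j (-2)) (branchComp K j (-1)) (branchComp K j 0) k

/-- The Lie algebra `𝔦𝔯(9; (n, 1, …, 1))`: the derived algebra of the prolong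
`(𝔤₋, [𝔤₋₁, 𝔤₁])_{*,(n,1,…,1)}` for `𝔤 = 𝔬'_Π(8)/𝔠`. -/
noncomputable def ir (K : Type*) [Field K] (n : ℕ∞) : LieSubalgebra K (Op K) :=
  derivedSub (tildeProlong K 1 (shear n))

/-! ### The orthogonal Lie algebras of matrices -/

/-- `8 × 8` matrices in `4 + 4` block form. -/
abbrev Mat (K : Type*) [Field K] : Type _ := Matrix (Fin 4 ⊕ Fin 4) (Fin 4 ⊕ Fin 4) K

/-- `𝔬_Π(8)`: the matrices `X` with `Xᵗ Π = - Π X`, where `Π = (0 1; 1 0)`. -/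
noncomputable def oPi (K : Type*) [Field K] : LieSubalgebra K (Mat K) :=
  skewAdjointMatricesLieSubalgebra (Matrix.fromBlocks 0 1 1 0 : Mat K)

/-- `I₀ = diag(1₄, 0₄)`. -/
noncomputable def matI0 (K : Type*) [Field K] : Mat K := Matrix.fromBlocks 1 0 0 0

/-- The Lie algebras `𝔬_Π^{(2)}(8)`, `𝔬'_Π(8)` and `𝔬'_Π(8) ⋉ K I₀`. -/
noncomputable def orth (K : Type*) [Field K] : Fin 3 → LieSubalgebra K (Mat K) :=
  ![derivedSub (derivedSub (oPi K)), derivedSub (oPi K),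
    LieSubalgebra.lieSpan K (Mat K) ((derivedSub (oPi K) : Set (Mat K)) ∪ {matI0 K})]

/-- The Chevalley generators `e_i^+ = E^{i,i+1} + E^{4+i+1,4+i}` for `i = 1, 2, 3` and
`e_4^+ = E^{3,8} + E^{4,7}`. -/
noncomputable def matPlus (K : Type*) [Field K] : Fin 4 → Mat K :=
  ![Matrix.single (Sum.inl 0) (Sum.inl 1) 1 + Matrix.single (Sum.inr 1) (Sum.inr 0) 1,
    Matrix.single (Sum.inl 1) (Sum.inl 2) 1 + Matrix.single (Sum.inr 2) (Sum.inr 1) 1,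
    Matrix.single (Sum.inl 2) (Sum.inl 3) 1 + Matrix.single (Sum.inr 3) (Sum.inr 2) 1,
    Matrix.single (Sum.inl 2) (Sum.inr 3) 1 + Matrix.single (Sum.inl 3) (Sum.inr 2) 1]

/-- The Chevalley generators `e_i^- = (e_i^+)ᵗ`. -/
noncomputable def matMinus (K : Type*) [Field K] (i : Fin 4) : Mat K := (matPlus K i).transpose

/-- Degrees of the basis vectors of the `8`-dimensional space; with them `deg e_2^± = ±1` and
`deg e_i^± = 0` for `i ≠ 2`. -/
def vecDeg : Fin 4 ⊕ Fin 4 → ℤ := Sum.elim ![1, 1, 0, 0] ![-1, -1, 0, 0]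

/-- The matrices of degree `k`, in the grading obtained by selecting the branching node. -/
def matDeg (K : Type*) [Field K] (k : ℤ) : Submodule K (Mat K) where
  carrier := {M | ∀ a b, M a b ≠ 0 → vecDeg a - vecDeg b = k}
  zero_mem' := by intro a b h; exact absurd rfl h
  add_mem' := by
    intro M M' hM hM' a b h
    by_cases h1 : M a b = 0
    · refine hM' a b fun h2 => h ?_
      simp [h1, h2]
    · exact hM a b h1
  smul_mem' := by
    intro c M hM a b h
    refine hM a b fun h1 => h ?_
    simp [h1]

/-! ### Lie superalgebras in characteristic two -/

/-- A structure of Lie superalgebra in characteristic `2` on a Lie algebra `L`: a grading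
`L = L₀ ⊕ L₁` by `ℤ/2`, and a squaring `L₁ → L₀` with `(a x)² = a² x²`, whose polarization is
the bracket of odd elements, and such that `[x², y] = [x, [x, y]]`. (In characteristic `2` the
bracket of a Lie superalgebra makes it a Lie algebra when parity is forgotten.) -/
structure SuperStructure (K L : Type*) [Field K] [LieRing L] [LieAlgebra K L] where
  even : Submodule K L
  odd : Submodule K L
  isCompl : IsCompl even odd
  lie_even_even : ∀ x ∈ even, ∀ y ∈ even, ⁅x, y⁆ ∈ even
  lie_even_odd : ∀ x ∈ even, ∀ y ∈ odd, ⁅x, y⁆ ∈ odd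
  lie_odd_odd : ∀ x ∈ odd, ∀ y ∈ odd, ⁅x, y⁆ ∈ even
  sq : odd → even
  sq_smul : ∀ (a : K) (x : odd), sq (a • x) = a ^ 2 • sq x
  sq_add : ∀ x y : odd, ((sq (x + y) : even) : L) = sq x + sq y + ⁅(x : L), (y : L)⁆
  sq_lie : ∀ (x : odd) (y : L), ⁅((sq x : even) : L), y⁆ = ⁅(x : L), ⁅(x : L), y⁆⁆

/-- The derived superalgebra: the span of all brackets and of all squares of odd elements. -/
def SuperStructure.derived {K L : Type*} [Field K] [LieRing L] [LieAlgebra K L]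
    (S : SuperStructure K L) : Submodule K L :=
  Submodule.span K ({z | ∃ x y : L, z = ⁅x, y⁆} ∪ {z | ∃ x : S.odd, z = (S.sq x : L)})

/-- Simplicity of a Lie superalgebra: it is not abelian, and its only ideals (homogeneous and
closed under squaring) are zero and everything. -/
def SuperStructure.IsSimple {K L : Type*} [Field K] [LieRing L] [LieAlgebra K L]
    (S : SuperStructure K L) : Prop :=
  ¬ IsLieAbelian L ∧ ∀ I : LieIdeal K L,
    (∀ x ∈ S.even, ∀ y ∈ S.odd, x + y ∈ I → x ∈ I ∧ y ∈ I) →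
    (∀ x : S.odd, (x : L) ∈ I → (S.sq x : L) ∈ I) → I = ⊥ ∨ I = ⊤

/-! ### Superizations of Lie algebras of vector fields -/

/-- Row `j` lists the coefficients of `w` in terms of the simple roots, where `-w` is the root of
the element of `𝔤₋` that starts with `∂_j`. -/
def rootCoeff : Fin 9 → Fin 4 → ZMod 2 :=
  ![![1, 2, 1, 1], ![0, 1, 0, 0], ![1, 1, 0, 0], ![0, 1, 1, 0], ![0, 1, 0, 1],
    ![1, 1, 1, 0], ![1, 1, 0, 1], ![0, 1, 1, 1], ![1, 1, 1, 1]]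

/-- The parities of `x_1, …, x_9` that result from giving `X_i^±` the parity `p i`. -/
def varParity (p : Fin 4 → ZMod 2) (j : Fin 9) : ZMod 2 := ∑ i, p i * rootCoeff j i

/-- The span of the vector fields `x^(r) ∂_i` of parity `c`. -/
noncomputable def fieldParity (K : Type*) [Field K] (p : Fin 4 → ZMod 2) (c : ZMod 2) :
    Submodule K (Op K) :=
  Submodule.span K {D | ∃ (r : Fin 9 → ℕ) (i : Fin 9),
    ∑ j, (r j : ZMod 2) * varParity p j + varParity p i = c ∧ D = vf K r i}

/-- `S` is the superization, for the parities `p` of the Chevalley generators, of the Lie algebra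
`L` of vector fields on `𝒪(9; N)`: parity is that of vector fields, and the square of an odd
field `D` is the field that acts on `𝒪(9; N)` as `D ∘ D`. -/
def IsSuperization {K : Type*} [Field K] (p : Fin 4 → ZMod 2) (N : Fin 9 → ℕ∞)
    (L : LieSubalgebra K (Op K)) (S : SuperStructure K L) : Prop :=
  (∀ x : L, x ∈ S.even ↔ (x : Op K) ∈ fieldParity K p 0) ∧
  (∀ x : L, x ∈ S.odd ↔ (x : Op K) ∈ fieldParity K p 1) ∧
  ∀ x : S.odd, ∀ u ∈ dpSub K N,
    (((S.sq x : S.even) : L) : Op K) u = ((x : L) : Op K) (((x : L) : Op K) u)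

/-! ### Ortho-orthogonal and periplectic Lie superalgebras -/

/-- The matrices of parity `c`, where `q` gives the parities of the basis vectors. -/
def matParity (K : Type*) [Field K] (q : Fin 4 ⊕ Fin 4 → ZMod 2) (c : ZMod 2) : Set (Mat K) :=
  {M | ∀ a b, M a b ≠ 0 → q a + q b = c}

/-- The derived superalgebra of a Lie superalgebra of matrices: generated by the brackets and the
squares of odd elements. -/
noncomputable def matSuperDerived {K : Type*} [Field K] (q : Fin 4 ⊕ Fin 4 → ZMod 2)
    (L : LieSubalgebra K (Mat K)) : LieSubalgebra K (Mat K) :=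
  LieSubalgebra.lieSpan K (Mat K)
    ({z | ∃ x ∈ L, ∃ y ∈ L, z = ⁅x, y⁆} ∪ {z | ∃ x ∈ L, x ∈ matParity K q 1 ∧ z = x * x})

/-- The second derived superalgebra of the Lie superalgebra that preserves the form `Π`, where `q`
gives the parities of the basis vectors. -/
noncomputable def superOrth (K : Type*) [Field K] (q : Fin 4 ⊕ Fin 4 → ZMod 2) : LieSubalgebra K (Mat K) :=
  matSuperDerived q (matSuperDerived q (oPi K))

/-- Format `2|2|2|2`: `Π` is an even form on a space of superdimension `4|4`, and
`superOrth K parity44` is `𝔬𝔬_ΠΠ^{(2)}(4|4)`. -/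
def parity44 : Fin 4 ⊕ Fin 4 → ZMod 2 := Sum.elim ![0, 0, 1, 1] ![0, 0, 1, 1]

/-- Format `1|3|1|3`: `Π` is an even form on a space of superdimension `2|6`, and
`superOrth K parity26` is `𝔬𝔬_ΠΠ^{(2)}(2|6)`. -/
def parity26 : Fin 4 ⊕ Fin 4 → ZMod 2 := Sum.elim ![0, 1, 1, 1] ![0, 1, 1, 1]

/-- Format `4|4`: `Π` is an odd form on a space of superdimension `4|4`, and
`superOrth K parityPe` is `𝔭𝔢^{(2)}(4)`. -/
def parityPe : Fin 4 ⊕ Fin 4 → ZMod 2 := Sum.elim ![0, 0, 0, 0] ![1, 1, 1, 1]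

/-- `M` with the superstructure `S` is isomorphic to the quotient of `superOrth K q` modulo its
center `𝔠`: there is a surjective homomorphism of Lie superalgebras (it respects brackets,
parities and squares of odd elements) with kernel `𝔠`. -/
def IsSuperOrthModCenter {K M : Type*} [Field K] [LieRing M] [LieAlgebra K M]
    (q : Fin 4 ⊕ Fin 4 → ZMod 2) (S : SuperStructure K M) : Prop :=
  ∃ f : superOrth K q →ₗ⁅K⁆ M, Function.Surjective f ∧
    f.ker = LieAlgebra.center K (superOrth K q) ∧
    (∀ x : superOrth K q, (x : Mat K) ∈ matParity K q 0 → f x ∈ S.even) ∧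
    ∀ x : superOrth K q, (x : Mat K) ∈ matParity K q 1 →
      ∃ (h : f x ∈ S.odd) (y : superOrth K q),
        (y : Mat K) = (x : Mat K) * (x : Mat K) ∧ f y = (S.sq ⟨f x, h⟩ : M)

end CTS

namespace CTS

/-! ### The divided power algebra as a commutative ring -/

/-! All the fields involved are contact fields. The form `dx_1 + x_9 dx_2 + x_8 dx_3 + x_7 dx_4 +
x_6 dx_5` vanishes on the eight fields `zD`; the field `cD f` is built so that the form takes the
value `f` on it (`genFun_kap`), and `lie_cD` replaces brackets of such fields by the contact bracket
`cBr` of generating functions.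

The algebras are spanned by the fields with generating functions `F_v(x_1^(s))`. Here `F_v(u)`, `0 ≤
v ≤ 17`, is a differential expression in a function `u` of `x_1` whose coefficients are square-free
polynomials in `x_2, …, x_9`. The fields `F_v(1)` have degree -2 for `v = 0`, degree -1 for `1 ≤ v ≤
8`, are root vectors of degree zero for `9 ≤ v ≤ 14` and toral for `v ≥ 15`; the last two families
are used with constant `u` only. The decisive fact is the table `tab`: the bracket of `F_v(u)` and
`F_w(w)` is a sum of functions `F_z` of `uw`, `u'w`, `uw'` or `(uw)'`. This amounts to finitely many
identities with coefficients mod 2 (`tab_spec`, `cBr_Fv`). A subspace is then given by a set of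
pairs `(v, s)`, and closure under brackets becomes arithmetic of exponents (`lie_mem_LQ`): a
binomial coefficient is odd only if there are no carries, so the bound `s < 2 ^ n` survives
(`adm.add`).

Prolongs. The field `∂_1` differentiates `u`. If `D` has positive degree and its brackets with the
negative part are known, then `⁅∂_1, D⁆` is integrated and the integral is subtracted from `D`.
Constants in the last two families cannot be integrated, but the Jacobi identity forbids them
(`torus_eq_zero`). What remains commutes with `∂_1`; it vanishes since the constant fields of degree
zero have no first prolong (`first_prolong_eq_zero`), and in higher degrees by transitivity
(`eq_zero_of_lie_eq_zero`). This is `mem_of_lie_mem`. As the functions are square-free in `x_2, …,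
x_9`, only the first coordinate of the shearing vector matters.

Derived algebra. The six root families arise in brackets of the prolong only through `(uw)'`, so
they lose the power `x_1^(2^n - 1)`, and nothing else is lost (`derived_eq`). These six fields are
the new outer derivations. For simplicity, `∂_1` and then the fields of degree -1 bring any nonzero
element down to `∂_1`, which generates everything. The same reasoning shows that the centralizer of
the derived algebra is trivial (`eq_zero_of_commute`), hence that the complement acts by outer
derivations.

Matrices. A linear map `theta`, explicit on matrix units, is multiplicative by a check on spanning
sets (`thL_cmL`), and its image contains the generators. Its kernel is the center, because kernel
elements are scalar and the image has trivial centralizer.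

Superalgebras. Squaring of contact fields is the quadratic operation `sqF` on generating functions.
It vanishes on every family that can be odd, so squares of odd fields are sums of brackets and
enlarge nothing. It agrees with `D ∘ D` because the coefficient of an odd field at `∂_1` has no
constant term and therefore has square zero. On the matrix side the second derived superalgebra does
not depend on the format (`superOrth_eq`); parities are matched by combining permutations of the
three outer nodes with permutations of basis vectors. -/

theorem mulMono_single {K : Type*} [Field K] (r s : Fin 9 → ℕ) :
    mulMono K r (Finsupp.single s 1) =
      Finsupp.single (r + s) ((∏ j, (r j + s j).choose (r j) : ℕ) : K) := by
  rw [mulMono, Finsupp.linearCombination_single, one_smul]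

theorem pd_single {K : Type*} [Field K] (i : Fin 9) (s : Fin 9 → ℕ) :
    pd K i (Finsupp.single s 1) =
      if s i = 0 then 0 else Finsupp.single (Function.update s i (s i - 1)) (1 : K) := by
  rw [pd, Finsupp.linearCombination_single, one_smul]

/-- The vector space `DP K`, to be endowed with the product of divided powers. -/
def DPA (K : Type*) [Field K] : Type _ := DP K

section Ring

variable {K : Type*} [Field K]

noncomputable instance : AddCommGroup (DPA K) := inferInstanceAs (AddCommGroup (DP K))
noncomputable instance : Module K (DPA K) := inferInstanceAs (Module K (DP K))

/-- The divided power monomial `x^(r)`. -/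
noncomputable def mono (K : Type*) [Field K] (r : Fin 9 → ℕ) : DPA K :=
  (Finsupp.single r (1 : K) : DP K)

/-- The coefficient of `x^(r)`. -/
noncomputable def coef (r : Fin 9 → ℕ) : DPA K →ₗ[K] K := Finsupp.lapply (M := K) (R := K) r

theorem coef_mono (r s : Fin 9 → ℕ) :
    coef r (mono K s) = if s = r then 1 else 0 := by
  classical
  exact Finsupp.single_apply

theorem DPA.ext {f g : DPA K} (h : ∀ r, coef r f = coef r g) : f = g := Finsupp.ext h

theorem DPA.hom_ext {M : Type*} [AddCommMonoid M] [Module K M] {f g : DPA K →ₗ[K] M}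
    (h : ∀ r, f (mono K r) = g (mono K r)) : f = g := by
  refine Finsupp.lhom_ext' (M := K) (R := K) (N := M) fun r => ?_
  refine LinearMap.ext_ring ?_
  exact h r

/-- The structure constant of the product of two monomials. -/
def mcoef (r s : Fin 9 → ℕ) : ℕ := ∏ j, (r j + s j).choose (r j)

/-- The product of divided powers as a bilinear map. -/
noncomputable def mulBil (K : Type*) [Field K] : DPA K →ₗ[K] DPA K →ₗ[K] DPA K :=
  Finsupp.linearCombination K fun r : Fin 9 → ℕ => (mulMono K r : Module.End K (DP K))

theorem mulBil_mono_left (r : Fin 9 → ℕ) (f : DPA K) : mulBil K (mono K r) f = mulMono K r f := by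
  have : mulBil K (mono K r) = mulMono K r := by
    refine (Finsupp.linearCombination_single K (1 : K) r).trans ?_
    exact one_smul K _
  rw [this]
  rfl

theorem mulBil_mono (r s : Fin 9 → ℕ) :
    mulBil K (mono K r) (mono K s) = (mcoef r s : K) • mono K (r + s) := by
  rw [mulBil_mono_left]
  exact (mulMono_single r s).trans (Finsupp.smul_single_one _ _).symm

theorem mcoef_comm (r s : Fin 9 → ℕ) : mcoef r s = mcoef s r := by
  refine Finset.prod_congr rfl fun j _ => ?_
  rw [add_comm (s j) (r j), Nat.choose_symm_add]

/-- In each coordinate both products equal the trinomial coefficient `(r + s + t)! / (r! s! t!)`. -/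
theorem mcoef_assoc (r s t : Fin 9 → ℕ) :
    mcoef r s * mcoef (r + s) t = mcoef s t * mcoef r (s + t) := by
  simp only [mcoef, ← Finset.prod_mul_distrib]
  refine Finset.prod_congr rfl fun j _ => ?_
  simp only [Pi.add_apply]
  have h := Nat.choose_mul (n := r j + s j + t j) (k := r j + s j) (s := r j) (by omega)
  rw [show r j + s j + t j - r j = s j + t j by omega, show r j + s j - r j = s j by omega] at h
  rw [mul_comm, h, mul_comm, add_assoc]

theorem mulBil_comm (f g : DPA K) : mulBil K f g = mulBil K g f := by
  have : mulBil K = (mulBil K).flip := by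
    refine DPA.hom_ext fun r => DPA.hom_ext fun s => ?_
    rw [LinearMap.flip_apply, mulBil_mono, mulBil_mono, mcoef_comm, add_comm]
  conv_lhs => rw [this]
  rfl

theorem mulBil_assoc (f g h : DPA K) :
    mulBil K (mulBil K f g) h = mulBil K f (mulBil K g h) := by
  let A : DPA K →ₗ[K] DPA K →ₗ[K] DPA K →ₗ[K] DPA K := LinearMap.compr₂ (mulBil K) (mulBil K)
  let B : DPA K →ₗ[K] DPA K →ₗ[K] DPA K →ₗ[K] DPA K :=
    (LinearMap.lcomp K (DPA K →ₗ[K] DPA K) (mulBil K)).comp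
      ((LinearMap.llcomp K (DPA K) (DPA K) (DPA K)).comp (mulBil K))
  have hAB : A = B := by
    refine DPA.hom_ext fun r => DPA.hom_ext fun s => DPA.hom_ext fun t => ?_
    change mulBil K (mulBil K (mono K r) (mono K s)) (mono K t) =
      mulBil K (mono K r) (mulBil K (mono K s) (mono K t))
    rw [mulBil_mono, mulBil_mono, map_smul, map_smul, LinearMap.smul_apply, mulBil_mono,
      mulBil_mono, smul_smul, smul_smul, ← Nat.cast_mul, ← Nat.cast_mul, mcoef_assoc, add_assoc]
  exact congrArg (fun C : DPA K →ₗ[K] DPA K →ₗ[K] DPA K →ₗ[K] DPA K => C f g h) hAB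

theorem mulBil_one (f : DPA K) : mulBil K (mono K 0) f = f := by
  have : mulBil K (mono K 0) = LinearMap.id := by
    refine DPA.hom_ext fun r => ?_
    rw [mulBil_mono]
    simp [mcoef]
  rw [this, LinearMap.id_apply]

noncomputable instance : CommRing (DPA K) :=
  { (inferInstance : AddCommGroup (DPA K)) with
    mul := fun f g => mulBil K f g
    one := mono K 0
    left_distrib := fun f g h => map_add (mulBil K f) g h
    right_distrib := fun f g h => LinearMap.map_add₂ (mulBil K) f g h
    zero_mul := fun f => LinearMap.map_zero₂ (mulBil K) f
    mul_zero := fun f => map_zero (mulBil K f)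
    mul_assoc := mulBil_assoc
    one_mul := mulBil_one
    mul_one := fun f => (mulBil_comm f _).trans (mulBil_one f)
    mul_comm := mulBil_comm }

noncomputable instance : Algebra K (DPA K) :=
  Algebra.ofModule (fun c f g => LinearMap.map_smul₂ (mulBil K) c f g)
    (fun c f g => map_smul (mulBil K f) c g)

theorem mono_mul (r s : Fin 9 → ℕ) :
    mono K r * mono K s = (mcoef r s : K) • mono K (r + s) := mulBil_mono r s

theorem mono_zero : mono K 0 = 1 := rfl

instance : Nontrivial (DPA K) := ⟨⟨mono K 0, 0, fun h => by
  have := congrArg (coef (0 : Fin 9 → ℕ)) h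
  rw [coef_mono] at this
  simp at this⟩⟩

instance [CharP K 2] : CharP (DPA K) 2 := charP_of_injective_algebraMap' K 2

theorem mcoef_update (r s : Fin 9 → ℕ) (i : Fin 9) :
    mcoef r s = (r i + s i).choose (r i) *
      ∏ j ∈ Finset.univ.erase i, (r j + s j).choose (r j) :=
  (Finset.mul_prod_erase _ _ (Finset.mem_univ i)).symm

/-- The distinguished partial derivative as a linear map. -/
noncomputable def pdL (i : Fin 9) : DPA K →ₗ[K] DPA K := pd K i

theorem pdL_mono (i : Fin 9) (r : Fin 9 → ℕ) :
    pdL i (mono K r) = if r i = 0 then 0 else mono K (Function.update r i (r i - 1)) := by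
  refine (pd_single i r).trans ?_
  split_ifs <;> rfl

/-- Pascal's rule in the `i`-th factor. It is the Leibniz rule for `∂_i` on monomials that both
involve `x_i`. -/
theorem mcoef_pascal (r s : Fin 9 → ℕ) (i : Fin 9) (hr : r i ≠ 0) (hs : s i ≠ 0) :
    mcoef r s = mcoef (Function.update r i (r i - 1)) s +
      mcoef r (Function.update s i (s i - 1)) := by
  rw [mcoef_update r s i, mcoef_update _ s i, mcoef_update r _ i]
  have h1 : ∏ j ∈ Finset.univ.erase i, (Function.update r i (r i - 1) j + s j).choose
      (Function.update r i (r i - 1) j) = ∏ j ∈ Finset.univ.erase i, (r j + s j).choose (r j) :=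
    Finset.prod_congr rfl fun j hj => by
      rw [Function.update_of_ne (Finset.ne_of_mem_erase hj)]
  have h2 : ∏ j ∈ Finset.univ.erase i, (r j + Function.update s i (s i - 1) j).choose (r j) =
      ∏ j ∈ Finset.univ.erase i, (r j + s j).choose (r j) :=
    Finset.prod_congr rfl fun j hj => by
      rw [Function.update_of_ne (Finset.ne_of_mem_erase hj)]
  rw [h1, h2, ← add_mul, Function.update_self, Function.update_self]
  congr 1
  obtain ⟨a, ha⟩ := Nat.exists_eq_succ_of_ne_zero hr
  obtain ⟨b, hb⟩ := Nat.exists_eq_succ_of_ne_zero hs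
  rw [ha, hb, show a.succ + b.succ = (a + b.succ) + 1 by omega, Nat.choose_succ_succ]
  simp only [Nat.succ_eq_add_one, Nat.add_sub_cancel]
  rw [show a + (b + 1) = a + 1 + b by omega]

theorem mcoef_left_zero (r s : Fin 9 → ℕ) (i : Fin 9) (hr : r i = 0) (n : ℕ) :
    mcoef r (Function.update s i n) = mcoef r s := by
  refine Finset.prod_congr rfl fun j _ => ?_
  by_cases hj : j = i
  · subst hj; rw [hr]; simp
  · rw [Function.update_of_ne hj]

theorem pdL_mul (i : Fin 9) (f g : DPA K) : pdL i (f * g) = f * pdL i g + g * pdL i f := by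
  let A : DPA K →ₗ[K] DPA K →ₗ[K] DPA K := (mulBil K).compr₂ (pdL i)
  let B : DPA K →ₗ[K] DPA K →ₗ[K] DPA K :=
    (mulBil K).compl₂ (pdL i) + (mulBil K).comp (pdL i)
  have hAB : A = B := by
    refine DPA.hom_ext fun r => DPA.hom_ext fun s => ?_
    change pdL i (mulBil K (mono K r) (mono K s)) =
      mulBil K (mono K r) (pdL i (mono K s)) + mulBil K (pdL i (mono K r)) (mono K s)
    rw [mulBil_mono, map_smul, pdL_mono, pdL_mono, pdL_mono]
    by_cases hr : r i = 0
    · by_cases hs : s i = 0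
      · simp [hr, hs]
      · rw [if_neg (by simp [hs]), if_neg hs, if_pos hr, LinearMap.map_zero₂, add_zero,
          mulBil_mono, mcoef_left_zero r s i hr]
        congr 2
        funext j
        by_cases hj : j = i
        · subst hj; simp [hr]
        · simp [Function.update_of_ne hj]
    · by_cases hs : s i = 0
      · rw [if_neg (by simp [hr]), if_pos hs, if_neg hr, map_zero, zero_add,
          mulBil_mono, mcoef_comm, ← mcoef_left_zero s r i hs (r i - 1), mcoef_comm s]
        congr 2
        funext j
        by_cases hj : j = i
        · subst hj; simp [hs]
        · simp [Function.update_of_ne hj]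
      · rw [if_neg (by simp [hr]), if_neg hs, if_neg hr, mulBil_mono, mulBil_mono,
          mcoef_pascal r s i hr hs, Nat.cast_add, add_smul, add_comm]
        congr 3
        · funext j
          by_cases hj : j = i
          · subst hj; simp; omega
          · simp [Function.update_of_ne hj]
        · funext j
          by_cases hj : j = i
          · subst hj; simp; omega
          · simp [Function.update_of_ne hj]
  have h := congrArg (fun C : DPA K →ₗ[K] DPA K →ₗ[K] DPA K => C f g) hAB
  refine h.trans ?_
  change f * pdL i g + pdL i f * g = _
  ring

/-- The distinguished partial derivative as a derivation. -/
noncomputable def pdD (K : Type*) [Field K] (i : Fin 9) : Derivation K (DPA K) (DPA K) :=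
  Derivation.mk' (pdL i) fun f g => by rw [pdL_mul]; rfl

theorem pdD_mono (i : Fin 9) (r : Fin 9 → ℕ) :
    pdD K i (mono K r) = if r i = 0 then 0 else mono K (Function.update r i (r i - 1)) :=
  pdL_mono i r

/-- A derivation as an operator on `DP K`. -/
noncomputable def toOp : Derivation K (DPA K) (DPA K) →ₗ[K] Op K where
  toFun D := (D : DPA K →ₗ[K] DPA K)
  map_add' := fun _ _ => rfl
  map_smul' := fun _ _ => rfl

theorem toOp_injective : Function.Injective (toOp (K := K)) := fun _ _ h =>
  Derivation.ext fun f => congrArg (fun T : Op K => T f) h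

theorem lie_toOp (D E : Derivation K (DPA K) (DPA K)) : ⁅toOp D, toOp E⁆ = toOp ⁅D, E⁆ := by
  refine LinearMap.ext fun f => ?_
  exact (Derivation.commutator_apply (D1 := D) (D2 := E) (f : DPA K)).symm

theorem vf_eq (r : Fin 9 → ℕ) (i : Fin 9) : vf K r i = toOp (mono K r • pdD K i) := by
  refine LinearMap.ext fun f => ?_
  change mulMono K r (pd K i f) = mulBil K (mono K r) (pdL i f)
  rw [mulBil_mono_left]
  rfl

theorem pdD_comm (i j : Fin 9) (f : DPA K) : pdD K i (pdD K j f) = pdD K j (pdD K i f) := by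
  have : (pdL i).comp (pdL j) = (pdL j).comp (pdL (K := K) i) := by
    refine DPA.hom_ext fun r => ?_
    by_cases hij : i = j
    · rw [hij]
    simp only [LinearMap.comp_apply, pdL_mono]
    by_cases hi : r i = 0 <;> by_cases hj : r j = 0 <;>
      simp [hi, hj, pdL_mono, Function.update_of_ne hij, Function.update_of_ne (Ne.symm hij)]
    rw [Function.update_comm hij]
  exact congrArg (fun T : DPA K →ₗ[K] DPA K => T f) this

end Ring

/-! ### Contact fields -/

section Contact

variable {K : Type*} [Field K]

/-- The indeterminate of index `j`. -/
noncomputable def xv (K : Type*) [Field K] (j : Fin 9) : DPA K := mono K (Pi.single j 1)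

theorem pdD_xv (i j : Fin 9) : pdD K i (xv K j) = if i = j then 1 else 0 := by
  rw [xv, pdD_mono]
  by_cases h : i = j
  · subst h
    rw [if_neg (by simp), if_pos rfl, ← mono_zero]
    congr 1
    funext k
    by_cases hk : k = i
    · subst hk; simp
    · simp [Function.update_of_ne hk, Pi.single_eq_of_ne hk]
  · rw [if_neg h, if_pos (Pi.single_eq_of_ne h 1)]

/-- The fields of the contact distribution: `∂_j`, corrected by a multiple of `∂_1` for half of
the indices. -/
noncomputable def zD (K : Type*) [Field K] (i : Fin 8) : Derivation K (DPA K) (DPA K) :=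
  pdD K i.succ + (if i.val < 4 then xv K i.rev.succ else 0) • pdD K 0

theorem zD_apply (i : Fin 8) (a : DPA K) :
    zD K i a = pdD K i.succ a + (if i.val < 4 then xv K i.rev.succ else 0) * pdD K 0 a := rfl

theorem pdD_zero_zD (i : Fin 8) (a : DPA K) : pdD K 0 (zD K i a) = zD K i (pdD K 0 a) := by
  rw [zD_apply, zD_apply, map_add, Derivation.leibniz, pdD_comm]
  have : pdD K 0 (if i.val < 4 then xv K i.rev.succ else 0) = 0 := by
    split_ifs
    · rw [pdD_xv, if_neg (Fin.succ_ne_zero _).symm]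
    · exact map_zero _
  rw [this]
  simp

/-- Exactly one of `i` and `i.rev` is below 4, so exactly one field of each pair carries a multiple
of `∂_1`, and the other field differentiates its coefficient to 1. -/
theorem zD_comm [CharP K 2] (i j : Fin 8) (a : DPA K) :
    zD K i (zD K j a) = zD K j (zD K i a) + if j = i.rev then pdD K 0 a else 0 := by
  have key : ∀ i j : Fin 8, zD K i (zD K j a) = pdD K i.succ (pdD K j.succ a) +
      (if j.val < 4 ∧ i = j.rev then pdD K 0 a else 0) +
      (if j.val < 4 then xv K j.rev.succ else 0) * pdD K 0 (pdD K i.succ a) +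
      (if i.val < 4 then xv K i.rev.succ else 0) * pdD K 0 (pdD K j.succ a) +
      (if i.val < 4 then xv K i.rev.succ else 0) * (if j.val < 4 then xv K j.rev.succ else 0)
        * pdD K 0 (pdD K 0 a) := by
    intro i j
    rw [zD_apply i, pdD_zero_zD, zD_apply j, zD_apply j, map_add, Derivation.leibniz,
      pdD_comm i.succ 0, pdD_comm j.succ 0]
    have : pdD K i.succ (if j.val < 4 then xv K j.rev.succ else 0) =
        if j.val < 4 ∧ i = j.rev then 1 else 0 := by
      by_cases h : j.val < 4
      · rw [if_pos h, pdD_xv]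
        simp [h, Fin.succ_inj]
      · simp [h]
    rw [this]
    simp only [smul_eq_mul]
    by_cases hc : j.val < 4 ∧ i = j.rev
    · rw [if_pos hc, if_pos hc]; ring
    · rw [if_neg hc, if_neg hc]; ring
  rw [key i j, key j i, pdD_comm i.succ j.succ]
  have h2 : (if j.val < 4 ∧ i = j.rev then pdD K 0 a else 0) =
      (if i.val < 4 ∧ j = i.rev then pdD K 0 a else 0) + if j = i.rev then pdD K 0 a else 0 := by
    by_cases h : j = i.rev
    · subst h
      have hv := Fin.val_rev i
      by_cases hi : i.val < 4
      · have : ¬ (i.rev.val < 4) := by omega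
        rw [if_neg (by tauto), if_pos ⟨hi, rfl⟩, if_pos rfl, CharTwo.add_self_eq_zero]
      · have : i.rev.val < 4 := by omega
        rw [if_pos ⟨this, (Fin.rev_rev i).symm⟩, if_neg (by tauto), if_pos rfl, zero_add]
    · have h' : i ≠ j.rev := fun h1 => h (by rw [h1, Fin.rev_rev])
      simp [h, h']
  rw [h2]
  ring

/-- The contact field with generating function `f`. -/
noncomputable def cD (f : DPA K) : Derivation K (DPA K) (DPA K) :=
  f • pdD K 0 + ∑ i : Fin 8, zD K i.rev f • zD K i

theorem cD_apply (f a : DPA K) :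
    cD f a = f * pdD K 0 a + ∑ i : Fin 8, zD K i.rev f * zD K i a := by
  rw [cD, Derivation.add_apply, Derivation.smul_apply, smul_eq_mul]
  congr 1

/-- The contact bracket of generating functions. -/
noncomputable def cBr (f g : DPA K) : DPA K :=
  f * pdD K 0 g + pdD K 0 f * g + ∑ i : Fin 8, zD K i.rev f * zD K i g

theorem sum_rev {M : Type*} [AddCommMonoid M] (F : Fin 8 → M) :
    ∑ i : Fin 8, F i.rev = ∑ i, F i := Equiv.sum_comp Fin.revPerm F

set_option maxHeartbeats 1000000 in
theorem cD_cD (f g a : DPA K) : cD f (cD g a) =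
    f * pdD K 0 g * pdD K 0 a + f * g * pdD K 0 (pdD K 0 a) +
    (∑ j : Fin 8, f * zD K j.rev (pdD K 0 g) * zD K j a
      + ∑ j : Fin 8, f * zD K j.rev g * zD K j (pdD K 0 a)) +
    (∑ i : Fin 8, zD K i.rev f * zD K i g * pdD K 0 a +
      ∑ i : Fin 8, zD K i.rev f * g * zD K i (pdD K 0 a)) +
    (∑ i : Fin 8, ∑ j : Fin 8, zD K i.rev f * zD K i (zD K j.rev g) * zD K j a +
      ∑ i : Fin 8, ∑ j : Fin 8, zD K i.rev f * zD K j.rev g * zD K i (zD K j a)) := by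
  rw [cD_apply f, cD_apply g]
  simp only [map_add, map_sum, Derivation.leibniz, smul_eq_mul, pdD_zero_zD,
    mul_add, Finset.mul_sum, Finset.sum_add_distrib]
  simp only [mul_comm, mul_left_comm, mul_assoc]
  ring

-- Second-order terms in `a` cancel up to the commutators of `zD_comm`. The identities `A1`, `A2`,
-- `A3` reorder second derivatives of `a`, `g` and `f`, and the resulting extra terms assemble to
-- the contact field of the bracket.
set_option maxHeartbeats 1000000 in
theorem cD_cD_add [CharP K 2] (f g a : DPA K) :
    cD f (cD g a) + cD g (cD f a) = cD (cBr f g) a := by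
  have two : (2 : DPA K) = 0 := CharTwo.two_eq_zero
  have A1 : ∑ i : Fin 8, ∑ j : Fin 8, zD K i.rev g * zD K j.rev f * zD K i (zD K j a) =
      ∑ i : Fin 8, ∑ j : Fin 8, zD K i.rev f * zD K j.rev g * zD K i (zD K j a) +
      ∑ i : Fin 8, zD K i.rev f * zD K i g * pdD K 0 a := by
    rw [Finset.sum_comm, ← Finset.sum_add_distrib]
    refine Finset.sum_congr rfl fun i _ => ?_
    have : ∀ j : Fin 8, zD K j.rev g * zD K i.rev f * zD K j (zD K i a) =
        zD K i.rev f * zD K j.rev g * zD K i (zD K j a) +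
        if j = i.rev then zD K i.rev f * zD K j.rev g * pdD K 0 a else 0 := by
      intro j
      rw [zD_comm i j]
      split_ifs
      · linear_combination (-(zD K i.rev f * zD K j.rev g * pdD K 0 a)) * two
      · ring
    rw [Finset.sum_congr rfl fun j _ => this j, Finset.sum_add_distrib,
      Finset.sum_ite_eq' Finset.univ i.rev, if_pos (Finset.mem_univ _), Fin.rev_rev]
  have A2 : ∑ i : Fin 8, ∑ j : Fin 8, zD K i.rev f * zD K i (zD K j.rev g) * zD K j a =
      ∑ j : Fin 8, ∑ i : Fin 8, zD K i.rev f * zD K j.rev (zD K i g) * zD K j a +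
      ∑ j : Fin 8, zD K j.rev f * pdD K 0 g * zD K j a := by
    rw [Finset.sum_comm, ← Finset.sum_add_distrib]
    refine Finset.sum_congr rfl fun j _ => ?_
    have : ∀ i : Fin 8, zD K i.rev f * zD K i (zD K j.rev g) * zD K j a =
        zD K i.rev f * zD K j.rev (zD K i g) * zD K j a +
        if i = j then zD K i.rev f * pdD K 0 g * zD K j a else 0 := by
      intro i
      rw [zD_comm i j.rev]
      by_cases h : i = j
      · rw [if_pos h, if_pos (by rw [h])]; ring
      · rw [if_neg h, if_neg (fun h' => h (Fin.rev_injective h').symm)]; ring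
    rw [Finset.sum_congr rfl fun j _ => this j, Finset.sum_add_distrib,
      Finset.sum_ite_eq' Finset.univ j, if_pos (Finset.mem_univ _)]
  have A3 : ∑ i : Fin 8, ∑ j : Fin 8, zD K i.rev g * zD K i (zD K j.rev f) * zD K j a =
      ∑ j : Fin 8, ∑ i : Fin 8, zD K j.rev (zD K i.rev f) * zD K i g * zD K j a +
      ∑ j : Fin 8, zD K j.rev g * pdD K 0 f * zD K j a := by
    rw [Finset.sum_comm, ← Finset.sum_add_distrib]
    refine Finset.sum_congr rfl fun j _ => ?_
    rw [← sum_rev]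
    have : ∀ i : Fin 8, zD K i.rev.rev g * zD K i.rev (zD K j.rev f) * zD K j a =
        zD K j.rev (zD K i.rev f) * zD K i g * zD K j a +
        if i = j.rev then zD K i g * pdD K 0 f * zD K j a else 0 := by
      intro i
      rw [zD_comm i.rev j.rev, Fin.rev_rev]
      by_cases h : i = j.rev
      · rw [if_pos h, if_pos h.symm]; ring
      · rw [if_neg h, if_neg (fun h' => h h'.symm)]; ring
    rw [Finset.sum_congr rfl fun j _ => this j, Finset.sum_add_distrib,
      Finset.sum_ite_eq' Finset.univ j.rev, if_pos (Finset.mem_univ _)]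
  have A4 : ∑ i : Fin 8, zD K i.rev g * zD K i f * pdD K 0 a =
      ∑ i : Fin 8, zD K i.rev f * zD K i g * pdD K 0 a := by
    rw [← sum_rev]
    refine Finset.sum_congr rfl fun i _ => ?_
    rw [Fin.rev_rev]; ring
  have R : cD (cBr f g) a = (f * pdD K 0 g + pdD K 0 f * g) * pdD K 0 a +
      ∑ i : Fin 8, zD K i.rev f * zD K i g * pdD K 0 a +
      (∑ j : Fin 8, f * zD K j.rev (pdD K 0 g) * zD K j a +
       ∑ j : Fin 8, zD K j.rev f * pdD K 0 g * zD K j a +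
       ∑ j : Fin 8, g * zD K j.rev (pdD K 0 f) * zD K j a +
       ∑ j : Fin 8, zD K j.rev g * pdD K 0 f * zD K j a) +
      (∑ j : Fin 8, ∑ i : Fin 8, zD K i.rev f * zD K j.rev (zD K i g) * zD K j a +
       ∑ j : Fin 8, ∑ i : Fin 8, zD K j.rev (zD K i.rev f) * zD K i g * zD K j a) := by
    rw [cD_apply, cBr, add_mul, Finset.sum_mul]
    simp only [map_add, map_sum, Derivation.leibniz, smul_eq_mul, add_mul, Finset.sum_mul,
      Finset.sum_add_distrib]
    simp only [mul_comm, mul_left_comm]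
    ring
  have B1 : ∑ i : Fin 8, zD K i.rev f * g * zD K i (pdD K 0 a) =
      ∑ i : Fin 8, g * zD K i.rev f * zD K i (pdD K 0 a) :=
    Finset.sum_congr rfl fun i _ => by ring
  have B2 : ∑ i : Fin 8, zD K i.rev g * f * zD K i (pdD K 0 a) =
      ∑ i : Fin 8, f * zD K i.rev g * zD K i (pdD K 0 a) :=
    Finset.sum_congr rfl fun i _ => by ring
  rw [cD_cD, cD_cD, R, A1, A2, A3, A4, B1, B2]
  linear_combination (f * g * pdD K 0 (pdD K 0 a) +
    ∑ i : Fin 8, zD K i.rev f * zD K i g * pdD K 0 a +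
    ∑ i : Fin 8, f * zD K i.rev g * zD K i (pdD K 0 a) +
    ∑ i : Fin 8, g * zD K i.rev f * zD K i (pdD K 0 a) +
    ∑ i : Fin 8, ∑ j : Fin 8, zD K i.rev f * zD K j.rev g * zD K i (zD K j a)) * two

theorem lie_cD [CharP K 2] (f g : DPA K) : ⁅cD f, cD g⁆ = cD (cBr f g) := by
  ext a
  rw [Derivation.commutator_apply, CharTwo.sub_eq_add, cD_cD_add]

theorem cD_add (f g : DPA K) : cD (f + g) = cD f + cD g := by
  ext a
  simp only [Derivation.add_apply, cD_apply, map_add, add_mul, Finset.sum_add_distrib]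
  ring

theorem cD_smul (c : K) (f : DPA K) : cD (c • f) = c • cD f := by
  ext a
  simp only [Derivation.smul_apply, cD_apply, Derivation.map_smul, smul_mul_assoc, smul_add,
    Finset.smul_sum]

/-- The contact field with a given generating function, as an operator. -/
noncomputable def kap (K : Type*) [Field K] : DPA K →ₗ[K] Op K :=
  toOp.comp ({ toFun := cD, map_add' := cD_add, map_smul' := cD_smul } :
    DPA K →ₗ[K] Derivation K (DPA K) (DPA K))

theorem kap_apply (f : DPA K) : kap K f = toOp (cD f) := rfl

theorem lie_kap [CharP K 2] (f g : DPA K) : ⁅kap K f, kap K g⁆ = kap K (cBr f g) := by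
  rw [kap_apply, kap_apply, lie_toOp, lie_cD, kap_apply]

theorem cD_one : cD (1 : DPA K) = pdD K 0 := by
  ext a
  rw [cD_apply]
  simp

theorem kap_one : kap K 1 = toOp (pdD K 0) := by rw [kap_apply, cD_one]

theorem zD_xv_zero (i : Fin 8) :
    zD K i (xv K 0) = if i.val < 4 then xv K i.rev.succ else 0 := by
  rw [zD_apply, pdD_xv, pdD_xv, if_neg (Fin.succ_ne_zero i), if_pos rfl]
  ring

theorem zD_xv_succ (i j : Fin 8) : zD K i (xv K j.succ) = if i = j then 1 else 0 := by
  rw [zD_apply, pdD_xv, pdD_xv, if_neg (Fin.succ_ne_zero j).symm]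
  simp [Fin.succ_inj]

theorem cD_xv_succ (f : DPA K) (j : Fin 8) : cD f (xv K j.succ) = zD K j.rev f := by
  rw [cD_apply, pdD_xv, if_neg (Fin.succ_ne_zero j).symm]
  simp [zD_xv_succ]

theorem cD_xv_zero (f : DPA K) : cD f (xv K 0) =
    f + ∑ i : Fin 8, zD K i.rev f * if i.val < 4 then xv K i.rev.succ else 0 := by
  rw [cD_apply, pdD_xv, if_pos rfl, mul_one]
  simp only [zD_xv_zero]

/-- Evaluation of operators at a given element. -/
noncomputable def ev (a : DPA K) : Op K →ₗ[K] DPA K where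
  toFun D := D a
  map_add' := fun _ _ => rfl
  map_smul' := fun _ _ => rfl

theorem ev_toOp (a : DPA K) (D : Derivation K (DPA K) (DPA K)) : ev a (toOp D) = D a := rfl

/-- The generating function of a contact field, as a function of the field. -/
noncomputable def genFun (K : Type*) [Field K] : Op K →ₗ[K] DPA K :=
  ev (xv K 0) + ∑ i : Fin 8, (LinearMap.mulRight K
    (if i.val < 4 then xv K i.rev.succ else 0)).comp (ev (xv K i.succ))

theorem genFun_toOp (D : Derivation K (DPA K) (DPA K)) : genFun K (toOp D) = D (xv K 0) +
    ∑ i : Fin 8, D (xv K i.succ) * if i.val < 4 then xv K i.rev.succ else 0 := by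
  rw [genFun, LinearMap.add_apply, LinearMap.sum_apply]
  rfl

/-- The contact form vanishes on the fields `zD`: their contributions to `x_1` and to the other
indeterminates coincide and cancel. -/
theorem genFun_kap [CharP K 2] (f : DPA K) : genFun K (kap K f) = f := by
  rw [kap_apply, genFun_toOp, cD_xv_zero]
  simp only [cD_xv_succ]
  rw [add_assoc, CharTwo.add_self_eq_zero, add_zero]

/-- The coefficients of the contact form do not involve `x_1`. The field `D` need not be contact, so
this applies to an unknown member of a prolong. -/
theorem genFun_lie_pd (D : Derivation K (DPA K) (DPA K)) :
    genFun K ⁅toOp (pdD K 0), toOp D⁆ = pdD K 0 (genFun K (toOp D)) := by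
  rw [lie_toOp, genFun_toOp, genFun_toOp]
  have h0 : ∀ j : Fin 9, ⁅pdD K 0, D⁆ (xv K j) = pdD K 0 (D (xv K j)) := by
    intro j
    rw [Derivation.commutator_apply, pdD_xv]
    split_ifs
    · rw [Derivation.map_one_eq_zero, sub_zero]
    · rw [map_zero, sub_zero]
  rw [h0, map_add, map_sum]
  congr 1
  refine Finset.sum_congr rfl fun i _ => ?_
  rw [h0, Derivation.leibniz]
  have : pdD K 0 (if i.val < 4 then xv K i.rev.succ else 0) = 0 := by
    split_ifs
    · rw [pdD_xv, if_neg (Fin.succ_ne_zero _).symm]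
    · exact map_zero _
  rw [this]
  simp [mul_comm]

end Contact

/-! ### Functions of the even indeterminate with square-free coefficients, as lists -/

section Lists

/-- The exponent vector with exponent `s` of the first indeterminate, and with exponents of the
others given by the binary digits of `m`. -/
def bits (m s : ℕ) : Fin 9 → ℕ := Fin.cons s fun i : Fin 8 => (m.testBit i.val).toNat

theorem bits_zero (m s : ℕ) : bits m s 0 = s := rfl
theorem bits_succ (m s : ℕ) (i : Fin 8) : bits m s i.succ = (m.testBit i.val).toNat := rfl

/-- Partial derivative with respect to the first indeterminate. -/
def derL (f : List (ℕ × ℕ)) : List (ℕ × ℕ) := f.map fun p => (p.1 + 1, p.2)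

/-- An entry is the order of a derivative of `u` together with a square-free monomial. In the `∂_1`
part, monomials already divisible by the new factor are dropped, since `x_j x_j = 2 x_j^(2) = 0`. -/
def zedL (i : Fin 8) (f : List (ℕ × ℕ)) : List (ℕ × ℕ) :=
  (f.filter fun p => p.2.testBit i.val).map (fun p => (p.1, p.2 ^^^ 2 ^ i.val)) ++
  if i.val < 4 then (f.filter fun p => !p.2.testBit i.rev.val).map
    (fun p => (p.1 + 1, p.2 ||| 2 ^ i.rev.val)) else []

/-- Only products of coprime monomials survive. The reduction mod 256 confines the test to the eight
digits that `bits` reads. -/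
def mulL (f g : List (ℕ × ℕ)) : List (ℕ × ℕ × ℕ) :=
  f.flatMap fun p => (g.filter fun q => (p.2 &&& q.2) % 256 == 0).map
    fun q => (p.1, q.1, p.2 ||| q.2)

/-- The contact bracket. -/
def brL (f g : List (ℕ × ℕ)) : List (ℕ × ℕ × ℕ) :=
  mulL f (derL g) ++ mulL (derL f) g ++
    (List.finRange 8).flatMap fun i => mulL (zedL i.rev f) (zedL i g)

/-- The terms of the `c`-th derivative of `u^(a) w^(b)`; repetitions play the role of binomial
coefficients. -/
def leibL : ℕ → ℕ → ℕ → List (ℕ × ℕ)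
  | 0, a, b => [(a, b)]
  | c + 1, a, b => leibL c (a + 1) b ++ leibL c a (b + 1)

def expL (f : List (ℕ × ℕ)) (a b : ℕ) : List (ℕ × ℕ × ℕ) :=
  f.flatMap fun p => (leibL p.1 a b).map fun q => (q.1, q.2, p.2)

/-- Duplicate-free lists represent vectors over the field of two elements; this adds a basis vector.
-/
def toggle {α : Type*} [DecidableEq α] (t : α) (l : List α) : List α :=
  if t ∈ l then l.erase t else t :: l

/-- The list of those elements which occur an odd number of times. -/
def normL {α : Type*} [DecidableEq α] (l : List α) : List α := l.foldr toggle []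

theorem toggle_of_not_mem {α : Type*} [DecidableEq α] {t : α} {l : List α} (h : t ∉ l) :
    toggle t l = t :: l := if_neg h

theorem perm_toggle {α : Type*} [DecidableEq α] {t : α} {l : List α} (h : t ∈ l) :
    l.Perm (t :: toggle t l) := by
  rw [toggle, if_pos h]
  exact List.perm_cons_erase h

end Lists

/-! ### Differential expressions given by lists -/

section Den

variable {K : Type*} [Field K]

/-- The square-free monomial whose exponents are the binary digits of `m`. -/
noncomputable def xm (K : Type*) [Field K] (m : ℕ) : DPA K := mono K (bits m 0)

/-- The divided power of the first indeterminate. -/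
noncomputable def tp (K : Type*) [Field K] (s : ℕ) : DPA K := mono K (bits 0 s)

theorem mcoef_bits (m k s t : ℕ) : mcoef (bits m s) (bits k t) = (s + t).choose s *
    ∏ i : Fin 8, ((m.testBit i.val).toNat + (k.testBit i.val).toNat).choose
      (m.testBit i.val).toNat := by
  rw [mcoef, Fin.prod_univ_succ]
  rfl

theorem tp_mul_tp (s t : ℕ) : tp K s * tp K t = ((s + t).choose s : K) • tp K (s + t) := by
  rw [tp, tp, mono_mul, mcoef_bits]
  have : bits 0 s + bits 0 t = bits 0 (s + t) := by
    funext j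
    refine Fin.cases rfl (fun i => ?_) j
    simp [bits_succ]
  rw [this]
  simp [tp]

theorem tp_mul_xm (s m : ℕ) : tp K s * xm K m = mono K (bits m s) := by
  rw [tp, xm, mono_mul, mcoef_bits]
  have : bits 0 s + bits m 0 = bits m s := by
    funext j
    refine Fin.cases rfl (fun i => ?_) j
    simp [bits_succ]
  rw [this]
  simp

theorem and_mod_eq_zero (m k : ℕ) : (m &&& k) % 256 = 0 ↔
    ∀ i : Fin 8, (m.testBit i.val && k.testBit i.val) = false := by
  constructor
  · intro h i
    have := congrArg (fun n => n.testBit i.val) h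
    rwa [show 256 = 2 ^ 8 from rfl, Nat.testBit_mod_two_pow, Nat.zero_testBit, decide_eq_true i.isLt,
      Bool.true_and, Nat.testBit_and] at this
  · intro h
    refine Nat.eq_of_testBit_eq fun i => ?_
    rw [show 256 = 2 ^ 8 from rfl, Nat.testBit_mod_two_pow, Nat.testBit_and, Nat.zero_testBit]
    by_cases hi : i < 8
    · rw [h ⟨i, hi⟩, Bool.and_false]
    · simp [hi]

/-- A common factor contributes the binomial coefficient `2 = 0`; in all other positions the
coefficient is 1. -/
theorem xm_mul_xm [CharP K 2] (m k : ℕ) :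
    xm K m * xm K k = if (m &&& k) % 256 = 0 then xm K (m ||| k) else 0 := by
  rw [xm, xm, mono_mul, mcoef_bits]
  split_ifs with h
  · have hb := (and_mod_eq_zero m k).1 h
    have : bits m 0 + bits k 0 = bits (m ||| k) 0 := by
      funext j
      refine Fin.cases rfl (fun i => ?_) j
      have := hb i
      simp only [Pi.add_apply, bits_succ, Nat.testBit_or]
      revert this
      cases m.testBit i.val <;> cases k.testBit i.val <;> simp
    rw [this, Finset.prod_eq_one]
    · simp [xm]
    · intro i _
      have := hb i
      revert this
      cases m.testBit i.val <;> cases k.testBit i.val <;> simp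
  · rw [and_mod_eq_zero] at h
    push Not at h
    obtain ⟨i, h12⟩ := h
    obtain ⟨h1, h2⟩ : m.testBit i.val = true ∧ k.testBit i.val = true := by simpa using h12
    rw [← Finset.mul_prod_erase _ _ (Finset.mem_univ i), h1, h2]
    have : ((1 + 1 : ℕ).choose 1 : K) = 0 := by
      have : ((2 : ℕ) : K) = 0 := CharP.cast_eq_zero K 2
      simpa using this
    push_cast
    simp only [Bool.toNat_true, this]
    simp

theorem xv_succ (i : Fin 8) : xv K i.succ = xm K (2 ^ i.val) := by
  rw [xv, xm]
  congr 1
  funext j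
  refine Fin.cases ?_ (fun k => ?_) j
  · rw [Pi.single_eq_of_ne (Fin.succ_ne_zero i).symm]; rfl
  · rw [bits_succ, Nat.testBit_two_pow]
    by_cases h : k = i
    · subst h; simp
    · rw [Pi.single_eq_of_ne (fun h' => h (Fin.succ_injective _ h'))]
      have : i.val ≠ k.val := fun h' => h (Fin.ext h'.symm)
      simp [this]

theorem pdD_zero_xm (m : ℕ) : pdD K 0 (xm K m) = 0 := by
  rw [xm, pdD_mono, if_pos (bits_zero m 0)]

theorem pdD_succ_xm (i : Fin 8) (m : ℕ) :
    pdD K i.succ (xm K m) = if m.testBit i.val then xm K (m ^^^ 2 ^ i.val) else 0 := by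
  rw [xm, pdD_mono, bits_succ]
  cases h : m.testBit i.val
  · simp
  · simp only [Bool.toNat_true, one_ne_zero, if_false, if_true, xm]
    congr 1
    funext j
    by_cases hj : j = i.succ
    · subst hj
      rw [Function.update_self, bits_succ, Nat.testBit_xor, h, Nat.testBit_two_pow]
      simp
    · rw [Function.update_of_ne hj]
      revert hj
      refine Fin.cases (fun _ => rfl) (fun k hk => ?_) j
      have : i.val ≠ k.val := fun h' => hk (congrArg Fin.succ (Fin.ext h'.symm))
      rw [bits_succ, bits_succ, Nat.testBit_xor, Nat.testBit_two_pow]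
      simp [this]

theorem pdD_zero_tp (s : ℕ) : pdD K 0 (tp K s) = if s = 0 then 0 else tp K (s - 1) := by
  rw [tp, pdD_mono, bits_zero]
  split_ifs with h
  · rfl
  · rw [tp]
    congr 1
    funext j
    refine Fin.cases ?_ (fun i => ?_) j
    · rw [Function.update_self]; rfl
    · rw [Function.update_of_ne (Fin.succ_ne_zero i)]; rfl

theorem tp_zero : tp K 0 = 1 := by
  rw [← mono_zero, tp]
  congr 1
  funext j
  refine Fin.cases rfl (fun i => ?_) j
  simp [bits_succ]

theorem xm_zero : xm K 0 = 1 := tp_zero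

/-- Functions of the first indeterminate only. -/
def EvenFun (u : DPA K) : Prop := ∀ i : Fin 8, pdD K i.succ u = 0

theorem evenFun_tp (s : ℕ) : EvenFun (tp K s) := by
  intro i
  rw [tp, pdD_mono, if_pos]
  simp [bits_succ]

theorem EvenFun.pd {u : DPA K} (hu : EvenFun u) : EvenFun (pdD K 0 u) := fun i => by
  rw [pdD_comm, hu i, map_zero]

theorem EvenFun.iterate {u : DPA K} (hu : EvenFun u) (a : ℕ) : EvenFun ((pdD K 0)^[a] u) := by
  induction a with
  | zero => exact hu
  | succ a ih => rw [Function.iterate_succ_apply']; exact ih.pd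

/-- The function given by a list, where `(a, m)` is the product of the derivative of order `a` of
`u` and the square-free monomial `m`. -/
noncomputable def den1 (u : DPA K) (f : List (ℕ × ℕ)) : DPA K :=
  (f.map fun p => (pdD K 0)^[p.1] u * xm K p.2).sum

/-- The bilinear differential expression given by a list. -/
noncomputable def den2 (u w : DPA K) (f : List (ℕ × ℕ × ℕ)) : DPA K :=
  (f.map fun p => (pdD K 0)^[p.1] u * (pdD K 0)^[p.2.1] w * xm K p.2.2).sum

theorem den1_nil (u : DPA K) : den1 u [] = 0 := rfl
theorem den1_cons (u : DPA K) (p : ℕ × ℕ) (f : List (ℕ × ℕ)) :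
    den1 u (p :: f) = (pdD K 0)^[p.1] u * xm K p.2 + den1 u f := by simp [den1]
theorem den1_append (u : DPA K) (f g : List (ℕ × ℕ)) :
    den1 u (f ++ g) = den1 u f + den1 u g := by simp [den1]
theorem den2_nil (u w : DPA K) : den2 u w [] = 0 := rfl
theorem den2_cons (u w : DPA K) (p : ℕ × ℕ × ℕ) (f : List (ℕ × ℕ × ℕ)) :
    den2 u w (p :: f) = (pdD K 0)^[p.1] u * (pdD K 0)^[p.2.1] w * xm K p.2.2 + den2 u w f := by
  simp [den2]
theorem den2_append (u w : DPA K) (f g : List (ℕ × ℕ × ℕ)) :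
    den2 u w (f ++ g) = den2 u w f + den2 u w g := by simp [den2]
theorem den2_flatMap {α : Type*} (u w : DPA K) (l : List α) (F : α → List (ℕ × ℕ × ℕ)) :
    den2 u w (l.flatMap F) = (l.map fun x => den2 u w (F x)).sum := by
  induction l with
  | nil => rfl
  | cons x l ih => rw [List.flatMap_cons, den2_append, ih, List.map_cons, List.sum_cons]

theorem pdD_zero_den1 (u : DPA K) (f : List (ℕ × ℕ)) :
    pdD K 0 (den1 u f) = den1 u (derL f) := by
  induction f with
  | nil => exact map_zero _
  | cons p f ih =>
    have : derL (p :: f) = (p.1 + 1, p.2) :: derL f := rfl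
    rw [this, den1_cons, map_add, ih, Derivation.leibniz, pdD_zero_xm, smul_zero, zero_add,
      den1_cons, Function.iterate_succ_apply', smul_eq_mul, mul_comm]

/-- As `u` depends on `x_1` alone, `∂_1` acts only on the derivatives of `u`, and the other partial
derivatives act only on the monomials. -/
theorem zD_den1 [CharP K 2] {u : DPA K} (hu : EvenFun u) (i : Fin 8) (f : List (ℕ × ℕ)) :
    zD K i (den1 u f) = den1 u (zedL i f) := by
  obtain ⟨r, hr⟩ : ∃ r, i.rev = r := ⟨_, rfl⟩
  have key : ∀ p : ℕ × ℕ, zD K i ((pdD K 0)^[p.1] u * xm K p.2) =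
      (if p.2.testBit i.val then (pdD K 0)^[p.1] u * xm K (p.2 ^^^ 2 ^ i.val) else 0) +
      (if i.val < 4 then (if p.2.testBit r.val then 0 else
        (pdD K 0)^[p.1 + 1] u * xm K (p.2 ||| 2 ^ r.val)) else 0) := by
    intro p
    rw [zD_apply, hr, Derivation.leibniz, Derivation.leibniz, pdD_zero_xm, pdD_succ_xm,
      hu.iterate p.1 i, smul_zero, smul_zero, add_zero, zero_add, Function.iterate_succ_apply']
    congr 1
    · split_ifs <;> simp
    · by_cases h4 : i.val < 4
      · rw [if_pos h4, if_pos h4, xv_succ, smul_eq_mul, ← mul_assoc, xm_mul_xm]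
        have hb : (2 ^ r.val &&& p.2) % 256 = 0 ↔ p.2.testBit r.val = false := by
          rw [and_mod_eq_zero]
          constructor
          · intro h
            simpa using h r
          · intro h j
            rw [Nat.testBit_two_pow]
            by_cases hj : r.val = j.val
            · rw [← hj, h, Bool.and_false]
            · rw [decide_eq_false hj, Bool.false_and]
        cases h : p.2.testBit r.val
        · rw [if_pos (hb.2 h), if_neg (by simp), Nat.or_comm, mul_comm]
        · rw [if_neg (by rw [hb, h]; simp), if_pos rfl, zero_mul]
      · rw [if_neg h4, if_neg h4, zero_mul]
  induction f with
  | nil => rw [den1_nil, map_zero]; simp [zedL, den1_nil]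
  | cons p f ih =>
    rw [den1_cons, map_add, ih, key]
    simp only [zedL, hr, den1_append]
    by_cases h4 : i.val < 4
    · simp only [if_pos h4]
      cases h1 : p.2.testBit i.val <;> cases h2 : p.2.testBit r.val <;>
        simp [h1, h2, den1_cons] <;> abel
    · simp only [if_neg h4]
      cases h1 : p.2.testBit i.val <;> simp [h1, den1_cons]
      abel

theorem den1_mul [CharP K 2] (u w : DPA K) (f g : List (ℕ × ℕ)) :
    den1 u f * den1 w g = den2 u w (mulL f g) := by
  induction f with
  | nil => rw [den1_nil, zero_mul]; rfl
  | cons p f ih =>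
    rw [den1_cons, add_mul, ih, show mulL (p :: f) g = ((g.filter fun q => (p.2 &&& q.2) % 256 == 0).map
      fun q => (p.1, q.1, p.2 ||| q.2)) ++ mulL f g from rfl, den2_append]
    congr 1
    clear ih
    induction g with
    | nil => rw [den1_nil, mul_zero]; rfl
    | cons q g ih =>
      rw [den1_cons, mul_add, ih]
      have h := xm_mul_xm (K := K) p.2 q.2
      by_cases hd : (p.2 &&& q.2) % 256 = 0
      · rw [if_pos hd] at h
        rw [List.filter_cons_of_pos (by simpa using hd), List.map_cons, den2_cons, ← h]
        ring
      · rw [if_neg hd] at h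
        rw [List.filter_cons_of_neg (by simpa using hd)]
        linear_combination ((pdD K 0)^[p.1] u * (pdD K 0)^[q.1] w) * h

/-- Here `u` and `w` stay arbitrary, so a single list computation covers the brackets of two whole
families. -/
theorem cBr_den1 [CharP K 2] {u w : DPA K} (hu : EvenFun u) (hw : EvenFun w)
    (f g : List (ℕ × ℕ)) : cBr (den1 u f) (den1 w g) = den2 u w (brL f g) := by
  rw [cBr, brL, den2_append, den2_append, den2_flatMap, pdD_zero_den1, pdD_zero_den1,
    den1_mul, den1_mul]
  congr 1
  rw [← List.sum_ofFn, List.ofFn_eq_map]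
  congr 2
  funext i
  rw [zD_den1 hu, zD_den1 hw, den1_mul]

theorem iterate_leibL (u w : DPA K) (c a b : ℕ) :
    (pdD K 0)^[c] ((pdD K 0)^[a] u * (pdD K 0)^[b] w) =
      ((leibL c a b).map fun q => (pdD K 0)^[q.1] u * (pdD K 0)^[q.2] w).sum := by
  induction c generalizing a b with
  | zero => simp [leibL]
  | succ c ih =>
    rw [Function.iterate_succ_apply, Derivation.leibniz, leibL, List.map_append, List.sum_append,
      ← ih, ← ih, Function.iterate_succ_apply', Function.iterate_succ_apply', smul_eq_mul,
      smul_eq_mul, add_comm, mul_comm ((pdD K 0)^[b] w)]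
    exact map_iterate_add c _ _
where
  map_iterate_add (c : ℕ) (f g : DPA K) :
      (pdD K 0)^[c] (f + g) = (pdD K 0)^[c] f + (pdD K 0)^[c] g := by
    induction c generalizing f g with
    | zero => rfl
    | succ c ih => rw [Function.iterate_succ_apply, map_add, ih]; rfl

theorem den1_mul_iterate (u w : DPA K) (a b : ℕ) (f : List (ℕ × ℕ)) :
    den1 ((pdD K 0)^[a] u * (pdD K 0)^[b] w) f = den2 u w (expL f a b) := by
  rw [expL, den2_flatMap, den1]
  congr 2
  funext p
  rw [iterate_leibL, den2, List.map_map]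
  generalize leibL p.1 a b = l
  induction l with
  | nil => simp
  | cons q l ih => simp only [List.map_cons, List.sum_cons, add_mul, ih, Function.comp]

theorem den2_toggle [CharP K 2] (u w : DPA K) (t : ℕ × ℕ × ℕ) (l : List (ℕ × ℕ × ℕ)) :
    den2 u w (toggle t l) = den2 u w (t :: l) := by
  by_cases h : t ∈ l
  · rw [den2_cons u w t l, show den2 u w l = den2 u w (t :: toggle t l) from
      ((perm_toggle h).map _).sum_eq, den2_cons, ← add_assoc,
      CharTwo.add_self_eq_zero, zero_add]
  · rw [toggle_of_not_mem h]

/-- Equal terms cancel in pairs. This makes identities between differential expressions decidable.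
-/
theorem den2_normL [CharP K 2] (u w : DPA K) (l : List (ℕ × ℕ × ℕ)) :
    den2 u w (normL l) = den2 u w l := by
  induction l with
  | nil => rfl
  | cons t l ih =>
    rw [normL, List.foldr_cons, den2_toggle, den2_cons, den2_cons, ← ih]
    rfl

theorem den2_filter (u w : DPA K) (l : List (ℕ × ℕ × ℕ)) (P : ℕ × ℕ × ℕ → Bool)
    (h : ∀ p : ℕ × ℕ × ℕ, P p = false →
      (pdD K 0)^[p.1] u * (pdD K 0)^[p.2.1] w = 0) :
    den2 u w (l.filter P) = den2 u w l := by
  induction l with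
  | nil => rfl
  | cons t l ih =>
    cases hP : P t
    · rw [List.filter_cons_of_neg (by simp [hP]), ih, den2_cons, h t hP, zero_mul, zero_add]
    · rw [List.filter_cons_of_pos hP, den2_cons, den2_cons, ih]

theorem iterate_eq_zero {u : DPA K} (hu : pdD K 0 u = 0) {a : ℕ} (ha : a ≠ 0) :
    (pdD K 0)^[a] u = 0 := by
  obtain ⟨b, rfl⟩ := Nat.exists_eq_succ_of_ne_zero ha
  rw [Function.iterate_succ_apply, hu]
  induction b with
  | zero => rfl
  | succ b ih => rw [Function.iterate_succ_apply, map_zero]; exact ih (by omega)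

end Den

/-! ### The generating functions of the prolong -/

/-- The square-free monomial with the given factors `x_j`, `2 ≤ j ≤ 9`, as a binary number. -/
def msk (l : List ℕ) : ℕ := l.foldl (fun m j => m + 2 ^ (j - 2)) 0

/-- The coefficients of `u, u', u'', …` in the generating functions `F_v(u)`. Here `F_0(1)`
generates `∂_1`, the functions `F_v(1)` with `1 ≤ v ≤ 8` generate the component of degree `-1`,
those with `9 ≤ v ≤ 14` the fields `X_i^±` with `i ≠ 2`, `F_15(1)` generates the Euler field, and
the last two complete the torus. -/
def fam : Fin 18 → List (List (List ℕ)) :=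
  ![
    [[[]], [[2, 9]], [[2, 6, 7, 8]]],
    [[[2]], [[3, 4, 5], [2, 5, 6], [2, 4, 7], [2, 3, 8]], [[2, 4, 5, 6, 7], [2, 3, 5, 6, 8], [2, 3, 4, 7, 8], [2, 3, 4, 5, 9]], [[2, 3, 4, 5, 6, 7, 8]]],
    [[[3]], [[2, 6, 7], [2, 3, 9]], [[2, 3, 6, 7, 8]]],
    [[[4]], [[2, 6, 8], [2, 4, 9]], [[2, 4, 6, 7, 8]]],
    [[[5]], [[2, 7, 8], [2, 5, 9]], [[2, 5, 6, 7, 8]]],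
    [[[6]], [[4, 6, 7], [3, 6, 8], [3, 4, 9]], [[3, 4, 6, 7, 8]]],
    [[[7]], [[5, 6, 7], [3, 7, 8], [3, 5, 9]], [[3, 5, 6, 7, 8]]],
    [[[8]], [[5, 6, 8], [4, 7, 8], [4, 5, 9]], [[4, 5, 6, 7, 8]]],
    [[[9]], [[6, 7, 8]]],
    [[[2, 8], [4, 5]], [[2, 5, 6, 8], [2, 4, 7, 8], [2, 4, 5, 9]], [[2, 4, 5, 6, 7, 8]]],
    [[[3, 9], [6, 7]], [[3, 6, 7, 8]]],
    [[[2, 7], [3, 5]], [[2, 5, 6, 7], [2, 3, 7, 8], [2, 3, 5, 9]], [[2, 3, 5, 6, 7, 8]]],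
    [[[4, 9], [6, 8]], [[4, 6, 7, 8]]],
    [[[2, 6], [3, 4]], [[2, 4, 6, 7], [2, 3, 6, 8], [2, 3, 4, 9]], [[2, 3, 4, 6, 7, 8]]],
    [[[5, 9], [7, 8]], [[5, 6, 7, 8]]],
    [[[5, 6], [4, 7], [3, 8], [2, 9]], [[4, 5, 6, 7], [3, 5, 6, 8], [3, 4, 7, 8], [2, 6, 7, 8], [3, 4, 5, 9]], [[3, 4, 5, 6, 7, 8]]],
    [[[2, 9], [3, 8]]],
    [[[2, 9], [4, 7]]]]
/-- The function `F_v` in the form of a list. -/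
def lam (v : Fin 18) : List (ℕ × ℕ) :=
  (fam v).zipIdx.flatMap fun p => p.1.map fun w => (p.2, msk w)

/-- The monomials whose coefficients in `∑ F_w(u_w)` add up to `u_v`. -/
def dual : Fin 18 → List ℕ :=
  ![[msk []], [msk [2]], [msk [3]], [msk [4]], [msk [5]], [msk [6]], [msk [7]], [msk [8]],
    [msk [9]], [msk [4, 5]], [msk [6, 7]], [msk [3, 5]], [msk [6, 8]], [msk [3, 4]], [msk [7, 8]],
    [msk [5, 6]], [msk [3, 8], msk [5, 6]], [msk [4, 7], msk [5, 6]]]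

/-- The last two functions are only used with constant coefficients. -/
def constOK (v w : Fin 18) (p : ℕ × ℕ × ℕ) : Bool :=
  (v.val < 16 || p.1 == 0) && (w.val < 16 || p.2.1 == 0)

def brV (v w : Fin 18) : List (ℕ × ℕ × ℕ) := (brL (lam v) (lam w)).filter (constOK v w)

/-- The bilinear operations `u w`, `u' w`, `u w'` and `(u w)'` that occur in brackets. -/
inductive Kind
  | U | L | R | D
  deriving DecidableEq

/-- The orders of derivatives in a bilinear operation. -/
def Kind.orders : Kind → List (ℕ × ℕ)
  | .U => [(0, 0)]
  | .L => [(1, 0)]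
  | .R => [(0, 1)]
  | .D => [(1, 0), (0, 1)]

open Kind in
/-- The bracket `{F_v(u), F_w(w)}` is the sum of `F_z(k(u, w))` over the entries `(z, k)`. -/
def tab : Fin 18 → Fin 18 → List (Fin 18 × Kind) :=
  ![
    ![[(0, D)], [(1, R)], [(2, D)], [(3, D)], [(4, D)], [(5, R)], [(6, R)], [(7, R)], [(8, D)],
      [(9, D)], [(10, D)], [(11, D)], [(12, D)], [(13, D)], [(14, D)], [(15, R)], [], []],
    ![[(1, L)], [], [], [], [], [(13, D)], [(11, D)], [(9, D)], [(0, U), (15, L)], [], [(2, U)],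
      [], [(3, U)], [], [(4, U)], [(1, U)], [(1, U)], [(1, U)]],
    ![[(2, D)], [], [], [(13, D)], [(11, D)], [], [], [(0, U), (15, R)], [(10, D)], [(1, U)],
      [], [], [(5, U)], [], [(6, U)], [(2, U)], [(2, U)], []],
    ![[(3, D)], [], [(13, D)], [], [(9, D)], [], [(0, U), (15, R)], [], [(12, D)], [], [(5, U)],
      [(1, U)], [], [], [(7, U)], [(3, U)], [], [(3, U)]],
    ![[(4, D)], [], [(11, D)], [(9, D)], [], [(0, U), (15, R)], [], [], [(14, D)], [], [(6, U)],
      [], [(7, U)], [(1, U)], [], [(4, U)], [], []],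
    ![[(5, L)], [(13, D)], [], [], [(0, U), (15, L)], [], [(10, D)], [(12, D)], [], [(3, U)],
      [], [(2, U)], [], [], [(8, U)], [(5, U)], [], []],
    ![[(6, L)], [(11, D)], [], [(0, U), (15, L)], [], [(10, D)], [], [(14, D)], [], [(4, U)],
      [], [], [(8, U)], [(2, U)], [], [(6, U)], [], [(6, U)]],
    ![[(7, L)], [(9, D)], [(0, U), (15, L)], [], [], [(12, D)], [(14, D)], [], [], [], [(8, U)],
      [(4, U)], [], [(3, U)], [], [(7, U)], [(7, U)], []],
    ![[(8, D)], [(0, U), (15, R)], [(10, D)], [(12, D)], [(14, D)], [], [], [], [], [(7, U)],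
      [], [(6, U)], [], [(5, U)], [], [(8, U)], [(8, U)], [(8, U)]],
    ![[(9, D)], [], [(1, U)], [], [], [(3, U)], [(4, U)], [], [(7, U)], [], [(15, U)], [], [],
      [], [], [], [], [(9, U)]],
    ![[(10, D)], [(2, U)], [], [(5, U)], [(6, U)], [], [], [(8, U)], [], [(15, U)], [], [], [],
      [], [], [], [], [(10, U)]],
    ![[(11, D)], [], [], [(1, U)], [], [(2, U)], [], [(4, U)], [(6, U)], [], [], [], [(15, U)],
      [], [], [], [(11, U)], []],
    ![[(12, D)], [(3, U)], [(5, U)], [], [(7, U)], [], [(8, U)], [], [], [], [], [(15, U)], [],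
      [], [], [], [(12, U)], []],
    ![[(13, D)], [], [], [], [(1, U)], [], [(2, U)], [(3, U)], [(5, U)], [], [], [], [], [],
      [(15, U)], [], [(13, U)], [(13, U)]],
    ![[(14, D)], [(4, U)], [(6, U)], [(7, U)], [], [(8, U)], [], [], [], [], [], [], [],
      [(15, U)], [], [], [(14, U)], [(14, U)]],
    ![[(15, L)], [(1, U)], [(2, U)], [(3, U)], [(4, U)], [(5, U)], [(6, U)], [(7, U)], [(8, U)],
      [], [], [], [], [], [], [], [], []],
    ![[], [(1, U)], [(2, U)], [], [], [], [], [(7, U)], [(8, U)], [], [], [(11, U)], [(12, U)],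
      [(13, U)], [(14, U)], [], [], []],
    ![[], [(1, U)], [], [(3, U)], [], [], [(6, U)], [], [(8, U)], [(9, U)], [(10, U)], [], [],
      [(13, U)], [(14, U)], [], [], []]]

/-- The terms of the bracket and of its tabulated value cancel in pairs. The terms discarded by
`constOK` contain a derivative of a function that is required to be constant. -/
theorem tab_spec : ∀ v w : Fin 18, normL (brV v w ++ (tab v w).flatMap fun t =>
    t.2.orders.flatMap fun q => (expL (lam t.1) q.1 q.2).filter (constOK v w)) = [] := by
  decide +kernel

/-! ### Functions of the even indeterminate and the families `F_v(u)` -/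

section Families

variable {K : Type*} [Field K]

theorem sum_map_normL {α M : Type*} [DecidableEq α] [AddCommMonoid M] (h : ∀ x : M, x + x = 0)
    (F : α → M) (l : List α) : ((normL l).map F).sum = (l.map F).sum := by
  induction l with
  | nil => rfl
  | cons t l ih =>
    rw [normL, List.foldr_cons, ← normL, List.map_cons, List.sum_cons, ← ih]
    by_cases hm : t ∈ normL l
    · rw [((perm_toggle hm).map F).sum_eq, List.map_cons, List.sum_cons, ← add_assoc, h, zero_add]
    · rw [toggle_of_not_mem hm, List.map_cons, List.sum_cons]

/-- The span of the monomials with exponents in `S`. -/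
noncomputable def monoSpan (K : Type*) [Field K] (S : Set (Fin 9 → ℕ)) : Submodule K (DPA K) :=
  Submodule.span K (mono K '' S)

theorem eq_sum_coef (f : DPA K) : f = ∑ r ∈ Finsupp.support (f : DP K), (coef r f) • mono K r := by
  refine (Finsupp.sum_single (f : DP K)).symm.trans ?_
  refine Finset.sum_congr rfl fun r _ => ?_
  exact (Finsupp.smul_single_one r (coef r f)).symm

theorem mem_monoSpan_iff {S : Set (Fin 9 → ℕ)} {f : DPA K} :
    f ∈ monoSpan K S ↔ ∀ r, coef r f ≠ 0 → r ∈ S := by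
  constructor
  · intro hf
    refine Submodule.span_induction (p := fun f _ => ∀ r, coef r f ≠ 0 → r ∈ S) ?_ ?_ ?_ ?_ hf
    · rintro _ ⟨s, hs, rfl⟩ r hr
      rw [coef_mono] at hr
      obtain rfl : s = r := by by_contra h; simp [h] at hr
      exact hs
    · intro r hr; simp at hr
    · intro f g _ _ hf hg r hr
      by_contra h
      have h1 := not_not.1 (mt (hf r) h)
      have h2 := not_not.1 (mt (hg r) h)
      rw [map_add, h1, h2, add_zero] at hr
      exact hr rfl
    · intro c f _ hf r hr
      refine hf r fun h => hr ?_
      rw [map_smul, h, smul_zero]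
  · intro h
    rw [eq_sum_coef f]
    refine Submodule.sum_mem _ fun r _ => ?_
    by_cases h0 : coef r f = 0
    · rw [h0, zero_smul]; exact zero_mem _
    · exact Submodule.smul_mem _ _ (Submodule.subset_span ⟨r, h r h0, rfl⟩)

/-! #### Functions of the even indeterminate -/

/-- The span of the divided powers `x_1^(s)` for which `P s` holds. -/
noncomputable def evn (K : Type*) [Field K] (P : ℕ → Prop) : Submodule K (DPA K) :=
  Submodule.span K (tp K '' {s | P s})

theorem mem_evn_iff {P : ℕ → Prop} {f : DPA K} :
    f ∈ evn K P ↔ ∀ r, coef r f ≠ 0 → ∃ s, P s ∧ bits 0 s = r := by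
  refine Iff.trans ?_ (mem_monoSpan_iff (S := bits 0 '' {s | P s}))
  rw [monoSpan, Set.image_image]
  rfl

theorem tp_mem_evn {P : ℕ → Prop} {s : ℕ} (h : P s) : tp K s ∈ evn K P :=
  Submodule.subset_span ⟨s, h, rfl⟩

theorem evn_mono {P Q : ℕ → Prop} (h : ∀ s, P s → Q s) : evn K P ≤ evn K Q :=
  Submodule.span_mono (Set.image_mono h)

theorem bits_zero_injective : Function.Injective (bits 0) := fun _ _ h => congrFun h 0

theorem mem_evn_of_coef {P Q : ℕ → Prop} {f : DPA K} (hf : f ∈ evn K P)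
    (h : ∀ s, coef (bits 0 s) f ≠ 0 → Q s) : f ∈ evn K Q := by
  rw [mem_evn_iff] at hf ⊢
  intro r hr
  obtain ⟨s, -, rfl⟩ := hf r hr
  exact ⟨s, h s hr, rfl⟩

theorem evn_induction {P : ℕ → Prop} {p : DPA K → Prop} (h0 : p 0)
    (ha : ∀ f g, p f → p g → p (f + g)) (hs : ∀ (c : K) f, p f → p (c • f))
    (ht : ∀ s, P s → p (tp K s)) {f : DPA K} (hf : f ∈ evn K P) : p f := by
  refine Submodule.span_induction ?_ h0 (fun f g _ _ => ha f g) (fun c f _ => hs c f) hf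
  rintro _ ⟨s, h, rfl⟩
  exact ht s h

theorem coef_tp (s t : ℕ) : coef (bits 0 s) (tp K t) = if t = s then 1 else 0 := by
  rw [tp, coef_mono]
  simp [bits_zero_injective.eq_iff]

theorem evenFun_of_mem {P : ℕ → Prop} {f : DPA K} (hf : f ∈ evn K P) : EvenFun f := by
  refine evn_induction ?_ ?_ ?_ (fun s _ => evenFun_tp s) hf
  · exact fun i => map_zero _
  · exact fun f g hf hg i => by rw [map_add, hf i, hg i, add_zero]
  · exact fun c f hf i => by rw [Derivation.map_smul, hf i, smul_zero]

theorem pd_mem_evn {P Q : ℕ → Prop} (h : ∀ s, P (s + 1) → Q s) {f : DPA K} (hf : f ∈ evn K P) :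
    pdD K 0 f ∈ evn K Q := by
  refine evn_induction (p := fun f => pdD K 0 f ∈ evn K Q) ?_ ?_ ?_ ?_ hf
  · rw [map_zero]; exact zero_mem _
  · intro f g hf hg; rw [map_add]; exact add_mem hf hg
  · intro c f hf; rw [Derivation.map_smul]; exact Submodule.smul_mem _ _ hf
  · intro s hs
    rw [pdD_zero_tp]
    split_ifs with h0
    · exact zero_mem _
    · refine tp_mem_evn (h _ ?_)
      rwa [Nat.sub_add_cancel (Nat.pos_of_ne_zero h0)]

theorem coef_pd (s : ℕ) {P : ℕ → Prop} {f : DPA K} (hf : f ∈ evn K P) :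
    coef (bits 0 s) (pdD K 0 f) = coef (bits 0 (s + 1)) f := by
  refine evn_induction (p := fun f => coef (bits 0 s) (pdD K 0 f) = coef (bits 0 (s + 1)) f)
    ?_ ?_ ?_ ?_ hf
  · simp
  · intro f g hf hg; rw [map_add, map_add, map_add, hf, hg]
  · intro c f hf; rw [Derivation.map_smul, map_smul, map_smul, hf]
  · intro t _
    rw [pdD_zero_tp, coef_tp]
    split_ifs with h0 h1 h1
    · omega
    · exact map_zero _
    · rw [coef_tp, if_pos (by omega)]
    · rw [coef_tp, if_neg (by omega)]

theorem exists_pd_eq {P Q : ℕ → Prop} (h : ∀ s, P s → Q (s + 1)) {f : DPA K} (hf : f ∈ evn K P) :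
    ∃ g ∈ evn K Q, pdD K 0 g = f := by
  refine evn_induction (p := fun f => ∃ g ∈ evn K Q, pdD K 0 g = f) ?_ ?_ ?_ ?_ hf
  · exact ⟨0, zero_mem _, map_zero _⟩
  · rintro _ _ ⟨g, hg, rfl⟩ ⟨g', hg', rfl⟩
    exact ⟨g + g', add_mem hg hg', map_add _ _ _⟩
  · rintro c _ ⟨g, hg, rfl⟩
    exact ⟨c • g, Submodule.smul_mem _ _ hg, Derivation.map_smul _ _ _⟩
  · intro s hs
    exact ⟨tp K (s + 1), tp_mem_evn (h s hs), by rw [pdD_zero_tp, if_neg (by omega)]; rfl⟩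

theorem eq_smul_one {P : ℕ → Prop} {f : DPA K} (hf : f ∈ evn K P) (h : ∀ s, P s → s = 0) :
    f = (coef (bits 0 0) f) • 1 := by
  refine evn_induction (p := fun f => f = (coef (bits 0 0) f) • 1) ?_ ?_ ?_ ?_ hf
  · simp
  · intro f g hf hg; rw [map_add, add_smul, ← hf, ← hg]
  · intro c f hf; rw [map_smul, smul_eq_mul, mul_smul, ← hf]
  · intro s hs
    rw [h s hs, coef_tp, if_pos rfl, one_smul, tp_zero]

theorem pd_eq_zero_of_const {P : ℕ → Prop} {f : DPA K} (hf : f ∈ evn K P)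
    (h : ∀ s, P s → s = 0) : pdD K 0 f = 0 := by
  rw [eq_smul_one hf h, Derivation.map_smul, Derivation.map_one_eq_zero, smul_zero]

/-- The bilinear operation of a given kind. -/
noncomputable def Kind.app (k : Kind) (u w : DPA K) : DPA K :=
  match k with
  | .U => u * w
  | .L => pdD K 0 u * w
  | .R => u * pdD K 0 w
  | .D => pdD K 0 (u * w)

/-- `x_1^(r)` occurs in the result of the operation of kind `k` on `x_1^(s)` and `x_1^(t)`. -/
def Kind.Res (k : Kind) (s t r : ℕ) : Prop :=
  match k with
  | .U => r = s + t ∧ ¬ 2 ∣ (s + t).choose s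
  | .L => r + 1 = s + t ∧ s ≠ 0 ∧ ¬ 2 ∣ (s - 1 + t).choose (s - 1)
  | .R => r + 1 = s + t ∧ t ≠ 0 ∧ ¬ 2 ∣ (s + (t - 1)).choose s
  | .D => r + 1 = s + t ∧ ¬ 2 ∣ (s + t).choose s

theorem tp_mul_mem [CharP K 2] {P : ℕ → Prop} {s t : ℕ}
    (h : ¬ 2 ∣ (s + t).choose s → P (s + t)) : tp K s * tp K t ∈ evn K P := by
  rw [tp_mul_tp]
  by_cases hd : 2 ∣ (s + t).choose s
  · rw [(CharP.cast_eq_zero_iff K 2 _).2 hd, zero_smul]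
    exact zero_mem _
  · exact Submodule.smul_mem _ _ (tp_mem_evn (h hd))

theorem Kind.app_tp_mem [CharP K 2] (k : Kind) {P : ℕ → Prop} {s t : ℕ}
    (h : ∀ r, k.Res s t r → P r) : k.app (tp K s) (tp K t) ∈ evn K P := by
  cases k with
  | U => exact tp_mul_mem fun hd => h _ ⟨rfl, hd⟩
  | L =>
    change pdD K 0 (tp K s) * tp K t ∈ _
    rw [pdD_zero_tp]
    split_ifs with h0
    · rw [zero_mul]; exact zero_mem _
    · exact tp_mul_mem fun hd => h _ ⟨by omega, h0, hd⟩
  | R =>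
    change tp K s * pdD K 0 (tp K t) ∈ _
    rw [pdD_zero_tp]
    split_ifs with h0
    · rw [mul_zero]; exact zero_mem _
    · exact tp_mul_mem fun hd => h _ ⟨by omega, h0, hd⟩
  | D =>
    change pdD K 0 (tp K s * tp K t) ∈ _
    refine pd_mem_evn (P := fun r => r = s + t ∧ ¬ 2 ∣ (s + t).choose s) ?_
      (tp_mul_mem fun hd => ⟨rfl, hd⟩)
    exact fun r hr => h r ⟨hr.1, hr.2⟩

theorem Kind.app_add_left (k : Kind) (u u' w : DPA K) :
    k.app (u + u') w = k.app u w + k.app u' w := by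
  cases k <;> simp only [Kind.app, map_add, add_mul]

theorem Kind.app_add_right (k : Kind) (u w w' : DPA K) :
    k.app u (w + w') = k.app u w + k.app u w' := by
  cases k <;> simp only [Kind.app, map_add, mul_add]

theorem Kind.app_smul_left (k : Kind) (c : K) (u w : DPA K) :
    k.app (c • u) w = c • k.app u w := by
  cases k <;> simp only [Kind.app, Derivation.map_smul, smul_mul_assoc]

theorem Kind.app_smul_right (k : Kind) (c : K) (u w : DPA K) :
    k.app u (c • w) = c • k.app u w := by
  cases k <;> simp only [Kind.app, Derivation.map_smul, mul_smul_comm]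

theorem Kind.app_zero_left (k : Kind) (w : DPA K) : k.app 0 w = 0 := by
  cases k <;> simp [Kind.app]

theorem Kind.app_zero_right (k : Kind) (w : DPA K) : k.app w 0 = 0 := by
  cases k <;> simp [Kind.app]

theorem Kind.app_mem [CharP K 2] (k : Kind) {P P' P'' : ℕ → Prop}
    (h : ∀ s t r, P s → P' t → k.Res s t r → P'' r) {u w : DPA K} (hu : u ∈ evn K P)
    (hw : w ∈ evn K P') : k.app u w ∈ evn K P'' := by
  refine evn_induction (p := fun u => k.app u w ∈ evn K P'') ?_ ?_ ?_ ?_ hu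
  · rw [k.app_zero_left]; exact zero_mem _
  · intro f g hf hg; rw [k.app_add_left]; exact add_mem hf hg
  · intro c f hf; rw [k.app_smul_left]; exact Submodule.smul_mem _ _ hf
  · intro s hs
    refine evn_induction (p := fun w => k.app (tp K s) w ∈ evn K P'') ?_ ?_ ?_ ?_ hw
    · rw [k.app_zero_right]; exact zero_mem _
    · intro f g hf hg; rw [k.app_add_right]; exact add_mem hf hg
    · intro c f hf; rw [k.app_smul_right]; exact Submodule.smul_mem _ _ hf
    · exact fun t ht => k.app_tp_mem fun r => h s t r hs ht

/-! #### The functions `F_v(u)` -/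

theorem iterate_map_add (a : ℕ) (f g : DPA K) :
    (pdD K 0)^[a] (f + g) = (pdD K 0)^[a] f + (pdD K 0)^[a] g := by
  induction a generalizing f g with
  | zero => rfl
  | succ c ih => rw [Function.iterate_succ_apply, map_add, ih]; rfl

theorem iterate_map_smul (a : ℕ) (c : K) (f : DPA K) :
    (pdD K 0)^[a] (c • f) = c • (pdD K 0)^[a] f := by
  induction a generalizing f with
  | zero => rfl
  | succ a ih => rw [Function.iterate_succ_apply, Derivation.map_smul, ih]; rfl

theorem den1_add (u w : DPA K) (f : List (ℕ × ℕ)) : den1 (u + w) f = den1 u f + den1 w f := by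
  induction f with
  | nil => simp [den1_nil]
  | cons p f ih => simp only [den1_cons, ih, iterate_map_add]; ring

theorem den1_smul (c : K) (u : DPA K) (f : List (ℕ × ℕ)) : den1 (c • u) f = c • den1 u f := by
  induction f with
  | nil => simp [den1_nil]
  | cons p f ih => simp only [den1_cons, ih, iterate_map_smul, smul_add, smul_mul_assoc]

/-- The generating function `F_v(u)` as a function of `u`. -/
noncomputable def Fv (K : Type*) [Field K] (v : Fin 18) : DPA K →ₗ[K] DPA K where
  toFun u := den1 u (lam v)
  map_add' u w := den1_add u w _
  map_smul' c u := den1_smul c u _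

theorem Fv_apply (v : Fin 18) (u : DPA K) : Fv K v u = den1 u (lam v) := rfl

/-- The sum of all `F_v(u_v)`. -/
noncomputable def Fsum (K : Type*) [Field K] : (Fin 18 → DPA K) →ₗ[K] DPA K :=
  ∑ v, (Fv K v).comp (LinearMap.proj v)

theorem Fsum_apply (u : Fin 18 → DPA K) : Fsum K u = ∑ v, Fv K v (u v) := by
  rw [Fsum, LinearMap.sum_apply]
  rfl

theorem Fsum_single (v : Fin 18) (f : DPA K) : Fsum K (Pi.single v f) = Fv K v f := by
  rw [Fsum_apply, Finset.sum_eq_single v]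
  · rw [Pi.single_eq_same]
  · intro w _ hw; rw [Pi.single_eq_of_ne hw, map_zero]
  · intro h; exact absurd (Finset.mem_univ v) h

/-- This is `tab_spec` evaluated at `f` and `g`; the hypotheses on the last two families make the
discarded terms zero. -/
theorem cBr_Fv [CharP K 2] {v w : Fin 18} {f g : DPA K} (hf : EvenFun f) (hg : EvenFun g)
    (hv : 16 ≤ v.val → pdD K 0 f = 0) (hw : 16 ≤ w.val → pdD K 0 g = 0) :
    cBr (Fv K v f) (Fv K w g) = ((tab v w).map fun t => Fv K t.1 (t.2.app f g)).sum := by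
  have hP : ∀ p : ℕ × ℕ × ℕ, constOK v w p = false →
      (pdD K 0)^[p.1] f * (pdD K 0)^[p.2.1] g = 0 := by
    intro p hp
    rw [constOK, Bool.and_eq_false_iff, Bool.or_eq_false_iff, Bool.or_eq_false_iff] at hp
    simp only [decide_eq_false_iff_not, not_lt, beq_eq_false_iff_ne] at hp
    rcases hp with h | h
    · rw [iterate_eq_zero (hv h.1) h.2, zero_mul]
    · rw [iterate_eq_zero (hw h.1) h.2, mul_zero]
  have h0 := congrArg (den2 f g) (tab_spec v w)
  rw [den2_normL, den2_append, den2_nil, den2_flatMap, brV, den2_filter _ _ _ _ hP,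
    ← cBr_den1 hf hg, ← Fv_apply, ← Fv_apply] at h0
  rw [← CharTwo.sub_eq_add, sub_eq_zero] at h0
  rw [h0]
  congr 2
  funext t
  rw [den2_flatMap, Fv_apply]
  have : ∀ q : ℕ × ℕ, den2 f g ((expL (lam t.1) q.1 q.2).filter (constOK v w)) =
      den1 ((pdD K 0)^[q.1] f * (pdD K 0)^[q.2] g) (lam t.1) := by
    intro q
    rw [den2_filter _ _ _ _ hP, den1_mul_iterate]
  simp only [this]
  cases t.2 with
  | U => simp [Kind.orders, Kind.app]
  | L => simp [Kind.orders, Kind.app]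
  | R => simp [Kind.orders, Kind.app]
  | D =>
    simp only [Kind.orders, Kind.app, List.map_cons, List.map_nil, List.sum_cons, List.sum_nil,
      add_zero, ← den1_add, Derivation.leibniz, smul_eq_mul]
    congr 1
    change pdD K 0 f * g + f * pdD K 0 g = _
    ring

theorem lam_lt : ∀ v : Fin 18, ∀ p ∈ lam v, p.2 < 256 := by decide +kernel

theorem dual_lt : ∀ v : Fin 18, ∀ m ∈ dual v, m < 256 := by decide +kernel

/-- A biorthogonality relation: at the monomials in `dual v` the other families and all proper
derivatives of `u_v` cancel mod 2. It makes the families independent and supplies coordinates. Two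
monomials are needed for the last two families because their own leading monomials also occur in the
Euler family. -/
theorem dual_spec : ∀ v w : Fin 18, normL ((dual v).flatMap fun m =>
    ((lam w).filter fun p => p.2 == m).map fun p => p.1) = if v = w then [0] else [] := by
  decide +kernel

theorem bits_injective {m m' s s' : ℕ} (hm : m < 256) (hm' : m' < 256) (h : bits m s = bits m' s') :
    m = m' ∧ s = s' := by
  refine ⟨Nat.eq_of_testBit_eq fun i => ?_, congrFun h 0⟩
  by_cases hi : i < 8
  · have := congrFun h (Fin.succ ⟨i, hi⟩)
    rw [bits_succ, bits_succ] at this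
    revert this
    cases m.testBit i <;> cases m'.testBit i <;> simp
  · have hp : 256 ≤ 2 ^ i := by
      rw [show 256 = 2 ^ 8 from rfl]; exact Nat.pow_le_pow_right (by norm_num) (by omega)
    rw [Nat.testBit_lt_two_pow (by omega), Nat.testBit_lt_two_pow (by omega)]

theorem coef_mul_xm {P : ℕ → Prop} {f : DPA K} (hf : f ∈ evn K P) {m m' : ℕ} (s : ℕ)
    (hm : m < 256) (hm' : m' < 256) :
    coef (bits m s) (f * xm K m') = if m' = m then coef (bits 0 s) f else 0 := by
  refine evn_induction (p := fun f => coef (bits m s) (f * xm K m') =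
    if m' = m then coef (bits 0 s) f else 0) ?_ ?_ ?_ ?_ hf
  · simp
  · intro f g hf hg; rw [add_mul, map_add, hf, hg, map_add]; split_ifs <;> simp
  · intro c f hf; rw [smul_mul_assoc, map_smul, hf, map_smul]; split_ifs <;> simp
  · intro t _
    rw [tp_mul_xm, coef_mono, coef_tp]
    by_cases h : m' = m
    · subst h
      simp only [if_true]
      by_cases ht : t = s
      · rw [if_pos ht, if_pos (by rw [ht])]
      · rw [if_neg ht, if_neg fun h => ht (bits_injective hm' hm' h).2]
    · rw [if_neg h, if_neg fun h' => h (bits_injective hm' hm h').1]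

theorem iterate_mem_evn {P : ℕ → Prop} {f : DPA K} (hf : f ∈ evn K P) (a : ℕ) :
    (pdD K 0)^[a] f ∈ evn K fun _ => True := by
  induction a with
  | zero => exact evn_mono (fun _ _ => trivial) hf
  | succ a ih => rw [Function.iterate_succ_apply']; exact pd_mem_evn (fun _ _ => trivial) ih

theorem coef_den1 {P : ℕ → Prop} {f : DPA K} (hf : f ∈ evn K P) {m : ℕ} (hm : m < 256) (s : ℕ)
    (l : List (ℕ × ℕ)) (hl : ∀ p ∈ l, p.2 < 256) :
    coef (bits m s) (den1 f l) = (((l.filter fun p => p.2 == m).map fun p => p.1).map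
      fun a => coef (bits 0 s) ((pdD K 0)^[a] f)).sum := by
  induction l with
  | nil => simp [den1_nil]
  | cons p l ih =>
    rw [den1_cons, map_add, ih fun q hq => hl q (List.mem_cons_of_mem _ hq),
      coef_mul_xm (iterate_mem_evn hf _) s hm (hl p List.mem_cons_self)]
    by_cases h : p.2 = m
    · rw [if_pos h, List.filter_cons_of_pos (by simpa using h)]
      simp
    · rw [if_neg h, List.filter_cons_of_neg (by simpa using h), zero_add]

/-- The linear functional that extracts the coefficient of `x_1^(s)` in `u_v` from `∑ F_w(u_w)`. -/
noncomputable def dualCoef (v : Fin 18) (s : ℕ) : DPA K →ₗ[K] K :=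
  ((dual v).map fun m => coef (bits m s)).sum

theorem dualCoef_apply (v : Fin 18) (s : ℕ) (f : DPA K) :
    dualCoef v s f = ((dual v).map fun m => coef (bits m s) f).sum := by
  rw [dualCoef]
  induction dual v with
  | nil => rfl
  | cons m l ih => rw [List.map_cons, List.sum_cons, LinearMap.add_apply, ih]; rfl

theorem dualCoef_Fv [CharP K 2] (v w : Fin 18) (s : ℕ) {P : ℕ → Prop} {f : DPA K}
    (hf : f ∈ evn K P) :
    dualCoef v s (Fv K w f) = if v = w then coef (bits 0 s) f else 0 := by
  rw [dualCoef_apply]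
  have h1 : ∀ m ∈ dual v, coef (bits m s) (Fv K w f) =
      ((((lam w).filter fun p => p.2 == m).map fun p => p.1).map
      fun a => coef (bits 0 s) ((pdD K 0)^[a] f)).sum := fun m hm =>
    coef_den1 hf (dual_lt v m hm) s _ (lam_lt w)
  rw [List.map_congr_left h1]
  have h2 : ∀ (l : List ℕ), (l.map fun m => ((((lam w).filter fun p => p.2 == m).map
      fun p => p.1).map fun a => coef (bits 0 s) ((pdD K 0)^[a] f)).sum).sum =
      ((l.flatMap fun m => ((lam w).filter fun p => p.2 == m).map fun p => p.1).map
      fun a => coef (bits 0 s) ((pdD K 0)^[a] f)).sum := by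
    intro l
    induction l with
    | nil => rfl
    | cons m l ih =>
      rw [List.map_cons, List.sum_cons, ih, List.flatMap_cons, List.map_append, List.sum_append]
  rw [h2, ← sum_map_normL (fun x : K => CharTwo.add_self_eq_zero x), dual_spec]
  split_ifs <;> simp

theorem dualCoef_Fsum [CharP K 2] {Q : Fin 18 → ℕ → Prop} {u : Fin 18 → DPA K}
    (hu : ∀ v, u v ∈ evn K (Q v)) (v : Fin 18) (s : ℕ) :
    dualCoef v s (Fsum K u) = coef (bits 0 s) (u v) := by
  rw [Fsum_apply, map_sum, Finset.sum_eq_single v]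
  · rw [dualCoef_Fv v v s (hu v), if_pos rfl]
  · intro w _ hw
    rw [dualCoef_Fv v w s (hu w), if_neg hw.symm]
  · intro h; exact absurd (Finset.mem_univ v) h

end Families

/-! ### Gradings of functions and of vector fields -/

section Gradings

variable {K : Type*} [Field K] {G : Type*} [AddCommGroup G]

/-- Exponents that are admissible for `N` and have weight `g`. -/
def grSet (N : Fin 9 → ℕ∞) (w : Fin 9 → G) (g : G) : Set (Fin 9 → ℕ) :=
  {r | Adm N r ∧ ∑ j, r j • w j = g}

/-- Functions of weight `g` in the divided power algebra `𝒪(9; N)`. -/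
noncomputable def grFun (K : Type*) [Field K] (N : Fin 9 → ℕ∞) (w : Fin 9 → G) (g : G) :
    Submodule K (DPA K) := monoSpan K (grSet N w g)

/-- Vector fields of weight `g` on `𝒪(9; N)`. -/
noncomputable def grField (K : Type*) [Field K] (N : Fin 9 → ℕ∞) (w : Fin 9 → G) (g : G) :
    Submodule K (Op K) :=
  Submodule.span K {D | ∃ (r : Fin 9 → ℕ) (i : Fin 9),
    Adm N r ∧ ∑ j, r j • w j - w i = g ∧ D = vf K r i}

theorem vectDeg_eq (N : Fin 9 → ℕ∞) (k : ℤ) : vectDeg K N k = grField K N varDeg k := by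
  simp only [vectDeg, grField, nsmul_eq_mul]

theorem mono_mem_grFun {N : Fin 9 → ℕ∞} {w : Fin 9 → G} {g : G} {r : Fin 9 → ℕ} (h : Adm N r)
    (hg : ∑ j, r j • w j = g) : mono K r ∈ grFun K N w g :=
  Submodule.subset_span ⟨r, ⟨h, hg⟩, rfl⟩

theorem grFun_induction {N : Fin 9 → ℕ∞} {w : Fin 9 → G} {g : G} {S : Submodule K (DPA K)}
    {T : DPA K →ₗ[K] DPA K} (h : ∀ r, Adm N r → ∑ j, r j • w j = g → T (mono K r) ∈ S)
    {f : DPA K} (hf : f ∈ grFun K N w g) : T f ∈ S := by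
  have : grFun K N w g ≤ S.comap T := by
    refine Submodule.span_le.2 ?_
    rintro _ ⟨r, ⟨hr, hg⟩, rfl⟩
    exact h r hr hg
  exact this hf

theorem sum_update_sub (w : Fin 9 → G) (r : Fin 9 → ℕ) (i : Fin 9) (h : r i ≠ 0) :
    ∑ j, Function.update r i (r i - 1) j • w j = ∑ j, r j • w j - w i := by
  rw [eq_sub_iff_add_eq, ← Finset.add_sum_erase _ _ (Finset.mem_univ i),
    ← Finset.add_sum_erase _ (fun j => r j • w j) (Finset.mem_univ i), Function.update_self,
    add_right_comm, ← succ_nsmul, Nat.sub_add_cancel (Nat.pos_of_ne_zero h)]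
  congr 1
  refine Finset.sum_congr rfl fun j hj => ?_
  rw [Function.update_of_ne (Finset.ne_of_mem_erase hj)]

theorem pdD_mem_grFun {N : Fin 9 → ℕ∞} {w : Fin 9 → G} {g : G} {f : DPA K}
    (hf : f ∈ grFun K N w g) (i : Fin 9) : pdD K i f ∈ grFun K N w (g - w i) := by
  refine grFun_induction (T := pdL i) ?_ hf
  intro r hr hg
  rw [pdL_mono]
  split_ifs with h
  · exact zero_mem _
  · refine mono_mem_grFun (fun j m hm => ?_) (by rw [sum_update_sub w r i h, hg])
    by_cases hj : j = i
    · subst hj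
      rw [Function.update_self]
      have := hr j m hm
      omega
    · rw [Function.update_of_ne hj]
      exact hr j m hm

theorem mcoef_single (i : Fin 9) (r : Fin 9 → ℕ) : mcoef (Pi.single i 1) r = r i + 1 := by
  rw [mcoef_update _ _ i, Finset.prod_eq_one, Pi.single_eq_same, Nat.choose_one_right, mul_one,
    add_comm]
  intro j hj
  rw [Pi.single_eq_of_ne (Finset.ne_of_mem_erase hj), Nat.choose_zero_right]

/-- The product has coefficient `r i + 1`. The exponent leaves the admissible range only if `r i + 1
= 2 ^ m` with `m ≠ 0`, and then the coefficient is even. -/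
theorem xv_mul_mem_grFun [CharP K 2] {N : Fin 9 → ℕ∞} (hN : ∀ i, N i ≠ 0) {w : Fin 9 → G} {g : G}
    {f : DPA K} (hf : f ∈ grFun K N w g) (i : Fin 9) :
    xv K i * f ∈ grFun K N w (g + w i) := by
  refine grFun_induction (T := LinearMap.mulLeft K (xv K i)) ?_ hf
  intro r hr hg
  rw [LinearMap.mulLeft_apply, xv, mono_mul, mcoef_single]
  by_cases hd : 2 ∣ r i + 1
  · rw [(CharP.cast_eq_zero_iff K 2 _).2 hd, zero_smul]
    exact zero_mem _
  refine Submodule.smul_mem _ _ (mono_mem_grFun ?_ ?_)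
  · intro j m hm
    by_cases hj : j = i
    · subst hj
      rw [Pi.add_apply, Pi.single_eq_same]
      have h1 := hr j m hm
      have hm0 : m ≠ 0 := by
        rintro rfl
        exact hN j hm
      have h2 : 2 ∣ 2 ^ m := dvd_pow_self 2 hm0
      rcases Nat.lt_or_ge (r j + 1) (2 ^ m) with h3 | h3
      · omega
      · exact absurd (show 2 ∣ r j + 1 by rwa [show r j + 1 = 2 ^ m by omega]) hd
    · rw [Pi.add_apply, Pi.single_eq_of_ne hj, zero_add]
      exact hr j m hm
  · have : ∑ j, (Pi.single i 1 + r : Fin 9 → ℕ) j • w j =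
        ∑ j, (Pi.single i 1 : Fin 9 → ℕ) j • w j + ∑ j, r j • w j := by
      rw [← Finset.sum_add_distrib]
      exact Finset.sum_congr rfl fun j _ => by rw [Pi.add_apply, add_smul]
    rw [this, hg, Finset.sum_eq_single i]
    · rw [Pi.single_eq_same, one_smul, add_comm]
    · intro j _ hj; rw [Pi.single_eq_of_ne hj, zero_smul]
    · intro h; exact absurd (Finset.mem_univ i) h

theorem smul_pdD_mem {N : Fin 9 → ℕ∞} {w : Fin 9 → G} {g : G} {f : DPA K}
    (hf : f ∈ grFun K N w g) (i : Fin 9) : toOp (f • pdD K i) ∈ grField K N w (g - w i) := by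
  have : grFun K N w g ≤ (grField K N w (g - w i)).comap
      (toOp.comp (LinearMap.toSpanSingleton (DPA K) _ (pdD K i) |>.restrictScalars K)) := by
    refine Submodule.span_le.2 ?_
    rintro _ ⟨r, ⟨hr, hg⟩, rfl⟩
    refine Submodule.subset_span ⟨r, i, hr, by rw [hg], ?_⟩
    rw [vf_eq]
    rfl
  exact this hf

theorem zD_mem_grFun [CharP K 2] {N : Fin 9 → ℕ∞} (hN : ∀ i, N i ≠ 0) {w : Fin 9 → G}
    (hw : ∀ i : Fin 8, w i.succ + w i.rev.succ = w 0) {g : G} {f : DPA K}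
    (hf : f ∈ grFun K N w g) (i : Fin 8) : zD K i f ∈ grFun K N w (g - w i.succ) := by
  rw [zD_apply]
  refine add_mem (pdD_mem_grFun hf _) ?_
  split_ifs
  · have := xv_mul_mem_grFun hN (pdD_mem_grFun hf 0) i.rev.succ
    rwa [show g - w 0 + w i.rev.succ = g - w i.succ by rw [← hw i]; abel] at this
  · rw [zero_mul]; exact zero_mem _

theorem kap_mem_grField [CharP K 2] {N : Fin 9 → ℕ∞} (hN : ∀ i, N i ≠ 0) {w : Fin 9 → G}
    (hw : ∀ i : Fin 8, w i.succ + w i.rev.succ = w 0) {g : G} {f : DPA K}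
    (hf : f ∈ grFun K N w g) : kap K f ∈ grField K N w (g - w 0) := by
  rw [kap_apply, cD, map_add, map_sum]
  refine add_mem (smul_pdD_mem hf 0) (Submodule.sum_mem _ fun i _ => ?_)
  have h1 := zD_mem_grFun hN hw hf i.rev
  generalize zD K i.rev f = a at h1 ⊢
  rw [zD, smul_add, map_add, ← mul_smul]
  have e : g - w i.rev.succ - w i.succ = g - w 0 := by rw [← hw i]; abel
  refine add_mem (e ▸ smul_pdD_mem h1 i.succ) ?_
  split_ifs
  · have := xv_mul_mem_grFun hN h1 i.rev.succ
    rw [sub_add_cancel, mul_comm] at this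
    exact smul_pdD_mem this 0
  · rw [mul_zero, zero_smul, map_zero]; exact zero_mem _

theorem genFun_mem_grFun [CharP K 2] {N : Fin 9 → ℕ∞} (hN : ∀ i, N i ≠ 0) {w : Fin 9 → G}
    (hw : ∀ i : Fin 8, w i.succ + w i.rev.succ = w 0) {g : G} {D : Op K}
    (hD : D ∈ grField K N w g) : genFun K D ∈ grFun K N w (g + w 0) := by
  have : grField K N w g ≤ (grFun K N w (g + w 0)).comap (genFun K) := by
    refine Submodule.span_le.2 ?_
    rintro _ ⟨r, i, hr, hg, rfl⟩
    rw [SetLike.mem_coe, Submodule.mem_comap, vf_eq, genFun_toOp]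
    have hm : mono K r ∈ grFun K N w (g + w i) :=
      mono_mem_grFun hr (by rw [← hg, sub_add_cancel])
    simp only [Derivation.smul_apply, pdD_xv, smul_eq_mul]
    refine Fin.cases ?_ (fun k hm => ?_) i hm
    · intro hm
      simp [(Fin.succ_ne_zero _).symm, hm]
    · rw [if_neg (Fin.succ_ne_zero k), mul_zero, zero_add]
      refine Submodule.sum_mem _ fun l _ => ?_
      by_cases hkl : k = l
      · subst hkl
        rw [if_pos rfl, mul_one]
        split_ifs
        · have := xv_mul_mem_grFun hN hm k.rev.succ
          rwa [add_assoc, hw k, mul_comm] at this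
        · rw [mul_zero]; exact zero_mem _
      · rw [if_neg fun h => hkl (Fin.succ_injective _ h), mul_zero, zero_mul]; exact zero_mem _
  exact this hD

/-- The vector field with given coefficients. -/
noncomputable def fieldOf (f : Fin 9 → DPA K) : Derivation K (DPA K) (DPA K) :=
  ∑ i, f i • pdD K i

theorem fieldOf_apply (f : Fin 9 → DPA K) (a : DPA K) :
    fieldOf f a = ∑ i, f i * pdD K i a := by
  rw [fieldOf, ← Derivation.coeFnAddMonoidHom_apply, map_sum, Finset.sum_apply]
  rfl

theorem fieldOf_xv (f : Fin 9 → DPA K) (j : Fin 9) : fieldOf f (xv K j) = f j := by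
  rw [fieldOf_apply, Finset.sum_eq_single j]
  · rw [pdD_xv, if_pos rfl, mul_one]
  · intro i _ hi; rw [pdD_xv, if_neg hi, mul_zero]
  · intro h; exact absurd (Finset.mem_univ j) h

theorem fieldOf_add (f g : Fin 9 → DPA K) : fieldOf (f + g) = fieldOf f + fieldOf g := by
  ext a
  simp only [fieldOf_apply, Derivation.add_apply, Pi.add_apply, add_mul, Finset.sum_add_distrib]

theorem fieldOf_smul (c : K) (f : Fin 9 → DPA K) : fieldOf (c • f) = c • fieldOf f := by
  ext a
  simp only [fieldOf_apply, Derivation.smul_apply, Pi.smul_apply, smul_mul_assoc, Finset.smul_sum]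

theorem exists_fieldOf {N : Fin 9 → ℕ∞} {w : Fin 9 → G} {g : G} {D : Op K}
    (hD : D ∈ grField K N w g) :
    ∃ f : Fin 9 → DPA K, (∀ i, f i ∈ grFun K N w (g + w i)) ∧ D = toOp (fieldOf f) := by
  refine Submodule.span_induction (p := fun D _ => ∃ f : Fin 9 → DPA K,
    (∀ i, f i ∈ grFun K N w (g + w i)) ∧ D = toOp (fieldOf f)) ?_ ?_ ?_ ?_ hD
  · rintro _ ⟨r, i, hr, hg, rfl⟩
    refine ⟨Pi.single i (mono K r), fun j => ?_, ?_⟩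
    · by_cases hj : j = i
      · subst hj
        rw [Pi.single_eq_same]
        exact mono_mem_grFun hr (by rw [← hg, sub_add_cancel])
      · rw [Pi.single_eq_of_ne hj]; exact zero_mem _
    · rw [vf_eq, fieldOf, Finset.sum_eq_single i]
      · rw [Pi.single_eq_same]
      · intro j _ hj; rw [Pi.single_eq_of_ne hj, zero_smul]
      · intro h; exact absurd (Finset.mem_univ i) h
  · refine ⟨0, fun i => zero_mem _, ?_⟩
    have := fieldOf_smul (0 : K) (0 : Fin 9 → DPA K)
    rw [zero_smul, zero_smul] at this
    rw [this, map_zero]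
  · rintro _ _ _ _ ⟨f, hf, rfl⟩ ⟨f', hf', rfl⟩
    exact ⟨f + f', fun i => add_mem (hf i) (hf' i), by rw [fieldOf_add, map_add]⟩
  · rintro c _ _ ⟨f, hf, rfl⟩
    exact ⟨c • f, fun i => Submodule.smul_mem _ _ (hf i), by rw [fieldOf_smul, map_smul]⟩

/-! #### The negative part and transitivity -/

theorem cD_xv_apply_succ (b j : Fin 8) :
    cD (xv K b.succ) (xv K j.succ) = if j.rev = b then 1 else 0 := by
  rw [cD_xv_succ, zD_xv_succ]

theorem cD_xv_apply_zero [CharP K 2] (b : Fin 8) :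
    cD (xv K b.succ) (xv K 0) = if b.val < 4 then xv K b.succ else 0 := by
  rw [cD_xv_zero, Finset.sum_eq_single b.rev]
  · rw [zD_xv_succ, Fin.rev_rev, if_pos rfl, one_mul]
    have := Fin.val_rev b
    by_cases hb : b.val < 4
    · rw [if_neg (by omega), if_pos hb, add_zero]
    · rw [if_pos (by omega), if_neg hb, CharTwo.add_self_eq_zero]
  · intro i _ hi
    rw [zD_xv_succ, if_neg fun h => hi (by rw [← h, Fin.rev_rev]), zero_mul]
  · intro h; exact absurd (Finset.mem_univ _) h

theorem cD_xv_eq (b : Fin 8) (a : DPA K) :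
    cD (xv K b.succ) a = xv K b.succ * pdD K 0 a + zD K b.rev a := by
  rw [cD_apply, Finset.sum_eq_single b.rev]
  · rw [zD_xv_succ, Fin.rev_rev, if_pos rfl, one_mul]
  · intro i _ hi
    rw [zD_xv_succ, if_neg fun h => hi (by rw [← h, Fin.rev_rev]), zero_mul]
  · intro h; exact absurd (Finset.mem_univ _) h

theorem cBr_xv [CharP K 2] (b : Fin 8) : cBr (xv K b.succ) (xv K b.rev.succ) = 1 := by
  rw [cBr, pdD_xv, pdD_xv, if_neg (Fin.succ_ne_zero _).symm, if_neg (Fin.succ_ne_zero _).symm,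
    Finset.sum_eq_single b.rev]
  · rw [zD_xv_succ, zD_xv_succ, Fin.rev_rev, if_pos rfl, if_pos rfl]; ring
  · intro i _ hi
    rw [zD_xv_succ, if_neg fun h => hi (by rw [← h, Fin.rev_rev]), zero_mul]
  · intro h; exact absurd (Finset.mem_univ _) h

/-- Two paired fields of degree -1 have bracket `∂_1`; modulo `∂_1` the fields of degree -1 are the
other partial derivatives. -/
theorem pdD_eq_zero_of_cD [CharP K 2] {a : DPA K} (h : ∀ b : Fin 8, cD (xv K b.succ) a = 0)
    (j : Fin 9) : pdD K j a = 0 := by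
  have h0 : pdD K 0 a = 0 := by
    rw [← cD_one, ← cBr_xv 0, ← lie_cD, Derivation.commutator_apply, h, h, map_zero, map_zero,
      sub_zero]
  refine Fin.cases h0 (fun b => ?_) j
  have := h b.rev
  rwa [cD_xv_eq, h0, mul_zero, zero_add, Fin.rev_rev, zD_apply, h0, mul_zero, add_zero] at this

theorem eq_zero_of_pdD {a : DPA K} (h : ∀ j, pdD K j a = 0) (h0 : coef 0 a = 0) : a = 0 := by
  refine DPA.ext fun r => ?_
  rw [map_zero]
  by_cases hr : r = 0
  · rw [hr, h0]
  obtain ⟨j, hj⟩ : ∃ j, r j ≠ 0 := by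
    by_contra hn
    push Not at hn
    exact hr (funext hn)
  have key : ∀ a : DPA K, coef (Function.update r j (r j - 1)) (pdL j a) = coef r a := by
    intro a
    have : (coef (Function.update r j (r j - 1))).comp (pdL j) = coef (K := K) r := by
      refine DPA.hom_ext fun s => ?_
      rw [LinearMap.comp_apply, pdL_mono, coef_mono]
      by_cases hs : s j = 0
      · rw [if_pos hs, map_zero, if_neg]
        rintro rfl
        exact hj hs
      · rw [if_neg hs, coef_mono]
        congr 1
        rw [eq_iff_iff]
        constructor
        · intro h
          funext i
          by_cases hi : i = j
          · subst hi
            have := congrFun h i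
            rw [Function.update_self, Function.update_self] at this
            omega
          · have := congrFun h i
            rwa [Function.update_of_ne hi, Function.update_of_ne hi] at this
        · rintro rfl; rfl
    rw [← this]; rfl
  rw [← key a]
  rw [show pdL j a = 0 from h j, map_zero]

theorem coef_zero_of_grFun {N : Fin 9 → ℕ∞} {w : Fin 9 → G} {g : G} (hg : g ≠ 0) {a : DPA K}
    (ha : a ∈ grFun K N w g) : coef 0 a = 0 := by
  by_contra h
  have := (mem_monoSpan_iff.1 ha 0 h).2
  simp only [Pi.zero_apply, zero_smul, Finset.sum_const_zero] at this
  exact hg this.symm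

/-- A vector field of non-negative degree that commutes with the negative part is zero. -/
theorem eq_zero_of_lie_eq_zero [CharP K 2] {N : Fin 9 → ℕ∞} {k : ℤ} (hk : 0 ≤ k) {D : Op K}
    (hD : D ∈ vectDeg K N k) (h : ∀ b : Fin 8, ⁅kap K (xv K b.succ), D⁆ = 0) : D = 0 := by
  rw [vectDeg_eq] at hD
  obtain ⟨f, hf, rfl⟩ := exists_fieldOf hD
  have hc : ∀ (b : Fin 8) (a : DPA K),
      cD (xv K b.succ) (fieldOf f a) = fieldOf f (cD (xv K b.succ) a) := by
    intro b a
    have h1 := h b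
    rw [kap_apply, lie_toOp] at h1
    have h2 := congrArg (fun T : Op K => (T a : DPA K)) h1
    change ⁅cD (xv K b.succ), fieldOf f⁆ a = 0 at h2
    rwa [Derivation.commutator_apply, sub_eq_zero] at h2
  have hdeg : ∀ j, k + varDeg j ≠ 0 := by
    intro j
    have : 0 < varDeg j := by rw [varDeg]; split_ifs <;> norm_num
    omega
  -- The negative fields send these indeterminates to constants, so they annihilate the
  -- coefficients; a coefficient of positive degree that is annihilated must vanish. The coefficient
  -- at `∂_1` comes afterwards, since `x_1` is sent to multiples of the other indeterminates.
  have hs : ∀ j : Fin 8, f j.succ = 0 := by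
    intro j
    refine eq_zero_of_pdD (pdD_eq_zero_of_cD fun b => ?_)
      (coef_zero_of_grFun (hdeg _) (hf j.succ))
    rw [← fieldOf_xv f j.succ, hc, cD_xv_apply_succ]
    split_ifs
    · exact Derivation.map_one_eq_zero _
    · exact map_zero _
  have h0 : f 0 = 0 := by
    refine eq_zero_of_pdD (pdD_eq_zero_of_cD fun b => ?_)
      (coef_zero_of_grFun (hdeg _) (hf 0))
    rw [← fieldOf_xv f 0, hc, cD_xv_apply_zero]
    split_ifs
    · rw [fieldOf_xv, hs]
    · exact map_zero _
  have : f = 0 := funext fun j => Fin.cases h0 hs j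
  have h3 := fieldOf_smul (0 : K) (0 : Fin 9 → DPA K)
  rw [zero_smul, zero_smul] at h3
  rw [this, h3, map_zero]

end Gradings

/-! ### The bracket of operators -/

section
variable {K : Type*} [Field K]

theorem op_add_lie (a b c : Op K) : ⁅a + b, c⁆ = ⁅a, c⁆ + ⁅b, c⁆ := add_lie a b c

theorem op_lie_add (a b c : Op K) : ⁅a, b + c⁆ = ⁅a, b⁆ + ⁅a, c⁆ := lie_add a b c

theorem op_zero_lie (a : Op K) : ⁅(0 : Op K), a⁆ = 0 :=
  @zero_lie (Op K) (Op K) _ _ lieRingSelfModule a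

theorem op_lie_zero (a : Op K) : ⁅a, (0 : Op K)⁆ = 0 :=
  @lie_zero (Op K) (Op K) _ _ lieRingSelfModule a

theorem op_smul_lie (c : K) (a b : Op K) : ⁅c • a, b⁆ = c • ⁅a, b⁆ :=
  @smul_lie K (Op K) (Op K) _ _ _ _ _ lieRingSelfModule lieAlgebraSelfModule c a b

theorem op_lie_smul (c : K) (a b : Op K) : ⁅a, c • b⁆ = c • ⁅a, b⁆ :=
  @lie_smul K (Op K) (Op K) _ _ _ _ _ lieRingSelfModule lieAlgebraSelfModule c a b

theorem op_sum_lie {ι : Type*} (s : Finset ι) (f : ι → Op K) (b : Op K) :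
    ⁅∑ i ∈ s, f i, b⁆ = ∑ i ∈ s, ⁅f i, b⁆ := sum_lie s f b

theorem op_lie_sum {ι : Type*} (s : Finset ι) (f : ι → Op K) (b : Op K) :
    ⁅b, ∑ i ∈ s, f i⁆ = ∑ i ∈ s, ⁅b, f i⁆ := lie_sum s f b

theorem op_leibniz_lie (a b c : Op K) : ⁅a, ⁅b, c⁆⁆ = ⁅⁅a, b⁆, c⁆ + ⁅b, ⁅a, c⁆⁆ :=
  @LieRing.leibniz_lie (Op K) _ a b c

theorem op_add_self [CharP K 2] (a : Op K) : a + a = 0 := by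
  rw [← two_smul K a, show (2 : K) = 0 from CharTwo.two_eq_zero, zero_smul]

theorem op_neg [CharP K 2] (a : Op K) : -a = a :=
  @neg_eq_of_add_eq_zero_left (Op K) _ a a (op_add_self a)

theorem op_sub [CharP K 2] (a b : Op K) : a - b = a + b :=
  (@sub_eq_add_neg (Op K) _ a b).trans (congrArg _ (op_neg b))

theorem op_lie_comm [CharP K 2] (a b : Op K) : ⁅a, b⁆ = ⁅b, a⁆ := by
  rw [← op_neg ⁅b, a⁆]
  exact (@lie_skew (Op K) _ a b).symm

end

/-! ### Spaces of vector fields spanned by the fields with generating functions `F_v(x_1^(s))` -/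

section Spaces

variable {K : Type*} [Field K]

/-- `s < 2 ^ n`; no condition if `n = ∞`. -/
def adm (n : ℕ∞) (s : ℕ) : Prop := ∀ m : ℕ, n = (m : ℕ∞) → s < 2 ^ m

theorem adm.mono {n : ℕ∞} {s t : ℕ} (h : adm n s) (hts : t ≤ s) : adm n t :=
  fun m hm => lt_of_le_of_lt hts (h m hm)

theorem adm_zero (n : ℕ∞) : adm n 0 := fun m _ => Nat.two_pow_pos m

theorem adm_one {n : ℕ∞} (hn : n ≠ 0) : adm n 1 := fun m hm => by
  refine Nat.one_lt_two_pow ?_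
  rintro rfl
  exact hn hm

/-- Kummer's theorem: the exponent of 2 in the binomial coefficient counts the carries in `s + t`,
and here there is a carry into position `m`. -/
theorem two_dvd_choose_of_carry {s t m : ℕ} (hs : s < 2 ^ m) (ht : t < 2 ^ m)
    (h : 2 ^ m ≤ s + t) : 2 ∣ (s + t).choose s := by
  have hp : Fact (Nat.Prime 2) := ⟨Nat.prime_two⟩
  have hm : m ≠ 0 := by rintro rfl; simp at hs ht; omega
  have hb : Nat.log 2 (t + s) < Nat.log 2 (t + s) + 1 := Nat.lt_succ_self _
  have h1 := padicValNat_choose' (p := 2) (n := t) (k := s) hb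
  rw [add_comm t s] at h1
  refine dvd_of_one_le_padicValNat ?_
  rw [h1]
  refine Finset.card_pos.2 ⟨m, ?_⟩
  rw [Finset.mem_filter, Finset.mem_Ico, Nat.mod_eq_of_lt hs, Nat.mod_eq_of_lt ht]
  refine ⟨⟨by omega, ?_⟩, h⟩
  rw [Nat.lt_succ_iff]
  exact Nat.le_log_of_pow_le (by norm_num) h

/-- Admissible divided powers of `x_1` are thus closed under multiplication: a product that would
exceed the bound is zero. -/
theorem adm.add {n : ℕ∞} {s t : ℕ} (hs : adm n s) (ht : adm n t)
    (h : ¬ 2 ∣ (s + t).choose s) : adm n (s + t) := by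
  intro m hm
  by_contra hlt
  exact h (two_dvd_choose_of_carry (hs m hm) (ht m hm) (not_lt.1 hlt))

theorem Kind.Res.adm_of {k : Kind} {n : ℕ∞} {s t r : ℕ} (hs : adm n s) (ht : adm n t)
    (h : k.Res s t r) : adm n r := by
  cases k with
  | U => rw [h.1]; exact hs.add ht h.2
  | L =>
    obtain ⟨h1, h2, h3⟩ := h
    rw [show r = s - 1 + t by omega]
    exact (hs.mono (Nat.sub_le _ _)).add ht h3
  | R =>
    obtain ⟨h1, h2, h3⟩ := h
    rw [show r = s + (t - 1) by omega]
    exact hs.add (ht.mono (Nat.sub_le _ _)) h3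
  | D => exact (hs.add ht h.2).mono (by have := h.1; omega)

/-- Before differentiation the exponent is `r + 1`, so already that one is admissible. This is the
source of the gap between the prolong and its derived algebra. -/
theorem Kind.Res.adm_succ {n : ℕ∞} {s t r : ℕ} (hs : adm n s) (ht : adm n t)
    (h : Kind.D.Res s t r) : adm n (r + 1) := by
  rw [h.1]; exact hs.add ht h.2

theorem Kind.Res.sum_eq {k : Kind} {s t r : ℕ} (h : k.Res s t r) :
    (s + t : ℤ) = r + if k = .U then 0 else 1 := by
  cases k with
  | U => have := h.1; simp; omega
  | L => have := h.1; simp; omega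
  | R => have := h.1; simp; omega
  | D => have := h.1; simp; omega

/-- The span of the fields with generating functions `F_v(x_1^(s))` for which `Q v s` holds. -/
noncomputable def LQ (K : Type*) [Field K] (Q : Fin 18 → ℕ → Prop) : Submodule K (Op K) :=
  (Submodule.pi Set.univ fun v => evn K (Q v)).map ((kap K).comp (Fsum K))

theorem mem_LQ {Q : Fin 18 → ℕ → Prop} {D : Op K} :
    D ∈ LQ K Q ↔ ∃ u, (∀ v, u v ∈ evn K (Q v)) ∧ kap K (Fsum K u) = D := by
  simp only [LQ, Submodule.mem_map, Submodule.mem_pi, Set.mem_univ, true_imp_iff]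
  rfl

theorem LQ_mono {Q Q' : Fin 18 → ℕ → Prop} (h : ∀ v s, Q v s → Q' v s) : LQ K Q ≤ LQ K Q' := by
  intro D hD
  obtain ⟨u, hu, rfl⟩ := mem_LQ.1 hD
  exact mem_LQ.2 ⟨u, fun v => evn_mono (h v) (hu v), rfl⟩

theorem kap_Fv_mem {Q : Fin 18 → ℕ → Prop} {v : Fin 18} {f : DPA K} (h : f ∈ evn K (Q v)) :
    kap K (Fv K v f) ∈ LQ K Q := by
  refine mem_LQ.2 ⟨Pi.single v f, fun w => ?_, by rw [Fsum_single]⟩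
  by_cases hw : w = v
  · subst hw; rwa [Pi.single_eq_same]
  · rw [Pi.single_eq_of_ne hw]; exact zero_mem _

/-- The field with generating function `F_v(x_1^(s))`. -/
noncomputable def bs (K : Type*) [Field K] (v : Fin 18) (s : ℕ) : Op K := kap K (Fv K v (tp K s))

theorem bs_mem {Q : Fin 18 → ℕ → Prop} {v : Fin 18} {s : ℕ} (h : Q v s) : bs K v s ∈ LQ K Q :=
  kap_Fv_mem (tp_mem_evn h)

theorem LQ_le {Q : Fin 18 → ℕ → Prop} {S : Submodule K (Op K)}
    (h : ∀ v s, Q v s → bs K v s ∈ S) : LQ K Q ≤ S := by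
  intro D hD
  obtain ⟨u, hu, rfl⟩ := mem_LQ.1 hD
  rw [Fsum_apply, map_sum]
  refine Submodule.sum_mem _ fun v _ => ?_
  refine evn_induction (p := fun f => kap K (Fv K v f) ∈ S) ?_ ?_ ?_ (fun s hs => h v s hs) (hu v)
  · rw [map_zero, map_zero]; exact zero_mem _
  · intro f g hf hg; rw [map_add, map_add]; exact add_mem hf hg
  · intro c f hf; rw [map_smul, map_smul]; exact Submodule.smul_mem _ _ hf

theorem LQ_eq_span (Q : Fin 18 → ℕ → Prop) :
    LQ K Q = Submodule.span K {D | ∃ v s, Q v s ∧ bs K v s = D} := by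
  refine le_antisymm (LQ_le fun v s h => Submodule.subset_span ⟨v, s, h, rfl⟩) ?_
  refine Submodule.span_le.2 ?_
  rintro _ ⟨v, s, h, rfl⟩
  exact bs_mem h

theorem dualCoef_genFun [CharP K 2] {Q : Fin 18 → ℕ → Prop} {u : Fin 18 → DPA K}
    (hu : ∀ v, u v ∈ evn K (Q v)) (v : Fin 18) (s : ℕ) :
    dualCoef v s (genFun K (kap K (Fsum K u))) = coef (bits 0 s) (u v) := by
  rw [genFun_kap, dualCoef_Fsum hu]

/-- The functionals `dualCoef` recover the functions `u_v` from the field, so any information on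
nonzero coordinates can be imposed on the set of indices. -/
theorem mem_LQ_of_coef [CharP K 2] {P Q : Fin 18 → ℕ → Prop} {D : Op K} (hD : D ∈ LQ K P)
    (h : ∀ v s, P v s → dualCoef v s (genFun K D) ≠ 0 → Q v s) : D ∈ LQ K Q := by
  obtain ⟨u, hu, rfl⟩ := mem_LQ.1 hD
  refine mem_LQ.2 ⟨u, fun v => ?_, rfl⟩
  refine mem_evn_of_coef (hu v) fun s hs => ?_
  refine h v s ?_ (by rwa [dualCoef_genFun hu])
  obtain ⟨s', hs', he⟩ := mem_evn_iff.1 (hu v) _ hs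
  rwa [← bits_zero_injective he]

/-! #### Brackets -/

/-- Only constants are used in the last two families. -/
def ConstQ (Q : Fin 18 → ℕ → Prop) : Prop := ∀ v s, 16 ≤ v.val → Q v s → s = 0

theorem lie_kap_Fv [CharP K 2] {v w : Fin 18} {f g : DPA K} (hf : EvenFun f) (hg : EvenFun g)
    (hv : 16 ≤ v.val → pdD K 0 f = 0) (hw : 16 ≤ w.val → pdD K 0 g = 0) :
    ⁅kap K (Fv K v f), kap K (Fv K w g)⁆ =
      ((tab v w).map fun t => kap K (Fv K t.1 (t.2.app f g))).sum := by
  rw [lie_kap, cBr_Fv hf hg hv hw, map_list_sum, List.map_map]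
  rfl

/-- Reduces every closure statement about brackets to a condition on exponents at each entry of
`tab`. -/
theorem lie_mem_LQ [CharP K 2] {Q Q' Q'' : Fin 18 → ℕ → Prop} (hQ : ConstQ Q) (hQ' : ConstQ Q')
    (h : ∀ v w, ∀ t ∈ tab v w, ∀ s s' r, Q v s → Q' w s' → t.2.Res s s' r → Q'' t.1 r)
    {D E : Op K} (hD : D ∈ LQ K Q) (hE : E ∈ LQ K Q') : ⁅D, E⁆ ∈ LQ K Q'' := by
  obtain ⟨u, hu, rfl⟩ := mem_LQ.1 hD
  obtain ⟨u', hu', rfl⟩ := mem_LQ.1 hE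
  rw [Fsum_apply, Fsum_apply, map_sum, map_sum, op_sum_lie]
  refine Submodule.sum_mem _ fun v _ => ?_
  rw [op_lie_sum]
  refine Submodule.sum_mem _ fun w _ => ?_
  rw [lie_kap_Fv (evenFun_of_mem (hu v)) (evenFun_of_mem (hu' w))
    (fun hv => pd_eq_zero_of_const (hu v) fun s hs => hQ v s hv hs)
    (fun hw => pd_eq_zero_of_const (hu' w) fun s hs => hQ' w s hw hs)]
  refine list_sum_mem ?_
  intro x hx
  obtain ⟨t, ht, rfl⟩ := List.mem_map.1 hx
  exact kap_Fv_mem (t.2.app_mem (fun s s' r => h v w t ht s s' r) (hu v) (hu' w))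

theorem cBr_one (f : DPA K) : cBr 1 f = pdD K 0 f := by
  rw [cBr]
  simp

theorem lie_kap_one [CharP K 2] (f : DPA K) : ⁅kap K 1, kap K f⁆ = kap K (pdD K 0 f) := by
  rw [lie_kap, cBr_one]

theorem pdD_zero_Fv (v : Fin 18) (f : DPA K) : pdD K 0 (Fv K v f) = Fv K v (pdD K 0 f) := by
  rw [Fv_apply, Fv_apply, pdD_zero_den1]
  generalize lam v = l
  induction l with
  | nil => rfl
  | cons p l ih =>
    rw [derL, List.map_cons, den1_cons, den1_cons, ← ih]
    rfl

theorem pdD_zero_Fsum (u : Fin 18 → DPA K) :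
    pdD K 0 (Fsum K u) = Fsum K fun v => pdD K 0 (u v) := by
  rw [Fsum_apply, Fsum_apply, map_sum]
  exact Finset.sum_congr rfl fun v _ => pdD_zero_Fv v _

theorem Fv_zero_one : Fv K 0 1 = 1 := by
  rw [Fv_apply, show lam 0 = [(0, 0), (1, 129), (2, 113)] by decide +kernel]
  simp only [den1_cons, den1_nil, xm_zero]
  simp

theorem bs_zero_zero : bs K 0 0 = kap K 1 := by rw [bs, tp_zero, Fv_zero_one]

theorem Fv_xv (b : Fin 8) : Fv K ⟨b.val + 1, by omega⟩ 1 = xv K b.succ := by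
  rw [Fv_apply, xv_succ]
  have h : (lam ⟨b.val + 1, by omega⟩).filter (fun p => p.1 == 0) = [(0, 2 ^ b.val)] := by
    revert b; decide +kernel
  rw [show xm K (2 ^ b.val) = den1 1 [(0, 2 ^ b.val)] by simp [den1_cons, den1_nil], ← h]
  generalize lam ⟨b.val + 1, by omega⟩ = l
  clear h
  induction l with
  | nil => rfl
  | cons p l ih =>
    by_cases hp : p.1 = 0
    · rw [List.filter_cons_of_pos (by simpa using hp), den1_cons, den1_cons, ih]
    · rw [List.filter_cons_of_neg (by simpa using hp), den1_cons, ih,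
        iterate_eq_zero (Derivation.map_one_eq_zero _) hp, zero_mul, zero_add]

/-- The index of the family that starts with `u x_{b+2}`. -/
def oddIx (b : Fin 8) : Fin 18 := ⟨b.val + 1, by omega⟩

theorem bs_oddIx (b : Fin 8) : bs K (oddIx b) 0 = kap K (xv K b.succ) := by
  rw [bs, tp_zero, oddIx, Fv_xv]

/-- Degrees of the fields with generating functions `F_v(1)`. -/
def dg : Fin 18 → ℤ := ![-2, -1, -1, -1, -1, -1, -1, -1, -1, 0, 0, 0, 0, 0, 0, 0, 0, 0]

/-- The indices of the six families generated by the fields `X_i^±` with `i ≠ 2`. -/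
def isE (v : Fin 18) : Prop := 9 ≤ v.val ∧ v.val ≤ 14

instance : DecidablePred isE := fun _ => inferInstanceAs (Decidable (_ ∧ _))

theorem tab_deg : ∀ v w : Fin 18, ∀ t ∈ tab v w,
    dg t.1 = dg v + dg w + if t.2 = .U then 0 else 2 := by decide +kernel

theorem tab_lt : ∀ v w : Fin 18, ∀ t ∈ tab v w, t.1.val < 16 := by decide +kernel

/-- Apart from the scalar action of the last two families, the root families of degree zero are
reached only through `(uw)'`. Hence their top exponents never arise in brackets of the prolong
described by `Qt`. -/
theorem tab_isE : ∀ v w : Fin 18, ∀ t ∈ tab v w, isE t.1 →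
    t.2 = .D ∨ (t.2 = .U ∧ 16 ≤ v.val ∧ w = t.1) ∨ (t.2 = .U ∧ 16 ≤ w.val ∧ v = t.1) := by
  decide +kernel

/-- The condition that describes the prolong `(𝔤₋, [𝔤₋₁, 𝔤₁])_*`. -/
def Qt (n : ℕ∞) (v : Fin 18) (s : ℕ) : Prop := v.val < 16 ∧ adm n s

/-- The condition that describes the full prolong. -/
def Qf (j : Fin 3) (n : ℕ∞) (v : Fin 18) (s : ℕ) : Prop :=
  Qt n v s ∨ (16 ≤ v.val ∧ v.val < 16 + j.val ∧ s = 0)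

/-- The condition that describes the derived algebra. -/
def Qi (n : ℕ∞) (v : Fin 18) (s : ℕ) : Prop := Qt n v s ∧ (isE v → adm n (s + 1))

/-- The restriction of a condition to the component of degree `k`. -/
def Qg (Q : Fin 18 → ℕ → Prop) (k : ℤ) (v : Fin 18) (s : ℕ) : Prop := Q v s ∧ dg v + 2 * s = k

theorem Qf.adm {j : Fin 3} {n : ℕ∞} {v : Fin 18} {s : ℕ} (h : Qf j n v s) : adm n s := by
  rcases h with h | h
  · exact h.2
  · rw [h.2.2]; exact adm_zero n

theorem constQ_Qf (j : Fin 3) (n : ℕ∞) : ConstQ (Qf j n) := by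
  rintro v s hv (h | h)
  · exact absurd h.1 (by omega)
  · exact h.2.2

theorem ConstQ.mono {Q Q' : Fin 18 → ℕ → Prop} (hQ : ConstQ Q) (h : ∀ v s, Q' v s → Q v s) :
    ConstQ Q' := fun v s hv hs => hQ v s hv (h v s hs)

theorem constQ_Qt (n : ℕ∞) : ConstQ (Qt n) := (constQ_Qf 0 n).mono fun _ _ => Or.inl

theorem constQ_Qi (n : ℕ∞) : ConstQ (Qi n) := (constQ_Qt n).mono fun _ _ h => h.1

theorem ConstQ.Qg {Q : Fin 18 → ℕ → Prop} (hQ : ConstQ Q) (k : ℤ) : ConstQ (Qg Q k) :=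
  hQ.mono fun _ _ h => h.1

/-- The last two families never occur among the values of `tab`. -/
theorem lie_mem_full [CharP K 2] {j j' : Fin 3} {n : ℕ∞} {D E : Op K} (hD : D ∈ LQ K (Qf j n))
    (hE : E ∈ LQ K (Qf j' n)) : ⁅D, E⁆ ∈ LQ K (Qt n) :=
  lie_mem_LQ (constQ_Qf j n) (constQ_Qf j' n)
    (fun v w t ht _ _ _ hs hs' hr => ⟨tab_lt v w t ht, hr.adm_of hs.adm hs'.adm⟩) hD hE

theorem lie_mem_grade [CharP K 2] {j j' : Fin 3} {n : ℕ∞} {k l : ℤ} {D E : Op K}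
    (hD : D ∈ LQ K (Qg (Qf j n) k)) (hE : E ∈ LQ K (Qg (Qf j' n) l)) :
    ⁅D, E⁆ ∈ LQ K (Qg (Qt n) (k + l)) := by
  refine lie_mem_LQ ((constQ_Qf j n).Qg k) ((constQ_Qf j' n).Qg l) ?_ hD hE
  intro v w t ht s s' r hs hs' hr
  refine ⟨⟨tab_lt v w t ht, hr.adm_of hs.1.adm hs'.1.adm⟩, ?_⟩
  have h1 := tab_deg v w t ht
  have h2 := hr.sum_eq
  have h3 := hs.2
  have h4 := hs'.2
  split_ifs at h1 h2 <;> omega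

theorem lie_mem_derived [CharP K 2] {n : ℕ∞} {D E : Op K} (hD : D ∈ LQ K (Qt n))
    (hE : E ∈ LQ K (Qt n)) : ⁅D, E⁆ ∈ LQ K (Qi n) := by
  refine lie_mem_LQ (constQ_Qt n) (constQ_Qt n) ?_ hD hE
  intro v w t ht s s' r hs hs' hr
  refine ⟨⟨tab_lt v w t ht, hr.adm_of hs.2 hs'.2⟩, fun he => ?_⟩
  rcases tab_isE v w t ht he with h | h | h
  · rw [h] at hr; exact hr.adm_succ hs.2 hs'.2
  · exact absurd hs.1 (by omega)
  · exact absurd hs'.1 (by omega)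

theorem lie_mem_ideal [CharP K 2] {j : Fin 3} {n : ℕ∞} {D E : Op K} (hD : D ∈ LQ K (Qf j n))
    (hE : E ∈ LQ K (Qi n)) : ⁅D, E⁆ ∈ LQ K (Qi n) := by
  refine lie_mem_LQ (constQ_Qf j n) (constQ_Qi n) ?_ hD hE
  intro v w t ht s s' r hs hs' hr
  refine ⟨⟨tab_lt v w t ht, hr.adm_of hs.adm hs'.1.2⟩, fun he => ?_⟩
  rcases tab_isE v w t ht he with h | h | h
  · rw [h] at hr; exact hr.adm_succ hs.adm hs'.1.2
  -- A constant torus element acts by a scalar and leaves the exponent unchanged.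
  · have h0 := constQ_Qf j n v s h.2.1 hs
    rw [h.1] at hr
    have h2 := hs'.2 (h.2.2 ▸ he)
    rw [hr.1, h0, zero_add]
    exact h2
  · exact absurd hs'.1.1 (by omega)

end Spaces

/-! ### Degrees and parities of the generating functions -/

section Weights

variable {K : Type*} [Field K] {G : Type*} [AddCommGroup G]

theorem iterate_pd_tp (a s : ℕ) :
    (pdD K 0)^[a] (tp K s) = if a ≤ s then tp K (s - a) else 0 := by
  induction a with
  | zero => simp
  | succ a ih =>
    rw [Function.iterate_succ_apply', ih]
    by_cases h : a ≤ s
    · rw [if_pos h, pdD_zero_tp]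
      by_cases h' : s - a = 0
      · rw [if_pos h', if_neg (by omega)]
      · rw [if_neg h', if_pos (by omega), Nat.sub_sub]
    · rw [if_neg h, if_neg (by omega), map_zero]

/-- The weight of a square-free monomial in the last eight indeterminates. -/
def maskWt (w : Fin 9 → G) (m : ℕ) : G := ∑ i : Fin 8, (m.testBit i.val).toNat • w i.succ

theorem sum_bits (w : Fin 9 → G) (m s : ℕ) : ∑ j, bits m s j • w j = s • w 0 + maskWt w m := by
  rw [Fin.sum_univ_succ]
  rfl

theorem adm_bits {N : Fin 9 → ℕ∞} (hN : ∀ i, N i ≠ 0) {m s : ℕ} (h : adm (N 0) s) :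
    Adm N (bits m s) := by
  intro j n hn
  induction j using Fin.cases with
  | zero => exact h n hn
  | succ i =>
    have h0 : n ≠ 0 := by rintro rfl; exact hN _ hn
    refine lt_of_le_of_lt (Bool.toNat_le _) (Nat.one_lt_two_pow h0)

/-- The weights `w` of the indeterminates are compatible with the contact form, and the functions
`F_v(1)` are homogeneous of weight `g v`. -/
structure IsWeight (w : Fin 9 → G) (g : Fin 18 → G) : Prop where
  map_rev : ∀ i : Fin 8, w i.succ + w i.rev.succ = w 0
  map_lam : ∀ v, ∀ q ∈ lam v, maskWt w q.2 = q.1 • w 0 + g v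
  map_dual : ∀ v, ∀ m ∈ dual v, maskWt w m = g v

variable {w : Fin 9 → G} {g : Fin 18 → G}

/-- Each derivative of `u` lowers the weight by that of `x_1`, and the accompanying monomial makes
up for it. -/
theorem IsWeight.Fv_tp_mem (hw : IsWeight w g) {N : Fin 9 → ℕ∞} (hN : ∀ i, N i ≠ 0)
    (v : Fin 18) {s : ℕ} (hs : adm (N 0) s) : Fv K v (tp K s) ∈ grFun K N w (g v + s • w 0) := by
  have h := hw.map_lam v
  rw [Fv_apply]
  generalize lam v = l at h
  induction l with
  | nil => exact zero_mem _
  | cons q l ih =>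
    rw [den1_cons]
    refine add_mem ?_ (ih fun q hq => h q (List.mem_cons_of_mem _ hq))
    rw [iterate_pd_tp]
    split_ifs with hq
    · rw [tp_mul_xm]
      refine mono_mem_grFun (adm_bits hN (hs.mono (Nat.sub_le _ _))) ?_
      rw [sum_bits, h q List.mem_cons_self, ← add_assoc, ← add_smul, Nat.sub_add_cancel hq, add_comm]
    · rw [zero_mul]; exact zero_mem _

theorem IsWeight.bs_mem [CharP K 2] (hw : IsWeight w g) {N : Fin 9 → ℕ∞} (hN : ∀ i, N i ≠ 0)
    (v : Fin 18) {s : ℕ} (hs : adm (N 0) s) : bs K v s ∈ grField K N w (g v + s • w 0 - w 0) :=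
  kap_mem_grField hN hw.map_rev (hw.Fv_tp_mem hN v hs)

/-- A nonzero coordinate forces a monomial from `dual v`, times a power of `x_1`, to occur in the
generating function; its weight and the bound on its exponent are known. -/
theorem IsWeight.mem_LQ [CharP K 2] (hw : IsWeight w g) {N : Fin 9 → ℕ∞} (hN : ∀ i, N i ≠ 0)
    {Q : Fin 18 → ℕ → Prop} {k : G} {D : Op K} (hD : D ∈ LQ K Q) (hk : D ∈ grField K N w k) :
    D ∈ LQ K fun v s => Q v s ∧ adm (N 0) s ∧ g v + s • w 0 - w 0 = k := by
  refine mem_LQ_of_coef hD fun v s hv hne => ?_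
  obtain ⟨m, hm, hc⟩ : ∃ m ∈ dual v, coef (bits m s) (genFun K D) ≠ 0 := by
    by_contra! hall
    refine hne ?_
    rw [dualCoef_apply]
    exact List.sum_eq_zero fun x hx => by
      obtain ⟨m, hm, rfl⟩ := List.mem_map.1 hx
      exact hall m hm
  have h1 := mem_monoSpan_iff.1 (genFun_mem_grFun hN hw.map_rev hk) _ hc
  refine ⟨hv, fun n hn => h1.1 0 n hn, ?_⟩
  have h2 := h1.2
  rw [sum_bits, hw.map_dual v m hm] at h2
  rw [add_comm (g v), h2, add_sub_cancel_right]

/-- A generating function has the degree of its field plus 2, the degree of `x_1`. -/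
theorem isWeight_deg : IsWeight varDeg fun v => dg v + 2 := by
  constructor <;> decide +kernel

theorem LQ_le_vectDeg [CharP K 2] {N : Fin 9 → ℕ∞} (hN : ∀ i, N i ≠ 0) {Q : Fin 18 → ℕ → Prop}
    {k : ℤ} (h : ∀ v s, Q v s → adm (N 0) s) : LQ K (Qg Q k) ≤ vectDeg K N k := by
  refine LQ_le fun v s hs => ?_
  have := isWeight_deg.bs_mem (K := K) hN v (h v s hs.1)
  rw [vectDeg_eq]
  convert this using 2
  have := hs.2
  rw [show varDeg 0 = 2 from rfl, nsmul_eq_mul]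
  omega

theorem mem_LQ_Qg [CharP K 2] {N : Fin 9 → ℕ∞} (hN : ∀ i, N i ≠ 0) {Q : Fin 18 → ℕ → Prop}
    {k : ℤ} {D : Op K} (hD : D ∈ LQ K Q) (hk : D ∈ vectDeg K N k) : D ∈ LQ K (Qg Q k) := by
  rw [vectDeg_eq] at hk
  refine LQ_mono ?_ (isWeight_deg.mem_LQ hN hD hk)
  rintro v s ⟨h1, -, h2⟩
  refine ⟨h1, ?_⟩
  rw [show varDeg 0 = 2 from rfl, nsmul_eq_mul] at h2
  omega

/-- The parity of the field with generating function `F_v(1)`. -/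
def par (p : Fin 4 → ZMod 2) (v : Fin 18) : ZMod 2 := maskWt (varParity p) ((dual v).headD 0)

theorem isWeight_par : ∀ p : Fin 4 → ZMod 2, p 0 + p 2 + p 3 = 0 →
    IsWeight (varParity p) (par p) := by
  have h1 : ∀ p : Fin 4 → ZMod 2, p 0 + p 2 + p 3 = 0 →
      (∀ i : Fin 8, varParity p i.succ + varParity p i.rev.succ = varParity p 0) ∧
      (∀ v, ∀ q ∈ lam v, maskWt (varParity p) q.2 = q.1 • varParity p 0 + par p v) ∧
      ∀ v, ∀ m ∈ dual v, maskWt (varParity p) m = par p v := by decide +kernel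
  exact fun p hp => ⟨(h1 p hp).1, (h1 p hp).2.1, (h1 p hp).2.2⟩

end Weights

/-! ### The Chevalley generators in terms of generating functions -/

section Generators

variable {K : Type*} [Field K]

/-- The vector field given by a list, where `(j, a, m)` is the product of the derivative of order
`a` of `u`, the square-free monomial of index `m`, and the partial derivative with index `j`. -/
noncomputable def fden (u : DPA K) (l : List (Fin 9 × ℕ × ℕ)) : Derivation K (DPA K) (DPA K) :=
  (l.map fun p => ((pdD K 0)^[p.2.1] u * xm K p.2.2) • pdD K p.1).sum

theorem fden_cons (u : DPA K) (p : Fin 9 × ℕ × ℕ) (l : List (Fin 9 × ℕ × ℕ)) :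
    fden u (p :: l) = ((pdD K 0)^[p.2.1] u * xm K p.2.2) • pdD K p.1 + fden u l := by
  simp [fden]

theorem fden_append (u : DPA K) (l l' : List (Fin 9 × ℕ × ℕ)) :
    fden u (l ++ l') = fden u l + fden u l' := by
  simp [fden]

theorem fden_flatMap {α : Type*} (u : DPA K) (l : List α) (F : α → List (Fin 9 × ℕ × ℕ)) :
    fden u (l.flatMap F) = (l.map fun x => fden u (F x)).sum := by
  induction l with
  | nil => rfl
  | cons x l ih => rw [List.flatMap_cons, fden_append, ih, List.map_cons, List.sum_cons]

theorem fden_map (u : DPA K) (j : Fin 9) (l : List (ℕ × ℕ)) :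
    fden u (l.map fun p => (j, p)) = den1 u l • pdD K j := by
  induction l with
  | nil => simp [fden, den1_nil]
  | cons p l ih => rw [List.map_cons, fden_cons, ih, den1_cons, add_smul]

/-- Multiplication by the indeterminate with index `i.succ`. -/
def mulVarL (i : Fin 8) (l : List (ℕ × ℕ)) : List (ℕ × ℕ) :=
  (l.filter fun p => !p.2.testBit i.val).map fun p => (p.1, p.2 ||| 2 ^ i.val)

/-- The contact field with a given generating function. -/
def fldL (l : List (ℕ × ℕ)) : List (Fin 9 × ℕ × ℕ) :=
  (l.map fun p => (0, p)) ++ (List.finRange 8).flatMap fun i =>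
    ((zedL i.rev l).map fun p => (i.succ, p)) ++
      if i.val < 4 then (mulVarL i.rev (zedL i.rev l)).map fun p => (0, p) else []

theorem den1_mulVarL [CharP K 2] (u : DPA K) (i : Fin 8) (l : List (ℕ × ℕ)) :
    den1 u (mulVarL i l) = den1 u l * xv K i.succ := by
  induction l with
  | nil => simp [mulVarL, den1_nil]
  | cons p l ih =>
    have hk : (2 ^ i.val &&& p.2) % 256 = 0 ↔ p.2.testBit i.val = false := by
      rw [and_mod_eq_zero]
      constructor
      · intro h; simpa [Nat.testBit_two_pow_self] using h i
      · intro h j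
        by_cases hj : i.val = j.val
        · rw [← hj, h, Bool.and_false]
        · rw [Nat.testBit_two_pow_of_ne hj, Bool.false_and]
    have hm : xm K p.2 * xv K i.succ =
        if p.2.testBit i.val = false then xm K (p.2 ||| 2 ^ i.val) else 0 := by
      rw [mul_comm, xv_succ, xm_mul_xm, Nat.lor_comm]
      simp only [hk]
    rw [den1_cons, add_mul, ← ih, mul_assoc, hm, mulVarL, mulVarL]
    cases hb : p.2.testBit i.val
    · rw [List.filter_cons_of_pos (by simp [hb]), List.map_cons, den1_cons, if_pos rfl]
    · rw [List.filter_cons_of_neg (by simp [hb]), if_neg (by simp), mul_zero, zero_add]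

theorem cD_den1 [CharP K 2] {u : DPA K} (hu : EvenFun u) (l : List (ℕ × ℕ)) :
    cD (den1 u l) = fden u (fldL l) := by
  rw [fldL, fden_append, fden_map, fden_flatMap, cD, ← List.ofFn_eq_map, List.sum_ofFn]
  congr 1
  refine Finset.sum_congr rfl fun i _ => ?_
  rw [fden_append, fden_map, zD_den1 hu, zD, smul_add]
  congr 1
  split_ifs with h
  · rw [fden_map, den1_mulVarL, mul_smul]
  · simp [fden]

/-- A product of distinct indeterminates times a partial derivative, as a member of a list. -/
def ofFld (p : List ℕ × ℕ) : Fin 9 × ℕ × ℕ :=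
  (Fin.ofNat 9 (p.2 - 1), if 1 ∈ p.1 then 0 else 1, msk (p.1.erase 1))

/-- Everything is written in terms of `u = x_1`: a factor `x_1` is `u`, and its absence is `u' = 1`.
-/
theorem fld_eq {p : List ℕ × ℕ} (h : ∀ j : Fin 9, p.1.count (j.val + 1) =
    bits (ofFld p).2.2 (1 - (ofFld p).2.1) j) : fld K p.1 p.2 = toOp (fden (tp K 1) [ofFld p]) := by
  rw [fld, vf_eq, fden_cons, iterate_pd_tp, if_pos, tp_mul_xm, ← funext h]
  · simp [fden, ofFld]
  · simp only [ofFld]; split_ifs <;> simp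

theorem fden_filter (s : ℕ) (l : List (Fin 9 × ℕ × ℕ)) :
    fden (tp K s) (l.filter fun p => p.2.1 ≤ s) = fden (tp K s) l := by
  induction l with
  | nil => rfl
  | cons p l ih =>
    by_cases h : p.2.1 ≤ s
    · rw [List.filter_cons_of_pos (by simpa using h), fden_cons, fden_cons, ih]
    · rw [List.filter_cons_of_neg (by simpa using h), fden_cons, ih, iterate_pd_tp, if_neg h,
        zero_mul, zero_smul, zero_add]

/-- For `u = x_1` the derivatives of order above one vanish; these are the terms that the filter
removes before cancellation is tested. -/
theorem kap_den1_eq [CharP K 2] (l : List (ℕ × ℕ)) (t : List (List ℕ × ℕ))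
    (ht : ∀ p ∈ t, ∀ j : Fin 9, p.1.count (j.val + 1) = bits (ofFld p).2.2 (1 - (ofFld p).2.1) j)
    (h : normL ((fldL l ++ t.map ofFld).filter fun p => p.2.1 ≤ 1) = []) :
    kap K (den1 (tp K 1) l) = (t.map fun p => fld K p.1 p.2).sum := by
  have h1 : (t.map fun p => fld K p.1 p.2).sum = toOp (fden (tp K 1) (t.map ofFld)) := by
    clear h
    induction t with
    | nil => simp [fden]
    | cons p t ih =>
      rw [List.map_cons, List.sum_cons, ih fun q hq => ht q (List.mem_cons_of_mem _ hq),
        fld_eq (ht p List.mem_cons_self), ← map_add, ← fden_append]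
      rfl
  have hD : ∀ D : Derivation K (DPA K) (DPA K), D + D = 0 := fun D => by
    ext a; exact CharTwo.add_self_eq_zero _
  have h2 : fden (tp K 1) (fldL l) + fden (tp K 1) (t.map ofFld) = 0 := by
    rw [← fden_append, ← fden_filter, fden, ← sum_map_normL hD, h]
    rfl
  rw [h1, kap_apply, cD_den1 (evenFun_tp 1)]
  congr 1
  rw [← add_zero (fden (tp K 1) (fldL l)), ← hD (fden (tp K 1) (t.map ofFld)), ← add_assoc, h2,
    zero_add]

/-- Since 1 is the derivative of `x_1`, constant coefficients fit into the same test with `u = x_1`.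
-/
theorem bs_zero_eq (v : Fin 18) : bs K v 0 = kap K (den1 (tp K 1) (derL (lam v))) := by
  rw [← pdD_zero_den1, ← Fv_apply, pdD_zero_Fv, pdD_zero_tp, if_neg one_ne_zero]
  rfl

theorem bs_one_eq (v : Fin 18) : bs K v 1 = kap K (den1 (tp K 1) (lam v)) := rfl

theorem chevMinus_zero [CharP K 2] : chevMinus K 0 = bs K 9 0 := by
  rw [bs_zero_eq]
  refine Eq.trans ?_ (kap_den1_eq _ [([4, 5], 1), ([2], 3), ([4], 6), ([5], 7), ([8], 9)]
    (by decide +kernel) (by decide +kernel)).symm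
  simp [chevMinus, add_assoc]

theorem chevMinus_one [CharP K 2] : chevMinus K 1 = bs K 8 0 := by
  rw [bs_zero_eq]
  refine Eq.trans ?_ (kap_den1_eq _ [([], 2)]
    (by decide +kernel) (by decide +kernel)).symm
  simp [chevMinus, add_assoc]

theorem chevMinus_two [CharP K 2] : chevMinus K 2 = bs K 11 0 := by
  rw [bs_zero_eq]
  refine Eq.trans ?_ (kap_den1_eq _ [([3, 5], 1), ([2], 4), ([3], 6), ([5], 8), ([7], 9)]
    (by decide +kernel) (by decide +kernel)).symm
  simp [chevMinus, add_assoc]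

theorem chevMinus_three [CharP K 2] : chevMinus K 3 = bs K 13 0 := by
  rw [bs_zero_eq]
  refine Eq.trans ?_ (kap_den1_eq _ [([3, 4], 1), ([2], 5), ([3], 7), ([4], 8), ([6], 9)]
    (by decide +kernel) (by decide +kernel)).symm
  simp [chevMinus, add_assoc]

theorem chevPlus_zero [CharP K 2] : chevPlus K 0 = bs K 10 0 := by
  rw [bs_zero_eq]
  refine Eq.trans ?_ (kap_den1_eq _ [([6, 7], 1), ([3], 2), ([6], 4), ([7], 5), ([9], 8)]
    (by decide +kernel) (by decide +kernel)).symm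
  simp [chevPlus, add_assoc]

theorem chevPlus_one [CharP K 2] : chevPlus K 1 = bs K 1 1 := by
  rw [bs_one_eq]
  refine Eq.trans ?_ (kap_den1_eq _ [([1, 2], 1), ([3, 4, 5], 1), ([1], 9), ([2, 3], 3), ([2, 4], 4), ([2, 5], 5), ([2, 9], 9), ([3, 4], 6), ([3, 5], 7), ([3, 8], 9), ([4, 5], 8), ([4, 7], 9), ([5, 6], 9)]
    (by decide +kernel) (by decide +kernel)).symm
  simp [chevPlus, add_assoc]

theorem chevPlus_two [CharP K 2] : chevPlus K 2 = bs K 12 0 := by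
  rw [bs_zero_eq]
  refine Eq.trans ?_ (kap_den1_eq _ [([6, 8], 1), ([4], 2), ([6], 3), ([8], 5), ([9], 7)]
    (by decide +kernel) (by decide +kernel)).symm
  simp [chevPlus, add_assoc]

theorem chevPlus_three [CharP K 2] : chevPlus K 3 = bs K 14 0 := by
  rw [bs_zero_eq]
  refine Eq.trans ?_ (kap_den1_eq _ [([7, 8], 1), ([5], 2), ([7], 3), ([8], 4), ([9], 6)]
    (by decide +kernel) (by decide +kernel)).symm
  simp [chevPlus, add_assoc]

theorem tor1_eq [CharP K 2] : tor1 K = bs K 0 1 + bs K 16 0 := by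
  rw [bs_one_eq, bs_zero_eq, ← map_add, ← den1_append]
  refine Eq.trans ?_ (kap_den1_eq _ [([1], 1), ([3], 3), ([6], 6), ([7], 7), ([9], 9)]
    (by decide +kernel) (by decide +kernel)).symm
  simp [tor1, add_assoc]

theorem tor2_eq [CharP K 2] : tor2 K = bs K 0 1 + bs K 17 0 := by
  rw [bs_one_eq, bs_zero_eq, ← map_add, ← den1_append]
  refine Eq.trans ?_ (kap_den1_eq _ [([1], 1), ([4], 4), ([6], 6), ([8], 8), ([9], 9)]
    (by decide +kernel) (by decide +kernel)).symm
  simp [tor2, add_assoc]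

end Generators

/-! ### Brackets of the basis fields -/

section Basis

variable {K : Type*} [Field K]

/-- The list of the `r` for which `x_1^(r)` occurs in the value of the bilinear operation at
`x_1^(s)` and `x_1^(t)`. -/
def Kind.resL : Kind → ℕ → ℕ → List ℕ
  | .U, s, t => if (s + t).choose s % 2 = 1 then [s + t] else []
  | .L, s, t => if s = 0 then [] else if (s - 1 + t).choose (s - 1) % 2 = 1 then [s - 1 + t] else []
  | .R, s, t => if t = 0 then [] else if (s + (t - 1)).choose s % 2 = 1 then [s + (t - 1)] else []
  | .D, s, t => if s + t = 0 then [] else if (s + t).choose s % 2 = 1 then [s + t - 1] else []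

theorem tp_mul_tp_eq [CharP K 2] (s t : ℕ) : tp K s * tp K t =
    ((if (s + t).choose s % 2 = 1 then [s + t] else []).map (tp K)).sum := by
  rw [tp_mul_tp]
  split_ifs with h
  · rw [← Nat.div_add_mod ((s + t).choose s) 2, h]
    push_cast
    rw [show (2 : K) = 0 from CharTwo.two_eq_zero]
    simp
  · rw [(CharP.cast_eq_zero_iff K 2 _).2 (by omega), zero_smul]
    rfl

theorem Kind.app_tp [CharP K 2] (k : Kind) (s t : ℕ) :
    k.app (tp K s) (tp K t) = ((k.resL s t).map (tp K)).sum := by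
  cases k with
  | U => exact tp_mul_tp_eq s t
  | L =>
    simp only [Kind.app, Kind.resL, pdD_zero_tp]
    split_ifs with h h'
    · simp
    · rw [tp_mul_tp_eq, if_pos h']
    · rw [tp_mul_tp_eq, if_neg h']
  | R =>
    simp only [Kind.app, Kind.resL, pdD_zero_tp]
    split_ifs with h h'
    · simp
    · rw [tp_mul_tp_eq, if_pos h']
    · rw [tp_mul_tp_eq, if_neg h']
  | D =>
    simp only [Kind.app, Kind.resL]
    rw [tp_mul_tp_eq]
    generalize (s + t).choose s = c
    generalize s + t = m
    by_cases h : c % 2 = 1 <;> by_cases h' : m = 0 <;> simp [h, h', pdD_zero_tp]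

/-- The sum of the basis fields with indices in a list. -/
noncomputable def bsl (K : Type*) [Field K] (l : List (Fin 18 × ℕ)) : Op K :=
  (l.map fun p => bs K p.1 p.2).sum

theorem bsl_cons (p : Fin 18 × ℕ) (l : List (Fin 18 × ℕ)) :
    bsl K (p :: l) = bs K p.1 p.2 + bsl K l := by simp [bsl]

theorem bsl_append (l l' : List (Fin 18 × ℕ)) : bsl K (l ++ l') = bsl K l + bsl K l' := by
  simp [bsl]

theorem bsl_normL [CharP K 2] (l : List (Fin 18 × ℕ)) : bsl K (normL l) = bsl K l :=
  sum_map_normL op_add_self _ l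

theorem bsl_mem {S : Submodule K (Op K)} {l : List (Fin 18 × ℕ)}
    (h : ∀ p ∈ l, bs K p.1 p.2 ∈ S) : bsl K l ∈ S := by
  refine list_sum_mem ?_
  intro x hx
  obtain ⟨p, hp, rfl⟩ := List.mem_map.1 hx
  exact h p hp

/-- The bracket of two basis fields. -/
def brB (x y : Fin 18 × ℕ) : List (Fin 18 × ℕ) :=
  (tab x.1 y.1).flatMap fun t => (t.2.resL x.2 y.2).map fun r => (t.1, r)

theorem lie_bs [CharP K 2] {x y : Fin 18 × ℕ} (hx : 16 ≤ x.1.val → x.2 = 0)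
    (hy : 16 ≤ y.1.val → y.2 = 0) :
    ⁅bs K x.1 x.2, bs K y.1 y.2⁆ = bsl K (brB x y) := by
  rw [bs, bs, lie_kap_Fv (evenFun_tp _) (evenFun_tp _)
    (fun h => by rw [hx h, pdD_zero_tp, if_pos rfl])
    (fun h => by rw [hy h, pdD_zero_tp, if_pos rfl]), brB]
  generalize tab x.1 y.1 = l
  induction l with
  | nil => rfl
  | cons t l ih =>
    rw [List.map_cons, List.sum_cons, ih, List.flatMap_cons, bsl_append, Kind.app_tp]
    congr 1
    generalize t.2.resL x.2 y.2 = r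
    induction r with
    | nil => simp [bsl]
    | cons a r ihr =>
      rw [List.map_cons, List.sum_cons, map_add, map_add, ihr, List.map_cons, bsl_cons]
      rfl

/-- A certificate for membership in the Lie algebra generated by basis fields: each step brackets
two known basis fields and adds one to the known ones. -/
def genOK : List (Fin 18 × ℕ) → List ((Fin 18 × ℕ) × (Fin 18 × ℕ) × (Fin 18 × ℕ)) → Bool
  | _, [] => true
  | l, (x, y, z) :: c => decide (x ∈ l) && decide (y ∈ l) &&
      (normL (z :: brB x y)).all (fun p => decide (p ∈ l)) && genOK (z :: l) c

theorem genOK_mem [CharP K 2] {S : Submodule K (Op K)} (hS : ∀ a ∈ S, ∀ b ∈ S, ⁅a, b⁆ ∈ S)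
    (c : List ((Fin 18 × ℕ) × (Fin 18 × ℕ) × (Fin 18 × ℕ))) {l : List (Fin 18 × ℕ)}
    (hl : ∀ p ∈ l, bs K p.1 p.2 ∈ S) (hc : ∀ p ∈ l, p.1.val < 16)
    (hz : ∀ p ∈ c, p.2.2.1.val < 16) (h : genOK l c = true) :
    ∀ p ∈ c, bs K p.2.2.1 p.2.2.2 ∈ S := by
  induction c generalizing l with
  | nil => simp
  | cons a c ih =>
    obtain ⟨x, y, z⟩ := a
    simp only [genOK, Bool.and_eq_true, decide_eq_true_eq, List.all_eq_true] at h
    obtain ⟨⟨⟨hx, hy⟩, hn⟩, hr⟩ := h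
    have hzS : bs K z.1 z.2 ∈ S := by
      -- The reduced list contains exactly the known summands by which the bracket differs from `z`.
      have h1 : bsl K (normL (z :: brB x y)) ∈ S := bsl_mem fun p hp => hl p (hn p hp)
      rw [bsl_normL, bsl_cons, ← lie_bs (fun h => absurd (hc x hx) (by omega))
        (fun h => absurd (hc y hy) (by omega))] at h1
      have h2 := add_mem h1 (hS _ (hl x hx) _ (hl y hy))
      rwa [add_assoc, op_add_self, add_zero] at h2
    intro p hp
    rcases List.mem_cons.1 hp with rfl | hp
    · exact hzS
    · refine ih (l := z :: l) ?_ ?_ (fun p hp => hz p (List.mem_cons_of_mem _ hp)) hr p hp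
      · intro q hq
        rcases List.mem_cons.1 hq with rfl | hq
        · exact hzS
        · exact hl q hq
      · intro q hq
        rcases List.mem_cons.1 hq with rfl | hq
        · exact hz _ List.mem_cons_self
        · exact hc q hq

end Basis

/-! ### The Lie algebra generated by the Chevalley generators -/

section BranchAlgebra

variable {K : Type*} [Field K]

/-- The condition that describes the Lie algebra `𝔦𝔯(9; N)` extended by the part of the torus
that has index `j`. -/
def Qc (j : Fin 3) (n : ℕ∞) (v : Fin 18) (s : ℕ) : Prop :=
  Qi n v s ∨ (16 ≤ v.val ∧ v.val < 16 + j.val ∧ s = 0)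

theorem Qc.qf {j : Fin 3} {n : ℕ∞} {v : Fin 18} {s : ℕ} (h : Qc j n v s) : Qf j n v s :=
  h.imp (fun h => h.1) id

theorem constQ_Qc (j : Fin 3) (n : ℕ∞) : ConstQ (Qc j n) :=
  (constQ_Qf j n).mono fun _ _ => Qc.qf

theorem tab_const : ∀ v w : Fin 18, 16 ≤ v.val → 16 ≤ w.val → tab v w = [] := by decide +kernel

theorem lie_mem_Qi [CharP K 2] {j j' : Fin 3} {n : ℕ∞} {D E : Op K} (hD : D ∈ LQ K (Qc j n))
    (hE : E ∈ LQ K (Qc j' n)) : ⁅D, E⁆ ∈ LQ K (Qi n) := by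
  refine lie_mem_LQ (constQ_Qc j n) (constQ_Qc j' n) ?_ hD hE
  intro v w t ht s s' r hs hs' hr
  refine ⟨⟨tab_lt v w t ht, hr.adm_of hs.qf.adm hs'.qf.adm⟩, fun he => ?_⟩
  rcases tab_isE v w t ht he with h | h | h
  · rw [h] at hr; exact hr.adm_succ hs.qf.adm hs'.qf.adm
  · have h0 := constQ_Qc j n v s h.2.1 hs
    rw [h.1] at hr
    rcases hs' with hs' | hs'
    · have h2 := hs'.2 (h.2.2 ▸ he)
      rw [hr.1, h0, zero_add]
      exact h2
    · rw [tab_const v w h.2.1 hs'.1] at ht; simp at ht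
  · have h0 := constQ_Qc j' n w s' h.2.1 hs'
    rw [h.1] at hr
    rcases hs with hs | hs
    · have h2 := hs.2 (h.2.2 ▸ he)
      rw [hr.1, h0, add_zero]
      exact h2
    · rw [tab_const v w hs.1 h.2.1] at ht; simp at ht

/-- A space of vector fields that is closed under brackets, as a Lie algebra. -/
noncomputable def algOf (S : Submodule K (Op K)) (h : ∀ a ∈ S, ∀ b ∈ S, ⁅a, b⁆ ∈ S) :
    LieSubalgebra K (Op K) :=
  { S with lie_mem' := fun {a b} ha hb => h a ha b hb }

theorem lie_mem_of_lieSubalgebra (L : LieSubalgebra K (Op K)) {a b : Op K} (ha : a ∈ L)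
    (hb : b ∈ L) : ⁅a, b⁆ ∈ L := L.lie_mem ha hb

theorem LQ_Qi_le {n : ℕ∞} (j : Fin 3) : LQ K (Qi n) ≤ LQ K (Qc j n) := LQ_mono fun _ _ => Or.inl

theorem adm_one_iff {s : ℕ} : adm 1 s ↔ s < 2 := by
  constructor
  · intro h; exact h 1 rfl
  · intro h m hm
    have : m = 1 := by exact_mod_cast hm.symm
    subst this
    exact h

theorem generators_mem_LQ (n : ℕ∞) (hn : n ≠ 0) : ∀ p ∈ ([(9, 0), (10, 0), (11, 0), (12, 0),
    (13, 0), (14, 0), (8, 0), (1, 1)] : List (Fin 18 × ℕ)), Qi n p.1 p.2 := by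
  intro p hp
  simp only [List.mem_cons, List.not_mem_nil, or_false] at hp
  have h1 := adm_one hn
  have h0 := adm_zero n
  rcases hp with rfl | rfl | rfl | rfl | rfl | rfl | rfl | rfl <;>
    exact ⟨⟨by decide, by assumption⟩, fun h => by first | exact h1 | exact absurd h (by decide)⟩

theorem chev_mem_LQ [CharP K 2] (n : ℕ∞) (hn : n ≠ 0) (i : Fin 4) :
    chevPlus K i ∈ LQ K (Qi n) ∧ chevMinus K i ∈ LQ K (Qi n) := by
  have h := fun p hp => bs_mem (K := K) (generators_mem_LQ n hn p hp)
  fin_cases i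
  · exact ⟨chevPlus_zero (K := K) ▸ h (10, 0) (by simp), chevMinus_zero (K := K) ▸ h (9, 0) (by simp)⟩
  · exact ⟨chevPlus_one (K := K) ▸ h (1, 1) (by simp), chevMinus_one (K := K) ▸ h (8, 0) (by simp)⟩
  · exact ⟨chevPlus_two (K := K) ▸ h (12, 0) (by simp), chevMinus_two (K := K) ▸ h (11, 0) (by simp)⟩
  · exact ⟨chevPlus_three (K := K) ▸ h (14, 0) (by simp), chevMinus_three (K := K) ▸ h (13, 0) (by simp)⟩

theorem bs_zero_one_mem {n : ℕ∞} (hn : n ≠ 0) : bs K 0 1 ∈ LQ K (Qi n) :=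
  bs_mem ⟨⟨by decide, adm_one hn⟩, fun h => absurd h (by decide)⟩

theorem extraTorus_subset [CharP K 2] (j : Fin 3) {n : ℕ∞} (hn : n ≠ 0) :
    extraTorus K j ⊆ LQ K (Qc j n) := by
  have h0 := fun j => LQ_Qi_le (K := K) (n := n) j (bs_zero_one_mem hn)
  fin_cases j
  · exact Set.empty_subset _
  · rintro _ rfl
    rw [tor1_eq]
    exact add_mem (h0 1) (bs_mem (Or.inr (by decide)))
  · rintro _ (rfl | rfl)
    · rw [tor1_eq]
      exact add_mem (h0 2) (bs_mem (Or.inr (by decide)))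
    · rw [tor2_eq]
      exact add_mem (h0 2) (bs_mem (Or.inr (by decide)))

/-- The elements `d_1` and `d_2` differ from the last two basis fields by `F_0(x_1)`, which the
Chevalley generators already produce. -/
theorem bs_torus_mem [CharP K 2] {S : Submodule K (Op K)} (h : bs K 0 1 ∈ S) {j : Fin 3}
    (hj : extraTorus K j ⊆ S) {v : Fin 18} (h1 : 16 ≤ v.val) (h2 : v.val < 16 + j.val) :
    bs K v 0 ∈ S := by
  have key : ∀ x : Op K, bs K 0 1 + x ∈ S → x ∈ S := fun x hx => by
    have := add_mem h hx
    rwa [← add_assoc, op_add_self, zero_add] at this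
  obtain ⟨v, hv⟩ := v
  obtain ⟨j, hj'⟩ := j
  simp only at h1 h2
  interval_cases j
  · omega
  · obtain rfl : v = 16 := by omega
    exact key _ (tor1_eq (K := K) ▸ hj rfl)
  · interval_cases v
    · exact key _ (tor1_eq (K := K) ▸ hj (Or.inl rfl))
    · exact key _ (tor2_eq (K := K) ▸ hj (Or.inr rfl))

/-- The elements that the Chevalley generators generate. -/
def genCert : List ((Fin 18 × ℕ) × (Fin 18 × ℕ) × (Fin 18 × ℕ)) :=
  [((9, 0), (10, 0), (15, 0)), ((9, 0), (8, 0), (7, 0)), ((10, 0), (1, 1), (2, 1)),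
   ((11, 0), (8, 0), (6, 0)), ((11, 0), (7, 0), (4, 0)), ((12, 0), (1, 1), (3, 1)),
   ((12, 0), (2, 1), (5, 1)), ((13, 0), (8, 0), (5, 0)), ((13, 0), (7, 0), (3, 0)),
   ((13, 0), (6, 0), (2, 0)), ((13, 0), (4, 0), (1, 0)), ((14, 0), (1, 1), (4, 1)),
   ((14, 0), (2, 1), (6, 1)), ((14, 0), (3, 1), (7, 1)), ((14, 0), (5, 1), (8, 1)),
   ((8, 0), (1, 1), (0, 1)), ((8, 0), (1, 0), (0, 0)), ((1, 1), (8, 1), (15, 1))]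

theorem genCert_spec : ∀ (v : Fin 18) (s : Fin 2), v.val < 16 → (isE v → s = 0) →
    (v, s.val) ∈ ([(9, 0), (10, 0), (11, 0), (12, 0), (13, 0), (14, 0), (8, 0), (1, 1)] :
      List (Fin 18 × ℕ)) ∨ ∃ p ∈ genCert, p.2.2 = (v, s.val) := by decide +kernel

theorem LQ_Qi_one_le [CharP K 2] {S : Submodule K (Op K)} (hS : ∀ a ∈ S, ∀ b ∈ S, ⁅a, b⁆ ∈ S)
    (h : ∀ i, chevPlus K i ∈ S ∧ chevMinus K i ∈ S) : LQ K (Qi 1) ≤ S := by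
  have hg : ∀ p ∈ ([(9, 0), (10, 0), (11, 0), (12, 0), (13, 0), (14, 0), (8, 0), (1, 1)] :
      List (Fin 18 × ℕ)), bs K p.1 p.2 ∈ S := by
    intro p hp
    simp only [List.mem_cons, List.not_mem_nil, or_false] at hp
    rcases hp with rfl | rfl | rfl | rfl | rfl | rfl | rfl | rfl
    · exact chevMinus_zero (K := K) ▸ (h 0).2
    · exact chevPlus_zero (K := K) ▸ (h 0).1
    · exact chevMinus_two (K := K) ▸ (h 2).2
    · exact chevPlus_two (K := K) ▸ (h 2).1
    · exact chevMinus_three (K := K) ▸ (h 3).2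
    · exact chevPlus_three (K := K) ▸ (h 3).1
    · exact chevMinus_one (K := K) ▸ (h 1).2
    · exact chevPlus_one (K := K) ▸ (h 1).1
  have hc := genOK_mem hS genCert hg (by decide +kernel) (by decide +kernel) (by decide +kernel)
  refine LQ_le fun v s hs => ?_
  have hs2 := adm_one_iff.1 hs.1.2
  rcases genCert_spec v ⟨s, hs2⟩ hs.1.1 (fun he => by
    have := adm_one_iff.1 (hs.2 he)
    exact Fin.ext (by simp only [Fin.val_zero]; omega)) with h1 | ⟨p, hp, he⟩
  · exact hg (v, s) h1
  · have := hc p hp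
    rw [he] at this
    exact this

/-- One inclusion is closure under brackets; for the other, `genCert` reaches every remaining basis
field from the generators. -/
theorem branchAlg_eq [CharP K 2] (j : Fin 3) : (branchAlg K j).toSubmodule = LQ K (Qc j 1) := by
  apply le_antisymm
  · have : branchAlg K j ≤ algOf (LQ K (Qc j 1)) fun a ha b hb => LQ_Qi_le j (lie_mem_Qi ha hb) := by
      refine LieSubalgebra.lieSpan_le.2 ?_
      rintro x ((⟨i, rfl⟩ | ⟨i, rfl⟩) | hx)
      · exact LQ_Qi_le j (chev_mem_LQ 1 one_ne_zero i).1
      · exact LQ_Qi_le j (chev_mem_LQ 1 one_ne_zero i).2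
      · exact extraTorus_subset j one_ne_zero hx
    exact this
  · have hsub := LieSubalgebra.subset_lieSpan (R := K) (L := Op K)
      (s := Set.range (chevPlus K) ∪ Set.range (chevMinus K) ∪ extraTorus K j)
    have h1 : LQ K (Qi 1) ≤ (branchAlg K j).toSubmodule :=
      LQ_Qi_one_le (fun a ha b hb => lie_mem_of_lieSubalgebra _ ha hb) fun i =>
        ⟨hsub (Or.inl (Or.inl ⟨i, rfl⟩)), hsub (Or.inl (Or.inr ⟨i, rfl⟩))⟩
    refine LQ_le ?_
    rintro v s (hs | ⟨h2, h3, rfl⟩)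
    · exact h1 (bs_mem hs)
    · exact bs_torus_mem (h1 (bs_zero_one_mem one_ne_zero)) (fun x hx => hsub (Or.inr hx)) h2 h3

theorem dg_bounds : ∀ v, (v = 0 ∧ dg v = -2) ∨ (1 ≤ v.val ∧ v.val ≤ 8 ∧ dg v = -1) ∨
    (9 ≤ v.val ∧ dg v = 0) := by decide

/-- In degrees up to one the exponent is at most 1, and 0 in the root families, so the bound `2 ^ n`
has no effect. The non-positive part and `𝔤₁` are therefore those of the full prolong for every `n`.
-/
theorem Qc_grade_iff {j : Fin 3} {n : ℕ∞} (hn : n ≠ 0) {k : ℤ} (hk : k ≤ 1) (v : Fin 18) (s : ℕ) :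
    Qg (Qc j 1) k v s ↔ Qg (Qf j n) k v s := by
  refine and_congr_left fun hg => ?_
  have hs : s ≤ 1 ∧ (isE v → s = 0) := by
    rcases dg_bounds v with h | h | h
    · exact ⟨by omega, fun he => absurd he.1 (by rw [h.1]; decide)⟩
    · exact ⟨by omega, fun he => absurd he.1 (by omega)⟩
    · exact ⟨by omega, fun he => by omega⟩
  have a1 : adm n s := (adm_one hn).mono hs.1
  have a2 : adm 1 s := (adm_one one_ne_zero).mono hs.1
  refine or_congr ⟨fun h => ⟨h.1.1, a1⟩, fun h => ⟨⟨h.1, a2⟩, fun he => ?_⟩⟩ Iff.rfl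
  rw [hs.2 he]
  exact adm_one one_ne_zero

theorem shear_ne_zero {n : ℕ∞} (hn : n ≠ 0) (i : Fin 9) : shear n i ≠ 0 := by
  unfold shear; split_ifs
  · exact hn
  · exact one_ne_zero

theorem Qc.adm {j : Fin 3} {n : ℕ∞} {v : Fin 18} {s : ℕ} (h : Qc j n v s) : adm n s := h.qf.adm

theorem branchComp_eq [CharP K 2] (j : Fin 3) (k : ℤ) :
    branchComp K j k = LQ K (Qg (Qc j 1) k) := by
  have hN := shear_ne_zero (n := 1) one_ne_zero
  rw [branchComp, branchAlg_eq]
  refine le_antisymm (fun D hD => mem_LQ_Qg hN hD.1 hD.2) (le_inf (LQ_mono fun _ _ h => h.1) ?_)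
  exact LQ_le_vectDeg hN fun _ _ h => h.adm

theorem LQ_congr {Q Q' : Fin 18 → ℕ → Prop} (h : ∀ v s, Q v s ↔ Q' v s) : LQ K Q = LQ K Q' :=
  le_antisymm (LQ_mono fun v s => (h v s).1) (LQ_mono fun v s => (h v s).2)

theorem branchComp_eq_full [CharP K 2] (j : Fin 3) {n : ℕ∞} (hn : n ≠ 0) {k : ℤ} (hk : k ≤ 1) :
    branchComp K j k = LQ K (Qg (Qf j n) k) := by
  rw [branchComp_eq]
  exact LQ_congr (Qc_grade_iff hn hk)

/-- One bracket of `F_b(1)` with `F_c(x_1)` yields the required field up to `F_0(x_1)`, which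
`tildeZero_spec'` obtains separately. -/
theorem tildeZero_spec : ∀ v : Fin 18, 9 ≤ v.val → v.val < 16 → ∃ b c : Fin 8,
    ∀ p ∈ normL ((v, 0) :: brB (oddIx b, 0) (oddIx c, 1)), p = (0, 1) := by
  decide +kernel

theorem tildeZero_spec' : ∀ p ∈ normL (((0 : Fin 18), 1) :: brB (oddIx 0, 0) (oddIx 7, 1)), False := by
  decide +kernel

theorem mem_of_normL [CharP K 2] {S : Submodule K (Op K)} {x y v : Fin 18} {s t r : ℕ}
    (hx : x.val < 16) (hy : y.val < 16) (h : ⁅bs K x s, bs K y t⁆ ∈ S)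
    (hn : ∀ p ∈ normL ((v, r) :: brB (x, s) (y, t)), bs K p.1 p.2 ∈ S) : bs K v r ∈ S := by
  have h1 := bsl_mem hn
  rw [bsl_normL, bsl_cons, ← lie_bs (x := (x, s)) (y := (y, t)) (fun h => absurd h (not_le.2 hx))
    (fun h => absurd h (not_le.2 hy))] at h1
  have h2 := add_mem h1 h
  rwa [add_assoc, op_add_self, add_zero] at h2

theorem dg_oddIx (b : Fin 8) : dg (oddIx b) = -1 := by revert b; decide

theorem oddIx_lt (b : Fin 8) : (oddIx b).val < 16 := by revert b; decide

theorem tildeZero_eq [CharP K 2] (j : Fin 3) {n : ℕ∞} (hn : n ≠ 0) :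
    tildeZero K j = LQ K (Qg (Qt n) 0) := by
  rw [tildeZero, branchComp_eq_full j hn (by norm_num), branchComp_eq_full j hn le_rfl]
  apply le_antisymm
  · refine Submodule.span_le.2 ?_
    rintro _ ⟨a, ha, b, hb, rfl⟩
    have h := lie_mem_grade ha hb
    rw [show (-1 + 1 : ℤ) = 0 by norm_num] at h
    exact h
  · generalize hS : bracketSpan (A := Op K) K (LQ K (Qg (Qf j n) (-1))) (LQ K (Qg (Qf j n) 1)) = S
    have hb : ∀ b c : Fin 8, ⁅bs K (oddIx b) 0, bs K (oddIx c) 1⁆ ∈ S := fun b c => by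
      rw [← hS]
      refine Submodule.subset_span ⟨_, bs_mem ⟨Or.inl ⟨oddIx_lt b, adm_zero n⟩, ?_⟩, _,
        bs_mem ⟨Or.inl ⟨oddIx_lt c, adm_one hn⟩, ?_⟩, rfl⟩
      · rw [dg_oddIx]; rfl
      · rw [dg_oddIx]; rfl
    have h01 : bs K 0 1 ∈ S := mem_of_normL (oddIx_lt 0)
      (oddIx_lt 7) (hb 0 7) fun p hp => (tildeZero_spec' p hp).elim
    refine LQ_le fun v s hs => ?_
    rcases dg_bounds v with h | h | h
    · have h2 := hs.2
      obtain rfl : s = 1 := by omega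
      rw [h.1]; exact h01
    · have h2 := hs.2
      omega
    · have h2 := hs.2
      obtain rfl : s = 0 := by omega
      obtain ⟨b, c, hbc⟩ := tildeZero_spec v h.1 hs.1.1
      refine mem_of_normL (oddIx_lt b) (oddIx_lt c) (hb b c) fun p hp => ?_
      obtain rfl := hbc p hp
      exact h01

end BranchAlgebra

/-! ### Coordinates -/

section Coordinates

variable {K : Type*} [Field K]

/-- The coordinate of a field with respect to a basis field. -/
noncomputable def crd (v : Fin 18) (s : ℕ) : Op K →ₗ[K] K := (dualCoef v s).comp (genFun K)

theorem crd_kap_Fsum [CharP K 2] {Q : Fin 18 → ℕ → Prop} {u : Fin 18 → DPA K}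
    (hu : ∀ v, u v ∈ evn K (Q v)) (v : Fin 18) (s : ℕ) :
    crd v s (kap K (Fsum K u)) = coef (bits 0 s) (u v) := dualCoef_genFun hu v s

theorem crd_bs [CharP K 2] (v w : Fin 18) (s t : ℕ) :
    crd v s (bs K w t) = if v = w ∧ t = s then 1 else 0 := by
  change dualCoef v s (genFun K (kap K (Fv K w (tp K t)))) = _
  rw [genFun_kap, dualCoef_Fv v w s (tp_mem_evn (P := fun _ => True) trivial), coef_tp, ite_and]

theorem crd_bsl [CharP K 2] (v : Fin 18) (s : ℕ) (l : List (Fin 18 × ℕ)) :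
    crd v s (bsl K l) = (l.count (v, s) : K) := by
  induction l with
  | nil => simp [bsl]
  | cons p l ih =>
    rw [bsl_cons, map_add, ih, crd_bs, List.count_cons, add_comm]
    push_cast
    congr 1
    obtain ⟨w, t⟩ := p
    by_cases h : v = w ∧ t = s
    · rw [if_pos h, if_pos (by simp [h.1, h.2])]
    · rw [if_neg h, if_neg]
      simp only [beq_iff_eq, Prod.mk.injEq]
      exact fun h' => h ⟨h'.1.symm, h'.2⟩

theorem bs_ne_zero [CharP K 2] (v : Fin 18) (s : ℕ) : bs K v s ≠ 0 := fun h => by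
  have := crd_bs (K := K) v v s s
  rw [h, map_zero, if_pos ⟨rfl, rfl⟩] at this
  exact one_ne_zero this.symm

theorem eq_sum_crd [CharP K 2] {Q : Fin 18 → ℕ → Prop} {D : Op K} (hD : D ∈ LQ K Q)
    (h : ∀ v s, Q v s → s = 0) : D = ∑ v, crd v 0 D • bs K v 0 := by
  obtain ⟨u, hu, rfl⟩ := mem_LQ.1 hD
  simp only [crd_kap_Fsum hu]
  rw [Fsum_apply, map_sum]
  refine Finset.sum_congr rfl fun v _ => ?_
  rw [bs, tp_zero, ← map_smul, ← map_smul, ← eq_smul_one (hu v) (h v)]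

theorem mem_LQ_of_crd [CharP K 2] {P Q : Fin 18 → ℕ → Prop} {D : Op K} (hD : D ∈ LQ K P)
    (h : ∀ v s, P v s → crd v s D ≠ 0 → Q v s) : D ∈ LQ K Q := mem_LQ_of_coef hD h

theorem crd_eq_zero [CharP K 2] {Q : Fin 18 → ℕ → Prop} {D : Op K} (hD : D ∈ LQ K Q)
    {v : Fin 18} {s : ℕ} (h : ¬ Q v s) : crd v s D = 0 := by
  obtain ⟨u, hu, rfl⟩ := mem_LQ.1 hD
  rw [crd_kap_Fsum hu]
  by_contra hne
  obtain ⟨t, ht, he⟩ := mem_evn_iff.1 (hu v) _ hne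
  exact h (bits_zero_injective he ▸ ht)

theorem eq_zero_of_crd [CharP K 2] {Q : Fin 18 → ℕ → Prop} {D : Op K} (hD : D ∈ LQ K Q)
    (h : ∀ v s, Q v s → crd v s D = 0) : D = 0 := by
  have h1 := mem_LQ_of_crd (Q := fun _ _ => False) hD fun v s hv hne => hne (h v s hv)
  have h2 : LQ K (fun _ _ => False) ≤ ⊥ := LQ_le fun _ _ => False.elim
  exact (Submodule.mem_bot K).1 (h2 h1)

theorem lie_one_bs [CharP K 2] (v : Fin 18) (s : ℕ) :
    ⁅kap K 1, bs K v s⁆ = if s = 0 then 0 else bs K v (s - 1) := by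
  rw [bs, lie_kap_one, pdD_zero_Fv, pdD_zero_tp]
  split_ifs
  · rw [map_zero, map_zero]
  · rfl

theorem crd_lie_one [CharP K 2] {Q : Fin 18 → ℕ → Prop} {D : Op K} (hD : D ∈ LQ K Q)
    (v : Fin 18) (s : ℕ) : crd v s ⁅kap K 1, D⁆ = crd v (s + 1) D := by
  obtain ⟨u, hu, rfl⟩ := mem_LQ.1 hD
  rw [lie_kap_one, pdD_zero_Fsum, crd_kap_Fsum (Q := fun _ _ => True) fun v =>
    pd_mem_evn (fun _ _ => trivial) (hu v), crd_kap_Fsum hu, coef_pd s (hu v)]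

theorem lie_one_mem [CharP K 2] {Q : Fin 18 → ℕ → Prop} {D : Op K} (hD : D ∈ LQ K Q) :
    ⁅kap K 1, D⁆ ∈ LQ K fun v s => Q v (s + 1) := by
  obtain ⟨u, hu, rfl⟩ := mem_LQ.1 hD
  rw [lie_kap_one, pdD_zero_Fsum]
  exact mem_LQ.2 ⟨_, fun v => pd_mem_evn (fun _ h => h) (hu v), rfl⟩

/-- Bracketing with `∂_1` shifts the coordinate at `s + 1` to `s`, so only the coordinates at 0 can
survive. -/
theorem mem_of_lie_one_eq_zero [CharP K 2] {Q : Fin 18 → ℕ → Prop} {D : Op K} (hD : D ∈ LQ K Q)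
    (h : ⁅kap K 1, D⁆ = 0) : D ∈ LQ K fun v s => Q v s ∧ s = 0 := by
  refine mem_LQ_of_crd hD fun v s hv hne => ⟨hv, ?_⟩
  by_contra hs
  obtain ⟨t, rfl⟩ := Nat.exists_eq_succ_of_ne_zero hs
  refine hne ?_
  rw [Nat.succ_eq_add_one, ← crd_lie_one hD, h, map_zero]

theorem exists_integral [CharP K 2] {P Q : Fin 18 → ℕ → Prop} (h : ∀ v s, P v s → Q v (s + 1))
    {E : Op K} (hE : E ∈ LQ K P) : ∃ D ∈ LQ K Q, ⁅kap K 1, D⁆ = E := by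
  obtain ⟨u, hu, rfl⟩ := mem_LQ.1 hE
  choose g hg hgu using fun v => exists_pd_eq (h v) (hu v)
  refine ⟨_, mem_LQ.2 ⟨g, hg, rfl⟩, ?_⟩
  rw [lie_kap_one, pdD_zero_Fsum]
  simp only [hgu]

theorem coef_bits_pdD (m s : ℕ) (g : DPA K) :
    coef (bits m s) (pdD K 0 g) = coef (bits m (s + 1)) g := by
  have : (coef (bits m s)).comp (pdL 0) = coef (K := K) (bits m (s + 1)) := by
    refine DPA.hom_ext fun r => ?_
    rw [LinearMap.comp_apply, pdL_mono, coef_mono]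
    split_ifs with h h' h'
    · rw [h'] at h; exact absurd h (Nat.succ_ne_zero s)
    · rw [map_zero]
    · rw [coef_mono, if_pos]
      rw [h']
      funext j
      refine Fin.cases ?_ (fun i => ?_) j
      · rw [Function.update_self]; rfl
      · rw [Function.update_of_ne (Fin.succ_ne_zero i)]; rfl
    · rw [coef_mono, if_neg]
      intro he
      refine h' (funext fun j => ?_)
      have hj := congrFun he j
      revert hj
      refine Fin.cases (fun hj => ?_) (fun i hj => ?_) j
      · rw [Function.update_self] at hj
        have : bits m s 0 = s := rfl
        have : bits m (s + 1) 0 = s + 1 := rfl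
        omega
      · rw [Function.update_of_ne (Fin.succ_ne_zero i)] at hj
        exact hj
  exact LinearMap.congr_fun this g

/-- The coordinates of `⁅∂_1, D⁆` at `s` are coefficients of the generating function of `D` at
exponent `s + 1`, and that function lies in `𝒪(9; N)`. So integrals of `⁅∂_1, D⁆` respect the bound
on exponents. -/
theorem lie_kap_one_vect [CharP K 2] {N : Fin 9 → ℕ∞} (hN : ∀ i, N i ≠ 0) {k : ℤ} {D : Op K}
    (hD : D ∈ vectDeg K N k) {v : Fin 18} {s : ℕ} (h : crd v s ⁅kap K 1, D⁆ ≠ 0) :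
    adm (N 0) (s + 1) := by
  rw [vectDeg_eq] at hD
  have hg := genFun_mem_grFun hN isWeight_deg.map_rev hD
  obtain ⟨f, -, rfl⟩ := exists_fieldOf hD
  change dualCoef v s (genFun K _) ≠ 0 at h
  rw [kap_one, genFun_lie_pd, dualCoef_apply] at h
  obtain ⟨m, hm, hc⟩ : ∃ m ∈ dual v, coef (bits m s) (pdD K 0 (genFun K (toOp (fieldOf f)))) ≠ 0 := by
    by_contra! hall
    exact h <| List.sum_eq_zero fun x hx => by
      obtain ⟨m, hm, rfl⟩ := List.mem_map.1 hx
      exact hall m hm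
  rw [coef_bits_pdD] at hc
  exact fun n hn => (mem_monoSpan_iff.1 hg _ hc).1 0 n hn

end Coordinates

/-! ### The prolongs -/

section Prolong

variable {K : Type*} [Field K]

theorem mem_bracketInto {A B : Submodule K (Op K)} {D : Op K} :
    D ∈ bracketInto K A B ↔ ∀ X ∈ A, ⁅X, D⁆ ∈ B := by
  rw [bracketInto, Submodule.mem_iInf, Subtype.forall]
  rfl

/-- The coefficient of `F_d(1)` in the bracket of `F_a(1)` with `F_e(1)`. -/
def cst (a d : Fin 8) (e : Fin 18) : ℕ := (brB (oddIx a, 0) (e, 0)).count (oddIx d, 0) % 2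

/-- With `X_a` the field `F(1)` of index `oddIx a`: no constant field of degree zero moves `X_a`
towards `X_d`, and only `e` moves `X_b` there. The Jacobi relation for this triple isolates one
unknown. -/
theorem cst_spec_e : ∀ (a : Fin 8) (e : Fin 18), isE e → ∃ b d : Fin 8, ∀ f : Fin 18, 9 ≤ f.val →
    cst a d f = 0 ∧ cst b d f = if f = e then 1 else 0 := by decide +kernel

/-- On the torus spanned by the last three families, the sum of the weights of `X_d` and `X_d'` is
the functional dual to `e`. -/
theorem cst_spec_t : ∀ (b : Fin 8) (e : Fin 18), 16 ≤ e.val → ∃ d d' : Fin 8, d ≠ b ∧ d' ≠ b ∧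
    ∀ f : Fin 18, 15 ≤ f.val → (cst d d f + cst d' d' f) % 2 = if f = e then 1 else 0 := by
  decide +kernel

theorem cst_self : ∀ b d : Fin 8, d ≠ b → (∀ f : Fin 18, 15 ≤ f.val → cst b d f = 0) ∧
    cst d d 15 = 1 := by decide +kernel

theorem cst_self' : ∀ b : Fin 8, ∃ d, d ≠ b := by decide +kernel

theorem crd_lie_odd [CharP K 2] (a d : Fin 8) (e : Fin 18) :
    crd (oddIx d) 0 ⁅bs K (oddIx a) 0, bs K e 0⁆ = (cst a d e : K) := by
  rw [lie_bs (x := (oddIx a, 0)) (y := (e, 0)) (fun _ => rfl) (fun _ => rfl), crd_bsl, cst]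
  exact CharTwo.natCast_eq_mod _

/-- The fields of degree zero that annihilate `∂_1` have trivial first prolong. -/
theorem first_prolong_eq_zero [CharP K 2] {w : Fin 8 → Fin 18 → K}
    (h : ∀ a b d : Fin 8, ∑ e ∈ Finset.univ.filter (fun e : Fin 18 => 9 ≤ e.val),
        (w b e * (cst a d e : K) + w a e * (cst b d e : K)) = 0)
    (a : Fin 8) {e : Fin 18} (he : 9 ≤ e.val) : w a e = 0 := by
  have hE : ∀ (a : Fin 8) (e : Fin 18), isE e → w a e = 0 := by
    intro a e he
    obtain ⟨b, d, hbd⟩ := cst_spec_e a e he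
    have h1 := h a b d
    rw [Finset.sum_eq_single e] at h1
    · rw [(hbd e he.1).1, (hbd e he.1).2, if_pos rfl] at h1
      simpa using h1
    · intro f hf hfe
      have := hbd f (Finset.mem_filter.1 hf).2
      rw [this.1, this.2, if_neg hfe]
      simp
    · intro hn
      exact absurd (Finset.mem_filter.2 ⟨Finset.mem_univ e, he.1⟩) hn
  -- The torus acts diagonally. In the relation with `a = d`, the terms for `X_b` drop out and only
  -- the weight of `X_d` remains.
  have hT : ∀ b d : Fin 8, d ≠ b → ∑ e ∈ Finset.univ.filter (fun e : Fin 18 => 15 ≤ e.val),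
      w b e * (cst d d e : K) = 0 := by
    intro b d hd
    have h1 := h d b d
    rw [← Finset.sum_subset (s₁ := Finset.univ.filter (fun e : Fin 18 => 15 ≤ e.val))] at h1
    · rw [← h1]
      refine Finset.sum_congr rfl fun e he => ?_
      rw [(cst_self b d hd).1 e (Finset.mem_filter.1 he).2]
      simp
    · intro e he
      rw [Finset.mem_filter] at he ⊢
      exact ⟨he.1, by omega⟩
    · intro e he he'
      rw [Finset.mem_filter] at he he'
      have : isE e := ⟨he.2, by
        by_contra hlt
        exact he' ⟨he.1, by omega⟩⟩
      rw [hE _ _ this, hE _ _ this]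
      simp
  have hT' : ∀ (b : Fin 8) (e : Fin 18), 16 ≤ e.val → w b e = 0 := by
    intro b e he
    obtain ⟨d, d', hd, hd', hs⟩ := cst_spec_t b e he
    have h1 : ∑ f ∈ Finset.univ.filter (fun e : Fin 18 => 15 ≤ e.val),
        w b f * ((cst d d f + cst d' d' f : ℕ) : K) = 0 := by
      simp only [Nat.cast_add, mul_add, Finset.sum_add_distrib]
      rw [hT b d hd, hT b d' hd', add_zero]
    rw [Finset.sum_eq_single e] at h1
    · rw [CharTwo.natCast_eq_mod, hs e (by omega), if_pos rfl] at h1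
      simpa using h1
    · intro f hf hfe
      rw [CharTwo.natCast_eq_mod, hs f (Finset.mem_filter.1 hf).2, if_neg hfe]
      simp
    · intro hn
      exact absurd (Finset.mem_filter.2 ⟨Finset.mem_univ e, by omega⟩) hn
  by_cases h9 : isE e
  · exact hE a e h9
  by_cases h16 : 16 ≤ e.val
  · exact hT' a e h16
  obtain rfl : e = 15 := Fin.ext (by
    have : ¬ (9 ≤ e.val ∧ e.val ≤ 14) := h9
    simp; omega)
  obtain ⟨d, hd⟩ := cst_self' a
  have h1 := hT a d hd
  rw [Finset.sum_eq_single 15] at h1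
  · rw [(cst_self a d hd).2] at h1
    simpa using h1
  · intro f hf hfe
    rw [hT' a f, zero_mul]
    have := (Finset.mem_filter.1 hf).2
    have h2 : f.val ≠ 15 := fun h => hfe (Fin.ext h)
    omega
  · intro hn
    exact absurd (Finset.mem_filter.2 ⟨Finset.mem_univ _, by decide⟩) hn

theorem crd_lie_of_mem [CharP K 2] {Q : Fin 18 → ℕ → Prop}
    (h : ∀ v s, Q v s → s = 0) {D : Op K} (hD : D ∈ LQ K Q) (a d : Fin 8) :
    crd (oddIx d) 0 ⁅bs K (oddIx a) 0, D⁆ = ∑ e, crd e 0 D * (cst a d e : K) := by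
  conv_lhs => rw [eq_sum_crd hD h, op_lie_sum]
  rw [map_sum]
  refine Finset.sum_congr rfl fun e _ => ?_
  rw [op_lie_smul, map_smul, crd_lie_odd, smul_eq_mul]

/-- An integral of `⁅∂_1, D⁆`, up to constants in the last two families. -/
theorem exists_sub_const [CharP K 2] {N : Fin 9 → ℕ∞} (hN : ∀ i, N i ≠ 0) {j : Fin 3} {k : ℤ}
    {D : Op K} (hD : D ∈ vectDeg K N k) (h1 : ⁅kap K 1, D⁆ ∈ LQ K (Qg (Qf j (N 0)) (k - 2))) :
    ∃ D₀ ∈ LQ K (Qg (Qf j (N 0)) k),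
      ⁅kap K 1, D + D₀⁆ ∈ LQ K fun v s => 16 ≤ v.val ∧ s = 0 ∧ k = 2 := by
  obtain ⟨u, hu, he⟩ := mem_LQ.1 h1
  -- The last two families hold constants only, so they contain no integrals; they are left aside
  -- and survive as the error term.
  let u₀ : Fin 18 → DPA K := fun v => if v.val < 16 then u v else 0
  have hu₀ : ∀ v, u₀ v ∈ evn K fun s => v.val < 16 ∧ adm (N 0) (s + 1) ∧ dg v + 2 * s = k - 2 := by
    intro v
    simp only [u₀]
    split_ifs with hv
    · refine mem_evn_of_coef (hu v) fun s hs => ⟨hv, ?_, ?_⟩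
      · refine lie_kap_one_vect hN hD (v := v) ?_
        rwa [← he, crd_kap_Fsum hu]
      · obtain ⟨t, ht, hts⟩ := mem_evn_iff.1 (hu v) _ hs
        exact bits_zero_injective hts ▸ ht.2
    · exact zero_mem _
  obtain ⟨D₀, hD₀, hDe⟩ := exists_integral (Q := Qg (Qf j (N 0)) k) (fun v s hs =>
    ⟨Or.inl ⟨hs.1, hs.2.1⟩, by have := hs.2.2; push_cast; omega⟩)
    (mem_LQ.2 ⟨u₀, hu₀, rfl⟩)
  refine ⟨D₀, hD₀, ?_⟩
  rw [op_lie_add, hDe, ← he, ← map_add, ← map_add]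
  refine mem_LQ.2 ⟨_, fun v => ?_, rfl⟩
  change u v + (if v.val < 16 then u v else 0) ∈ _
  split_ifs with hv
  · rw [CharTwo.add_self_eq_zero]; exact zero_mem _
  · rw [add_zero]
    refine evn_mono (fun s hs => ?_) (hu v)
    have h0 := constQ_Qf j (N 0) v s (not_lt.1 hv) hs.1
    refine ⟨not_lt.1 hv, h0, ?_⟩
    have h2 := hs.2
    have h3 := dg_bounds v
    rcases h3 with h3 | h3 | h3
    · rw [h3.1] at hv; exact absurd (by decide) hv
    · omega
    · omega

theorem lie_kap_xv [CharP K 2] (b : Fin 8) (D : Op K) (h : ⁅kap K 1, D⁆ = 0) :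
    ⁅kap K 1, ⁅kap K (xv K b.succ), D⁆⁆ = 0 := by
  rw [op_leibniz_lie, h, op_lie_zero, add_zero, ← bs_oddIx, lie_one_bs, if_pos rfl, op_zero_lie]

theorem lie_odd_odd [CharP K 2] (a b : Fin 8) : ∃ c : K,
    ⁅bs K (oddIx a) 0, bs K (oddIx b) 0⁆ = c • kap K 1 := by
  have h : ∀ a b : Fin 8, ∀ p ∈ brB (oddIx a, 0) (oddIx b, 0), p = (0, 0) := by decide +kernel
  rw [lie_bs (x := (oddIx a, 0)) (y := (oddIx b, 0)) (fun _ => rfl) (fun _ => rfl)]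
  suffices hm : bsl K (brB (oddIx a, 0) (oddIx b, 0)) ∈ Submodule.span K {kap K 1} by
    obtain ⟨c, hc⟩ := Submodule.mem_span_singleton.1 hm
    exact ⟨c, hc.symm⟩
  refine bsl_mem fun p hp => ?_
  rw [h a b p hp]
  exact Submodule.mem_span_singleton.2 ⟨1, by rw [one_smul, bs_zero_zero]⟩

/-- The brackets `⁅X_b, D⁆` are constant fields of degree zero. As `⁅X_a, X_b⁆` is a multiple of
`∂_1`, which commutes with `D`, the Jacobi identity turns them into the data of a first prolong. -/
theorem eq_zero_of_degree_one [CharP K 2] {N : Fin 9 → ℕ∞} {j : Fin 3} {D : Op K}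
    (hD : D ∈ vectDeg K N 1) (h : ⁅kap K 1, D⁆ = 0)
    (hb : ∀ b : Fin 8, ⁅kap K (xv K b.succ), D⁆ ∈ LQ K (Qg (Qf j (N 0)) 0)) : D = 0 := by
  have h0 := fun b => mem_of_lie_one_eq_zero (hb b) (lie_kap_xv b D h)
  have hQ : ∀ v s, (Qg (Qf j (N 0)) 0 v s ∧ s = 0) → s = 0 := fun _ _ h => h.2
  have hlow : ∀ (b : Fin 8) (v : Fin 18), ¬ 9 ≤ v.val → crd v 0 ⁅kap K (xv K b.succ), D⁆ = 0 := by
    intro b v hv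
    refine crd_eq_zero (h0 b) fun h => ?_
    have h2 := h.1.2
    rcases dg_bounds v with h3 | h3 | h3
    · omega
    · omega
    · exact hv h3.1
  have hw : ∀ a b d : Fin 8, ∑ e ∈ Finset.univ.filter (fun e : Fin 18 => 9 ≤ e.val),
      (crd e 0 ⁅kap K (xv K b.succ), D⁆ * (cst a d e : K) +
        crd e 0 ⁅kap K (xv K a.succ), D⁆ * (cst b d e : K)) = 0 := by
    intro a b d
    rw [Finset.sum_filter_of_ne, Finset.sum_add_distrib, ← crd_lie_of_mem hQ (h0 b),
      ← crd_lie_of_mem hQ (h0 a), ← map_add, bs_oddIx, bs_oddIx, op_leibniz_lie, add_assoc,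
      op_add_self, add_zero, ← bs_oddIx, ← bs_oddIx]
    · obtain ⟨c, hc⟩ := lie_odd_odd (K := K) a b
      rw [hc, op_smul_lie, h, smul_zero, map_zero]
    · intro e _ hne
      by_contra hlt
      refine hne ?_
      rw [hlow b e hlt, hlow a e hlt, zero_mul, zero_mul, add_zero]
  refine eq_zero_of_lie_eq_zero zero_le_one hD fun b => ?_
  refine eq_zero_of_crd (h0 b) fun v s hs => ?_
  rw [hs.2]
  by_cases hv : 9 ≤ v.val
  · exact first_prolong_eq_zero hw b hv
  · exact hlow b v hv

theorem sum_sixteen (f : Fin 18 → K) (h : ∀ v : Fin 18, ¬ 16 ≤ v.val → f v = 0) (g : Fin 18 → Op K) :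
    ∑ v, f v • g v = f 16 • g 16 + f 17 • g 17 := by
  rw [← Finset.sum_subset (s₁ := ({16, 17} : Finset (Fin 18))) (Finset.subset_univ _),
    Finset.sum_pair (by decide)]
  intro v _ hv
  rw [h v, zero_smul]
  intro h16
  refine hv ?_
  have : v = 16 ∨ v = 17 := by revert h16; revert v; decide
  simpa using this

/-- If `⁅∂_1, D⁆` were a nonzero combination of the last two torus elements, then `⁅X_b, D⁆` would
be `F_b(x_1)` times the weight of `X_b`. The Jacobi identity for suitable commuting `X_b`, `X_b'`
forces equal weights, which determines both coefficients to be zero. -/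
theorem torus_eq_zero [CharP K 2] {N : Fin 9 → ℕ∞} (hN : ∀ i, N i ≠ 0) {j : Fin 3} {D : Op K}
    (h : ⁅kap K 1, D⁆ ∈ LQ K fun v s => 16 ≤ v.val ∧ s = 0)
    (hb : ∀ b : Fin 8, ⁅kap K (xv K b.succ), D⁆ ∈ LQ K (Qg (Qf j (N 0)) 1)) :
    ⁅kap K 1, D⁆ = 0 := by
  obtain ⟨E, hE⟩ : ∃ E, E = ⁅kap K 1, D⁆ := ⟨_, rfl⟩
  rw [← hE] at h ⊢
  have h1 := eq_sum_crd h fun _ _ h => h.2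
  rw [sum_sixteen _ fun v hv => crd_eq_zero h fun h => hv h.1] at h1
  generalize crd 16 0 E = c at h1
  generalize crd 17 0 E = d at h1
  -- Both sides have the same bracket with `∂_1`; their difference would be a constant field of
  -- degree one, and there is none.
  have hX : ∀ (b : Fin 8) (r : K), ⁅bs K (oddIx b) 0, E⁆ = r • bs K (oddIx b) 0 →
      ⁅bs K (oddIx b) 0, D⁆ = r • bs K (oddIx b) 1 := by
    intro b r hr
    have hmem : ⁅kap K (xv K b.succ), D⁆ + r • bs K (oddIx b) 1 ∈ LQ K (Qg (Qf j (N 0)) 1) := by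
      refine add_mem (hb b) (Submodule.smul_mem _ _ (bs_mem ⟨Or.inl ⟨oddIx_lt b, adm_one (hN 0)⟩, ?_⟩))
      rw [dg_oddIx]; rfl
    have hl : ⁅kap K 1, ⁅kap K (xv K b.succ), D⁆ + r • bs K (oddIx b) 1⁆ = 0 := by
      rw [op_lie_add, op_leibniz_lie, ← bs_oddIx, lie_one_bs, if_pos rfl, op_zero_lie, zero_add,
        ← hE, hr, op_lie_smul, lie_one_bs, if_neg one_ne_zero, op_add_self]
    have h2 := eq_zero_of_crd (mem_of_lie_one_eq_zero hmem hl) fun v s hs => by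
      have h2 := hs.1.2
      have h3 := hs.2
      rcases dg_bounds v with h3 | h3 | h3 <;> omega
    rw [bs_oddIx, ← add_zero ⁅kap K (xv K b.succ), D⁆, ← op_add_self (r • bs K (oddIx b) 1),
      ← add_assoc, h2, zero_add]
  have br : ∀ (b : Fin 8) (l l' : List (Fin 18 × ℕ)), brB (oddIx b, 0) (16, 0) = l →
      brB (oddIx b, 0) (17, 0) = l' → ⁅bs K (oddIx b) 0, E⁆ = c • bsl K l + d • bsl K l' := by
    intro b l l' hl hl'
    rw [h1, op_lie_add, op_lie_smul, op_lie_smul,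
      lie_bs (x := (oddIx b, 0)) (y := (16, 0)) (fun _ => rfl) (fun _ => rfl),
      lie_bs (x := (oddIx b, 0)) (y := (17, 0)) (fun _ => rfl) (fun _ => rfl), hl, hl']
  -- The weights of the fields with indices 0, 5 and 6 are `c + d`, `d` and `c`. Equality of the
  -- first with each of the others gives `c = 0` and `d = 0`.
  have h0 := hX 0 (c + d) ((br 0 [(oddIx 0, 0)] [(oddIx 0, 0)] (by decide +kernel)
    (by decide +kernel)).trans (by simp [bsl, add_smul]))
  have h5 := hX 5 d ((br 5 [] [(oddIx 5, 0)] (by decide +kernel)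
    (by decide +kernel)).trans (by simp [bsl]))
  have h6 := hX 6 c ((br 6 [(oddIx 6, 0)] [] (by decide +kernel)
    (by decide +kernel)).trans (by simp [bsl]))
  have key : ∀ (b b' : Fin 8) (e : Fin 18) (r r' : K), ⁅bs K (oddIx b) 0, D⁆ = r • bs K (oddIx b) 1 →
      ⁅bs K (oddIx b') 0, D⁆ = r' • bs K (oddIx b') 1 → brB (oddIx b, 0) (oddIx b', 0) = [] →
      brB (oddIx b, 0) (oddIx b', 1) = [(e, 0)] → brB (oddIx b', 0) (oddIx b, 1) = [(e, 0)] →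
      r + r' = 0 := by
    intro b b' e r r' hr hr' hbb h1 h2
    have hlt : ∀ b : Fin 8, 16 ≤ (oddIx b).val → ∀ n : ℕ, n = 0 := fun b h =>
      absurd h (not_le.2 (oddIx_lt b))
    have l1 := lie_bs (K := K) (x := (oddIx b, 0)) (y := (oddIx b', 0)) (fun h => hlt _ h _)
      (fun h => hlt _ h _)
    have l2 := lie_bs (K := K) (x := (oddIx b, 0)) (y := (oddIx b', 1)) (fun h => hlt _ h _)
      (fun h => hlt _ h _)
    have l3 := lie_bs (K := K) (x := (oddIx b', 0)) (y := (oddIx b, 1)) (fun h => hlt _ h _)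
      (fun h => hlt _ h _)
    rw [hbb] at l1; rw [h1] at l2; rw [h2] at l3
    have h3 := op_leibniz_lie (bs K (oddIx b) 0) (bs K (oddIx b') 0) D
    simp only at l1 l2 l3
    rw [l1, hr, hr', op_lie_smul, op_lie_smul, l2, l3] at h3
    have h4 := congrArg (crd e 0) h3
    simp only [bsl, List.map_nil, List.sum_nil, List.map_cons, List.sum_cons, add_zero, op_zero_lie,
      zero_add, map_smul, crd_bs, and_self, if_true, smul_eq_mul, mul_one] at h4
    rw [h4, CharTwo.add_self_eq_zero]
  have k1 := key 0 5 11 _ _ h0 h5 (by decide +kernel) (by decide +kernel) (by decide +kernel)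
  have k2 := key 0 6 9 _ _ h0 h6 (by decide +kernel) (by decide +kernel) (by decide +kernel)
  rw [add_assoc, CharTwo.add_self_eq_zero, add_zero] at k1
  rw [k1, zero_add, add_zero] at k2
  rw [h1, k1, k2, zero_smul, zero_smul, add_zero]

/-- The inductive step of the prolongation: after subtraction of an integral of `⁅∂_1, D⁆`, the
remainder commutes with `∂_1` and is shown to be zero. -/
theorem mem_of_lie_mem [CharP K 2] {N : Fin 9 → ℕ∞} (hN : ∀ i, N i ≠ 0) {j : Fin 3} {k : ℤ}
    (hk : 1 ≤ k) {D : Op K} (hD : D ∈ vectDeg K N k)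
    (h1 : ⁅kap K 1, D⁆ ∈ LQ K (Qg (Qf j (N 0)) (k - 2)))
    (hb : ∀ b : Fin 8, ⁅kap K (xv K b.succ), D⁆ ∈ LQ K (Qg (Qf j (N 0)) (k - 1))) :
    D ∈ LQ K (Qg (Qf j (N 0)) k) := by
  obtain ⟨D₀, hD₀, he⟩ := exists_sub_const hN hD h1
  have hDD : D + D₀ ∈ vectDeg K N k :=
    add_mem hD (LQ_le_vectDeg hN (fun _ _ h => Qf.adm h) hD₀)
  have hbb : ∀ b : Fin 8, ⁅kap K (xv K b.succ), D + D₀⁆ ∈ LQ K (Qg (Qf j (N 0)) (k - 1)) := by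
    intro b
    rw [op_lie_add]
    refine add_mem (hb b) ?_
    have h2 := lie_mem_grade (j := j) (n := N 0) (k := -1) (bs_mem (v := oddIx b) (s := 0)
      ⟨Or.inl ⟨oddIx_lt b, adm_zero _⟩, by rw [dg_oddIx]; rfl⟩) hD₀
    rw [bs_oddIx, neg_add_eq_sub] at h2
    exact LQ_mono (fun v s h => ⟨Or.inl h.1, h.2⟩) h2
  have h0 : ⁅kap K 1, D + D₀⁆ = 0 := by
    by_cases hk2 : k = 2
    · subst hk2
      exact torus_eq_zero hN (LQ_mono (fun v s h => ⟨h.1, h.2.1⟩) he) hbb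
    · exact eq_zero_of_crd he fun v s h => absurd h.2.2 hk2
  suffices hz : D + D₀ = 0 by
    have : D = D₀ := by rw [← add_zero D, ← op_add_self D₀, ← add_assoc, hz, zero_add]
    rwa [this]
  rcases hk.eq_or_lt with rfl | hk1
  · exact eq_zero_of_degree_one hDD h0 hbb
  -- For `k ≥ 2` each bracket with a field of degree -1 would be a constant field of positive
  -- degree, which does not exist.
  · refine eq_zero_of_lie_eq_zero (by omega) hDD fun b => ?_
    refine eq_zero_of_crd (mem_of_lie_one_eq_zero (hbb b) (lie_kap_xv b _ h0)) fun v s hs => ?_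
    have h2 := hs.1.2
    have h3 := hs.2
    rcases dg_bounds v with h3 | h3 | h3 <;> omega

theorem ctsComp_mem [CharP K 2] {N : Fin 9 → ℕ∞} (hN : ∀ i, N i ≠ 0) {j : Fin 3} {k : ℤ}
    (hk : 1 ≤ k) {D : Op K} : D ∈ LQ K (Qg (Qf j (N 0)) k) ↔ D ∈ vectDeg K N k ⊓
      bracketInto K (LQ K (Qg (Qf j (N 0)) (-1))) (LQ K (Qg (Qf j (N 0)) (k - 1))) ⊓
      bracketInto K (LQ K (Qg (Qf j (N 0)) (-2))) (LQ K (Qg (Qf j (N 0)) (k - 2))) := by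
  simp only [Submodule.mem_inf, mem_bracketInto]
  constructor
  · intro hD
    refine ⟨⟨LQ_le_vectDeg hN (fun _ _ h => Qf.adm h) hD, fun X hX => ?_⟩, fun X hX => ?_⟩
    · have h2 := lie_mem_grade hX hD
      rw [neg_add_eq_sub] at h2
      exact LQ_mono (fun v s h => ⟨Or.inl h.1, h.2⟩) h2
    · have h2 := lie_mem_grade hX hD
      rw [neg_add_eq_sub] at h2
      exact LQ_mono (fun v s h => ⟨Or.inl h.1, h.2⟩) h2
  · rintro ⟨⟨hD, h1⟩, h2⟩
    refine mem_of_lie_mem hN hk hD (h2 _ ?_) fun b => h1 _ ?_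
    · rw [← bs_zero_zero]
      exact bs_mem ⟨Or.inl ⟨by decide, adm_zero _⟩, by decide⟩
    · rw [← bs_oddIx]
      exact bs_mem ⟨Or.inl ⟨oddIx_lt b, adm_zero _⟩, by rw [dg_oddIx]; rfl⟩

theorem ctsComp_eq [CharP K 2] {N : Fin 9 → ℕ∞} (hN : ∀ i, N i ≠ 0) (j : Fin 3) (k : ℕ) :
    ctsComp K N (LQ K (Qg (Qf j (N 0)) (-2))) (LQ K (Qg (Qf j (N 0)) (-1)))
      (LQ K (Qg (Qf j (N 0)) 0)) k = LQ K (Qg (Qf j (N 0)) k) := by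
  induction k using Nat.strong_induction_on with
  | _ k ih =>
    match k with
    | 0 => rfl
    | 1 =>
      ext D
      exact (ctsComp_mem (k := 1) hN le_rfl).symm
    | k + 2 =>
      ext D
      rw [ctsComp, ih (k + 1) (by omega), ih k (by omega)]
      have h := ctsComp_mem (K := K) (k := k + 2) hN (j := j) (D := D) (by omega)
      rw [show (k : ℤ) + 2 - 1 = k + 1 by ring, show (k : ℤ) + 2 - 2 = k by ring] at h
      push_cast
      exact h.symm

theorem ctsSum_eq [CharP K 2] {N : Fin 9 → ℕ∞} (hN : ∀ i, N i ≠ 0) (j : Fin 3) :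
    ctsSum K N (LQ K (Qg (Qf j (N 0)) (-2))) (LQ K (Qg (Qf j (N 0)) (-1)))
      (LQ K (Qg (Qf j (N 0)) 0)) = LQ K (Qf j (N 0)) := by
  rw [ctsSum]
  simp only [ctsComp_eq hN]
  apply le_antisymm
  · refine sup_le (sup_le ?_ ?_) (iSup_le fun k => ?_) <;> exact LQ_mono fun _ _ h => h.1
  · refine LQ_le fun v s hs => ?_
    by_cases h2 : dg v + 2 * s = -2
    · exact Submodule.mem_sup_left (Submodule.mem_sup_left (bs_mem ⟨hs, h2⟩))
    by_cases h1 : dg v + 2 * s = -1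
    · exact Submodule.mem_sup_left (Submodule.mem_sup_right (bs_mem ⟨hs, h1⟩))
    refine Submodule.mem_sup_right (Submodule.mem_iSup_of_mem (dg v + 2 * s).toNat (bs_mem ⟨hs, ?_⟩))
    rcases dg_bounds v with h3 | h3 | h3 <;> omega

theorem ctsProlong_eq [CharP K 2] {N : Fin 9 → ℕ∞} (hN : ∀ i, N i ≠ 0) (j : Fin 3) :
    (ctsProlong K N (LQ K (Qg (Qf j (N 0)) (-2))) (LQ K (Qg (Qf j (N 0)) (-1)))
      (LQ K (Qg (Qf j (N 0)) 0))).toSubmodule = LQ K (Qf j (N 0)) := by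
  rw [ctsProlong, ctsSum_eq hN]
  apply le_antisymm
  · have : LieSubalgebra.lieSpan K (Op K) (LQ K (Qf j (N 0)) : Set (Op K)) ≤
        algOf (LQ K (Qf j (N 0)))
          fun a ha b hb => LQ_mono (fun v s h => Or.inl h) (lie_mem_full ha hb) :=
      LieSubalgebra.lieSpan_le.2 fun x hx => hx
    exact this
  · exact LieSubalgebra.subset_lieSpan

theorem Qf_zero (n : ℕ∞) (v : Fin 18) (s : ℕ) : Qf 0 n v s ↔ Qt n v s :=
  or_iff_left fun h => absurd h.2.1 (by simp; omega)

theorem branchComp_eq_zero [CharP K 2] (j : Fin 3) {n : ℕ∞} (hn : n ≠ 0) {k : ℤ} (hk : k < 0) :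
    branchComp K j k = LQ K (Qg (Qf 0 n) k) := by
  rw [branchComp_eq_full j hn (by omega)]
  refine LQ_congr fun v s => and_congr_left fun h => ?_
  rw [Qf_zero]
  refine or_iff_left fun h2 => ?_
  rcases dg_bounds v with h3 | h3 | h3
  · rw [h3.1] at h2; exact absurd h2.1 (by decide)
  · omega
  · omega

theorem tildeZero_eq_zero [CharP K 2] {N : Fin 9 → ℕ∞} (hN : ∀ i, N i ≠ 0) (j : Fin 3) :
    tildeZero K j = LQ K (Qg (Qf 0 (N 0)) 0) := by
  rw [tildeZero_eq j (hN 0)]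
  exact LQ_congr fun v s => and_congr_left fun _ => (Qf_zero _ _ _).symm

theorem tildeProlong_eq_sum [CharP K 2] {N : Fin 9 → ℕ∞} (hN : ∀ i, N i ≠ 0) (j : Fin 3) :
    (tildeProlong K j N).toSubmodule =
    ctsSum K N (branchComp K j (-2)) (branchComp K j (-1)) (tildeZero K j) := by
  rw [tildeProlong, tildeZero_eq_zero hN, branchComp_eq_zero j (hN 0) (by norm_num),
    branchComp_eq_zero j (hN 0) (by norm_num), ctsProlong_eq hN, ctsSum_eq hN]

theorem tildeProlong_toSubmodule [CharP K 2] {N : Fin 9 → ℕ∞} (hN : ∀ i, N i ≠ 0) (j : Fin 3) :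
    (tildeProlong K j N).toSubmodule = LQ K (Qt (N 0)) := by
  rw [tildeProlong, tildeZero_eq_zero hN, branchComp_eq_zero j (hN 0) (by norm_num),
    branchComp_eq_zero j (hN 0) (by norm_num), ctsProlong_eq hN]
  exact LQ_congr (Qf_zero _)

theorem fullProlong_eq_sum [CharP K 2] {N : Fin 9 → ℕ∞} (hN : ∀ i, N i ≠ 0) (j : Fin 3) :
    (fullProlong K j N).toSubmodule =
    ctsSum K N (branchComp K j (-2)) (branchComp K j (-1)) (branchComp K j 0) := by
  rw [fullProlong, branchComp_eq_full j (hN 0) (by norm_num),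
    branchComp_eq_full j (hN 0) (by norm_num), branchComp_eq_full j (hN 0) (by norm_num),
    ctsProlong_eq hN, ctsSum_eq hN]

theorem fullProlong_toSubmodule [CharP K 2] {N : Fin 9 → ℕ∞} (hN : ∀ i, N i ≠ 0) (j : Fin 3) :
    (fullProlong K j N).toSubmodule = LQ K (Qf j (N 0)) := by
  rw [fullProlong, branchComp_eq_full j (hN 0) (by norm_num),
    branchComp_eq_full j (hN 0) (by norm_num), branchComp_eq_full j (hN 0) (by norm_num),
    ctsProlong_eq hN]

theorem fullComp_eq [CharP K 2] {N : Fin 9 → ℕ∞} (hN : ∀ i, N i ≠ 0) (j : Fin 3) (k : ℕ) :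
    fullComp K j N k = LQ K (Qg (Qf j (N 0)) k) := by
  rw [fullComp, branchComp_eq_full j (hN 0) (by norm_num),
    branchComp_eq_full j (hN 0) (by norm_num), branchComp_eq_full j (hN 0) (by norm_num),
    ctsComp_eq hN]

theorem shear_zero (n : ℕ∞) : shear n 0 = n := rfl

/-- The prolongs are the sums of their components and depend only on the first coordinate of the
shearing vector. -/
theorem prolongs_eq [CharP K 2] (j : Fin 3) {N : Fin 9 → ℕ∞} (hN : ∀ i, N i ≠ 0) :
    (tildeProlong K j N).toSubmodule =
        ctsSum K N (branchComp K j (-2)) (branchComp K j (-1)) (tildeZero K j) ∧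
      (fullProlong K j N).toSubmodule =
        ctsSum K N (branchComp K j (-2)) (branchComp K j (-1)) (branchComp K j 0) ∧
      tildeProlong K j N = tildeProlong K j (shear (N 0)) ∧
      fullProlong K j N = fullProlong K j (shear (N 0)) ∧
      tildeProlong K j N = fullProlong K 0 N := by
  have hs := shear_ne_zero (hN 0)
  refine ⟨tildeProlong_eq_sum hN j, fullProlong_eq_sum hN j, ?_, ?_, ?_⟩ <;>
    rw [← LieSubalgebra.toSubmodule_inj]
  · rw [tildeProlong_toSubmodule hN, tildeProlong_toSubmodule hs, shear_zero]
  · rw [fullProlong_toSubmodule hN, fullProlong_toSubmodule hs, shear_zero]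
  · rw [tildeProlong_toSubmodule hN, fullProlong_toSubmodule hN]
    exact LQ_congr fun v s => (Qf_zero _ _ _).symm

end Prolong

/-! ### The derived algebra and its simplicity -/

section Simple

variable {K : Type*} [Field K]

/-- Brackets with fields `F_v(1)`. -/
theorem lie_bs_zero [CharP K 2] (v w : Fin 18) (s : ℕ) (hw : w.val < 16) :
    ⁅bs K v 0, bs K w s⁆ = bsl K ((tab v w).flatMap fun t => match t.2 with
      | .U => [(t.1, s)]
      | .L => []
      | _ => if s = 0 then [] else [(t.1, s - 1)]) := by
  rw [lie_bs (x := (v, 0)) (y := (w, s)) (fun _ => rfl) (fun h => absurd h (not_le.2 hw)), brB]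
  congr 1
  refine List.flatMap_congr fun t _ => ?_
  obtain ⟨t, k⟩ := t
  cases k <;> simp [Kind.resL] <;> split_ifs <;> simp

/-- The parity conditions come from `x_1^(m) x_1 = (m + 1) x_1^(m + 1)`. -/
theorem lie_bs_one [CharP K 2] (v w : Fin 18) (s : ℕ) (hv : v.val < 16) (hw : w.val < 16) :
    ⁅bs K v s, bs K w 1⁆ = bsl K ((tab v w).flatMap fun t => match t.2 with
      | .U => if s % 2 = 0 then [(t.1, s + 1)] else []
      | .L => if s = 0 then [] else if s % 2 = 1 then [(t.1, s)] else []
      | .R => [(t.1, s)]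
      | .D => if s % 2 = 0 then [(t.1, s)] else []) := by
  rw [lie_bs (x := (v, s)) (y := (w, 1)) (fun h => absurd h (not_le.2 hv))
    (fun h => absurd h (not_le.2 hw)), brB]
  congr 1
  refine List.flatMap_congr fun t _ => ?_
  obtain ⟨t, k⟩ := t
  have h : ∀ m : ℕ, (m + 1).choose m % 2 = 1 ↔ m % 2 = 0 := fun m => by
    rw [Nat.choose_succ_self_right]; omega
  cases k
  · simp only [Kind.resL, h]; split_ifs <;> rfl
  · simp only [Kind.resL, h]
    by_cases hs : s = 0
    · rw [if_pos hs, if_pos hs]; rfl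
    · rw [if_neg hs, if_neg hs, Nat.sub_add_cancel (by omega)]
      by_cases h2 : s % 2 = 1
      · rw [if_pos h2, if_pos (by omega)]; rfl
      · rw [if_neg h2, if_neg (by omega)]; rfl
  · simp [Kind.resL]
  · simp only [Kind.resL, h]; split_ifs <;> simp_all

theorem lie_euler [CharP K 2] (b : Fin 8) (s : ℕ) :
    ⁅bs K 15 0, bs K (oddIx b) s⁆ = bs K (oddIx b) s := by
  have h : ∀ b, tab 15 (oddIx b) = [(oddIx b, .U)] := by decide +kernel
  rw [lie_bs_zero _ _ _ (oddIx_lt b), h]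
  simp [bsl]

theorem lie_one_eight [CharP K 2] (s : ℕ) : ⁅bs K 1 0, bs K 8 s⁆ = bs K 0 s := by
  rw [lie_bs_zero _ _ _ (by decide), show tab 1 8 = [(0, .U), (15, .L)] by decide +kernel]
  simp [bsl]

theorem lie_nine_ten [CharP K 2] (s : ℕ) : ⁅bs K 9 0, bs K 10 s⁆ = bs K 15 s := by
  rw [lie_bs_zero _ _ _ (by decide), show tab 9 10 = [(15, .U)] by decide +kernel]
  simp [bsl]

/-- The undifferentiated term has coefficient `s + 1`, which is even. For the top exponent `s = 2 ^
n - 1` this reaches the Euler family although no higher power is available to be differentiated. -/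
theorem lie_two_seven [CharP K 2] (s : ℕ) (hs : s % 2 = 1) :
    ⁅bs K 2 s, bs K 7 1⁆ = bs K 15 s := by
  rw [lie_bs_one _ _ _ (by decide) (by decide),
    show tab 2 7 = [(0, .U), (15, .R)] by decide +kernel]
  simp [bsl, hs]

theorem exists_lie_odd [CharP K 2] (e : Fin 18) (he : isE e) : ∃ b c : Fin 8, ∀ s : ℕ,
    ⁅bs K (oddIx b) 0, bs K (oddIx c) (s + 1)⁆ = bs K e s := by
  have h : ∀ e, isE e → ∃ b c : Fin 8, tab (oddIx b) (oddIx c) = [(e, .D)] := by decide +kernel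
  obtain ⟨b, c, hbc⟩ := h e he
  refine ⟨b, c, fun s => ?_⟩
  rw [lie_bs_zero _ _ _ (oddIx_lt c), hbc]
  simp [bsl]

/-- For even `s` the product `x_1^(s) x_1` would be nonzero, hence admissible. -/
theorem odd_of_not_adm {n : ℕ∞} (hn : n ≠ 0) {s : ℕ} (hs : adm n s) (h : ¬ adm n (s + 1)) :
    s % 2 = 1 := by
  by_contra h2
  refine h (hs.add (adm_one hn) ?_)
  rw [Nat.choose_succ_self_right]
  omega

theorem exists_oddIx {v : Fin 18} (h1 : 1 ≤ v.val) (h8 : v.val ≤ 8) : ∃ b, v = oddIx b :=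
  ⟨⟨v.val - 1, by omega⟩, Fin.ext (by simp [oddIx]; omega)⟩

theorem index_cases {v : Fin 18} (hv : v.val < 16) :
    v = 0 ∨ (∃ b, v = oddIx b) ∨ isE v ∨ v = 15 := by
  by_cases h0 : v.val = 0
  · exact Or.inl (Fin.ext h0)
  by_cases h8 : v.val ≤ 8
  · exact Or.inr (Or.inl (exists_oddIx (by omega) h8))
  by_cases h14 : v.val ≤ 14
  · exact Or.inr (Or.inr (Or.inl ⟨by omega, h14⟩))
  · exact Or.inr (Or.inr (Or.inr (Fin.ext (by simp; omega))))

theorem not_isE_oddIx (b : Fin 8) : ¬ isE (oddIx b) := by revert b; decide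

theorem Qi_oddIx {n : ℕ∞} (b : Fin 8) {s : ℕ} (hs : adm n s) : Qi n (oddIx b) s :=
  ⟨⟨oddIx_lt b, hs⟩, fun h => absurd h (not_isE_oddIx b)⟩

theorem Qi_zero {n : ℕ∞} {s : ℕ} (hs : adm n s) : Qi n 0 s :=
  ⟨⟨by decide, hs⟩, fun h => absurd h (by decide)⟩

theorem Qi_euler {n : ℕ∞} {s : ℕ} (hs : adm n s) : Qi n 15 s :=
  ⟨⟨by decide, hs⟩, fun h => absurd h (by decide)⟩

/-- A subspace that contains `∂_1` and is stable under brackets with `𝔦𝔯(9; N)` contains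
`𝔦𝔯(9; N)`. -/
theorem LQ_Qi_le_of_ideal [CharP K 2] {n : ℕ∞} (hn : n ≠ 0) {S : Submodule K (Op K)}
    (hS : ∀ X ∈ LQ K (Qi n), ∀ D ∈ S, ⁅X, D⁆ ∈ S) (h0 : bs K 0 0 ∈ S) : LQ K (Qi n) ≤ S := by
  have hS' : ∀ D ∈ S, ∀ X ∈ LQ K (Qi n), ⁅D, X⁆ ∈ S := fun D hD X hX => by
    rw [op_lie_comm]; exact hS X hX D hD
  have hd : ∀ v s, Qi n v (s + 1) → bs K v s ∈ S := fun v s h => by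
    have := hS' _ h0 _ (bs_mem h)
    rwa [bs_zero_zero, lie_one_bs, if_neg (Nat.succ_ne_zero s), Nat.add_sub_cancel] at this
  -- The Euler field acts as the identity on the families of odd degree, so it yields these families
  -- in full, including their top exponents.
  have h15 : bs K 15 0 ∈ S := hd _ _ (Qi_euler (adm_one hn))
  have hodd : ∀ b s, adm n s → bs K (oddIx b) s ∈ S := fun b s hs => by
    rw [← lie_euler]
    exact hS' _ h15 _ (bs_mem (Qi_oddIx b hs))
  refine LQ_le fun v s hs => ?_
  have ha := hs.1.2
  rcases index_cases hs.1.1 with rfl | ⟨b, rfl⟩ | he | rfl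
  · rw [← lie_one_eight]
    exact hS' _ (hodd 0 0 (adm_zero n)) _ (bs_mem (Qi_oddIx 7 ha))
  · exact hodd b s ha
  · obtain ⟨b, c, hbc⟩ := exists_lie_odd (K := K) v he
    rw [← hbc]
    exact hS' _ (hodd b 0 (adm_zero n)) _ (bs_mem (Qi_oddIx c (hs.2 he)))
  -- Differentiation gives every member of the Euler family except the top one, whose exponent is
  -- odd.
  · by_cases h1 : adm n (s + 1)
    · exact hd _ _ (Qi_euler h1)
    · rw [← lie_two_seven s (odd_of_not_adm hn ha h1)]
      exact hS' _ (hodd 1 s ha) _ (bs_mem (Qi_oddIx 6 (adm_one hn)))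

/-- Each basis field is a single bracket. The root families of degree zero are available only as
derivatives, which costs them the top exponent; the Euler family loses nothing, since it is the
undifferentiated bracket of two opposite root families. -/
theorem derived_eq [CharP K 2] (n : ℕ∞) :
    bracketSpan (A := Op K) K (LQ K (Qt n)) (LQ K (Qt n)) = LQ K (Qi n) := by
  apply le_antisymm
  · refine Submodule.span_le.2 ?_
    rintro _ ⟨a, ha, b, hb, rfl⟩
    exact lie_mem_derived ha hb
  · have hlt := LQ_mono (K := K) (Q := Qi n) (Q' := Qt n) fun _ _ h => h.1
    have hm : ∀ a ∈ LQ K (Qt n), ∀ b ∈ LQ K (Qt n),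
        ⁅a, b⁆ ∈ bracketSpan (A := Op K) K (LQ K (Qt n)) (LQ K (Qt n)) :=
      fun a ha b hb => Submodule.subset_span ⟨a, ha, b, hb, rfl⟩
    refine LQ_le fun v s hs => ?_
    have ha := hs.1.2
    rcases index_cases hs.1.1 with rfl | ⟨b, rfl⟩ | he | rfl
    · rw [← lie_one_eight]
      exact hm _ (bs_mem ⟨by decide, adm_zero n⟩) _ (bs_mem ⟨by decide, ha⟩)
    · rw [← lie_euler]
      exact hm _ (bs_mem ⟨by decide, adm_zero n⟩) _ (bs_mem ⟨oddIx_lt b, ha⟩)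
    · obtain ⟨b, c, hbc⟩ := exists_lie_odd (K := K) v he
      rw [← hbc]
      exact hm _ (bs_mem ⟨oddIx_lt b, adm_zero n⟩) _ (bs_mem ⟨oddIx_lt c, hs.2 he⟩)
    · rw [← lie_nine_ten]
      exact hm _ (bs_mem ⟨by decide, adm_zero n⟩) _ (bs_mem ⟨by decide, ha⟩)

theorem ir_toSubmodule [CharP K 2] {n : ℕ∞} (hn : n ≠ 0) : (ir K n).toSubmodule = LQ K (Qi n) := by
  have h := tildeProlong_toSubmodule (K := K) (shear_ne_zero hn) 1
  rw [shear_zero] at h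
  rw [← derived_eq n, ← h]
  rfl

theorem mem_ir [CharP K 2] {n : ℕ∞} (hn : n ≠ 0) {D : Op K} : D ∈ ir K n ↔ D ∈ LQ K (Qi n) := by
  rw [← ir_toSubmodule hn]
  rfl

theorem ir_one_eq [CharP K 2] : ir K 1 = branchAlg K 0 := by
  rw [← LieSubalgebra.toSubmodule_inj, ir_toSubmodule one_ne_zero, branchAlg_eq]
  refine LQ_congr fun v s => (or_iff_left fun h => ?_).symm
  have h2 := h.2.1
  have h1 := h.1
  simp at h2
  omega

theorem exists_bound [CharP K 2] {Q : Fin 18 → ℕ → Prop} {D : Op K} (hD : D ∈ LQ K Q) :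
    ∃ M : ℕ, D ∈ LQ K fun v s => Q v s ∧ s < M := by
  rw [LQ_eq_span] at hD
  refine Submodule.span_induction (p := fun D _ => ∃ M : ℕ, D ∈ LQ K fun v s => Q v s ∧ s < M)
    ?_ ⟨0, zero_mem _⟩ ?_ ?_ hD
  · rintro _ ⟨v, s, h, rfl⟩
    exact ⟨s + 1, bs_mem ⟨h, Nat.lt_succ_self s⟩⟩
  · rintro x y _ _ ⟨M, hM⟩ ⟨M', hM'⟩
    exact ⟨max M M', add_mem
      (LQ_mono (fun v s h => ⟨h.1, h.2.trans_le (le_max_left _ _)⟩) hM)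
      (LQ_mono (fun v s h => ⟨h.1, h.2.trans_le (le_max_right _ _)⟩) hM')⟩
  · rintro c x _ ⟨M, hM⟩
    exact ⟨M, Submodule.smul_mem _ c hM⟩

/-- Each bracket with `∂_1` lowers the bound on the exponents, so the last nonzero iterate is the
required field. Boundedness holds for every single field, even if `n = ∞`. -/
theorem exists_lie_one_eq_zero [CharP K 2] {S : Submodule K (Op K)}
    (hS : ∀ D ∈ S, ⁅kap K 1, D⁆ ∈ S) (M : ℕ) {D : Op K}
    (hD : D ∈ S) (h0 : D ≠ 0) (hM : D ∈ LQ K fun _ s => s < M) :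
    ∃ E ∈ S, E ≠ 0 ∧ ⁅kap K 1, E⁆ = 0 := by
  induction M generalizing D with
  | zero => exact absurd (eq_zero_of_crd hM fun v s h => absurd h (Nat.not_lt_zero s)) h0
  | succ M ih =>
    by_cases h : ⁅kap K 1, D⁆ = 0
    · exact ⟨D, hD, h0, h⟩
    · exact ih (hS D hD) h (LQ_mono (fun v s h => by omega) (lie_one_mem hM))

theorem lie_odd_const [CharP K 2] {Q : Fin 18 → ℕ → Prop} (h : ∀ v s, Q v s → s = 0) {D : Op K}
    (hD : D ∈ LQ K Q) (b : Fin 8) :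
    ⁅bs K (oddIx b) 0, D⁆ ∈ LQ K fun v s => v.val ≤ 8 ∧ s = 0 := by
  have key : ∀ (b : Fin 8) (v : Fin 18), ∀ p ∈ brB (oddIx b, 0) (v, 0), p.1.val ≤ 8 ∧ p.2 = 0 := by
    decide +kernel
  rw [eq_sum_crd hD h, op_lie_sum]
  refine Submodule.sum_mem _ fun v _ => ?_
  rw [op_lie_smul, lie_bs (x := (oddIx b, 0)) (y := (v, 0)) (fun _ => rfl) (fun _ => rfl)]
  exact Submodule.smul_mem _ _ (bsl_mem fun p hp => bs_mem (key b v p hp))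

/-- The bracket `𝔤₋₁ × 𝔤₋₁ → 𝔤₋₂` is the nondegenerate form that pairs `d` with `d.rev`, so it reads
off coordinates. -/
theorem lie_odd_low [CharP K 2] {D : Op K} (hD : D ∈ LQ K fun v s => v.val ≤ 8 ∧ s = 0)
    (d : Fin 8) : ⁅bs K (oddIx d.rev) 0, D⁆ = crd (oddIx d) 0 D • bs K 0 0 := by
  have key : ∀ (d : Fin 8), normL (brB (oddIx d.rev, 0) (oddIx d, 0)) = [(0, 0)] ∧
      ∀ v : Fin 18, v.val ≤ 8 → v ≠ oddIx d → brB (oddIx d.rev, 0) (v, 0) = [] := by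
    decide +kernel
  conv_lhs => rw [eq_sum_crd hD fun _ _ h => h.2, op_lie_sum]
  rw [Finset.sum_eq_single (oddIx d)]
  · rw [op_lie_smul, lie_bs (x := (oddIx d.rev, 0)) (y := (oddIx d, 0)) (fun _ => rfl)
      (fun _ => rfl), ← bsl_normL, (key d).1]
    simp [bsl]
  · intro v _ hv
    by_cases h8 : v.val ≤ 8
    · rw [op_lie_smul, lie_bs (x := (oddIx d.rev, 0)) (y := (v, 0)) (fun _ => rfl)
        (fun _ => rfl), (key d).2 v h8 hv]
      simp [bsl]
    · rw [crd_eq_zero hD fun h => h8 h.1, zero_smul, op_lie_zero]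
  · intro h; exact absurd (Finset.mem_univ _) h

theorem cst_low : ∀ (a d : Fin 8) (f : Fin 18), ¬ 9 ≤ f.val → cst a d f = 0 := by decide +kernel

/-- A nonzero field with constant coordinates that annihilates `∂_1` generates `∂_1`. -/
theorem exists_smul_mem [CharP K 2] {S : Submodule K (Op K)}
    (hS : ∀ (b : Fin 8), ∀ D ∈ S, ⁅bs K (oddIx b) 0, D⁆ ∈ S) {Q : Fin 18 → ℕ → Prop}
    (hQ : ∀ v s, Q v s → s = 0 ∧ v.val < 16) {D : Op K} (hD : D ∈ LQ K Q) (hDS : D ∈ S)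
    (h0 : D ≠ 0) : bs K 0 0 ∈ S := by
  have fin : ∀ E ∈ S, E ∈ LQ K (fun v s => v.val ≤ 8 ∧ s = 0) → ∀ d, crd (oddIx d) 0 E ≠ 0 →
      bs K 0 0 ∈ S := by
    intro E hE hE8 d hd
    have := hS d.rev E hE
    rw [lie_odd_low hE8] at this
    exact (S.smul_mem_iff hd).1 this
  have step : ∀ b d : Fin 8, ∀ e : Fin 18, (∀ f, f ≠ e → crd f 0 D * (cst b d f : K) = 0) →
      cst b d e = 1 → crd e 0 D ≠ 0 → bs K 0 0 ∈ S := by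
    intro b d e h h1 he
    refine fin _ (hS b D hDS) (lie_odd_const (fun v s h => (hQ v s h).1) hD b) d ?_
    rw [crd_lie_of_mem (fun v s h => (hQ v s h).1) hD, Finset.sum_eq_single e (fun f _ => h f)
      (fun h => absurd (Finset.mem_univ _) h), h1]
    simpa using he
  -- A root component of degree zero is detected by a bracket with a suitable `X_b`; failing that,
  -- the Euler component, then the components of degree -1, and finally `∂_1` itself.
  by_cases hE : ∃ e, isE e ∧ crd e 0 D ≠ 0
  · obtain ⟨e, he, hne⟩ := hE
    obtain ⟨b, d, hbd⟩ := cst_spec_e 0 e he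
    refine step b d e (fun f hf => ?_) ?_ hne
    · by_cases h9 : 9 ≤ f.val
      · rw [(hbd f h9).2, if_neg hf]; simp
      · rw [cst_low b d f h9]; simp
    · rw [(hbd e he.1).2, if_pos rfl]
  push Not at hE
  by_cases h15 : crd 15 0 D ≠ 0
  · refine step 0 0 15 (fun f hf => ?_) (by decide +kernel) h15
    by_cases h9 : 9 ≤ f.val
    · by_cases h16 : f.val < 16
      · rw [hE f ⟨h9, ?_⟩, zero_mul]
        have : f.val ≠ 15 := fun h => hf (Fin.ext h)
        omega
      · rw [crd_eq_zero hD fun h => h16 (hQ _ _ h).2, zero_mul]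
    · rw [cst_low _ _ f h9]; simp
  push Not at h15
  have h8 : D ∈ LQ K fun v s => v.val ≤ 8 ∧ s = 0 := by
    refine mem_LQ_of_crd hD fun v s hs hne => ?_
    obtain ⟨rfl, h16⟩ := hQ v s hs
    refine ⟨?_, rfl⟩
    by_contra hlt
    rcases index_cases h16 with rfl | ⟨b, rfl⟩ | he | rfl
    · exact hlt (by decide)
    · exact hlt (by simp [oddIx])
    · exact hne (hE v he)
    · exact hne h15
  by_cases hb : ∃ b, crd (oddIx b) 0 D ≠ 0
  · obtain ⟨b, hb⟩ := hb
    exact fin D hDS h8 b hb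
  push Not at hb
  have hD0 := eq_sum_crd h8 fun _ _ h => h.2
  rw [Finset.sum_eq_single 0] at hD0
  · have hne : crd 0 0 D ≠ 0 := fun h => h0 (by rw [hD0, h, zero_smul])
    rw [hD0] at hDS
    exact (S.smul_mem_iff hne).1 hDS
  · intro v _ hv
    by_cases hv8 : v.val ≤ 8
    · obtain ⟨b, rfl⟩ := exists_oddIx (v := v) (Nat.one_le_iff_ne_zero.2 fun h => hv (Fin.ext h)) hv8
      rw [hb b, zero_smul]
    · rw [crd_eq_zero h8 fun h => hv8 h.1, zero_smul]
  · intro h; exact absurd (Finset.mem_univ _) h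

/-- The subspaces of `𝔦𝔯(9; N)` that are stable under brackets. -/
theorem LQ_Qi_le_of_ne_bot [CharP K 2] {n : ℕ∞} (hn : n ≠ 0) {S : Submodule K (Op K)}
    (hle : S ≤ LQ K (Qi n)) (hS : ∀ X ∈ LQ K (Qi n), ∀ D ∈ S, ⁅X, D⁆ ∈ S) {D : Op K} (hD : D ∈ S)
    (h0 : D ≠ 0) : LQ K (Qi n) ≤ S := by
  refine LQ_Qi_le_of_ideal hn hS ?_
  have h1 : ∀ D ∈ S, ⁅kap K 1, D⁆ ∈ S := fun D hD => by
    rw [← bs_zero_zero]; exact hS _ (bs_mem (Qi_zero (adm_zero n))) D hD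
  obtain ⟨M, hM⟩ := exists_bound (hle hD)
  obtain ⟨E, hE, hE0, hE1⟩ := exists_lie_one_eq_zero h1 M hD h0
    (LQ_mono (fun _ _ h => h.2) hM)
  exact exists_smul_mem (fun b D hD => hS _ (bs_mem (Qi_oddIx b (adm_zero n))) D hD)
    (fun v s h => ⟨h.2, h.1.1.1⟩) (mem_of_lie_one_eq_zero (hle hE) hE1) hE hE0

theorem ir_isSimple [CharP K 2] {n : ℕ∞} (hn : n ≠ 0) : LieAlgebra.IsSimple K (ir K n) := by
  constructor
  · intro I
    by_cases hI : I = ⊥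
    · exact Or.inl hI
    right
    obtain ⟨x, hx, hx0⟩ : ∃ x ∈ I, x ≠ 0 := by
      by_contra! hall
      exact hI ((LieSubmodule.eq_bot_iff I).2 hall)
    let S : Submodule K (Op K) := I.toSubmodule.map (ir K n).toSubmodule.subtype
    have hmem : ∀ y : ir K n, (y : Op K) ∈ S ↔ y ∈ I := fun y => by
      constructor
      · rintro ⟨z, hz, he⟩
        exact Subtype.ext he ▸ hz
      · exact fun h => ⟨y, h, rfl⟩
    have hle : S ≤ LQ K (Qi n) := by
      rintro _ ⟨z, hz, rfl⟩
      exact (mem_ir hn).1 z.2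
    have hS : ∀ X ∈ LQ K (Qi n), ∀ D ∈ S, ⁅X, D⁆ ∈ S := by
      rintro X hX _ ⟨z, hz, rfl⟩
      exact ⟨⁅(⟨X, (mem_ir hn).2 hX⟩ : ir K n), z⁆, lie_mem_right K (ir K n) I _ _ hz, rfl⟩
    have h := LQ_Qi_le_of_ne_bot hn hle hS ((hmem x).2 hx) fun h => hx0 (Subtype.ext h)
    ext y
    exact ⟨fun _ => trivial, fun _ => (hmem y).1 (h ((mem_ir hn).1 y.2))⟩
  · intro h
    have h15 : bs K 15 0 ∈ ir K n := (mem_ir hn).2 (bs_mem (Qi_euler (adm_zero n)))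
    have h1 : bs K (oddIx 0) 0 ∈ ir K n := (mem_ir hn).2 (bs_mem (Qi_oddIx 0 (adm_zero n)))
    have := h.trivial ⟨_, h15⟩ ⟨_, h1⟩
    exact bs_ne_zero (K := K) (oddIx 0) 0 ((lie_euler 0 0).symm.trans (congrArg Subtype.val this))

/-- Only zero commutes with `𝔦𝔯(9; N)`. -/
theorem eq_zero_of_commute [CharP K 2] {n : ℕ∞} (hn : n ≠ 0) {j : Fin 3} {E : Op K}
    (hE : E ∈ LQ K (Qf j n)) (h : ∀ y ∈ LQ K (Qi n), ⁅E, y⁆ = 0) : E = 0 := by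
  have h' : ∀ y ∈ LQ K (Qi n), ⁅y, E⁆ = 0 := fun y hy => by rw [op_lie_comm, h y hy]
  have h0 := mem_of_lie_one_eq_zero hE
    (by rw [← bs_zero_zero]; exact h' _ (bs_mem (Qi_zero (adm_zero n))))
  have hodd : ∀ b, ⁅bs K (oddIx b) 0, E⁆ = 0 := fun b => h' _ (bs_mem (Qi_oddIx b (adm_zero n)))
  -- Since `E` commutes with every `X_a`, the same coordinates taken for all eight indices satisfy
  -- the first prolong equations.
  have h9 : ∀ e : Fin 18, 9 ≤ e.val → crd e 0 E = 0 := fun e he => by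
    refine first_prolong_eq_zero (w := fun _ e => crd e 0 E) (fun a b d => ?_) 0 he
    rw [Finset.sum_filter_of_ne, Finset.sum_add_distrib, ← crd_lie_of_mem (fun _ _ h => h.2) h0,
      ← crd_lie_of_mem (fun _ _ h => h.2) h0, hodd, hodd, map_zero, add_zero]
    intro e _ hne
    by_contra hlt
    exact hne (by rw [cst_low _ _ e hlt, cst_low _ _ e hlt]; simp)
  have h8 : E ∈ LQ K fun v s => v.val ≤ 8 ∧ s = 0 := by
    refine mem_LQ_of_crd h0 fun v s hs hne => ⟨?_, hs.2⟩
    by_contra hlt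
    obtain ⟨-, rfl⟩ := hs
    exact hne (h9 v (by omega))
  have hb : ∀ d, crd (oddIx d) 0 E = 0 := fun d => by
    have h2 := lie_odd_low h8 d
    rw [hodd] at h2
    exact (smul_eq_zero.1 h2.symm).resolve_right (bs_ne_zero 0 0)
  have hE0 := eq_sum_crd h8 fun _ _ h => h.2
  rw [Finset.sum_eq_single 0] at hE0
  -- A multiple of `∂_1` is excluded because `∂_1` does not commute with `F_1(x_1)`.
  · have h2 := h' _ (bs_mem (K := K) (Qi_oddIx 0 (adm_one hn)))
    rw [hE0, op_lie_smul, op_lie_comm, bs_zero_zero, lie_one_bs, if_neg one_ne_zero] at h2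
    rw [hE0, (smul_eq_zero.1 h2).resolve_right (bs_ne_zero _ _), zero_smul]
  · intro v _ hv
    by_cases hv8 : v.val ≤ 8
    · obtain ⟨b, rfl⟩ := exists_oddIx (v := v) (Nat.one_le_iff_ne_zero.2 fun h => hv (Fin.ext h)) hv8
      rw [hb b, zero_smul]
    · rw [crd_eq_zero h8 fun h => hv8 h.1, zero_smul]
  · intro h; exact absurd (Finset.mem_univ _) h

end Simple

/-! ### Outer derivations -/

section Outer

variable {K : Type*} [Field K]

theorem linearIndependent_of_dual {ι : Type*} [Fintype ι] [DecidableEq ι] {g : ι → Op K}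
    (φ : ι → Op K →ₗ[K] K) (h : ∀ i k, φ i (g k) = if i = k then 1 else 0) :
    LinearIndependent K g := by
  refine LinearIndependent.of_comp (LinearMap.pi φ) ?_
  have h1 : LinearMap.pi φ ∘ g = fun k => Pi.single k 1 := by
    funext k i
    rw [Function.comp_apply, LinearMap.pi_apply, h, Pi.single_apply]
  rw [h1]
  exact Pi.linearIndependent_single_one ι K

theorem adm_coe_iff {n s : ℕ} : adm (n : ℕ∞) s ↔ s < 2 ^ n := by
  constructor
  · intro h; exact h n rfl
  · intro h m hm
    rw [← ENat.natCast_inj.1 hm]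
    exact h

/-- The outer derivation with a given index: a field of the highest degree, or an element of the
torus. -/
noncomputable def outerField (K : Type*) [Field K] (m : ℕ) (v : Fin 18) : Op K :=
  if v.val < 16 then bs K v m else bs K 0 1 + bs K v 0

/-- The indices of outer derivations. -/
def IsOuter (j : Fin 3) (v : Fin 18) : Prop := isE v ∨ (16 ≤ v.val ∧ v.val < 16 + j.val)

instance (j : Fin 3) : DecidablePred (IsOuter j) := fun _ => inferInstanceAs (Decidable (_ ∨ _))

theorem card_isOuter : ∀ j : Fin 3, Fintype.card {v // IsOuter j v} = 6 + j.val := by decide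

theorem card_isE : Fintype.card {v // isE v} = 6 := by decide

theorem crd_outerField [CharP K 2] {m : ℕ} {j : Fin 3} {v w : Fin 18} (hv : IsOuter j v)
    (hw : IsOuter j w) :
    crd v (if v.val < 16 then m else 0) (outerField K m w) = if v = w then 1 else 0 := by
  have h0 : v ≠ 0 := by
    rintro rfl
    rcases hv with hv | hv
    · exact absurd hv (by decide)
    · exact absurd hv.1 (by decide)
  have hc : ∀ t, crd v t (bs K 0 1) = 0 := fun t => by
    rw [crd_bs, if_neg fun h => h0 h.1]
  unfold outerField
  by_cases hvw : v = w
  · subst hvw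
    rw [if_pos rfl]
    by_cases h1 : v.val < 16
    · rw [if_pos h1, if_pos h1, crd_bs, if_pos ⟨rfl, rfl⟩]
    · rw [if_neg h1, if_neg h1, map_add, hc, crd_bs, if_pos ⟨rfl, rfl⟩, zero_add]
  · rw [if_neg hvw]
    split_ifs
    all_goals first
      | rw [map_add, hc, crd_bs, if_neg fun h => hvw h.1, zero_add]
      | rw [crd_bs, if_neg fun h => hvw h.1]

theorem mem_extraTorus [CharP K 2] {j : Fin 3} {x : Op K} : x ∈ extraTorus K j ↔
    ∃ v : Fin 18, (16 ≤ v.val ∧ v.val < 16 + j.val) ∧ x = bs K 0 1 + bs K v 0 := by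
  have h1 : ∀ v : Fin 18, 16 ≤ v.val → v = 16 ∨ v = 17 := by decide
  fin_cases j
  · refine iff_of_false (Set.notMem_empty x) ?_
    rintro ⟨v, ⟨h1, h2⟩, -⟩
    simp at h2
    omega
  · constructor
    · rintro rfl
      exact ⟨16, by decide, tor1_eq⟩
    · rintro ⟨v, ⟨h2, h3⟩, rfl⟩
      rcases h1 v h2 with rfl | rfl
      · exact tor1_eq.symm
      · exact absurd h3 (by decide)
  · constructor
    · rintro (rfl | rfl)
      · exact ⟨16, by decide, tor1_eq⟩
      · exact ⟨17, by decide, tor2_eq⟩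
    · rintro ⟨v, ⟨h2, h3⟩, rfl⟩
      rcases h1 v h2 with rfl | rfl
      · exact Or.inl tor1_eq.symm
      · exact Or.inr tor2_eq.symm

theorem isE_lt {v : Fin 18} (h : isE v) : v.val < 16 := by have := h.2; omega

theorem outerField_of_isE {v : Fin 18} (h : isE v) (m : ℕ) : outerField K m v = bs K v m :=
  if_pos (isE_lt h)

theorem outerField_of_torus {v : Fin 18} (h : 16 ≤ v.val) (m : ℕ) :
    outerField K m v = bs K 0 1 + bs K v 0 := if_neg (not_lt.2 h)

/-- The span of the outer derivations. -/
noncomputable def outerSpan (K : Type*) [Field K] (j : Fin 3) (m : ℕ) : Submodule K (Op K) :=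
  Submodule.span K (Set.range fun v : {v // IsOuter j v} => outerField K m v)

theorem outerField_mem {j : Fin 3} {v : Fin 18} (h : IsOuter j v) (m : ℕ) :
    outerField K m v ∈ outerSpan K j m := Submodule.subset_span ⟨⟨v, h⟩, rfl⟩

/-- The outer derivations of the highest degree. -/
noncomputable def topSpan (K : Type*) [Field K] (m : ℕ) : Submodule K (Op K) :=
  LQ K fun v s => isE v ∧ s = m

theorem outerSpan_eq (j : Fin 3) [CharP K 2] (m : ℕ) :
    outerSpan K j m = Submodule.span K (extraTorus K j) ⊔ topSpan K m := by
  apply le_antisymm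
  · refine Submodule.span_le.2 ?_
    rintro _ ⟨⟨v, hv | hv⟩, rfl⟩
    · refine Submodule.mem_sup_right ?_
      simp only [outerField_of_isE hv]
      exact bs_mem ⟨hv, rfl⟩
    · refine Submodule.mem_sup_left (Submodule.subset_span ?_)
      simp only [outerField_of_torus hv.1]
      exact mem_extraTorus.2 ⟨v, hv, rfl⟩
  · refine sup_le (Submodule.span_le.2 fun x hx => ?_) (LQ_le ?_)
    · obtain ⟨v, hv, rfl⟩ := mem_extraTorus.1 hx
      rw [← outerField_of_torus hv.1 m]
      exact outerField_mem (Or.inr hv) m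
    · rintro v _ ⟨hv, rfl⟩
      rw [← outerField_of_isE hv]
      exact outerField_mem (Or.inl hv) _

theorem topSpan_eq (m : ℕ) :
    topSpan K m = Submodule.span K (Set.range fun v : {v // isE v} => bs K v m) := by
  apply le_antisymm
  · refine LQ_le ?_
    rintro v _ ⟨hv, rfl⟩
    exact Submodule.subset_span ⟨⟨v, hv⟩, rfl⟩
  · refine Submodule.span_le.2 ?_
    rintro _ ⟨⟨v, hv⟩, rfl⟩
    exact bs_mem ⟨hv, rfl⟩

theorem linearIndependent_outerField [CharP K 2] (j : Fin 3) (m : ℕ) :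
    LinearIndependent K fun v : {v // IsOuter j v} => outerField K m v := by
  refine linearIndependent_of_dual (fun v => crd v.1 (if v.1.val < 16 then m else 0)) fun v w => ?_
  rw [crd_outerField v.2 w.2]
  simp only [Subtype.ext_iff]

theorem finrank_outerSpan [CharP K 2] (j : Fin 3) (m : ℕ) :
    Module.finrank K (outerSpan K j m) = 6 + j.val := by
  rw [outerSpan, finrank_span_eq_card (linearIndependent_outerField j m), card_isOuter]

theorem finrank_topSpan [CharP K 2] (m : ℕ) : Module.finrank K (topSpan K m) = 6 := by
  rw [topSpan_eq, finrank_span_eq_card, card_isE]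
  refine linearIndependent_of_dual (fun v => crd v.1 m) fun v w => ?_
  rw [crd_bs]
  simp only [Subtype.ext_iff, and_true]

theorem span_lie_mem {s : Set (Op K)} {S : Submodule K (Op K)} (h : ∀ x ∈ s, ∀ y ∈ s, ⁅x, y⁆ ∈ S)
    {x y : Op K} (hx : x ∈ Submodule.span K s) (hy : y ∈ Submodule.span K s) : ⁅x, y⁆ ∈ S := by
  have h1 : ∀ x ∈ s, ∀ y ∈ Submodule.span K s, ⁅x, y⁆ ∈ S := fun x hx y hy => by
    refine Submodule.span_induction (p := fun y _ => ⁅x, y⁆ ∈ S) (h x hx) ?_ ?_ ?_ hy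
    · rw [op_lie_zero]; exact zero_mem _
    · intro a b _ _ ha hb; rw [op_lie_add]; exact add_mem ha hb
    · intro c a _ ha; rw [op_lie_smul]; exact S.smul_mem c ha
  refine Submodule.span_induction (p := fun x _ => ⁅x, y⁆ ∈ S) (fun x hx => h1 x hx y hy) ?_ ?_ ?_ hx
  · rw [op_zero_lie]; exact zero_mem _
  · intro a b _ _ ha hb; rw [op_add_lie]; exact add_mem ha hb
  · intro c a _ ha; rw [op_smul_lie]; exact S.smul_mem c ha

theorem two_pow_sub_one_odd {n : ℕ} (hn : n ≠ 0) : (2 ^ n - 1) % 2 = 1 := by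
  obtain ⟨k, rfl⟩ := Nat.exists_eq_succ_of_ne_zero hn
  have := Nat.two_pow_pos k
  rw [Nat.pow_succ]
  omega

/-- Two top fields commute because the product of their coefficients has a carry; two torus elements
commute; a torus element acts on a top field by a scalar. -/
theorem lie_outerField [CharP K 2] {n : ℕ} (hn : n ≠ 0) {j : Fin 3} {v w : Fin 18}
    (hv : IsOuter j v) (hw : IsOuter j w) :
    ⁅outerField K (2 ^ n - 1) v, outerField K (2 ^ n - 1) w⁆ ∈ outerSpan K j (2 ^ n - 1) := by
  have hodd := two_pow_sub_one_odd hn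
  have hpos := Nat.two_pow_pos n
  have mixed : ∀ {v w : Fin 18}, 16 ≤ v.val → isE w →
      ⁅outerField K (2 ^ n - 1) v, outerField K (2 ^ n - 1) w⁆ ∈ outerSpan K j (2 ^ n - 1) := by
    intro v w hv hw
    have h1 : ∀ w, isE w → tab 0 w = [(w, .D)] ∧ tab w 0 = [(w, .D)] := by decide +kernel
    have h2 : ∀ v w : Fin 18, 16 ≤ v.val → isE w → tab v w = [] ∨ tab v w = [(w, .U)] := by
      decide +kernel
    -- The bracket is governed by the derivative of `x_1 x_1^(2^n - 1) = 2^n x_1^(2^n)`, which is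
    -- zero.
    have h3 : ⁅bs K 0 1, bs K w (2 ^ n - 1)⁆ = 0 := by
      rw [op_lie_comm, lie_bs_one _ _ _ (isE_lt hw) (by decide),
        (h1 w hw).2]
      simp [bsl, hodd]
    rw [outerField_of_torus hv, outerField_of_isE hw, op_add_lie, h3, zero_add,
      lie_bs_zero _ _ _ (isE_lt hw)]
    rcases h2 v w hv hw with h | h
    · rw [h]; exact zero_mem _
    · have h4 := outerField_mem (K := K) (j := j) (Or.inl hw) (2 ^ n - 1)
      rw [outerField_of_isE hw] at h4
      rw [h]
      simpa [bsl] using h4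
  rcases hv with hv | hv <;> rcases hw with hw | hw
  · have h1 : ∀ v w, isE v → isE w → tab v w = [] ∨ tab v w = [(15, .U)] := by decide +kernel
    rw [outerField_of_isE hv, outerField_of_isE hw,
      lie_bs (x := (v, 2 ^ n - 1)) (y := (w, 2 ^ n - 1))
        (fun h => absurd h (not_le.2 (isE_lt hv))) (fun h => absurd h (not_le.2 (isE_lt hw))), brB]
    have h2 : ¬ (2 ^ n - 1 + (2 ^ n - 1)).choose (2 ^ n - 1) % 2 = 1 := by
      have := two_dvd_choose_of_carry (s := 2 ^ n - 1) (t := 2 ^ n - 1) (m := n) (by omega)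
        (by omega) (by omega)
      omega
    rcases h1 v w hv hw with h | h
    · simp only [h]; exact zero_mem _
    · simp only [h, List.flatMap_cons, Kind.resL, if_neg h2]; exact zero_mem _
  · rw [op_lie_comm]; exact mixed hw.1 hv
  · exact mixed hv.1 hw
  · have h1 : ∀ w : Fin 18, 16 ≤ w.val → tab 0 w = [] ∧ tab w 0 = [] := by decide +kernel
    rw [outerField_of_torus hv.1, outerField_of_torus hw.1, op_add_lie, op_lie_add, op_lie_add,
      lie_bs (x := (0, 1)) (y := (0, 1)) (by decide) (by decide),
      lie_bs (x := (0, 1)) (y := (w, 0)) (by decide) (fun _ => rfl),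
      lie_bs (x := (v, 0)) (y := (0, 1)) (fun _ => rfl) (by decide),
      lie_bs (x := (v, 0)) (y := (w, 0)) (fun _ => rfl) (fun _ => rfl),
      show brB (0, 1) (0, 1) = [] by decide +kernel]
    simp only [brB, (h1 w hw.1).1, (h1 v hv.1).2, tab_const v w hv.1 hw.1]
    simp [bsl]

/-- The Lie algebra of outer derivations. -/
noncomputable def outerAlg (K : Type*) [Field K] [CharP K 2] (j : Fin 3) {n : ℕ} (hn : n ≠ 0) :
    LieSubalgebra K (Op K) :=
  algOf (outerSpan K j (2 ^ n - 1)) fun a ha b hb => span_lie_mem (by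
    rintro _ ⟨v, rfl⟩ _ ⟨w, rfl⟩
    exact lie_outerField hn v.2 w.2) ha hb

theorem not_Qi_top {n : ℕ} {v : Fin 18} (hv : isE v) : ¬ Qi n v (2 ^ n - 1) := fun h => by
  have h1 := adm_coe_iff.1 (h.2 hv)
  have := Nat.two_pow_pos n
  omega

theorem disjoint_outerSpan [CharP K 2] (j : Fin 3) (n : ℕ) :
    Disjoint (LQ K (Qi n)) (outerSpan K j (2 ^ n - 1)) := by
  rw [Submodule.disjoint_def]
  intro x hx hy
  obtain ⟨c, rfl⟩ := (Submodule.mem_span_range_iff_exists_fun K).1 hy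
  refine Finset.sum_eq_zero fun v _ => ?_
  have h1 : crd v.1 (if v.1.val < 16 then 2 ^ n - 1 else 0)
      (∑ w : {v // IsOuter j v}, c w • outerField K (2 ^ n - 1) w) = 0 := by
    refine crd_eq_zero hx fun h => ?_
    obtain ⟨v, hv | hv⟩ := v
    · simp only [if_pos (isE_lt hv)] at h
      exact not_Qi_top hv h
    · exact absurd h.1.1 (not_lt.2 hv.1)
  rw [map_sum, Finset.sum_eq_single v] at h1
  · rw [map_smul, crd_outerField v.2 v.2, if_pos rfl, smul_eq_mul, mul_one] at h1
    rw [h1, zero_smul]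
  · intro w _ hw
    rw [map_smul, crd_outerField v.2 w.2, if_neg fun h => hw (Subtype.ext h.symm), smul_zero]
  · intro h; exact absurd (Finset.mem_univ _) h

/-- The indices of the full prolong that are missing from the derived algebra are exactly the root
families at exponent `2 ^ n - 1` and the torus constants. Passing from the latter to `d_1` and `d_2`
changes them by `F_0(x_1)`, which lies in the derived algebra. -/
theorem LQ_Qi_sup_outerSpan [CharP K 2] (j : Fin 3) {n : ℕ} (hn : n ≠ 0) :
    LQ K (Qi n) ⊔ outerSpan K j (2 ^ n - 1) = LQ K (Qf j n) := by
  have hn' : (n : ℕ∞) ≠ 0 := by exact_mod_cast hn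
  have hpos := Nat.two_pow_pos n
  have h01 := bs_zero_one_mem (K := K) hn'
  apply le_antisymm
  · refine sup_le (LQ_mono fun v s h => Or.inl h.1) (Submodule.span_le.2 ?_)
    rintro _ ⟨⟨v, hv | hv⟩, rfl⟩
    · simp only [outerField_of_isE hv]
      exact bs_mem (Or.inl ⟨isE_lt hv, adm_coe_iff.2 (by omega)⟩)
    · simp only [outerField_of_torus hv.1]
      exact add_mem (LQ_mono (fun v s h => Or.inl h.1) h01) (bs_mem (Or.inr ⟨hv.1, hv.2, rfl⟩))
  · refine LQ_le fun v s hs => ?_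
    rcases hs with hs | ⟨h1, h2, rfl⟩
    · by_cases h : isE v ∧ ¬ adm n (s + 1)
      · obtain ⟨he, h⟩ := h
        rw [adm_coe_iff] at h
        have h3 := adm_coe_iff.1 hs.2
        obtain rfl : s = 2 ^ n - 1 := by omega
        rw [← outerField_of_isE he]
        exact Submodule.mem_sup_right (outerField_mem (Or.inl he) _)
      · exact Submodule.mem_sup_left (bs_mem ⟨hs, fun he => by_contra fun h' => h ⟨he, h'⟩⟩)
    · have h3 := outerField_mem (K := K) (j := j) (v := v) (Or.inr ⟨h1, h2⟩) (2 ^ n - 1)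
      rw [outerField_of_torus h1] at h3
      have h4 := add_mem (Submodule.mem_sup_left (T := outerSpan K j (2 ^ n - 1)) h01)
        (Submodule.mem_sup_right h3)
      rwa [← add_assoc, op_add_self, zero_add] at h4

/-- The full prolong is the sum of `𝔦𝔯(9; N)` and of a Lie algebra of outer derivations. -/
theorem fullProlong_eq_semidirect [CharP K 2] (j : Fin 3) {n : ℕ} (hn : n ≠ 0) :
    ∃ (T : Submodule K (Op K)) (D : LieSubalgebra K (Op K)),
        T ≤ fullComp K j (shear n) (2 ^ (n + 1) - 2) ∧
        (∀ k, 2 ^ (n + 1) - 2 < k → fullComp K j (shear n) k = ⊥) ∧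
        Module.finrank K T = 6 ∧
        D.toSubmodule = Submodule.span K (extraTorus K j) ⊔ T ∧
        Module.finrank K D = 6 + (j : ℕ) ∧
        (ir K n).toSubmodule ⊔ D.toSubmodule = (fullProlong K j (shear n)).toSubmodule ∧
        Disjoint (ir K n).toSubmodule D.toSubmodule ∧
        (∀ x ∈ fullProlong K j (shear n), ∀ y ∈ ir K n, ⁅x, y⁆ ∈ ir K n) ∧
        (∀ x ∈ D, ∀ z ∈ ir K n, (∀ y ∈ ir K n, ⁅x, y⁆ = ⁅z, y⁆) → x = 0) := by
  have hn' : (n : ℕ∞) ≠ 0 := by exact_mod_cast hn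
  have hN := shear_ne_zero hn'
  have hfull := fullProlong_toSubmodule (K := K) hN j
  have hcomp := fullComp_eq (K := K) hN j
  rw [shear_zero] at hfull hcomp
  have hpos := Nat.two_pow_pos n
  have hdis := disjoint_outerSpan (K := K) j n
  have hD : (outerAlg K j hn).toSubmodule = outerSpan K j (2 ^ n - 1) := rfl
  have hsup := LQ_Qi_sup_outerSpan (K := K) j hn
  refine ⟨topSpan K (2 ^ n - 1), outerAlg K j hn, ?_, fun k hk => ?_, finrank_topSpan _,
    outerSpan_eq j _, finrank_outerSpan j _, ?_, ?_, ?_, ?_⟩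
  · rw [hcomp]
    refine LQ_le ?_
    rintro v _ ⟨hv, rfl⟩
    refine bs_mem ⟨Or.inl ⟨isE_lt hv, adm_coe_iff.2 (by omega)⟩, ?_⟩
    rcases dg_bounds v with h | h | h
    · rw [h.1] at hv; exact absurd hv (by decide)
    · exact absurd hv.1 (by omega)
    · rw [h.2, Nat.pow_succ]; omega
  · rw [hcomp, eq_bot_iff]
    refine LQ_le fun v s hs => ?_
    have h1 := adm_coe_iff.1 hs.1.adm
    have h2 := hs.2
    rw [Nat.pow_succ] at hk
    rcases dg_bounds v with h | h | h <;> omega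
  · rw [ir_toSubmodule hn', hfull, hD, hsup]
  · rw [ir_toSubmodule hn', hD]
    exact hdis
  · intro x hx y hy
    have hx' : x ∈ LQ K (Qf j n) := hfull ▸ hx
    exact (mem_ir hn').2 (lie_mem_ideal hx' ((mem_ir hn').1 hy))
  · intro x hx z hz h
    have hx' : x ∈ outerSpan K j (2 ^ n - 1) := hx
    have hz' := (mem_ir hn').1 hz
    -- If `x` acted as the inner derivation given by `z`, then their difference, which is their sum
    -- here, would centralize the derived algebra.
    have h1 : x + z = 0 := by
      refine eq_zero_of_commute hn' (j := j) ?_ fun y hy => ?_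
      · rw [← hsup]
        exact add_mem (Submodule.mem_sup_right hx') (Submodule.mem_sup_left hz')
      · rw [op_add_lie, h y ((mem_ir hn').2 hy), op_add_self]
    have h2 : x = z := by rw [← add_zero x, ← op_add_self z, ← add_assoc, h1, zero_add]
    exact (Submodule.disjoint_def.1 hdis) x (h2 ▸ hz') hx'

end Outer

/-! ### The orthogonal Lie algebras -/

section Matrices

variable {K : Type*} [Field K]

/-- The indices of the basis vectors of the `8`-dimensional space. -/
abbrev Ix : Type := Fin 4 ⊕ Fin 4

instance : LawfulBEq Ix where
  rfl {a} := by
    rcases a with a | a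
    · exact beq_self_eq_true a
    · exact beq_self_eq_true a
  eq_of_beq {a b} h := by
    rcases a with a | a <;> rcases b with b | b
    · exact congrArg _ (eq_of_beq (α := Fin 4) h)
    · exact absurd h Bool.false_ne_true
    · exact absurd h Bool.false_ne_true
    · exact congrArg _ (eq_of_beq (α := Fin 4) h)

/-- The sum of the matrix units with indices in a list. -/
noncomputable def ml (K : Type*) [Field K] (l : List (Ix × Ix)) : Mat K :=
  (l.map fun p => Matrix.single p.1 p.2 1).sum

theorem ml_nil : ml K [] = 0 := rfl

theorem ml_cons (p : Ix × Ix) (l : List (Ix × Ix)) :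
    ml K (p :: l) = Matrix.single p.1 p.2 1 + ml K l := by
  rw [ml, List.map_cons, List.sum_cons]; rfl

theorem ml_append (l l' : List (Ix × Ix)) : ml K (l ++ l') = ml K l + ml K l' := by
  rw [ml, List.map_append, List.sum_append]; rfl

theorem ml_apply (l : List (Ix × Ix)) (c d : Ix) : ml K l c d = (l.count (c, d) : K) := by
  induction l with
  | nil => simp [ml_nil]
  | cons p l ih =>
    rw [ml_cons, Matrix.add_apply, ih, List.count_cons, Matrix.single_apply, add_comm]
    rw [Nat.cast_add]
    congr 1
    by_cases h : p = (c, d)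
    · rw [if_pos (beq_iff_eq.2 h), h, if_pos ⟨rfl, rfl⟩, Nat.cast_one]
    · rw [if_neg (fun h' => h (Prod.ext h'.1 h'.2)), if_neg (mt beq_iff_eq.1 h), Nat.cast_zero]

/-- The product of sums of matrix units. -/
def mmL (l l' : List (Ix × Ix)) : List (Ix × Ix) :=
  l.flatMap fun p => l'.flatMap fun q => if p.2 = q.1 then [(p.1, q.2)] else []

theorem ml_mul (l l' : List (Ix × Ix)) : ml K l * ml K l' = ml K (mmL l l') := by
  induction l with
  | nil => simp [ml_nil, mmL]
  | cons p l ih =>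
    rw [ml_cons, add_mul, ih, mmL, mmL, List.flatMap_cons, ml_append]
    congr 1
    clear ih
    induction l' with
    | nil => simp [ml_nil]
    | cons q l' ih =>
      rw [ml_cons, mul_add, ih, List.flatMap_cons, ml_append]
      congr 1
      split_ifs with h
      · rw [ml_cons, ml_nil, add_zero, h, Matrix.single_mul_single_same, mul_one]
      · rw [ml_nil, Matrix.single_mul_single_of_ne _ _ _ _ h]

/-- The commutator of sums of matrix units, in characteristic two. -/
def cmL (l l' : List (Ix × Ix)) : List (Ix × Ix) := mmL l l' ++ mmL l' l

theorem lie_ml [CharP K 2] (l l' : List (Ix × Ix)) : ⁅ml K l, ml K l'⁆ = ml K (cmL l l') := by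
  rw [LieRing.of_associative_ring_bracket, ml_mul, ml_mul, cmL, ml_append, CharTwo.sub_eq_add]

/-- Two lists are equal up to terms that occur an even number of times. -/
def ParEq {α : Type*} [BEq α] (l l' : List α) : Prop :=
  ∀ p ∈ l ++ l', (l.count p + l'.count p) % 2 = 0

instance {α : Type*} [BEq α] (l l' : List α) : Decidable (ParEq l l') :=
  inferInstanceAs (Decidable (∀ _ ∈ _, _))

theorem ParEq.count_eq {α : Type*} [BEq α] [LawfulBEq α] [CharP K 2] {l l' : List α} (h : ParEq l l')
    (p : α) : (l.count p : K) = (l'.count p : K) := by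
  have h1 : (l.count p + l'.count p) % 2 = 0 := by
    by_cases hp : p ∈ l ++ l'
    · exact h p hp
    · rw [List.mem_append, not_or] at hp
      rw [List.count_eq_zero_of_not_mem hp.1, List.count_eq_zero_of_not_mem hp.2]
  have h2 : ((l.count p + l'.count p : ℕ) : K) = 0 :=
    (CharP.cast_eq_zero_iff K 2 _).2 (Nat.dvd_of_mod_eq_zero h1)
  push_cast at h2
  rw [← CharTwo.sub_eq_add] at h2
  exact sub_eq_zero.1 h2

theorem ParEq.ml_eq [CharP K 2] {l l' : List (Ix × Ix)} (h : ParEq l l') : ml K l = ml K l' := by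
  ext c d
  rw [ml_apply, ml_apply, h.count_eq]

/-- Multiplication by `Π` exchanges the two halves of the indices, and the sign in the defining
condition disappears in characteristic two. -/
theorem mem_oPi [CharP K 2] {M : Mat K} :
    M ∈ oPi K ↔ ∀ c d, M c d = M d.swap c.swap := by
  have h1 : M ∈ oPi K ↔ M.transpose * Matrix.fromBlocks 0 1 1 0 =
      Matrix.fromBlocks 0 1 1 0 * (-M) := by
    rw [oPi, mem_skewAdjointMatricesLieSubalgebra, mem_skewAdjointMatricesSubmodule]
    rfl
  have h2 : ∀ c d, (M.transpose * Matrix.fromBlocks 0 1 1 0 : Mat K) c d = M d.swap c := by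
    intro c d
    rw [Matrix.mul_apply, Finset.sum_eq_single d.swap]
    · rcases d with d | d <;> simp
    · intro e _ he
      rcases d with d | d <;> rcases e with e | e <;> simp at he ⊢
      · right; exact Matrix.one_apply_ne he
      · right; exact Matrix.one_apply_ne he
    · intro h; exact absurd (Finset.mem_univ _) h
  have h3 : ∀ c d, (Matrix.fromBlocks 0 1 1 0 * (-M) : Mat K) c d = M c.swap d := by
    intro c d
    rw [Matrix.mul_apply, Finset.sum_eq_single c.swap]
    · rw [Matrix.neg_apply, CharTwo.neg_eq]
      rcases c with c | c <;> simp
    · intro e _ he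
      rcases c with c | c <;> rcases e with e | e <;> simp at he ⊢
      · left; exact Matrix.one_apply_ne (Ne.symm he)
      · left; exact Matrix.one_apply_ne (Ne.symm he)
    · intro h; exact absurd (Finset.mem_univ _) h
  rw [h1]
  constructor
  · intro h c d
    have := congrFun (congrFun h d) c.swap
    rwa [h2, h3, Sum.swap_swap] at this
  · intro h
    ext c d
    rw [h2, h3, h d.swap c, Sum.swap_swap]

/-! #### The derived algebras -/

/-- The matrices of `𝔬_Π(8)` with alternating off-diagonal blocks. -/
def IsAlt (M : Mat K) : Prop := (∀ c d, M c d = M d.swap c.swap) ∧ ∀ c, M c c.swap = 0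

/-- The matrices of trace zero with alternating off-diagonal blocks. -/
def IsSl (M : Mat K) : Prop := IsAlt M ∧ ∑ a, M (Sum.inl a) (Sum.inl a) = 0

theorem sum_swap (f : Ix → K) : ∑ e : Ix, f e.swap = ∑ e, f e :=
  Equiv.sum_comp (Equiv.sumComm (Fin 4) (Fin 4)) f

/-- At a position `(c, c.swap)` the substitution `e ↦ e.swap` in the sum carries the entry of `M M'`
into that of `M' M`, so the commutator vanishes there. -/
theorem isAlt_lie [CharP K 2] {M M' : Mat K} (hM : M ∈ oPi K) (hM' : M' ∈ oPi K) :
    IsAlt ⁅M, M'⁆ := by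
  refine ⟨mem_oPi.1 ((oPi K).lie_mem hM hM'), fun c => ?_⟩
  have h := mem_oPi.1 hM
  have h' := mem_oPi.1 hM'
  rw [LieRing.of_associative_ring_bracket, Matrix.sub_apply, Matrix.mul_apply, Matrix.mul_apply,
    ← sum_swap fun e => M c e * M' e c.swap, ← Finset.sum_sub_distrib]
  refine Finset.sum_eq_zero fun e _ => ?_
  rw [h' e.swap, h e, Sum.swap_swap, Sum.swap_swap, mul_comm, sub_self]

/-- The off-diagonal blocks are symmetric with zero diagonal, so every unordered pair of indices
contributes twice. -/
theorem IsAlt.sum_eq_zero [CharP K 2] {M M' : Mat K} (h : IsAlt M) (h' : IsAlt M') :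
    ∑ a, ∑ b, M (Sum.inl a) (Sum.inr b) * M' (Sum.inr b) (Sum.inl a) = 0 := by
  have h1 : ∀ a b, M (Sum.inl a) (Sum.inr b) = M (Sum.inl b) (Sum.inr a) := fun a b => h.1 _ _
  have h2 : ∀ a b, M' (Sum.inr a) (Sum.inl b) = M' (Sum.inr b) (Sum.inl a) := fun a b => h'.1 _ _
  have h3 : ∀ a, M (Sum.inl a) (Sum.inr a) = 0 := fun a => h.2 (Sum.inl a)
  simp only [Fin.sum_univ_four, h3, zero_mul]
  rw [h1 1 0, h1 2 0, h1 3 0, h1 2 1, h1 3 1, h1 3 2, h2 1 0, h2 2 0, h2 3 0, h2 2 1, h2 3 1,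
    h2 3 2]
  ring_nf
  rw [show (2 : K) = 0 from CharTwo.two_eq_zero]
  ring

theorem mul_trace [CharP K 2] {M M' : Mat K} (h : IsAlt M) (h' : IsAlt M') :
    ∑ a, (M * M') (Sum.inl a) (Sum.inl a) =
      ∑ a, ∑ b, M (Sum.inl a) (Sum.inl b) * M' (Sum.inl b) (Sum.inl a) := by
  simp only [Matrix.mul_apply, Fintype.sum_sum_type]
  rw [Finset.sum_add_distrib, h.sum_eq_zero h', add_zero]

theorem IsAlt.isSl_lie [CharP K 2] {M M' : Mat K} (h : IsAlt M) (h' : IsAlt M')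
    (hs : IsAlt ⁅M, M'⁆) : IsSl ⁅M, M'⁆ := by
  refine ⟨hs, ?_⟩
  simp only [LieRing.of_associative_ring_bracket, Matrix.sub_apply]
  rw [Finset.sum_sub_distrib, mul_trace h h', mul_trace h' h, sub_eq_zero,
    Finset.sum_comm]
  simp only [mul_comm]

theorem mul_symm {M : Mat K} (h : ∀ c d, M c d = M d.swap c.swap) (c d : Ix) :
    (M * M) c d = (M * M) d.swap c.swap := by
  rw [Matrix.mul_apply, Matrix.mul_apply, ← sum_swap]
  refine Finset.sum_congr rfl fun e _ => ?_
  rw [h c, h e.swap, Sum.swap_swap, mul_comm]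

/-- The square of a matrix in `𝔬_Π(8)` has alternating off-diagonal blocks. -/
theorem isAlt_mul_self [CharP K 2] {M : Mat K} (h : ∀ c d, M c d = M d.swap c.swap) :
    IsAlt (M * M) := by
  refine ⟨mul_symm h, fun c => ?_⟩
  rw [Matrix.mul_apply, Fintype.sum_sum_type, ← Finset.sum_add_distrib]
  refine Finset.sum_eq_zero fun a _ => ?_
  rw [h (Sum.inl a), h (Sum.inr a), Sum.swap_swap, Sum.swap_inl, Sum.swap_inr,
    mul_comm, CharTwo.add_self_eq_zero]

/-- With a zero diagonal, the trace of the square of the first block is a sum over unordered pairs,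
each counted twice. -/
theorem IsAlt.isSl_mul_self [CharP K 2] {M : Mat K} (h : IsAlt M)
    (h0 : ∀ a, M (Sum.inl a) (Sum.inl a) = 0) : IsSl (M * M) := by
  refine ⟨isAlt_mul_self h.1, ?_⟩
  rw [mul_trace h h]
  simp only [Fin.sum_univ_four, h0]
  ring_nf
  rw [show (2 : K) = 0 from CharTwo.two_eq_zero]
  ring

/-- The elements of the standard basis: sums of two matrix units exchanged by the involution. -/
def sb (p : Ix × Ix) : List (Ix × Ix) :=
  match p with
  | (.inl a, .inl b) => [(.inl a, .inl b), (.inr b, .inr a)]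
  | (.inl a, .inr b) => if a < b then [(.inl a, .inr b), (.inl b, .inr a)] else []
  | (.inr a, .inl b) => if a < b then [(.inr a, .inl b), (.inr b, .inl a)] else []
  | _ => []

/-- The index of the element of the standard basis in which a matrix unit occurs. -/
def sbIx (p : Ix × Ix) : Ix × Ix :=
  match p with
  | (.inl a, .inl b) => (.inl a, .inl b)
  | (.inl a, .inr b) => (.inl (min a b), .inr (max a b))
  | (.inr a, .inl b) => (.inr (min a b), .inl (max a b))
  | (.inr a, .inr b) => (.inl b, .inl a)

theorem count_sb : ∀ c d : Ix, c ≠ d.swap → ∀ p,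
    (sb p).count (c, d) = if p = sbIx (c, d) then 1 else 0 := by decide +kernel

theorem count_sb_swap : ∀ c p, (sb p).count (c, Sum.swap c) = 0 := by decide +kernel

theorem apply_sbIx {M : Mat K} (h : ∀ c d, M c d = M d.swap c.swap) (p : Ix × Ix) :
    M (sbIx p).1 (sbIx p).2 = M p.1 p.2 := by
  obtain ⟨c, d⟩ := p
  rcases c with a | a <;> rcases d with b | b
  · rfl
  · rcases le_total a b with hab | hab
    · simp only [sbIx, min_eq_left hab, max_eq_right hab]
    · simp only [sbIx, min_eq_right hab, max_eq_left hab]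
      exact h _ _
  · rcases le_total a b with hab | hab
    · simp only [sbIx, min_eq_left hab, max_eq_right hab]
    · simp only [sbIx, min_eq_right hab, max_eq_left hab]
      exact h _ _
  · exact h _ _

theorem IsAlt.eq_sum {M : Mat K} (h : IsAlt M) : M = ∑ p : Ix × Ix, M p.1 p.2 • ml K (sb p) := by
  ext c d
  rw [Matrix.sum_apply]
  simp only [Matrix.smul_apply, ml_apply, smul_eq_mul]
  by_cases hcd : c = d.swap
  · subst hcd
    rw [Finset.sum_eq_zero]
    · have := h.2 d.swap
      rwa [Sum.swap_swap] at this
    · intro p _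
      have := count_sb_swap d.swap p
      rw [Sum.swap_swap] at this
      rw [this, Nat.cast_zero, mul_zero]
  · rw [Finset.sum_eq_single (sbIx (c, d))]
    · rw [count_sb c d hcd, if_pos rfl, Nat.cast_one, mul_one, apply_sbIx h.1]
    · intro p _ hp
      rw [count_sb c d hcd, if_neg hp, Nat.cast_zero, mul_zero]
    · intro h; exact absurd (Finset.mem_univ _) h

end Matrices

/-! ### Bases of the derived algebras and the extension by `I₀` -/

section Derived

variable {K : Type*} [Field K]

theorem IsAlt.zero : IsAlt (0 : Mat K) := ⟨fun _ _ => rfl, fun _ => rfl⟩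

theorem IsAlt.add {M M' : Mat K} (h : IsAlt M) (h' : IsAlt M') : IsAlt (M + M') :=
  ⟨fun c d => by rw [Matrix.add_apply, Matrix.add_apply, ← h.1, ← h'.1],
    fun c => by rw [Matrix.add_apply, h.2, h'.2, add_zero]⟩

theorem IsAlt.smul {M : Mat K} (k : K) (h : IsAlt M) : IsAlt (k • M) :=
  ⟨fun c d => by rw [Matrix.smul_apply, Matrix.smul_apply, ← h.1],
    fun c => by rw [Matrix.smul_apply, h.2, smul_zero]⟩

theorem IsSl.zero : IsSl (0 : Mat K) := ⟨IsAlt.zero, Finset.sum_eq_zero fun _ _ => rfl⟩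

theorem IsSl.add {M M' : Mat K} (h : IsSl M) (h' : IsSl M') : IsSl (M + M') := by
  refine ⟨h.1.add h'.1, ?_⟩
  simp only [Matrix.add_apply]
  rw [Finset.sum_add_distrib, h.2, h'.2, add_zero]

theorem IsSl.smul {M : Mat K} (k : K) (h : IsSl M) : IsSl (k • M) := by
  refine ⟨h.1.smul k, ?_⟩
  simp only [Matrix.smul_apply]
  rw [← Finset.smul_sum, h.2, smul_zero]

/-- The standard basis of `𝔬_Π(8)`. -/
def ob (p : Ix × Ix) : List (Ix × Ix) :=
  match p with
  | (.inl a, .inl b) => [(.inl a, .inl b), (.inr b, .inr a)]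
  | (.inl a, .inr b) => if a = b then [p] else [(.inl a, .inr b), (.inl b, .inr a)]
  | (.inr a, .inl b) => if a = b then [p] else [(.inr a, .inl b), (.inr b, .inl a)]
  | (.inr a, .inr b) => [(.inr a, .inr b), (.inl b, .inl a)]

theorem ml_ob_mem [CharP K 2] (p : Ix × Ix) : ml K (ob p) ∈ oPi K := by
  have key : ∀ (p : Ix × Ix) (c d : Ix), (ob p).count (c, d) = (ob p).count (d.swap, c.swap) := by
    decide +kernel
  refine mem_oPi.2 fun c d => ?_
  rw [ml_apply, ml_apply, key]

/-- Elements of the diagonal blocks use the single matrix units on the diagonals of the off-diagonal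
blocks, which `𝔬_Π(8)` contains and its derived algebra does not. The other elements are
eigenvectors of a torus element. -/
theorem sb_eq_lie : ∀ p : Ix × Ix, ∃ q q' : Ix × Ix, ParEq (sb p) (cmL (ob q) (ob q')) := by
  have h1 : ∀ a b : Fin 4, ParEq (sb (.inl a, .inl b))
      (cmL (ob (.inl a, .inr a)) (ob (.inr a, .inl b))) := by decide +kernel
  have h2 : ∀ a b : Fin 4, ParEq (sb (.inl a, .inr b))
      (cmL (ob (.inl a, .inl a)) (sb (.inl a, .inr b))) := by decide +kernel
  have h3 : ∀ a b : Fin 4, ParEq (sb (.inr a, .inl b))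
      (cmL (ob (.inl a, .inl a)) (sb (.inr a, .inl b))) := by decide +kernel
  have h4 : ∀ a b : Fin 4, ParEq (sb (.inr a, .inr b))
      (cmL (ob (.inl a, .inl a)) (ob (.inl a, .inl a))) := by decide +kernel
  have h5 : ∀ a b : Fin 4, sb (.inl a, .inr b) = [] ∨ sb (.inl a, .inr b) = ob (.inl a, .inr b) := by
    decide +kernel
  have h6 : ∀ a b : Fin 4, sb (.inr a, .inl b) = [] ∨ sb (.inr a, .inl b) = ob (.inr a, .inl b) := by
    decide +kernel
  rintro ⟨a | a, b | b⟩
  · exact ⟨_, _, h1 a b⟩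
  · rcases h5 a b with h | h
    · rw [h]; exact ⟨_, _, h4 a b⟩
    · have := h2 a b
      rw [h] at this ⊢
      exact ⟨_, _, this⟩
  · rcases h6 a b with h | h
    · rw [h]; exact ⟨_, _, h4 a b⟩
    · have := h3 a b
      rw [h] at this ⊢
      exact ⟨_, _, this⟩
  · exact ⟨_, _, h4 a b⟩

theorem mem_derived_oPi [CharP K 2] {M : Mat K} : M ∈ derivedSub (oPi K) ↔ IsAlt M := by
  constructor
  · intro h
    refine Submodule.span_induction (p := fun M _ => IsAlt M) ?_ IsAlt.zero
      (fun _ _ _ _ => IsAlt.add) (fun k _ _ => IsAlt.smul k) h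
    rintro _ ⟨a, ha, b, hb, rfl⟩
    exact isAlt_lie ha hb
  · intro h
    rw [h.eq_sum]
    refine Submodule.sum_mem (derivedSub (oPi K)).toSubmodule fun p _ => Submodule.smul_mem _ _ ?_
    obtain ⟨q, q', hq⟩ := sb_eq_lie p
    rw [hq.ml_eq, ← lie_ml]
    exact Submodule.subset_span ⟨_, ml_ob_mem q, _, ml_ob_mem q', rfl⟩

/-- The standard basis of the second derived algebra. -/
def sb2 (p : Ix × Ix) : List (Ix × Ix) :=
  if ∃ a : Fin 4, p = (.inl a, .inl a) then sb p ++ sb (.inl 3, .inl 3) else sb p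

theorem IsSl.eq_sum {M : Mat K} (h : IsSl M) :
    M = ∑ p : Ix × Ix, M p.1 p.2 • ml K (sb2 p) := by
  have h1 : ∀ p : Ix × Ix, M p.1 p.2 • ml K (sb2 p) = M p.1 p.2 • ml K (sb p) +
      (if ∃ a : Fin 4, p = (.inl a, .inl a) then M p.1 p.2 else 0) • ml K (sb (.inl 3, .inl 3)) := by
    intro p
    rw [sb2]
    split_ifs
    · rw [ml_append, smul_add]
    · rw [zero_smul, add_zero]
  have h2 : ∑ p : Ix × Ix, (if ∃ a : Fin 4, p = (.inl a, .inl a) then M p.1 p.2 else 0) = 0 := by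
    rw [Fintype.sum_prod_type]
    simp only [Fintype.sum_sum_type, Prod.mk.injEq, Sum.inl.injEq, reduceCtorEq, false_and, and_false,
      exists_false, if_false, Finset.sum_const_zero, add_zero]
    refine (Finset.sum_congr rfl fun a _ => ?_).trans h.2
    rw [Finset.sum_eq_single a]
    · rw [if_pos ⟨a, rfl, rfl⟩]
    · intro b _ hb
      rw [if_neg]
      rintro ⟨c, rfl, rfl⟩
      exact hb rfl
    · intro h; exact absurd (Finset.mem_univ _) h
  simp only [h1]
  rw [Finset.sum_add_distrib, ← h.1.eq_sum, ← Finset.sum_smul, h2, zero_smul, add_zero]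

theorem isAlt_sb [CharP K 2] (p : Ix × Ix) : IsAlt (ml K (sb p)) := by
  obtain ⟨q, q', hq⟩ := sb_eq_lie p
  rw [hq.ml_eq, ← lie_ml]
  exact isAlt_lie (ml_ob_mem q) (ml_ob_mem q')

/-- For distinct `a` and `b` the commutator passes through a third index: `a + 1`, or `a + 2` if `b
= a + 1`. Diagonal elements are brackets of opposite root vectors, which produces them only in
differences. -/
theorem sb2_eq_lie (p : Ix × Ix) : ∃ q q' : Ix × Ix, ParEq (sb2 p) (cmL (sb q) (sb q')) := by
  have h1 : ∀ a b : Fin 4, a ≠ b → ParEq (sb2 (.inl a, .inl b)) (if b = a + 1 then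
      cmL (sb (.inl a, .inl (a + 2))) (sb (.inl (a + 2), .inl b)) else
      cmL (sb (.inl a, .inl (a + 1))) (sb (.inl (a + 1), .inl b))) := by decide +kernel
  have h2 : ∀ a : Fin 4, ParEq (sb2 (.inl a, .inl a))
      (cmL (sb (.inl a, .inl 3)) (sb (.inl 3, .inl a))) := by decide +kernel
  have h3 : ∀ a b : Fin 4, ParEq (sb2 (.inl a, .inr b))
      (cmL (sb (.inl a, .inl a)) (sb (.inl a, .inr b))) := by decide +kernel
  have h4 : ∀ a b : Fin 4, ParEq (sb2 (.inr a, .inl b))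
      (cmL (sb (.inl a, .inl a)) (sb (.inr a, .inl b))) := by decide +kernel
  have h5 : ∀ a b : Fin 4, ParEq (sb2 (.inr a, .inr b))
      (cmL (sb (.inl a, .inl a)) (sb (.inl a, .inl a))) := by decide +kernel
  obtain ⟨a | a, b | b⟩ := p
  · by_cases hab : a = b
    · subst hab; exact ⟨_, _, h2 a⟩
    · have := h1 a b hab
      split_ifs at this
      · exact ⟨_, _, this⟩
      · exact ⟨_, _, this⟩
  · exact ⟨_, _, h3 a b⟩
  · exact ⟨_, _, h4 a b⟩
  · exact ⟨_, _, h5 a b⟩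

theorem mem_derived_derived_oPi [CharP K 2] {M : Mat K} :
    M ∈ derivedSub (derivedSub (oPi K)) ↔ IsSl M := by
  constructor
  · intro h
    refine Submodule.span_induction (p := fun M _ => IsSl M) ?_ IsSl.zero
      (fun _ _ _ _ => IsSl.add) (fun k _ _ => IsSl.smul k) h
    rintro _ ⟨a, ha, b, hb, rfl⟩
    exact (mem_derived_oPi.1 ha).isSl_lie (mem_derived_oPi.1 hb)
      (mem_derived_oPi.1 ((derivedSub (oPi K)).lie_mem ha hb))
  · intro h
    rw [h.eq_sum]
    refine Submodule.sum_mem (derivedSub (derivedSub (oPi K))).toSubmodule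
      fun p _ => Submodule.smul_mem _ _ ?_
    obtain ⟨q, q', hq⟩ := sb2_eq_lie p
    rw [hq.ml_eq, ← lie_ml]
    exact Submodule.subset_span ⟨_, mem_derived_oPi.2 (isAlt_sb q), _,
      mem_derived_oPi.2 (isAlt_sb q'), rfl⟩

theorem isSl_sb2 [CharP K 2] (p : Ix × Ix) : IsSl (ml K (sb2 p)) := by
  obtain ⟨q, q', hq⟩ := sb2_eq_lie p
  rw [hq.ml_eq, ← lie_ml, ← mem_derived_derived_oPi]
  exact Submodule.subset_span ⟨_, mem_derived_oPi.2 (isAlt_sb q), _,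
    mem_derived_oPi.2 (isAlt_sb q'), rfl⟩

theorem I0_apply (c d : Ix) : matI0 K c d = if c = d ∧ c.isLeft then 1 else 0 := by
  rcases c with c | c <;> rcases d with d | d <;> simp [matI0, Matrix.one_apply]

theorem lie_I0_apply (M : Mat K) (c d : Ix) : ⁅matI0 K, M⁆ c d =
    ((if c.isLeft then 1 else 0) - if d.isLeft then 1 else 0) * M c d := by
  rw [LieRing.of_associative_ring_bracket, Matrix.sub_apply, Matrix.mul_apply, Matrix.mul_apply,
    Finset.sum_eq_single c, Finset.sum_eq_single d, I0_apply, I0_apply]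
  · simp only [true_and]; ring
  · intro e _ he; rw [I0_apply, if_neg fun h => he h.1, mul_zero]
  · intro h; exact absurd (Finset.mem_univ _) h
  · intro e _ he; rw [I0_apply, if_neg fun h => he h.1.symm, zero_mul]
  · intro h; exact absurd (Finset.mem_univ _) h

theorem IsAlt.lie_I0 [CharP K 2] {M : Mat K} (h : IsAlt M) : IsAlt ⁅matI0 K, M⁆ := by
  refine ⟨fun c d => ?_, fun c => ?_⟩
  · rw [lie_I0_apply, lie_I0_apply, ← h.1]
    congr 1
    rcases c with c | c <;> rcases d with d | d <;> simp [CharTwo.neg_eq]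
  · rw [lie_I0_apply, h.2, mul_zero]

/-- Bracketing with `I₀` preserves the alternating condition, so adding the line spanned by `I₀`
already gives a Lie algebra. -/
theorem mem_orth_two [CharP K 2] {M : Mat K} :
    M ∈ orth K 2 ↔ ∃ c : K, IsAlt (M + c • matI0 K) := by
  have h0 : orth K 2 = LieSubalgebra.lieSpan K (Mat K)
      ((derivedSub (oPi K) : Set (Mat K)) ∪ {matI0 K}) := rfl
  constructor
  · intro h
    rw [h0] at h
    refine LieSubalgebra.lieSpan_induction K (p := fun M _ => ∃ c : K, IsAlt (M + c • matI0 K))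
      ?_ ?_ ?_ ?_ ?_ h
    · rintro M (h | rfl)
      · exact ⟨0, by rw [zero_smul, add_zero]; exact mem_derived_oPi.1 h⟩
      · exact ⟨1, by rw [one_smul, CharTwo.add_self_eq_zero]; exact IsAlt.zero⟩
    · exact ⟨0, by rw [zero_smul, add_zero]; exact IsAlt.zero⟩
    · rintro M M' - - ⟨c, hc⟩ ⟨c', hc'⟩
      refine ⟨c + c', ?_⟩
      rw [add_smul, add_add_add_comm]
      exact hc.add hc'
    · rintro k M - ⟨c, hc⟩
      refine ⟨k * c, ?_⟩
      rw [mul_smul, ← smul_add]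
      exact hc.smul k
    · rintro M M' - - ⟨c, hc⟩ ⟨c', hc'⟩
      refine ⟨0, ?_⟩
      have e : ⁅M, M'⁆ = ⁅M + c • matI0 K, M' + c' • matI0 K⁆ +
          (c • ⁅matI0 K, M' + c' • matI0 K⁆ + c' • ⁅matI0 K, M + c • matI0 K⁆) := by
        have e1 : M = (M + c • matI0 K) + c • matI0 K := by
          rw [add_assoc, CharTwo.add_self_eq_zero, add_zero]
        have e2 : M' = (M' + c' • matI0 K) + c' • matI0 K := by
          rw [add_assoc, CharTwo.add_self_eq_zero, add_zero]
        generalize M + c • matI0 K = A at *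
        generalize M' + c' • matI0 K = B at *
        rw [e1, e2, add_lie, lie_add, lie_add, smul_lie, lie_smul, smul_lie, lie_smul, lie_self,
          smul_zero, smul_zero, add_zero, ← lie_skew A (matI0 K), CharTwo.neg_eq]
        abel
      rw [zero_smul, add_zero, e]
      exact (isAlt_lie (mem_oPi.2 hc.1) (mem_oPi.2 hc'.1)).add
        ((hc'.lie_I0.smul c).add (hc.lie_I0.smul c'))
  · rintro ⟨c, hc⟩
    have e1 : M = (M + c • matI0 K) + c • matI0 K := by
      rw [add_assoc, CharTwo.add_self_eq_zero, add_zero]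
    rw [e1, h0]
    exact add_mem (LieSubalgebra.subset_lieSpan (Or.inl (mem_derived_oPi.2 hc)))
      (LieSubalgebra.smul_mem _ _ (LieSubalgebra.subset_lieSpan (Or.inr rfl)))

/-- All pairs of indices. -/
def allIx : List (Ix × Ix) :=
  ((List.finRange 4).map Sum.inl ++ (List.finRange 4).map Sum.inr) ×ˢ
    ((List.finRange 4).map Sum.inl ++ (List.finRange 4).map Sum.inr)

theorem mem_allIx (p : Ix × Ix) : p ∈ allIx := by
  obtain ⟨a | a, b | b⟩ := p <;> simp [allIx]

/-- Lists of sums of matrix units that span the algebras `orth K j`. -/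
def basL : Fin 3 → List (List (Ix × Ix)) :=
  ![(allIx.map sb2).filter (· ≠ []), (allIx.map sb).filter (· ≠ []),
    (List.finRange 4).map (fun a => (.inl a, .inl a)) :: (allIx.map sb).filter (· ≠ [])]

theorem ml_I0 : ml K ((List.finRange 4).map fun a => (.inl a, .inl a)) = matI0 K := by
  have key : ∀ c d : Ix, ((List.finRange 4).map fun a => ((.inl a, .inl a) : Ix × Ix)).count (c, d) =
      if c = d ∧ c.isLeft then 1 else 0 := by decide +kernel
  ext c d
  rw [ml_apply, key, I0_apply]
  split_ifs <;> simp

/-- The span of the sums of matrix units with indices in given lists. -/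
noncomputable def mlSpan (K : Type*) [Field K] (B : List (List (Ix × Ix))) : Submodule K (Mat K) :=
  Submodule.span K {M | ∃ l ∈ B, M = ml K l}

theorem ml_mem_mlSpan {B : List (List (Ix × Ix))} {l : List (Ix × Ix)} (h : l ∈ B.filter (· ≠ []) ∨ l = []) :
    ml K l ∈ mlSpan K (B.filter (· ≠ [])) := by
  rcases h with h | rfl
  · exact Submodule.subset_span ⟨l, h, rfl⟩
  · rw [ml_nil]; exact zero_mem _

theorem mem_filter_or {B : List (List (Ix × Ix))} {l : List (Ix × Ix)} (h : l ∈ B) :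
    l ∈ B.filter (· ≠ []) ∨ l = [] := by
  by_cases hl : l = []
  · exact Or.inr hl
  · exact Or.inl (List.mem_filter.2 ⟨h, by simpa using hl⟩)

theorem orth_le_mlSpan [CharP K 2] (j : Fin 3) {M : Mat K} (h : M ∈ orth K j) :
    M ∈ mlSpan K (basL j) := by
  have h1 : ∀ M : Mat K, IsAlt M → M ∈ mlSpan K (basL 1) := fun M hM => by
    rw [hM.eq_sum]
    exact Submodule.sum_mem _ fun p _ => Submodule.smul_mem _ _
      (ml_mem_mlSpan (mem_filter_or (List.mem_map_of_mem (mem_allIx p))))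
  fin_cases j
  · have h2 := mem_derived_derived_oPi.1 h
    rw [h2.eq_sum]
    exact Submodule.sum_mem _ fun p _ => Submodule.smul_mem _ _
      (ml_mem_mlSpan (mem_filter_or (List.mem_map_of_mem (mem_allIx p))))
  · exact h1 M (mem_derived_oPi.1 h)
  · obtain ⟨c, hc⟩ := mem_orth_two.1 h
    have e1 : M = (M + c • matI0 K) + c • matI0 K := by
      rw [add_assoc, CharTwo.add_self_eq_zero, add_zero]
    rw [e1]
    refine add_mem ?_ (Submodule.smul_mem _ _ (Submodule.subset_span ⟨_, List.mem_cons_self, ml_I0.symm⟩))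
    refine Submodule.span_mono ?_ (h1 _ hc)
    rintro _ ⟨l, hl, rfl⟩
    exact ⟨l, List.mem_cons_of_mem _ hl, rfl⟩

theorem orth_le_two [CharP K 2] (j : Fin 3) {M : Mat K} (h : M ∈ orth K j) : M ∈ orth K 2 := by
  have h1 : ∀ M : Mat K, IsAlt M → M ∈ orth K 2 := fun M hM =>
    mem_orth_two.2 ⟨0, by rwa [zero_smul, add_zero]⟩
  fin_cases j
  · exact h1 M (mem_derived_derived_oPi.1 h).1
  · exact h1 M (mem_derived_oPi.1 h)
  · exact h

theorem orth_zero_le [CharP K 2] (j : Fin 3) {M : Mat K} (h : IsSl M) : M ∈ orth K j := by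
  fin_cases j
  · exact mem_derived_derived_oPi.2 h
  · exact mem_derived_oPi.2 h.1
  · exact mem_orth_two.2 ⟨0, by rw [zero_smul, add_zero]; exact h.1⟩

end Derived

/-! ### Matrices as vector fields -/

section Fields

variable {K : Type*} [Field K]

/-- The permutations of the three nodes next to the branching node. -/
def nodePerm : Fin 6 → Fin 3 → Fin 3 :=
  ![![0, 1, 2], ![0, 2, 1], ![1, 0, 2], ![1, 2, 0], ![2, 0, 1], ![2, 1, 0]]

/-- The permutations of root vectors that result from permutations of nodes. -/
def rootPerm (τ : Fin 6) : Fin 18 → Fin 18 :=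
  ![0, 1, ![2, 3, 4] (nodePerm τ 0), ![2, 3, 4] (nodePerm τ 1), ![2, 3, 4] (nodePerm τ 2),
    ![7, 6, 5] (nodePerm τ 2), ![7, 6, 5] (nodePerm τ 1), ![7, 6, 5] (nodePerm τ 0), 8,
    ![9, 11, 13] (nodePerm τ 0), ![10, 12, 14] (nodePerm τ 0),
    ![9, 11, 13] (nodePerm τ 1), ![10, 12, 14] (nodePerm τ 1),
    ![9, 11, 13] (nodePerm τ 2), ![10, 12, 14] (nodePerm τ 2), 15, 16, 17]

/-- The field that corresponds to an off-diagonal element of the standard basis. -/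
def rootField (p : Ix × Ix) : Fin 18 × ℕ :=
  match p with
  | (.inl a, .inl b) => (![![0, 10, 2, 5], ![9, 0, 1, 3], ![7, 8, 0, 12], ![4, 6, 11, 0]] a b,
      if a.val < 2 ∧ 2 ≤ b.val then 1 else 0)
  | (.inl a, .inr b) => (![![0, 15, 8, 6], ![0, 0, 7, 4], ![0, 0, 0, 14], ![0, 0, 0, 0]] a b,
      if a.val < 2 then 1 else 0)
  | (.inr a, .inl b) => (![![0, 0, 1, 3], ![0, 0, 2, 5], ![0, 0, 0, 13], ![0, 0, 0, 0]] a b, 0)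
  | _ => (0, 0)

/-- The diagonal fields. -/
def diagField (τ : Fin 6) (i : Fin 3) : List (Fin 18 × ℕ) :=
  ![[(16, 0)], [(17, 0)], [(15, 0), (16, 0), (17, 0)]] (nodePerm τ i)

/-- The field that corresponds to `I₀`. -/
def fieldI0 (τ : Fin 6) : List (Fin 18 × ℕ) := (0, 1) :: diagField τ 2

/-- The coefficients of a matrix entry in the corresponding field. -/
def thL (τ : Fin 6) (p : Ix × Ix) : List (Fin 18 × ℕ) :=
  if p.1 = p.2 then
    -- The entries at `.inl 0` and `.inr 0` differ by the coefficient of `I₀`. The terms `fieldI0 τ`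
    -- cancel if the two entries agree, and the four first entries of `I₀` add up to `fieldI0 τ`.
    match p.1 with
    | .inl a => ![(0, 1) :: diagField τ 0 ++ fieldI0 τ, (0, 1) :: (15, 0) :: diagField τ 0,
        diagField τ 0, (15, 0) :: diagField τ 0] a
    | .inr a => if a = 0 then fieldI0 τ else []
  else if sb p = [] then [] else
    match p with
    | (.inr _, .inr _) => []
    | _ => [(rootPerm τ (rootField p).1, (rootField p).2)]

/-- The vector field that corresponds to a matrix. -/
noncomputable def theta (K : Type*) [Field K] (τ : Fin 6) : Mat K →ₗ[K] Op K :=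
  (Fintype.linearCombination K fun p : Ix × Ix => bsl K (thL τ p)).comp
    (LinearMap.pi fun p : Ix × Ix => Matrix.entryLinearMap K K p.1 p.2)

theorem theta_apply (τ : Fin 6) (M : Mat K) :
    theta K τ M = ∑ p : Ix × Ix, M p.1 p.2 • bsl K (thL τ p) := by
  rw [theta, LinearMap.comp_apply, Fintype.linearCombination_apply]
  exact Finset.sum_congr rfl fun p _ => by
    rw [LinearMap.pi_apply, Matrix.entryLinearMap_apply]

theorem theta_single (τ : Fin 6) (p : Ix × Ix) :
    theta K τ (Matrix.single p.1 p.2 1) = bsl K (thL τ p) := by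
  rw [theta_apply, Finset.sum_eq_single p]
  · rw [Matrix.single_apply, if_pos ⟨rfl, rfl⟩, one_smul]
  · intro q _ hq
    rw [Matrix.single_apply, if_neg fun h => hq (Prod.ext h.1.symm h.2.symm), zero_smul]
  · intro h; exact absurd (Finset.mem_univ _) h

theorem theta_ml (τ : Fin 6) (l : List (Ix × Ix)) :
    theta K τ (ml K l) = bsl K (l.flatMap (thL τ)) := by
  induction l with
  | nil => rw [ml_nil, map_zero]; rfl
  | cons p l ih => rw [ml_cons, map_add, ih, theta_single, List.flatMap_cons, bsl_append]

/-- The bracket of sums of basis fields. -/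
def brLL (l l' : List (Fin 18 × ℕ)) : List (Fin 18 × ℕ) :=
  l.flatMap fun x => l'.flatMap fun y => brB x y

theorem lie_bsl [CharP K 2] {l l' : List (Fin 18 × ℕ)} (h : ∀ x ∈ l, 16 ≤ x.1.val → x.2 = 0)
    (h' : ∀ x ∈ l', 16 ≤ x.1.val → x.2 = 0) : ⁅bsl K l, bsl K l'⁆ = bsl K (brLL l l') := by
  induction l with
  | nil => exact op_zero_lie _
  | cons x l ih =>
    rw [bsl_cons, op_add_lie, ih fun y hy => h y (List.mem_cons_of_mem _ hy), brLL, brLL,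
      List.flatMap_cons, bsl_append]
    congr 1
    clear ih
    have hx := h x List.mem_cons_self
    clear h
    induction l' with
    | nil => exact op_lie_zero _
    | cons y l' ih =>
      rw [bsl_cons, op_lie_add, ih fun y hy => h' y (List.mem_cons_of_mem _ hy), List.flatMap_cons,
        bsl_append, lie_bs hx (h' y List.mem_cons_self)]

theorem bsl_eq_of_normL [CharP K 2] {l l' : List (Fin 18 × ℕ)} (h : normL (l ++ l') = []) :
    bsl K l = bsl K l' := by
  have h1 := bsl_normL (K := K) (l ++ l')
  rw [h, bsl_append] at h1
  have h2 : bsl K l + bsl K l' + bsl K l' = bsl K l' := by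
    rw [← h1]; exact zero_add _
  rwa [add_assoc, op_add_self, add_zero] at h2

theorem thL_const : ∀ (τ : Fin 6) (p : Ix × Ix), ∀ x ∈ thL τ p, 16 ≤ x.1.val → x.2 = 0 := by
  decide +kernel

-- By bilinearity the spanning matrices suffice for multiplicativity of `theta`. The largest of the
-- three algebras contains the others, so one check per permutation of nodes serves all of them.
set_option maxRecDepth 10000 in
theorem thL_cmL : ∀ τ : Fin 6, ∀ l ∈ basL 2, ∀ l' ∈ basL 2,
    normL ((cmL l l').flatMap (thL τ) ++ brLL (l.flatMap (thL τ)) (l'.flatMap (thL τ))) = [] := by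
  decide +kernel

theorem flatMap_const {τ : Fin 6} {l : List (Ix × Ix)} :
    ∀ x ∈ l.flatMap (thL τ), 16 ≤ x.1.val → x.2 = 0 := fun x hx => by
  obtain ⟨p, -, hp⟩ := List.mem_flatMap.1 hx
  exact thL_const τ p x hp

theorem theta_lie [CharP K 2] (τ : Fin 6) {M M' : Mat K} (h : M ∈ orth K 2) (h' : M' ∈ orth K 2) :
    theta K τ ⁅M, M'⁆ = ⁅theta K τ M, theta K τ M'⁆ := by
  have hM := orth_le_mlSpan 2 h
  have hM' := orth_le_mlSpan 2 h'
  clear h h'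
  have key : ∀ l ∈ basL 2, theta K τ ⁅ml K l, M'⁆ = ⁅theta K τ (ml K l), theta K τ M'⁆ := by
    intro l hl
    refine Submodule.span_induction
      (p := fun M' _ => theta K τ ⁅ml K l, M'⁆ = ⁅theta K τ (ml K l), theta K τ M'⁆) ?_ ?_ ?_ ?_ hM'
    · rintro _ ⟨l', hl', rfl⟩
      rw [lie_ml, theta_ml, theta_ml, theta_ml, lie_bsl flatMap_const flatMap_const]
      exact bsl_eq_of_normL (thL_cmL τ l hl l' hl')
    · rw [lie_zero, map_zero, op_lie_zero]
    · intro a b _ _ ha hb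
      rw [lie_add, map_add, map_add, ha, hb, op_lie_add]
    · intro c a _ ha
      rw [lie_smul, map_smul, map_smul, ha, op_lie_smul]
  refine Submodule.span_induction
    (p := fun M _ => theta K τ ⁅M, M'⁆ = ⁅theta K τ M, theta K τ M'⁆) ?_ ?_ ?_ ?_ hM
  · rintro _ ⟨l, hl, rfl⟩
    exact key l hl
  · rw [zero_lie, map_zero, op_zero_lie]
  · intro a b _ _ ha hb
    rw [add_lie, map_add, map_add, ha, hb, op_add_lie]
  · intro c a _ ha
    rw [smul_lie, map_smul, map_smul, ha, op_smul_lie]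

end Fields

/-! ### The isomorphism of matrices modulo the center with vector fields -/

section Isomorphism

variable {K : Type*} [Field K]

theorem Qc_one_iff {j : Fin 3} {v : Fin 18} {s : ℕ} : Qc j 1 v s ↔
    ((v.val < 16 ∧ s < 2) ∧ (isE v → s + 1 < 2)) ∨ (16 ≤ v.val ∧ v.val < 16 + j.val ∧ s = 0) := by
  simp only [Qc, Qi, Qt, adm_one_iff]

/-- The graded isomorphism uses the trivial permutation of nodes; the others are needed for the
second derived algebra only, where they serve to match parities. -/
theorem thL_mem : ∀ (τ : Fin 6) (j : Fin 3), j = 0 ∨ τ = 0 → ∀ l ∈ basL j,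
    ∀ x ∈ normL (l.flatMap (thL τ)), ((x.1.val < 16 ∧ x.2 < 2) ∧ (isE x.1 → x.2 + 1 < 2)) ∨
      (16 ≤ x.1.val ∧ x.1.val < 16 + j.val ∧ x.2 = 0) := by
  decide +kernel

theorem theta_mem [CharP K 2] {τ : Fin 6} {j : Fin 3} (hj : j = 0 ∨ τ = 0) {M : Mat K}
    (h : M ∈ orth K j) : theta K τ M ∈ LQ K (Qc j 1) := by
  have h1 : mlSpan K (basL j) ≤ (LQ K (Qc j 1)).comap (theta K τ) := by
    refine Submodule.span_le.2 ?_
    rintro _ ⟨l, hl, rfl⟩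
    change theta K τ (ml K l) ∈ LQ K (Qc j 1)
    rw [theta_ml, ← bsl_normL]
    exact bsl_mem fun x hx => bs_mem (Qc_one_iff.2 (thL_mem τ j hj l hl x hx))
  exact h1 (orth_le_mlSpan j h)

/-- The image of `orth K j` in the Lie algebra of vector fields. -/
noncomputable def imageSub (K : Type*) [Field K] (τ : Fin 6) (j : Fin 3) : Submodule K (Op K) :=
  (orth K j).toSubmodule.map (theta K τ)

theorem imageSub_lie [CharP K 2] (τ : Fin 6) (j : Fin 3) : ∀ a ∈ imageSub K τ j,
    ∀ b ∈ imageSub K τ j, ⁅a, b⁆ ∈ imageSub K τ j := by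
  rintro _ ⟨a, ha, rfl⟩ _ ⟨b, hb, rfl⟩
  rw [← theta_lie τ (orth_le_two j ha) (orth_le_two j hb)]
  exact ⟨_, (orth K j).lie_mem ha hb, rfl⟩

theorem bs_mem_imageSub [CharP K 2] (τ : Fin 6) (j : Fin 3) {x : Fin 18 × ℕ} {p : Ix × Ix}
    (h : normL ((sb2 p).flatMap (thL τ) ++ [x]) = []) : bs K x.1 x.2 ∈ imageSub K τ j := by
  refine ⟨ml K (sb2 p), orth_zero_le j (isSl_sb2 p), ?_⟩
  rw [theta_ml, bsl_eq_of_normL h, bsl_cons]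
  simp [bsl]

theorem exists_sb2 : ∀ (τ : Fin 6), ∀ x ∈ ([(9, 0), (10, 0), (11, 0), (12, 0), (13, 0), (14, 0),
    (8, 0), (1, 1)] : List (Fin 18 × ℕ)), ∃ p, normL ((sb2 p).flatMap (thL τ) ++ [x]) = [] := by
  decide +kernel

theorem chev_mem_imageSub [CharP K 2] (τ : Fin 6) (j : Fin 3) (i : Fin 4) :
    chevPlus K i ∈ imageSub K τ j ∧ chevMinus K i ∈ imageSub K τ j := by
  have h : ∀ x ∈ ([(9, 0), (10, 0), (11, 0), (12, 0), (13, 0), (14, 0), (8, 0), (1, 1)] :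
      List (Fin 18 × ℕ)), bs K x.1 x.2 ∈ imageSub K τ j := fun x hx => by
    obtain ⟨p, hp⟩ := exists_sb2 τ x hx
    exact bs_mem_imageSub τ j hp
  fin_cases i
  · exact ⟨chevPlus_zero (K := K) ▸ h (10, 0) (by simp), chevMinus_zero (K := K) ▸ h (9, 0) (by simp)⟩
  · exact ⟨chevPlus_one (K := K) ▸ h (1, 1) (by simp), chevMinus_one (K := K) ▸ h (8, 0) (by simp)⟩
  · exact ⟨chevPlus_two (K := K) ▸ h (12, 0) (by simp), chevMinus_two (K := K) ▸ h (11, 0) (by simp)⟩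
  · exact ⟨chevPlus_three (K := K) ▸ h (14, 0) (by simp), chevMinus_three (K := K) ▸ h (13, 0) (by simp)⟩

theorem extraTorus_subset_imageSub [CharP K 2] (j : Fin 3) :
    extraTorus K j ⊆ imageSub K 0 j := by
  have h1 : ∀ j, (∀ M : Mat K, IsAlt M → M ∈ orth K j) → tor1 K ∈ imageSub K 0 j := fun j hj => by
    refine ⟨ml K (sb (.inl 0, .inl 0)), hj _ (isAlt_sb _), ?_⟩
    rw [theta_ml, bsl_eq_of_normL (l' := [(0, 1), (16, 0)]) (by decide +kernel), tor1_eq]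
    simp [bsl]
  have h2 : ∀ M : Mat K, IsAlt M → M ∈ orth K 2 := fun M hM =>
    orth_le_two 1 (mem_derived_oPi.2 hM)
  fin_cases j
  · exact Set.empty_subset _
  · rintro _ rfl
    exact h1 1 fun M hM => mem_derived_oPi.2 hM
  · rintro _ (rfl | rfl)
    · exact h1 2 h2
    · refine ⟨ml K ((List.finRange 4).map (fun a => (.inl a, .inl a)) ++ sb (.inl 3, .inl 3)), ?_, ?_⟩
      · rw [ml_append, ml_I0]
        refine add_mem (mem_orth_two.2 ⟨1, ?_⟩) (h2 _ (isAlt_sb _))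
        rw [one_smul, CharTwo.add_self_eq_zero]
        exact IsAlt.zero
      · rw [theta_ml, bsl_eq_of_normL (l' := [(0, 1), (17, 0)]) (by decide +kernel), tor2_eq]
        simp [bsl]

theorem imageSub_eq [CharP K 2] {τ : Fin 6} {j : Fin 3} (hj : j = 0 ∨ τ = 0) :
    imageSub K τ j = (branchAlg K j).toSubmodule := by
  apply le_antisymm
  · rintro _ ⟨M, hM, rfl⟩
    rw [branchAlg_eq]
    exact theta_mem hj hM
  · have h : branchAlg K j ≤ algOf (imageSub K τ j) (imageSub_lie τ j) := by
      refine LieSubalgebra.lieSpan_le.2 ?_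
      rintro x ((⟨i, rfl⟩ | ⟨i, rfl⟩) | hx)
      · exact (chev_mem_imageSub τ j i).1
      · exact (chev_mem_imageSub τ j i).2
      · rcases hj with rfl | rfl
        · exact absurd hx (Set.notMem_empty x)
        · exact extraTorus_subset_imageSub j hx
    exact h

theorem orth_swap [CharP K 2] {M : Mat K} (h : M ∈ orth K 2) (c : Ix) : M c c.swap = 0 := by
  obtain ⟨k, hk⟩ := mem_orth_two.1 h
  have h1 := hk.2 c
  rw [Matrix.add_apply, Matrix.smul_apply, I0_apply, if_neg] at h1
  · simpa using h1
  · rcases c with c | c <;> simp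

theorem orth_sbIx [CharP K 2] {M : Mat K} (h : M ∈ orth K 2) {c d : Ix} (hcd : c ≠ d) :
    M (sbIx (c, d)).1 (sbIx (c, d)).2 = M c d := by
  obtain ⟨k, hk⟩ := mem_orth_two.1 h
  have h1 := apply_sbIx hk.1 (c, d)
  have h2 : ∀ c d : Ix, c ≠ d → (sbIx (c, d)).1 ≠ (sbIx (c, d)).2 := by decide +kernel
  rw [Matrix.add_apply, Matrix.add_apply, Matrix.smul_apply, Matrix.smul_apply, I0_apply, I0_apply,
    if_neg fun h => h2 c d hcd h.1, if_neg fun h => hcd h.1] at h1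
  simpa using h1

theorem count_thL : ∀ (τ : Fin 6) (c d : Ix), c ≠ d → c ≠ d.swap → ∀ p, (thL τ p).count
    (rootPerm τ (rootField (sbIx (c, d))).1, (rootField (sbIx (c, d))).2) =
      if p = sbIx (c, d) then 1 else 0 := by
  decide +kernel

/-- Outside the positions `(c, c.swap)`, which are zero, every off-diagonal entry is a coordinate of
the image (`count_thL`). -/
theorem apply_of_theta_eq_zero [CharP K 2] {τ : Fin 6} {M : Mat K} (h : M ∈ orth K 2)
    (h0 : theta K τ M = 0) {c d : Ix} (hcd : c ≠ d) : M c d = 0 := by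
  by_cases hs : c = d.swap
  · subst hs
    have := orth_swap h d.swap
    rwa [Sum.swap_swap] at this
  · rw [← orth_sbIx h hcd]
    have h1 := congrArg (crd (rootPerm τ (rootField (sbIx (c, d))).1)
      (rootField (sbIx (c, d))).2) h0
    rw [map_zero, theta_apply, map_sum, Finset.sum_eq_single (sbIx (c, d))] at h1
    · rwa [map_smul, crd_bsl, count_thL τ c d hcd hs, if_pos rfl, Nat.cast_one, smul_eq_mul,
        mul_one] at h1
    · intro p _ hp
      rw [map_smul, crd_bsl, count_thL τ c d hcd hs, if_neg hp, Nat.cast_zero, smul_zero]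
    · intro h; exact absurd (Finset.mem_univ _) h

theorem count_sb2 : ∀ c d : Ix, c ≠ d → c ≠ d.swap → (sb2 (sbIx (c, d))).count (c, d) = 1 := by
  decide +kernel

theorem lie_diag_apply {M M' : Mat K} (h : ∀ c d, c ≠ d → M c d = 0) (c d : Ix) :
    ⁅M, M'⁆ c d = (M c c - M d d) * M' c d := by
  rw [LieRing.of_associative_ring_bracket, Matrix.sub_apply, Matrix.mul_apply, Matrix.mul_apply,
    Finset.sum_eq_single c, Finset.sum_eq_single d]
  · ring
  · intro e _ he; rw [h e d he, mul_zero]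
  · intro h; exact absurd (Finset.mem_univ _) h
  · intro e _ he; rw [h c e he.symm, zero_mul]
  · intro h; exact absurd (Finset.mem_univ _) h

theorem exists_third : ∀ c : Ix, ∃ e, c ≠ e ∧ c ≠ Sum.swap e ∧ e ≠ Sum.swap c ∧ e ≠ Sum.swap (Sum.swap c) := by
  decide +kernel

/-- The kernel consists of scalar matrices. -/
theorem lie_eq_zero_of_theta [CharP K 2] {τ : Fin 6} {M : Mat K} (h : M ∈ orth K 2)
    (h0 : theta K τ M = 0) (M' : Mat K) : ⁅M, M'⁆ = 0 := by
  have hd := fun c d => apply_of_theta_eq_zero (c := c) (d := d) h h0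
  -- The bracket of the diagonal matrix `M` with a root vector is again in the kernel, and its
  -- off-diagonal entry is a difference of diagonal entries of `M`.
  have h1 : ∀ c d : Ix, c ≠ d → c ≠ d.swap → M c c - M d d = 0 := by
    intro c d hcd hs
    have hm := orth_zero_le 2 (isSl_sb2 (K := K) (sbIx (c, d)))
    have h2 := apply_of_theta_eq_zero (τ := τ) ((orth K 2).lie_mem h hm)
      (by rw [theta_lie τ h hm, h0, op_zero_lie]) hcd
    rwa [lie_diag_apply hd, ml_apply, count_sb2 c d hcd hs, Nat.cast_one, mul_one] at h2
  have h2 : ∀ c d, M c c - M d d = 0 := by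
    intro c d
    by_cases hcd : c = d
    · rw [hcd, sub_self]
    by_cases hs : c = d.swap
    -- No root vector joins an index to its opposite, so these two are compared through a third
    -- index.
    · obtain ⟨e, he1, he2, he3, he4⟩ := exists_third c
      obtain rfl : d = c.swap := by rw [hs, Sum.swap_swap]
      have a1 := h1 c e he1 he2
      have a2 := h1 e c.swap he3 he4
      rw [← sub_add_sub_cancel _ (M e e), a1, a2, add_zero]
    · exact h1 c d hcd hs
  ext c d
  rw [lie_diag_apply hd, h2, zero_mul]
  rfl

theorem theta_mem_branchAlg [CharP K 2] {τ : Fin 6} {j : Fin 3} (hj : j = 0 ∨ τ = 0) {M : Mat K}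
    (h : M ∈ orth K j) : theta K τ M ∈ branchAlg K j := by
  have : theta K τ M ∈ imageSub K τ j := ⟨M, h, rfl⟩
  rw [imageSub_eq hj] at this
  exact this

/-- The homomorphism of Lie algebras given by a linear map. -/
noncomputable def homOf (T : Mat K →ₗ[K] Op K) (L : LieSubalgebra K (Mat K))
    (L' : LieSubalgebra K (Op K)) (h : ∀ x ∈ L, T x ∈ L')
    (hl : ∀ x ∈ L, ∀ y ∈ L, T ⁅x, y⁆ = ⁅T x, T y⁆) : L →ₗ⁅K⁆ L' where
  toFun x := ⟨T x, h x x.2⟩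
  map_add' x y := Subtype.ext (map_add T (x : Mat K) y)
  map_smul' c x := Subtype.ext (map_smul T c (x : Mat K))
  map_lie' {x y} := Subtype.ext (hl x x.2 y y.2)

/-- The homomorphism from a Lie algebra of matrices onto a Lie algebra of vector fields. -/
noncomputable def phi (K : Type*) [Field K] [CharP K 2] (τ : Fin 6) (j : Fin 3)
    (hj : j = 0 ∨ τ = 0) : orth K j →ₗ⁅K⁆ branchAlg K j :=
  homOf (theta K τ) _ _ (fun _ h => theta_mem_branchAlg hj h)
    fun _ h _ h' => theta_lie τ (orth_le_two j h) (orth_le_two j h')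

theorem phi_coe [CharP K 2] {τ : Fin 6} {j : Fin 3} (hj : j = 0 ∨ τ = 0) (x : orth K j) :
    (phi K τ j hj x : Op K) = theta K τ x := rfl

theorem phi_surjective [CharP K 2] {τ : Fin 6} {j : Fin 3} (hj : j = 0 ∨ τ = 0) :
    Function.Surjective (phi K τ j hj) := by
  rintro ⟨y, hy⟩
  have : y ∈ imageSub K τ j := by rw [imageSub_eq hj]; exact hy
  obtain ⟨M, hM, rfl⟩ := this
  exact ⟨⟨M, hM⟩, rfl⟩

/-- Kernel elements are scalar matrices. Conversely, the image of a central element commutes with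
the simple algebra `𝔦𝔯(9; (1, …, 1))`, whose centralizer is trivial. -/
theorem phi_eq_zero_iff [CharP K 2] {τ : Fin 6} {j : Fin 3} (hj : j = 0 ∨ τ = 0) (x : orth K j) :
    phi K τ j hj x = 0 ↔ ∀ y : orth K j, ⁅(y : Mat K), (x : Mat K)⁆ = 0 := by
  constructor
  · intro h y
    have h0 : theta K τ x = 0 := congrArg Subtype.val h
    rw [← lie_skew, lie_eq_zero_of_theta (orth_le_two j x.2) h0, neg_zero]
  · intro h
    refine Subtype.ext ?_
    refine eq_zero_of_commute (n := 1) one_ne_zero (j := j)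
      (LQ_mono (fun _ _ => Qc.qf) (theta_mem hj x.2)) fun y hy => ?_
    have hy' : y ∈ imageSub K τ j := by
      rw [imageSub_eq hj, branchAlg_eq]; exact LQ_Qi_le j hy
    obtain ⟨M, hM, rfl⟩ := hy'
    rw [phi_coe, ← theta_lie τ (orth_le_two j x.2) (orth_le_two j hM), ← lie_skew, h ⟨M, hM⟩,
      neg_zero, map_zero]

theorem phi_ker [CharP K 2] {τ : Fin 6} {j : Fin 3} (hj : j = 0 ∨ τ = 0) :
    (phi K τ j hj).ker = LieAlgebra.center K (orth K j) := by
  ext x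
  rw [LieHom.mem_ker, phi_eq_zero_iff, LieModule.mem_maxTrivSubmodule]
  exact forall_congr' fun y => ⟨fun h => Subtype.ext h, fun h => congrArg Subtype.val h⟩

theorem matPlus_eq (i : Fin 4) : matPlus K i = ml K (sb
    ((![(.inl 0, .inl 1), (.inl 1, .inl 2), (.inl 2, .inl 3), (.inl 2, .inr 3)] :
      Fin 4 → Ix × Ix) i)) := by
  fin_cases i <;> simp [matPlus, sb, ml]

theorem matMinus_eq (i : Fin 4) : matMinus K i = ml K (sb
    ((![(.inl 1, .inl 0), (.inl 2, .inl 1), (.inl 3, .inl 2), (.inr 2, .inl 3)] :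
      Fin 4 → Ix × Ix) i)) := by
  fin_cases i <;> simp [matMinus, matPlus, sb, ml, Matrix.transpose_add, Matrix.transpose_single,
    add_comm]

theorem thL_deg : ∀ (p : Ix × Ix), ∀ x ∈ thL 0 p,
    dg x.1 + 2 * x.2 = vecDeg p.1 - vecDeg p.2 ∧ x.2 < 2 := by decide +kernel

theorem theta_mem_vectDeg [CharP K 2] {k : ℤ} {M : Mat K} (h : M ∈ matDeg K k) :
    theta K 0 M ∈ vectDeg K (shear 1) k := by
  refine LQ_le_vectDeg (Q := fun _ s => s < 2) (shear_ne_zero one_ne_zero)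
    (fun _ _ h => adm_one_iff.2 h) ?_
  rw [theta_apply]
  refine Submodule.sum_mem _ fun p _ => ?_
  by_cases hp : M p.1 p.2 = 0
  · rw [hp, zero_smul]; exact zero_mem _
  · refine Submodule.smul_mem _ _ (bsl_mem fun x hx => bs_mem ?_)
    obtain ⟨h1, h2⟩ := thL_deg p x hx
    exact ⟨h2, by rw [h1, h _ _ hp]⟩

theorem exists_hom_of_orth [CharP K 2] (j : Fin 3) : ∃ φ : orth K j →ₗ⁅K⁆ branchAlg K j,
      Function.Surjective φ ∧ φ.ker = LieAlgebra.center K (orth K j) ∧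
      (∀ i, ∃ h : matPlus K i ∈ orth K j, (φ ⟨matPlus K i, h⟩ : Op K) = chevPlus K i) ∧
      (∀ i, ∃ h : matMinus K i ∈ orth K j, (φ ⟨matMinus K i, h⟩ : Op K) = chevMinus K i) ∧
      (∀ (k : ℤ) (x : orth K j), (x : Mat K) ∈ matDeg K k →
        (φ x : Op K) ∈ vectDeg K (shear 1) k) := by
  have hsl : ∀ c d : Fin 4, c ≠ d → IsSl (ml K (sb (.inl c, .inl d))) := fun c d h => by
    have := isSl_sb2 (K := K) (.inl c, .inl d)
    rwa [sb2, if_neg] at this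
    rintro ⟨a, ha⟩
    simp only [Prod.mk.injEq, Sum.inl.injEq] at ha
    exact h (ha.1.trans ha.2.symm)
  have hsl' : IsSl (ml K (sb (.inl 2, .inr 3))) ∧ IsSl (ml K (sb (.inr 2, .inl 3))) := by
    have h1 := isSl_sb2 (K := K) (.inl 2, .inr 3)
    have h2 := isSl_sb2 (K := K) (.inr 2, .inl 3)
    rw [sb2, if_neg (by simp)] at h1 h2
    exact ⟨h1, h2⟩
  refine ⟨phi K 0 j (Or.inr rfl), phi_surjective _, phi_ker _, fun i => ?_, fun i => ?_,
    fun k x hx => theta_mem_vectDeg hx⟩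
  · refine ⟨orth_zero_le j ?_, ?_⟩
    · rw [matPlus_eq]
      fin_cases i
      · exact hsl 0 1 (by decide)
      · exact hsl 1 2 (by decide)
      · exact hsl 2 3 (by decide)
      · exact hsl'.1
    · rw [phi_coe]
      change theta K 0 (matPlus K i) = _
      rw [matPlus_eq, theta_ml]
      fin_cases i
      · rw [bsl_eq_of_normL (l' := [(10, 0)]) (by decide +kernel)]
        simp [bsl, ← chevPlus_zero]
      · rw [bsl_eq_of_normL (l' := [(1, 1)]) (by decide +kernel)]
        simp [bsl, ← chevPlus_one]
      · rw [bsl_eq_of_normL (l' := [(12, 0)]) (by decide +kernel)]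
        simp [bsl, ← chevPlus_two]
      · rw [bsl_eq_of_normL (l' := [(14, 0)]) (by decide +kernel)]
        simp [bsl, ← chevPlus_three]
  · refine ⟨orth_zero_le j ?_, ?_⟩
    · rw [matMinus_eq]
      fin_cases i
      · exact hsl 1 0 (by decide)
      · exact hsl 2 1 (by decide)
      · exact hsl 3 2 (by decide)
      · exact hsl'.2
    · rw [phi_coe]
      change theta K 0 (matMinus K i) = _
      rw [matMinus_eq, theta_ml]
      fin_cases i
      · rw [bsl_eq_of_normL (l' := [(9, 0)]) (by decide +kernel)]
        simp [bsl, ← chevMinus_zero]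
      · rw [bsl_eq_of_normL (l' := [(8, 0)]) (by decide +kernel)]
        simp [bsl, ← chevMinus_one]
      · rw [bsl_eq_of_normL (l' := [(11, 0)]) (by decide +kernel)]
        simp [bsl, ← chevMinus_two]
      · rw [bsl_eq_of_normL (l' := [(13, 0)]) (by decide +kernel)]
        simp [bsl, ← chevMinus_three]

end Isomorphism

/-! ### Squares of contact fields -/

section Squares

variable {K : Type*} [Field K]

theorem half_sum {M : Type*} [AddCommMonoid M] (F : Fin 8 → M) :
    (∑ i : Fin 8, if i.val < 4 then F i + F i.rev else 0) = ∑ i, F i := by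
  simp only [Fin.sum_univ_eight]
  simp only [show (Fin.rev 0 : Fin 8) = 7 from rfl, show (Fin.rev 1 : Fin 8) = 6 from rfl,
    show (Fin.rev 2 : Fin 8) = 5 from rfl, show (Fin.rev 3 : Fin 8) = 4 from rfl]
  norm_num
  abel

/-- The generating function of the square of a contact field. -/
noncomputable def sqF (f : DPA K) : DPA K :=
  f * pdD K 0 f + ∑ i : Fin 8, if i.val < 4 then zD K i f * zD K i.rev f else 0

/-- The sum over one index from each pair is a quadratic form; its polarization is the sum over all
eight indices in the contact bracket. -/
theorem sqF_add [CharP K 2] (f g : DPA K) : sqF (f + g) = sqF f + sqF g + cBr f g := by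
  have h : ∑ i : Fin 8, zD K i.rev f * zD K i g =
      ∑ i : Fin 8, if i.val < 4 then zD K i f * zD K i.rev g + zD K i.rev f * zD K i g else 0 := by
    rw [← sum_rev, ← half_sum]
    simp only [Fin.rev_rev]
  rw [sqF, sqF, sqF, cBr, h]
  have h2 : ∀ i : Fin 8, (if i.val < 4 then zD K i (f + g) * zD K i.rev (f + g) else 0) =
      (if i.val < 4 then zD K i f * zD K i.rev f else 0) +
      (if i.val < 4 then zD K i g * zD K i.rev g else 0) +
      if i.val < 4 then zD K i f * zD K i.rev g + zD K i.rev f * zD K i g else 0 := by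
    intro i
    split_ifs
    · simp only [map_add]; ring
    · simp only [add_zero]
  rw [Finset.sum_congr rfl fun i _ => h2 i, Finset.sum_add_distrib, Finset.sum_add_distrib, map_add]
  ring

theorem sqF_smul (c : K) (f : DPA K) : sqF (c • f) = c ^ 2 • sqF f := by
  rw [sqF, sqF, smul_add, Finset.smul_sum, Derivation.map_smul, smul_mul_smul_comm, sq]
  congr 1
  refine Finset.sum_congr rfl fun i _ => ?_
  split_ifs
  · rw [Derivation.map_smul, Derivation.map_smul, smul_mul_smul_comm]
  · rw [smul_zero]

/-- Differentiation turns the half sum into a full sum. Moving `zD K c` to the inside costs one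
commutator, which cancels against a term in the derivative of `f * pdD K 0 f`. -/
theorem zD_sqF [CharP K 2] (f : DPA K) (c : Fin 8) : zD K c (sqF f) = cD f (zD K c f) := by
  have h1 : ∀ i : Fin 8, zD K c (if i.val < 4 then zD K i f * zD K i.rev f else 0) =
      if i.val < 4 then zD K i f * zD K c (zD K i.rev f) + zD K i.rev f * zD K c (zD K i.rev.rev f)
        else 0 := by
    intro i
    split_ifs
    · rw [Derivation.leibniz, smul_eq_mul, smul_eq_mul, Fin.rev_rev]
    · exact map_zero _
  have h2 : ∀ i : Fin 8, zD K i f * zD K c (zD K i.rev f) = zD K i f * zD K i.rev (zD K c f) +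
      if i = c then zD K c f * pdD K 0 f else 0 := by
    intro i
    rw [zD_comm c i.rev, mul_add]
    by_cases h : i = c
    · rw [if_pos h, if_pos (by rw [h]), h]
    · rw [if_neg h, if_neg fun h' => h (Fin.rev_injective h'), mul_zero]
  rw [sqF, map_add, map_sum]
  simp only [h1]
  rw [half_sum fun i => zD K i f * zD K c (zD K i.rev f)]
  simp only [h2]
  rw [Finset.sum_add_distrib, Finset.sum_ite_eq' Finset.univ c, if_pos (Finset.mem_univ c),
    Derivation.leibniz, cD_apply, pdD_zero_zD, ← sum_rev]
  simp only [Fin.rev_rev, smul_eq_mul]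
  linear_combination zD K c f * pdD K 0 f * (CharTwo.two_eq_zero : (2 : DPA K) = 0)

theorem cD_self [CharP K 2] (f : DPA K) : cD f f = f * pdD K 0 f := by
  rw [cD_apply, ← half_sum, Finset.sum_eq_zero, add_zero]
  intro i _
  split_ifs
  · rw [Fin.rev_rev, mul_comm, CharTwo.add_self_eq_zero]
  · rfl

/-- On indeterminates, a contact field squares to the contact field whose generating function is
the square. -/
theorem cD_sqF_xv [CharP K 2] (f : DPA K) (j : Fin 9) :
    cD (sqF f) (xv K j) = cD f (cD f (xv K j)) := by
  refine Fin.cases ?_ (fun b => ?_) j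
  · rw [cD_xv_zero, cD_xv_zero, map_add, map_sum, cD_self]
    have h : ∀ i : Fin 8, cD f (zD K i.rev f * if i.val < 4 then xv K i.rev.succ else 0) =
        (if i.val < 4 then zD K i f * zD K i.rev f else 0) +
          zD K i.rev (sqF f) * if i.val < 4 then xv K i.rev.succ else 0 := by
      intro i
      rw [Derivation.leibniz, smul_eq_mul, smul_eq_mul, ← zD_sqF]
      split_ifs
      · rw [cD_xv_succ, Fin.rev_rev]; ring
      · rw [map_zero]; ring
    simp only [h]
    rw [Finset.sum_add_distrib, ← add_assoc]
    rfl
  · rw [cD_xv_succ, cD_xv_succ, zD_sqF]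

/-- The square of a function of a list. -/
def sqL (l : List (ℕ × ℕ)) : List (ℕ × ℕ × ℕ) :=
  mulL l (derL l) ++ (List.finRange 8).flatMap fun i =>
    if i.val < 4 then mulL (zedL i l) (zedL i.rev l) else []

theorem sqF_den1 [CharP K 2] {u : DPA K} (hu : EvenFun u) (l : List (ℕ × ℕ)) :
    sqF (den1 u l) = den2 u u (sqL l) := by
  rw [sqF, sqL, den2_append, den2_flatMap, pdD_zero_den1, den1_mul]
  congr 1
  rw [← List.sum_ofFn, List.ofFn_eq_map]
  congr 2
  funext i
  split_ifs
  · rw [zD_den1 hu, zD_den1 hu, den1_mul]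
  · rfl

/-- The order of the first two entries does not matter in a square. -/
def sortL (p : ℕ × ℕ × ℕ) : ℕ × ℕ × ℕ := (min p.1 p.2.1, max p.1 p.2.1, p.2.2)

theorem den2_map_sortL (u : DPA K) (l : List (ℕ × ℕ × ℕ)) :
    den2 u u (l.map sortL) = den2 u u l := by
  induction l with
  | nil => rfl
  | cons p l ih =>
    rw [List.map_cons, den2_cons, den2_cons, ih]
    congr 2
    rcases le_total p.1 p.2.1 with h | h
    · rw [sortL, min_eq_left h, max_eq_right h]
    · rw [sortL, min_eq_right h, max_eq_left h, mul_comm]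

/-- Once the two derivatives of the same `u` are allowed to be exchanged, all terms cancel in pairs.
-/
theorem sqL_lam : ∀ v : Fin 18, 1 ≤ v.val → v.val ≤ 14 →
    normL ((sqL (lam v)).map sortL) = [] := by decide +kernel

theorem sqF_Fv [CharP K 2] {v : Fin 18} (h1 : 1 ≤ v.val) (h2 : v.val ≤ 14) {u : DPA K}
    (hu : EvenFun u) : sqF (Fv K v u) = 0 := by
  rw [Fv_apply, sqF_den1 hu, ← den2_map_sortL, ← den2_normL, sqL_lam v h1 h2, den2_nil]

/-- The square of a contact field. -/
noncomputable def sqOp (D : Op K) : Op K := kap K (sqF (genFun K D))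

theorem sqOp_kap [CharP K 2] (f : DPA K) : sqOp (kap K f) = kap K (sqF f) := by
  rw [sqOp, genFun_kap]

theorem sqOp_smul (c : K) (D : Op K) : sqOp (c • D) = c ^ 2 • sqOp D := by
  rw [sqOp, map_smul, sqF_smul, map_smul, sqOp]

theorem sqOp_zero : sqOp (0 : Op K) = 0 := by
  rw [sqOp, map_zero, sqF, zero_mul, Finset.sum_eq_zero, add_zero, map_zero]
  intro i _
  rw [map_zero, zero_mul, ite_self]

theorem exists_kap {Q : Fin 18 → ℕ → Prop} {D : Op K} (hD : D ∈ LQ K Q) : ∃ f, D = kap K f := by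
  obtain ⟨u, -, rfl⟩ := mem_LQ.1 hD
  exact ⟨_, rfl⟩

theorem sqOp_add [CharP K 2] {Q : Fin 18 → ℕ → Prop} {D E : Op K} (hD : D ∈ LQ K Q)
    (hE : E ∈ LQ K Q) : sqOp (D + E) = sqOp D + sqOp E + ⁅D, E⁆ := by
  obtain ⟨f, rfl⟩ := exists_kap hD
  obtain ⟨g, rfl⟩ := exists_kap hE
  rw [← map_add, sqOp_kap, sqOp_kap, sqOp_kap, sqF_add, map_add, map_add, lie_kap]

theorem sqOp_bs [CharP K 2] {v : Fin 18} (h1 : 1 ≤ v.val) (h2 : v.val ≤ 14) (s : ℕ) :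
    sqOp (bs K v s) = 0 := by
  rw [bs, sqOp_kap, sqF_Fv h1 h2 (evenFun_tp s), map_zero]

/-! #### Parities -/

/-- The restriction of a condition to the part of parity `c`. -/
def Qp (p : Fin 4 → ZMod 2) (Q : Fin 18 → ℕ → Prop) (c : ZMod 2) (v : Fin 18) (s : ℕ) : Prop :=
  Q v s ∧ par p v = c

theorem fieldParity_eq (p : Fin 4 → ZMod 2) (c : ZMod 2) :
    fieldParity K p c = grField K (fun _ => ⊤) (varParity p) c := by
  rw [fieldParity, grField]
  congr 1
  ext D
  refine exists_congr fun r => exists_congr fun i => ?_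
  have h : Adm (fun _ => ⊤) r := fun j m hm => absurd hm (ENat.natCast_ne_top m).symm
  simp only [nsmul_eq_mul, CharTwo.sub_eq_add, h, true_and]

theorem varParity_zero : ∀ p : Fin 4 → ZMod 2, p 0 + p 2 + p 3 = 0 → varParity p 0 = 0 := by
  decide +kernel

theorem top_shear_ne_zero (i : Fin 9) : (fun _ => ⊤ : Fin 9 → ℕ∞) i ≠ 0 := by simp

theorem mem_fieldParity_iff [CharP K 2] {p : Fin 4 → ZMod 2} (hp : p 0 + p 2 + p 3 = 0)
    {Q : Fin 18 → ℕ → Prop} {D : Op K} (hD : D ∈ LQ K Q) (c : ZMod 2) :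
    D ∈ fieldParity K p c ↔ D ∈ LQ K (Qp p Q c) := by
  have h0 := varParity_zero p hp
  rw [fieldParity_eq]
  constructor
  · intro h
    refine LQ_mono ?_ ((isWeight_par p hp).mem_LQ top_shear_ne_zero hD h)
    rintro v s ⟨h1, -, h2⟩
    rw [h0, smul_zero, add_zero, sub_zero] at h2
    exact ⟨h1, h2⟩
  · intro h
    refine LQ_le ?_ h
    rintro v s ⟨-, h2⟩
    have := (isWeight_par p hp).bs_mem (K := K) (N := fun _ => ⊤) top_shear_ne_zero v (s := s)
      fun m hm => absurd hm (ENat.natCast_ne_top m).symm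
    rwa [h0, smul_zero, add_zero, sub_zero, h2] at this

/-- The families that may be odd are among those on which squaring vanishes. -/
theorem par_range : ∀ p : Fin 4 → ZMod 2, p 0 + p 2 + p 3 = 0 → ∀ v : Fin 18, par p v = 1 →
    1 ≤ v.val ∧ v.val ≤ 14 := by decide +kernel

theorem par_tab : ∀ p : Fin 4 → ZMod 2, p 0 + p 2 + p 3 = 0 → ∀ v w : Fin 18, ∀ t ∈ tab v w,
    par p t.1 = par p v + par p w := by decide +kernel

theorem lie_mem_parity [CharP K 2] {p : Fin 4 → ZMod 2} (hp : p 0 + p 2 + p 3 = 0) {n : ℕ∞}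
    {c c' : ZMod 2} {D E : Op K} (hD : D ∈ LQ K (Qp p (Qt n) c)) (hE : E ∈ LQ K (Qp p (Qt n) c')) :
    ⁅D, E⁆ ∈ LQ K (Qp p (Qi n) (c + c')) := by
  have h1 : ⁅D, E⁆ ∈ LQ K (Qi n) := lie_mem_derived (LQ_mono (fun _ _ h => h.1) hD)
    (LQ_mono (fun _ _ h => h.1) hE)
  have h2 : ⁅D, E⁆ ∈ LQ K fun v _ => par p v = c + c' := by
    refine lie_mem_LQ ((constQ_Qt n).mono fun _ _ h => h.1) ((constQ_Qt n).mono fun _ _ h => h.1)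
      ?_ hD hE
    rintro v w t ht s s' r ⟨-, rfl⟩ ⟨-, rfl⟩ -
    exact par_tab p hp v w t ht
  exact mem_LQ_of_crd h1 fun v s hv hne => ⟨hv, by_contra fun h => hne (crd_eq_zero h2 h)⟩

/-- Odd basis fields have square zero, so the square of any odd field is a combination of brackets
of odd basis fields and lies in the ordinary derived algebra. -/
theorem sqOp_mem [CharP K 2] {p : Fin 4 → ZMod 2} (hp : p 0 + p 2 + p 3 = 0) {n : ℕ∞} {D : Op K}
    (hD : D ∈ LQ K (Qp p (Qt n) 1)) : sqOp D ∈ LQ K (Qp p (Qi n) 0) := by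
  rw [LQ_eq_span] at hD
  suffices h : D ∈ LQ K (Qp p (Qt n) 1) ∧ sqOp D ∈ LQ K (Qp p (Qi n) 0) from h.2
  refine Submodule.span_induction
    (p := fun D _ => D ∈ LQ K (Qp p (Qt n) 1) ∧ sqOp D ∈ LQ K (Qp p (Qi n) 0)) ?_ ?_ ?_ ?_ hD
  · rintro _ ⟨v, s, h, rfl⟩
    obtain ⟨h1, h2⟩ := par_range p hp v h.2
    exact ⟨bs_mem h, by rw [sqOp_bs h1 h2]; exact zero_mem _⟩
  · refine ⟨zero_mem _, ?_⟩
    rw [sqOp_zero]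
    exact zero_mem _
  · rintro D E - - ⟨h1, h2⟩ ⟨h3, h4⟩
    refine ⟨add_mem h1 h3, ?_⟩
    rw [sqOp_add h1 h3]
    have h5 := lie_mem_parity hp h1 h3
    rw [show (1 + 1 : ZMod 2) = 0 by decide] at h5
    exact add_mem (add_mem h2 h4) h5
  · rintro c D - ⟨h1, h2⟩
    refine ⟨(LQ K (Qp p (Qt n) 1)).smul_mem c h1, ?_⟩
    rw [sqOp_smul]
    exact (LQ K (Qp p (Qi n) 0)).smul_mem (c ^ 2) h2

end Squares

/-! ### Superizations -/

section Super

variable {K : Type*} [Field K]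

/-- Squaring is additive in characteristic two, and the square of `x^(r)` with `r ≠ 0` has a central
binomial coefficient, which is even, as a factor. -/
theorem mul_self_eq_zero_of_coef [CharP K 2] {a : DPA K} (h : coef 0 a = 0) : a * a = 0 := by
  rw [eq_sum_coef a, CharTwo.sum_mul_self]
  refine Finset.sum_eq_zero fun r _ => ?_
  rw [smul_mul_smul_comm, mono_mul]
  by_cases hr : r = 0
  · rw [hr, h, zero_mul, zero_smul]
  · obtain ⟨j, hj⟩ : ∃ j, r j ≠ 0 := by
      by_contra hn
      push Not at hn
      exact hr (funext hn)
    have h2 : 2 ∣ mcoef r r := by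
      rw [mcoef_update r r j, ← two_mul]
      exact Dvd.dvd.mul_right (Nat.two_dvd_centralBinom_of_one_le (Nat.pos_of_ne_zero hj)) _
    rw [(CharP.cast_eq_zero_iff K 2 _).2 h2, zero_smul, smul_zero]

/-- On functions of `x_1` alone, only the coefficient of the field at `∂_1` acts. -/
theorem cD_evenFun (f : DPA K) {u : DPA K} (hu : EvenFun u) :
    cD f u = cD f (xv K 0) * pdD K 0 u := by
  rw [cD_apply, cD_xv_zero, add_mul, Finset.sum_mul]
  congr 1
  refine Finset.sum_congr rfl fun i _ => ?_
  rw [show zD K i u = (if i.val < 4 then xv K i.rev.succ else 0) * pdD K 0 u by rw [zD_apply, hu i, zero_add], mul_assoc]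

theorem mono_eq_tp {r : Fin 9 → ℕ} (h : ∀ i : Fin 8, r i.succ = 0) : mono K r = tp K (r 0) := by
  rw [tp]
  congr 1
  funext j
  refine Fin.cases rfl (fun i => ?_) j
  rw [h i, bits_succ, Nat.zero_testBit]
  rfl

theorem mono_eq_xv_mul {r : Fin 9 → ℕ} {i : Fin 9} (h : r i = 1) :
    mono K r = xv K i * mono K (Function.update r i 0) := by
  rw [xv, mono_mul, mcoef_single, Function.update_self, zero_add, Nat.cast_one, one_smul]
  congr 1
  funext j
  by_cases hj : j = i
  · subst hj; simp [h]
  · simp [hj]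

/-- Where the field `cD f` has an odd coefficient at `∂_1`, its square is a contact field. -/
theorem cD_sqF_mono [CharP K 2] {f : DPA K} (h0 : coef 0 (cD f (xv K 0)) = 0) {r : Fin 9 → ℕ}
    (hr : ∀ i : Fin 8, r i.succ < 2) : cD (sqF f) (mono K r) = cD f (cD f (mono K r)) := by
  -- The square of a derivation is a derivation in characteristic two, so agreement passes to
  -- products. Square-freeness in the last eight indeterminates then reduces the claim to powers of
  -- `x_1`.
  have hmul : ∀ a b : DPA K, cD (sqF f) a = cD f (cD f a) → cD (sqF f) b = cD f (cD f b) →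
      cD (sqF f) (a * b) = cD f (cD f (a * b)) := by
    intro a b ha hb
    simp only [Derivation.leibniz, map_add, smul_eq_mul, ha, hb]
    linear_combination -(cD f a * cD f b) * (CharTwo.two_eq_zero : (2 : DPA K) = 0)
  generalize hm : ∑ i : Fin 8, r i.succ = m
  induction m generalizing r with
  | zero =>
    rw [mono_eq_tp fun i => (Finset.sum_eq_zero_iff.1 hm) i (Finset.mem_univ i)]
    have hu := evenFun_tp (K := K) (r 0)
    generalize tp K (r 0) = u at hu
    -- Divided powers of `x_1` are not polynomials in `x_1`, so the second derivative of `u` appears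
    -- here; its coefficient is the square of the coefficient at `∂_1`, which is zero.
    rw [cD_evenFun _ hu, cD_evenFun _ hu, cD_sqF_xv, Derivation.leibniz, cD_evenFun _ hu.pd]
    have := mul_self_eq_zero_of_coef h0
    rw [smul_eq_mul, smul_eq_mul, ← mul_assoc, this, zero_mul, zero_add, mul_comm]
  | succ m ih =>
    obtain ⟨i, hi⟩ : ∃ i : Fin 8, r i.succ ≠ 0 := by
      by_contra hn
      push Not at hn
      rw [Finset.sum_eq_zero fun i _ => hn i] at hm
      omega
    have hi1 : r i.succ = 1 := by have := hr i; omega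
    rw [mono_eq_xv_mul hi1]
    refine hmul _ _ (cD_sqF_xv f _) (ih ?_ ?_)
    · intro k
      by_cases hk : k = i
      · subst hk; rw [Function.update_self]; norm_num
      · rw [Function.update_of_ne fun h => hk (Fin.succ_injective _ h)]; exact hr k
    · rw [← Finset.add_sum_erase _ _ (Finset.mem_univ i)] at hm ⊢
      rw [Function.update_self]
      rw [Finset.sum_congr rfl fun k hk => Function.update_of_ne
        (fun h => Finset.ne_of_mem_erase hk (Fin.succ_injective _ h)) _ _]
      omega

theorem adm_shear_lt {n : ℕ∞} {r : Fin 9 → ℕ} (h : Adm (shear n) r) (i : Fin 8) :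
    r i.succ < 2 := h i.succ 1 (by rw [shear, if_neg (Fin.succ_ne_zero i)]; rfl)

/-- An odd vector field has no constant coefficient at `∂_1`. -/
theorem coef_odd {p : Fin 4 → ZMod 2} (hp : p 0 + p 2 + p 3 = 0) {f : DPA K}
    (h : kap K f ∈ fieldParity K p 1) : coef 0 (cD f (xv K 0)) = 0 := by
  rw [fieldParity_eq] at h
  obtain ⟨g, hg, he⟩ := exists_fieldOf h
  rw [kap_apply] at he
  rw [toOp_injective he, fieldOf_xv]
  refine coef_zero_of_grFun ?_ (hg 0)
  rw [varParity_zero p hp]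
  decide

theorem mem_monoSpan_of_dpSub {N : Fin 9 → ℕ∞} {u : DP K} (hu : u ∈ dpSub K N) :
    (u : DPA K) ∈ monoSpan K {r | Adm N r} := by
  refine mem_monoSpan_iff.2 fun r hr => ?_
  exact (Finsupp.mem_supported K u).1 hu (Finsupp.mem_support_iff.2 hr)

theorem cD_sqF_apply [CharP K 2] {n : ℕ∞} {f : DPA K} (h0 : coef 0 (cD f (xv K 0)) = 0) {u : DPA K}
    (hu : u ∈ monoSpan K {r | Adm (shear n) r}) : cD (sqF f) u = cD f (cD f u) := by
  refine Submodule.span_induction (p := fun u _ => cD (sqF f) u = cD f (cD f u)) ?_ ?_ ?_ ?_ hu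
  · rintro _ ⟨r, hr, rfl⟩
    exact cD_sqF_mono h0 (adm_shear_lt hr)
  · rw [map_zero, map_zero, map_zero]
  · intro a b _ _ ha hb
    rw [map_add, map_add, map_add, ha, hb]
  · intro c a _ ha
    rw [Derivation.map_smul, Derivation.map_smul, Derivation.map_smul, ha]

theorem sqOp_apply [CharP K 2] {p : Fin 4 → ZMod 2} (hp : p 0 + p 2 + p 3 = 0)
    {Q : Fin 18 → ℕ → Prop} {n : ℕ∞} {D : Op K} (hD : D ∈ LQ K Q) (h1 : D ∈ fieldParity K p 1)
    {u : DP K} (hu : u ∈ dpSub K (shear n)) : sqOp D u = D (D u) := by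
  obtain ⟨f, rfl⟩ := exists_kap hD
  rw [sqOp_kap]
  exact cD_sqF_apply (coef_odd hp h1) (mem_monoSpan_of_dpSub hu)

theorem cD_xv_mem [CharP K 2] {n : ℕ∞} (hn : n ≠ 0) {f : DPA K} (h : kap K f ∈ LQ K (Qt n))
    (j : Fin 9) : cD f (xv K j) ∈ monoSpan K {r | Adm (shear n) r} := by
  have key : LQ K (Qt n) ≤ (monoSpan K {r | Adm (shear n) r}).comap (ev (xv K j)) := by
    refine LQ_le fun v s hs => ?_
    have h1 := isWeight_deg.bs_mem (K := K) (shear_ne_zero hn) v (s := s) hs.2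
    obtain ⟨g, hg, he⟩ := exists_fieldOf h1
    rw [he, Submodule.mem_comap, ev_toOp, fieldOf_xv]
    exact Submodule.span_mono (Set.image_mono fun r hr => hr.1) (hg j)
  exact key h

theorem eq_of_cD_xv [CharP K 2] {f g : DPA K} (h : ∀ j, cD f (xv K j) = cD g (xv K j)) : f = g := by
  rw [← genFun_kap f, ← genFun_kap g, kap_apply, kap_apply, genFun_toOp, genFun_toOp]
  simp only [h]

theorem cD_cBr_apply [CharP K 2] (f g u : DPA K) : cD (cBr f g) u = cD f (cD g u) - cD g (cD f u) := by
  rw [← lie_cD, Derivation.commutator_apply]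

/-- A contact field is determined by its values on the indeterminates, and in `⁅D, ⁅D, y⁆⁆` the
mixed terms `D y D` cancel. The hypothesis is needed because `sqF` represents `D ∘ D` only on
functions with restricted exponents. -/
theorem sqF_cBr [CharP K 2] {f g : DPA K} (h : ∀ j, cD (sqF f) (cD g (xv K j)) =
    cD f (cD f (cD g (xv K j)))) : cBr (sqF f) g = cBr f (cBr f g) := by
  refine eq_of_cD_xv fun j => ?_
  rw [cD_cBr_apply, h j, cD_sqF_xv, cD_cBr_apply, cD_cBr_apply f g, cD_cBr_apply f g, map_sub]
  generalize cD f (cD f (cD g (xv K j))) = a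
  generalize cD f (cD g (cD f (xv K j))) = b
  generalize cD g (cD f (cD f (xv K j))) = c
  linear_combination (b - c) * (CharTwo.two_eq_zero : (2 : DPA K) = 0)

theorem sqOp_lie [CharP K 2] {p : Fin 4 → ZMod 2} (hp : p 0 + p 2 + p 3 = 0) {n : ℕ∞} (hn : n ≠ 0)
    {D y : Op K} (hD : D ∈ LQ K (Qt n)) (h1 : D ∈ fieldParity K p 1) (hy : y ∈ LQ K (Qt n)) :
    ⁅sqOp D, y⁆ = ⁅D, ⁅D, y⁆⁆ := by
  obtain ⟨f, rfl⟩ := exists_kap hD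
  obtain ⟨g, rfl⟩ := exists_kap hy
  have h : cBr (sqF f) g = cBr f (cBr f g) :=
    sqF_cBr fun j => cD_sqF_apply (coef_odd hp h1) (cD_xv_mem hn hy j)
  rw [sqOp_kap, lie_kap, lie_kap, lie_kap, h]

theorem exists_parity_add [CharP K 2] (p : Fin 4 → ZMod 2) {Q : Fin 18 → ℕ → Prop} {D : Op K}
    (hD : D ∈ LQ K Q) : ∃ a ∈ LQ K (Qp p Q 0), ∃ b ∈ LQ K (Qp p Q 1), a + b = D := by
  refine Submodule.mem_sup.1 (LQ_le (fun v s h => ?_) hD)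
  have h2 : ∀ c : ZMod 2, c = 0 ∨ c = 1 := by decide
  rcases h2 (par p v) with hv | hv
  · exact Submodule.mem_sup_left (bs_mem ⟨h, hv⟩)
  · exact Submodule.mem_sup_right (bs_mem ⟨h, hv⟩)

/-- A Lie algebra between `𝔦𝔯(9; N)` and the prolong that contains it. -/
structure IsIntermediate (n : ℕ∞) (Q : Fin 18 → ℕ → Prop) (L : LieSubalgebra K (Op K)) : Prop where
  eq_LQ : L.toSubmodule = LQ K Q
  le_Qt : ∀ v s, Q v s → Qt n v s
  Qi_le : ∀ v s, Qi n v s → Q v s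

section

variable {n : ℕ∞} {Q : Fin 18 → ℕ → Prop} {L : LieSubalgebra K (Op K)}

theorem IsIntermediate.mem (h : IsIntermediate n Q L) {D : Op K} : D ∈ L ↔ D ∈ LQ K Q := by
  rw [← h.eq_LQ]; rfl

theorem IsIntermediate.mem_Qt (h : IsIntermediate n Q L) {D : Op K} (hD : D ∈ L) :
    D ∈ LQ K (Qt n) := LQ_mono h.le_Qt (h.mem.1 hD)

theorem IsIntermediate.mem_parity [CharP K 2] (h : IsIntermediate n Q L) {p : Fin 4 → ZMod 2}
    (hp : p 0 + p 2 + p 3 = 0) {D : Op K} (hD : D ∈ L) {c : ZMod 2} (hc : D ∈ fieldParity K p c) :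
    D ∈ LQ K (Qp p (Qt n) c) :=
  (mem_fieldParity_iff hp (h.mem_Qt hD) c).1 hc

theorem IsIntermediate.of_parity [CharP K 2] (h : IsIntermediate n Q L) {p : Fin 4 → ZMod 2}
    (hp : p 0 + p 2 + p 3 = 0) {D : Op K} {c : ZMod 2} (hc : D ∈ LQ K (Qp p (Qi n) c)) :
    D ∈ L ∧ D ∈ fieldParity K p c := by
  have h1 : D ∈ LQ K (Qi n) := LQ_mono (fun _ _ h => h.1) hc
  exact ⟨h.mem.2 (LQ_mono h.Qi_le h1), (mem_fieldParity_iff hp h1 c).2 hc⟩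

theorem IsIntermediate.lie_parity [CharP K 2] (h : IsIntermediate n Q L) {p : Fin 4 → ZMod 2}
    (hp : p 0 + p 2 + p 3 = 0) {D E : Op K} (hD : D ∈ L) (hE : E ∈ L) {c c' d : ZMod 2}
    (hc : D ∈ fieldParity K p c) (hc' : E ∈ fieldParity K p c') (hd : c + c' = d) :
    ⁅D, E⁆ ∈ fieldParity K p d :=
  hd ▸ (h.of_parity hp (lie_mem_parity hp (h.mem_parity hp hD hc) (h.mem_parity hp hE hc'))).2

/-- The superization of a Lie algebra between `𝔦𝔯(9; N)` and the prolong that contains it. -/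
noncomputable def superOf [CharP K 2] (h : IsIntermediate n Q L) (hn : n ≠ 0) {p : Fin 4 → ZMod 2}
    (hp : p 0 + p 2 + p 3 = 0) : SuperStructure K L where
  even := (fieldParity K p 0).comap L.toSubmodule.subtype
  odd := (fieldParity K p 1).comap L.toSubmodule.subtype
  isCompl := by
    constructor
    · rw [Submodule.disjoint_def]
      intro x hx hx'
      have h1 := h.mem_parity hp x.2 hx
      have h2 := h.mem_parity hp x.2 hx'
      refine Subtype.ext (eq_zero_of_crd h1 fun v s hv => crd_eq_zero h2 fun hv' => ?_)
      have := hv.2.symm.trans hv'.2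
      exact absurd this (by decide)
    · rw [codisjoint_iff, eq_top_iff]
      intro x _
      obtain ⟨a, ha, b, hb, hab⟩ := exists_parity_add p (h.mem.1 x.2)
      have ha' := LQ_mono (fun _ _ h => h.1) ha
      have hb' := LQ_mono (fun _ _ h => h.1) hb
      rw [show x = ⟨a, h.mem.2 ha'⟩ + ⟨b, h.mem.2 hb'⟩ from Subtype.ext hab.symm]
      exact add_mem (Submodule.mem_sup_left ((mem_fieldParity_iff hp ha' 0).2 ha))
        (Submodule.mem_sup_right ((mem_fieldParity_iff hp hb' 1).2 hb))
  lie_even_even x hx y hy := h.lie_parity hp x.2 y.2 hx hy (by decide)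
  lie_even_odd x hx y hy := h.lie_parity hp x.2 y.2 hx hy (by decide)
  lie_odd_odd x hx y hy := h.lie_parity hp x.2 y.2 hx hy (by decide)
  sq x := ⟨⟨sqOp (x : L), (h.of_parity hp (sqOp_mem hp (h.mem_parity hp x.1.2 x.2))).1⟩,
    (h.of_parity hp (sqOp_mem hp (h.mem_parity hp x.1.2 x.2))).2⟩
  sq_smul a x := Subtype.ext (Subtype.ext (sqOp_smul a _))
  sq_add x y := Subtype.ext (sqOp_add (h.mem.1 x.1.2) (h.mem.1 y.1.2))
  sq_lie x y := Subtype.ext (sqOp_lie hp hn (h.mem_Qt x.1.2) x.2 (h.mem_Qt y.2))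

theorem superOf_sq [CharP K 2] (h : IsIntermediate n Q L) (hn : n ≠ 0) {p : Fin 4 → ZMod 2}
    (hp : p 0 + p 2 + p 3 = 0) (x : (superOf h hn hp).odd) :
    (((superOf h hn hp).sq x : L) : Op K) = sqOp ((x : L) : Op K) := rfl

theorem isSuperization_superOf [CharP K 2] (h : IsIntermediate n Q L) (hn : n ≠ 0)
    {p : Fin 4 → ZMod 2} (hp : p 0 + p 2 + p 3 = 0) :
    IsSuperization p (shear n) L (superOf h hn hp) :=
  ⟨fun _ => Iff.rfl, fun _ => Iff.rfl, fun x _ hu => sqOp_apply hp (h.mem.1 x.1.2) x.2 hu⟩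

end

theorem isIntermediate_tilde [CharP K 2] {n : ℕ∞} (hn : n ≠ 0) :
    IsIntermediate n (Qt n) (tildeProlong K 1 (shear n)) where
  eq_LQ := by
    have h := tildeProlong_toSubmodule (K := K) (shear_ne_zero hn) 1
    rwa [shear_zero] at h
  le_Qt _ _ h := h
  Qi_le _ _ h := h.1

theorem isIntermediate_ir [CharP K 2] {n : ℕ∞} (hn : n ≠ 0) :
    IsIntermediate n (Qi n) (ir K n) where
  eq_LQ := ir_toSubmodule hn
  le_Qt _ _ h := h.1
  Qi_le _ _ h := h

/-- By `sqOp_mem`, squares of odd fields contribute nothing beyond the brackets. -/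
theorem mem_derived_superOf [CharP K 2] {n : ℕ∞} (hn : n ≠ 0) {p : Fin 4 → ZMod 2}
    (hp : p 0 + p 2 + p 3 = 0) (x : tildeProlong K 1 (shear n)) :
    x ∈ (superOf (isIntermediate_tilde hn) hn hp).derived ↔ (x : Op K) ∈ ir K n := by
  have h := isIntermediate_tilde (K := K) hn
  constructor
  · intro hx
    have h1 : (superOf h hn hp).derived ≤
        (ir K n).toSubmodule.comap (tildeProlong K 1 (shear n)).toSubmodule.subtype := by
      refine Submodule.span_le.2 ?_
      rintro _ (⟨y, z, rfl⟩ | ⟨y, rfl⟩)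
      · exact (mem_ir hn).2 (lie_mem_derived (h.mem.1 y.2) (h.mem.1 z.2))
      · exact (mem_ir hn).2 (LQ_mono (fun _ _ h => h.1) (sqOp_mem hp (h.mem_parity hp y.1.2 y.2)))
    exact h1 hx
  · intro hx
    have h1 : (ir K n).toSubmodule ≤ (superOf h hn hp).derived.map
        (tildeProlong K 1 (shear n)).toSubmodule.subtype := by
      refine Submodule.span_le.2 ?_
      rintro _ ⟨a, ha, b, hb, rfl⟩
      exact ⟨⁅(⟨a, ha⟩ : tildeProlong K 1 (shear n)), ⟨b, hb⟩⁆,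
        Submodule.subset_span (Or.inl ⟨_, _, rfl⟩), rfl⟩
    obtain ⟨y, hy, hyx⟩ := h1 hx
    rwa [← show y = x from Subtype.ext hyx]

theorem isSimple_superOf [CharP K 2] {n : ℕ∞} (hn : n ≠ 0) {p : Fin 4 → ZMod 2}
    (hp : p 0 + p 2 + p 3 = 0) : (superOf (isIntermediate_ir (K := K) hn) hn hp).IsSimple := by
  have h := ir_isSimple (K := K) hn
  exact ⟨h.non_abelian, fun I _ _ => h.eq_bot_or_eq_top I⟩

end Super

/-! ### Matrix models of the superizations -/

section Models

variable {K : Type*} [Field K]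

/-- The square of any matrix in `𝔬_Π(8)`, of whatever parity, already has alternating off-diagonal
blocks. -/
theorem matSuperDerived_oPi [CharP K 2] (q : Ix → ZMod 2) :
    matSuperDerived q (oPi K) = derivedSub (oPi K) := by
  refine le_antisymm (LieSubalgebra.lieSpan_le.2 ?_) ?_
  · rintro _ (⟨x, hx, y, hy, rfl⟩ | ⟨x, hx, -, rfl⟩)
    · exact mem_derived_oPi.2 (isAlt_lie hx hy)
    · exact mem_derived_oPi.2 (isAlt_mul_self (mem_oPi.1 hx))
  · have h : (derivedSub (oPi K)).toSubmodule ≤ (matSuperDerived q (oPi K)).toSubmodule := by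
      refine Submodule.span_le.2 ?_
      rintro _ ⟨x, hx, y, hy, rfl⟩
      exact LieSubalgebra.subset_lieSpan (Or.inl ⟨x, hx, y, hy, rfl⟩)
    exact h

theorem apply_self_of_odd {q : Ix → ZMod 2} {M : Mat K} (h : M ∈ matParity K q 1) (c : Ix) :
    M c c = 0 := by
  by_contra h0
  have h1 := h c c h0
  rw [CharTwo.add_self_eq_zero] at h1
  exact absurd h1 (by decide)

/-- An odd matrix has zero diagonal, so the first block of its square has trace zero; squares again
add nothing, whatever the format. -/
theorem superOrth_eq [CharP K 2] (q : Ix → ZMod 2) : superOrth K q = orth K 0 := by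
  rw [superOrth, matSuperDerived_oPi]
  refine le_antisymm (LieSubalgebra.lieSpan_le.2 ?_) ?_
  · rintro _ (⟨x, hx, y, hy, rfl⟩ | ⟨x, hx, h, rfl⟩)
    · exact Submodule.subset_span ⟨x, hx, y, hy, rfl⟩
    · exact mem_derived_derived_oPi.2
        ((mem_derived_oPi.1 hx).isSl_mul_self fun a => apply_self_of_odd h _)
  · have h : (derivedSub (derivedSub (oPi K))).toSubmodule ≤
        (matSuperDerived q (derivedSub (oPi K))).toSubmodule := by
      refine Submodule.span_le.2 ?_
      rintro _ ⟨x, hx, y, hy, rfl⟩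
      exact LieSubalgebra.subset_lieSpan (Or.inl ⟨x, hx, y, hy, rfl⟩)
    exact h

theorem mem_orth_zero [CharP K 2] {M : Mat K} : M ∈ orth K 0 ↔ IsSl M := mem_derived_derived_oPi

/-- Some permutations of the indices of the basis vectors. -/
def idxPerm : Fin 5 → Equiv.Perm (Fin 4) := ![1, Equiv.swap 0 2, Equiv.swap 0 3, 1, 1]

/-- Some permutations of the basis vectors that preserve the form `Π`. -/
def basisPerm (i : Fin 5) : Ix → Ix
  | .inl a => if (i = 3 ∧ (a = 1 ∨ a = 2)) ∨ (i = 4 ∧ (a = 1 ∨ a = 3)) then .inr a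
      else .inl (idxPerm i a)
  | .inr a => if (i = 3 ∧ (a = 1 ∨ a = 2)) ∨ (i = 4 ∧ (a = 1 ∨ a = 3)) then .inl a
      else .inr (idxPerm i a)

theorem basisPerm_involutive : ∀ i, Function.Involutive (basisPerm i) := by
  unfold Function.Involutive
  decide +kernel

theorem basisPerm_swap : ∀ i c, basisPerm i (Sum.swap c) = (basisPerm i c).swap := by
  decide +kernel

theorem basisPerm_inl : ∀ i a, basisPerm i (.inl a) = .inl (idxPerm i a) ∨
    basisPerm i (.inl a) = .inr (idxPerm i a) := by decide +kernel

/-- The automorphism of the algebra of matrices given by a permutation of the basis vectors. -/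
noncomputable def permAut (K : Type*) [Field K] (i : Fin 5) : Mat K →ₗ[K] Mat K :=
  (Matrix.reindexAlgEquiv K K (basisPerm_involutive i).toPerm).toLinearMap

theorem permAut_mul (i : Fin 5) (M M' : Mat K) :
    permAut K i (M * M') = permAut K i M * permAut K i M' :=
  map_mul (Matrix.reindexAlgEquiv K K (basisPerm_involutive i).toPerm) M M'

theorem permAut_apply (i : Fin 5) (M : Mat K) (c d : Ix) :
    permAut K i M c d = M (basisPerm i c) (basisPerm i d) := rfl

theorem permAut_permAut (i : Fin 5) (M : Mat K) : permAut K i (permAut K i M) = M := by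
  ext c d
  rw [permAut_apply, permAut_apply, basisPerm_involutive, basisPerm_involutive]

theorem permAut_lie (i : Fin 5) (M M' : Mat K) :
    permAut K i ⁅M, M'⁆ = ⁅permAut K i M, permAut K i M'⁆ := by
  rw [LieRing.of_associative_ring_bracket, LieRing.of_associative_ring_bracket, map_sub,
    permAut_mul, permAut_mul]

theorem IsSl.permAut {M : Mat K} (h : IsSl M) (i : Fin 5) : IsSl (permAut K i M) := by
  refine ⟨⟨fun c d => ?_, fun c => ?_⟩, ?_⟩
  · rw [permAut_apply, permAut_apply, basisPerm_swap, basisPerm_swap]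
    exact h.1.1 _ _
  · rw [permAut_apply, basisPerm_swap]
    exact h.1.2 _
  · rw [← h.2, ← Equiv.sum_comp (idxPerm i) fun a => M (.inl a) (.inl a)]
    refine Finset.sum_congr rfl fun a _ => ?_
    rw [permAut_apply]
    rcases basisPerm_inl i a with h1 | h1
    · rw [h1]
    · rw [h1, h.1.1]; rfl

theorem permAut_mem [CharP K 2] (i : Fin 5) {M : Mat K} (h : M ∈ orth K 0) :
    permAut K i M ∈ orth K 0 :=
  mem_orth_zero.2 ((mem_orth_zero.1 h).permAut i)

/-- The vector field that corresponds to a matrix after a permutation of the basis vectors. -/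
noncomputable def thetaPerm (K : Type*) [Field K] (τ : Fin 6) (i : Fin 5) : Mat K →ₗ[K] Op K :=
  (theta K τ).comp (permAut K i)

theorem thetaPerm_apply (τ : Fin 6) (i : Fin 5) (M : Mat K) :
    thetaPerm K τ i M = theta K τ (permAut K i M) := LinearMap.comp_apply _ _ _

theorem thetaPerm_mem [CharP K 2] (τ : Fin 6) (i : Fin 5) {M : Mat K} (h : M ∈ orth K 0) :
    thetaPerm K τ i M ∈ ir K 1 := by
  rw [ir_one_eq, thetaPerm_apply]
  exact theta_mem_branchAlg (Or.inl rfl) (permAut_mem i h)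

theorem thetaPerm_lie [CharP K 2] (τ : Fin 6) (i : Fin 5) {M M' : Mat K} (h : M ∈ orth K 0)
    (h' : M' ∈ orth K 0) : thetaPerm K τ i ⁅M, M'⁆ = ⁅thetaPerm K τ i M, thetaPerm K τ i M'⁆ := by
  rw [thetaPerm_apply, permAut_lie, theta_lie τ (orth_le_two 0 (permAut_mem i h))
    (orth_le_two 0 (permAut_mem i h')), thetaPerm_apply, thetaPerm_apply]

theorem exists_thetaPerm [CharP K 2] (τ : Fin 6) (i : Fin 5) {D : Op K} (h : D ∈ ir K 1) :
    ∃ M ∈ orth K 0, thetaPerm K τ i M = D := by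
  rw [ir_one_eq] at h
  have h1 : D ∈ imageSub K τ 0 := by rw [imageSub_eq (Or.inl rfl)]; exact h
  obtain ⟨M, hM, rfl⟩ := h1
  exact ⟨permAut K i M, permAut_mem i hM, by rw [thetaPerm_apply, permAut_permAut]⟩

theorem theta_eq_zero_iff [CharP K 2] {τ : Fin 6} {M : Mat K} (h : M ∈ orth K 0) :
    theta K τ M = 0 ↔ ∀ M' ∈ orth K 0, ⁅M', M⁆ = 0 := by
  have h1 := phi_eq_zero_iff (K := K) (τ := τ) (j := 0) (Or.inl rfl) ⟨M, h⟩
  exact ⟨fun h2 M' hM' => h1.1 (Subtype.ext h2) ⟨M', hM'⟩,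
    fun h2 => congrArg Subtype.val (h1.2 fun y => h2 y y.2)⟩

theorem thetaPerm_eq_zero_iff [CharP K 2] (τ : Fin 6) (i : Fin 5) {M : Mat K} (h : M ∈ orth K 0) :
    thetaPerm K τ i M = 0 ↔ ∀ M' ∈ orth K 0, ⁅M', M⁆ = 0 := by
  rw [thetaPerm_apply, theta_eq_zero_iff (permAut_mem i h)]
  refine ⟨fun h2 M' hM' => ?_, fun h2 y hy => ?_⟩
  · have h3 := congrArg (permAut K i) (h2 _ (permAut_mem i hM'))
    rwa [permAut_lie, permAut_permAut, permAut_permAut, map_zero] at h3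
  · have h3 := congrArg (permAut K i) (h2 _ (permAut_mem i hy))
    rwa [permAut_lie, permAut_permAut, map_zero] at h3

/-- The parities of the basis vectors are compatible with the parities of the fields. -/
def IsCompat (p : Fin 4 → ZMod 2) (q : Ix → ZMod 2) (τ : Fin 6) (i : Fin 5) : Prop :=
  ∀ a b, ∀ x ∈ thL τ (a, b), par p x.1 = q (basisPerm i a) + q (basisPerm i b)

instance (p : Fin 4 → ZMod 2) (q : Ix → ZMod 2) (τ : Fin 6) (i : Fin 5) :
    Decidable (IsCompat p q τ i) := by unfold IsCompat; infer_instance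

theorem IsCompat.thetaPerm_mem [CharP K 2] {p : Fin 4 → ZMod 2} {q : Ix → ZMod 2} {τ : Fin 6}
    {i : Fin 5} (h : IsCompat p q τ i) (hp : p 0 + p 2 + p 3 = 0) {c : ZMod 2} {M : Mat K}
    (hM : M ∈ matParity K q c) : thetaPerm K τ i M ∈ fieldParity K p c := by
  have h1 : thetaPerm K τ i M ∈ LQ K (Qp p (fun _ _ => True) c) := by
    rw [thetaPerm_apply, theta_apply]
    refine Submodule.sum_mem _ fun x _ => ?_
    by_cases h0 : permAut K i M x.1 x.2 = 0
    · rw [h0, zero_smul]; exact zero_mem _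
    · refine Submodule.smul_mem _ _ (bsl_mem fun y hy => bs_mem ⟨trivial, ?_⟩)
      rw [h x.1 x.2 y hy]
      exact hM _ _ h0
  exact (mem_fieldParity_iff hp (LQ_mono (fun _ _ h => h.1) h1) c).2 h1

theorem lie_mul_self [CharP K 2] (M M' : Mat K) : ⁅M * M, M'⁆ = ⁅M, ⁅M, M'⁆⁆ := by
  have h2 : M * M' * M + M * M' * M = 0 := CharTwo.add_self_eq_zero _
  rw [LieRing.of_associative_ring_bracket, LieRing.of_associative_ring_bracket,
    LieRing.of_associative_ring_bracket]
  calc M * M * M' - M' * (M * M) = M * M * M' - M' * (M * M) - (M * M' * M + M * M' * M)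
        + (M' * (M * M) + M' * (M * M)) := by rw [h2, CharTwo.add_self_eq_zero, sub_zero, add_zero]
    _ = M * (M * M' - M' * M) - (M * M' - M' * M) * M := by noncomm_ring

/-- Both sides act on `𝔦𝔯(9; (1, …, 1))` as the square of the same inner derivation, and the
centralizer is trivial. Compatibility of brackets thus implies compatibility of squarings. -/
theorem thetaPerm_mul_self [CharP K 2] {p : Fin 4 → ZMod 2} {τ : Fin 6} {i : Fin 5}
    (hp : p 0 + p 2 + p 3 = 0) {M : Mat K} (hM : M ∈ orth K 0) (hM2 : M * M ∈ orth K 0)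
    (h1 : thetaPerm K τ i M ∈ fieldParity K p 1) :
    thetaPerm K τ i (M * M) = sqOp (thetaPerm K τ i M) := by
  have hQ : ∀ {D : Op K}, D ∈ LQ K (Qi 1) → D ∈ LQ K (Qf 0 1) :=
    fun h => LQ_mono (fun _ _ => Qc.qf) (LQ_Qi_le 0 h)
  have hi := isIntermediate_ir (K := K) (n := 1) one_ne_zero
  have hD := thetaPerm_mem (K := K) τ i hM
  have hs := (hi.of_parity hp (sqOp_mem hp (hi.mem_parity hp hD h1))).1
  suffices h : thetaPerm K τ i (M * M) + sqOp (thetaPerm K τ i M) = 0 by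
    rw [← op_sub] at h
    exact (@sub_eq_zero (Op K) _ _ _).1 h
  refine eq_zero_of_commute (n := 1) one_ne_zero (j := 0) (Submodule.add_mem _
    (hQ (hi.mem.1 (thetaPerm_mem τ i hM2))) (hQ (hi.mem.1 hs))) fun y hy => ?_
  obtain ⟨M', hM', rfl⟩ := exists_thetaPerm τ i (hi.mem.2 hy)
  rw [op_add_lie, ← thetaPerm_lie τ i hM2 hM', lie_mul_self,
    thetaPerm_lie τ i hM ((orth K 0).lie_mem hM hM'), thetaPerm_lie τ i hM hM',
    sqOp_lie hp one_ne_zero (hi.mem_Qt hD) h1 (hi.mem_Qt (hi.mem.2 hy)), op_add_self]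

/-- The homomorphism from the Lie algebra of matrices after a permutation of the basis vectors. -/
noncomputable def phiPerm (K : Type*) [Field K] [CharP K 2] (τ : Fin 6) (i : Fin 5) :
    orth K 0 →ₗ⁅K⁆ ir K 1 :=
  homOf (thetaPerm K τ i) _ _ (fun _ h => thetaPerm_mem τ i h)
    fun _ h _ h' => thetaPerm_lie τ i h h'

theorem phiPerm_coe [CharP K 2] (τ : Fin 6) (i : Fin 5) (x : orth K 0) :
    (phiPerm K τ i x : Op K) = thetaPerm K τ i x := rfl

theorem phiPerm_surjective [CharP K 2] (τ : Fin 6) (i : Fin 5) :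
    Function.Surjective (phiPerm K τ i) := by
  rintro ⟨y, hy⟩
  obtain ⟨M, hM, h⟩ := exists_thetaPerm τ i hy
  exact ⟨⟨M, hM⟩, Subtype.ext h⟩

theorem phiPerm_ker [CharP K 2] (τ : Fin 6) (i : Fin 5) :
    (phiPerm K τ i).ker = LieAlgebra.center K (orth K 0) := by
  ext x
  rw [LieHom.mem_ker, LieModule.mem_maxTrivSubmodule]
  constructor
  · intro h y
    exact Subtype.ext ((thetaPerm_eq_zero_iff τ i x.2).1 (congrArg Subtype.val h) y y.2)
  · intro h
    refine Subtype.ext ?_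
    rw [phiPerm_coe]
    exact (thetaPerm_eq_zero_iff τ i x.2).2 fun y hy => congrArg Subtype.val (h ⟨y, hy⟩)

theorem IsCompat.isSuperOrthModCenter [CharP K 2] {p : Fin 4 → ZMod 2}
    (hp : p 0 + p 2 + p 3 = 0) {q : Ix → ZMod 2} {τ : Fin 6} {i : Fin 5} (h : IsCompat p q τ i)
    {S : SuperStructure K (ir K 1)} (he : ∀ x : ir K 1, (x : Op K) ∈ fieldParity K p 0 → x ∈ S.even)
    (ho : ∀ x : ir K 1, (x : Op K) ∈ fieldParity K p 1 → x ∈ S.odd)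
    (hs : ∀ x : S.odd, ((S.sq x : ir K 1) : Op K) = sqOp ((x : ir K 1) : Op K)) :
    IsSuperOrthModCenter q S := by
  rw [IsSuperOrthModCenter, superOrth_eq]
  refine ⟨phiPerm K τ i, phiPerm_surjective τ i, phiPerm_ker τ i, fun x hx => he _ ?_,
    fun x hx => ?_⟩
  · rw [phiPerm_coe]
    exact h.thetaPerm_mem hp hx
  · have h1 := h.thetaPerm_mem hp hx
    have h2 : (x : Mat K) * x ∈ orth K 0 := mem_orth_zero.2
      ((mem_orth_zero.1 x.2).1.isSl_mul_self fun a => apply_self_of_odd hx _)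
    have h3 : phiPerm K τ i x ∈ S.odd := ho _ (by rw [phiPerm_coe]; exact h1)
    refine ⟨h3, ⟨_, h2⟩, rfl, Subtype.ext ?_⟩
    rw [hs, phiPerm_coe, phiPerm_coe]
    exact thetaPerm_mul_self hp x.2 h2 h1

theorem isSuperOrthModCenter_superOf [CharP K 2] {p : Fin 4 → ZMod 2} (hp : p 0 + p 2 + p 3 = 0)
    {q : Ix → ZMod 2} (h : ∃ τ i, IsCompat p q τ i) (hn : (1 : ℕ∞) ≠ 0) :
    IsSuperOrthModCenter q (superOf (isIntermediate_ir (K := K) hn) hn hp) := by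
  obtain ⟨τ, i, h⟩ := h
  exact h.isSuperOrthModCenter hp (fun _ h => h) (fun _ h => h) (superOf_sq _ hn hp)

theorem exists_isCompat_parity44 : ∃ τ i, IsCompat ![0, 1, 0, 0] parity44 τ i := by
  decide +kernel

/-- A search over six permutations of nodes and five of basis vectors. Permutations of the outer
nodes allow the same matrix format to serve all parities in question. -/
theorem exists_isCompat_parity26 : ∀ p : Fin 4 → ZMod 2, p ≠ 0 → p 0 + p 2 + p 3 = 0 →
    p ≠ ![0, 1, 0, 0] → ∃ τ i, IsCompat p parity26 τ i := by
  decide +kernel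

theorem exists_isCompat_parityPe : ∀ p : Fin 4 → ZMod 2, p ≠ 0 → p 0 + p 2 + p 3 = 0 →
    p ≠ ![0, 1, 0, 0] → ∃ τ i, IsCompat p parityPe τ i := by
  decide +kernel

theorem card_odd : ∀ p : Fin 4 → ZMod 2, p ≠ 0 → p 0 + p 2 + p 3 = 0 →
    Fintype.card {i : Fin 9 // varParity p i = 1} = (if p = ![0, 1, 0, 0] then 8 else 4) := by
  decide +kernel

theorem par_chev : ∀ p : Fin 4 → ZMod 2, p 0 + p 2 + p 3 = 0 →
    (par p 10 = p 0 ∧ par p 9 = p 0) ∧ (par p 1 = p 1 ∧ par p 8 = p 1) ∧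
    (par p 12 = p 2 ∧ par p 11 = p 2) ∧ (par p 14 = p 3 ∧ par p 13 = p 3) := by
  decide +kernel

theorem bs_mem_fieldParity [CharP K 2] {p : Fin 4 → ZMod 2} (hp : p 0 + p 2 + p 3 = 0)
    {v : Fin 18} {s : ℕ} {c : ZMod 2} (h : par p v = c) : bs K v s ∈ fieldParity K p c :=
  (mem_fieldParity_iff hp (bs_mem (Q := fun _ _ => True) trivial) c).2 (bs_mem ⟨trivial, h⟩)

theorem chev_mem_fieldParity [CharP K 2] {p : Fin 4 → ZMod 2} (hp : p 0 + p 2 + p 3 = 0)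
    (i : Fin 4) : chevPlus K i ∈ fieldParity K p (p i) ∧ chevMinus K i ∈ fieldParity K p (p i) := by
  obtain ⟨h0, h1, h2, h3⟩ := par_chev p hp
  fin_cases i
  · exact ⟨chevPlus_zero (K := K) ▸ bs_mem_fieldParity hp h0.1,
      chevMinus_zero (K := K) ▸ bs_mem_fieldParity hp h0.2⟩
  · exact ⟨chevPlus_one (K := K) ▸ bs_mem_fieldParity hp h1.1,
      chevMinus_one (K := K) ▸ bs_mem_fieldParity hp h1.2⟩
  · exact ⟨chevPlus_two (K := K) ▸ bs_mem_fieldParity hp h2.1,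
      chevMinus_two (K := K) ▸ bs_mem_fieldParity hp h2.2⟩
  · exact ⟨chevPlus_three (K := K) ▸ bs_mem_fieldParity hp h3.1,
      chevMinus_three (K := K) ▸ bs_mem_fieldParity hp h3.2⟩

end Models

end CTS

open CTS in
theorem mainTheorem1 (K : Type*) [Field K] [IsAlgClosed K] [CharP K 2] :
    -- the graded Lie algebras `𝔬_Π^{(2)}(8)/𝔠`, `𝔬'_Π(8)/𝔠`, `(𝔬'_Π(8) ⋉ K I₀)/𝔠`
    -- in terms of vector fields
    (∀ j : Fin 3, ∃ φ : orth K j →ₗ⁅K⁆ branchAlg K j,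
      Function.Surjective φ ∧ φ.ker = LieAlgebra.center K (orth K j) ∧
      (∀ i, ∃ h : matPlus K i ∈ orth K j, (φ ⟨matPlus K i, h⟩ : Op K) = chevPlus K i) ∧
      (∀ i, ∃ h : matMinus K i ∈ orth K j, (φ ⟨matMinus K i, h⟩ : Op K) = chevMinus K i) ∧
      (∀ (k : ℤ) (x : orth K j), (x : Mat K) ∈ matDeg K k →
        (φ x : Op K) ∈ vectDeg K (shear 1) k)) ∧
    -- the prolongs are the sums of their components; only the first coordinate of `N` is free;
    -- `(𝔤₋, [𝔤₋₁, 𝔤₁])_*` is the full prolong of the non-positive part of `𝔬_Π^{(2)}(8)/𝔠`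
    (∀ (j : Fin 3) (N : Fin 9 → ℕ∞), (∀ i, N i ≠ 0) →
      (tildeProlong K j N).toSubmodule =
        ctsSum K N (branchComp K j (-2)) (branchComp K j (-1)) (tildeZero K j) ∧
      (fullProlong K j N).toSubmodule =
        ctsSum K N (branchComp K j (-2)) (branchComp K j (-1)) (branchComp K j 0) ∧
      tildeProlong K j N = tildeProlong K j (shear (N 0)) ∧
      fullProlong K j N = fullProlong K j (shear (N 0)) ∧
      tildeProlong K j N = fullProlong K 0 N) ∧
    -- `𝔦𝔯(9; N)` is simple
    (∀ n : ℕ∞, n ≠ 0 → LieAlgebra.IsSimple K (ir K n)) ∧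
    -- the full prolongs are `𝔦𝔯(9; N) ⋉ D`, where `D` consists of six outer derivations in the
    -- highest component and of the `j` outer derivations of degree zero present in `𝔤₀`
    (∀ (j : Fin 3) (n : ℕ), n ≠ 0 →
      ∃ (T : Submodule K (Op K)) (D : LieSubalgebra K (Op K)),
        T ≤ fullComp K j (shear n) (2 ^ (n + 1) - 2) ∧
        (∀ k, 2 ^ (n + 1) - 2 < k → fullComp K j (shear n) k = ⊥) ∧
        Module.finrank K T = 6 ∧
        D.toSubmodule = Submodule.span K (extraTorus K j) ⊔ T ∧
        Module.finrank K D = 6 + (j : ℕ) ∧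
        (ir K n).toSubmodule ⊔ D.toSubmodule = (fullProlong K j (shear n)).toSubmodule ∧
        Disjoint (ir K n).toSubmodule D.toSubmodule ∧
        (∀ x ∈ fullProlong K j (shear n), ∀ y ∈ ir K n, ⁅x, y⁆ ∈ ir K n) ∧
        (∀ x ∈ D, ∀ z ∈ ir K n, (∀ y ∈ ir K n, ⁅x, y⁆ = ⁅z, y⁆) → x = 0)) ∧
    -- the case `N = (1, …, 1)`
    ir K 1 = branchAlg K 0 ∧
    -- superizations
    (∀ p : Fin 4 → ZMod 2, p ≠ 0 → p 0 + p 2 + p 3 = 0 →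
      varParity p 0 = 0 ∧
      Fintype.card {i : Fin 9 // varParity p i = 1} = (if p = ![0, 1, 0, 0] then 8 else 4) ∧
      (∀ i, chevPlus K i ∈ fieldParity K p (p i) ∧ chevMinus K i ∈ fieldParity K p (p i)) ∧
      ∀ n : ℕ∞, n ≠ 0 →
        (∃ S' : SuperStructure K (tildeProlong K 1 (shear n)),
          IsSuperization p (shear n) (tildeProlong K 1 (shear n)) S' ∧
          ∀ x : tildeProlong K 1 (shear n), x ∈ S'.derived ↔ (x : Op K) ∈ ir K n) ∧
        ∃ S : SuperStructure K (ir K n),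
          IsSuperization p (shear n) (ir K n) S ∧ S.IsSimple ∧
          (n = 1 → p = ![0, 1, 0, 0] → IsSuperOrthModCenter parity44 S) ∧
          (n = 1 → p ≠ ![0, 1, 0, 0] →
            IsSuperOrthModCenter parity26 S ∧ IsSuperOrthModCenter parityPe S)) := by
  refine ⟨exists_hom_of_orth, fun j N hN => prolongs_eq j hN, fun n hn => ir_isSimple hn,
    fun j n hn => fullProlong_eq_semidirect j hn, ir_one_eq, fun p h0 hp =>
      ⟨varParity_zero p hp, card_odd p h0 hp, chev_mem_fieldParity hp, fun n hn =>
        ⟨⟨superOf (isIntermediate_tilde hn) hn hp, isSuperization_superOf _ hn hp,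
            mem_derived_superOf hn hp⟩,
          superOf (isIntermediate_ir hn) hn hp, isSuperization_superOf _ hn hp,
          isSimple_superOf hn hp, ?_, ?_⟩⟩⟩
  · rintro rfl rfl
    exact isSuperOrthModCenter_superOf hp exists_isCompat_parity44 hn
  · rintro rfl h
    exact ⟨isSuperOrthModCenter_superOf hp (exists_isCompat_parity26 p h0 hp h) hn,
      isSuperOrthModCenter_superOf hp (exists_isCompat_parityPe p h0 hp h) hn⟩
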